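/- Let $\Sigma$ be a compact connected Riemann surface of arbitrary genus $g(\Sigma)$, let $L$ be a holomorphic line bundle over $\Sigma$ with $c_1(L)>0$, let $\phi\in H^0(\Sigma,L)$ be a non-zero holomorphic section, and let $\tau>0$ and $\alpha>0$ be real constants. A solution of the gravitating vortex equations on $(\Sigma,L,\phi)$ is a pair $(\omega,h)$ of a (smooth) Kähler form $\omega$ on $\Sigma$ and a (smooth) hermitian metric $h$ on $L$ such that, for some constant $c\in\mathbb R$, $$i\Lambda_\omega F_h+\tfrac12\left(|\phi|_h^2-\tau\right)=0,\qquad S_\omega+\alpha(\Delta_\omega+\tau)\left(|\phi|_h^2-\tau\right)=c ,$$ where $F_h$ is the curvature of the Chern connection of $h$, $\Lambda_\omega$ is the contraction with $\omega$, $S_\omega$ is the scalar curvature of $\omega$ (normalized so that $\int_\Sigma S_\omega\,\omega=2\pi\chi(\Sigma)$) and $\Delta_\omega f=2i\Lambda_\omega\bar\partial\partial f$. Let $\operatorname{Aut}(\Sigma,L)$ be the group, with the compact-open topology, of $\mathbb C^*$-equivariant biholomorphic maps of the total space of $L$, and let $\operatorname{Aut}(\Sigma,L,\phi)$ be the isotropy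 subgroup of $\phi$. Its Lie algebra $\mathfrak g=\operatorname{Lie}\operatorname{Aut}(\Sigma,L,\phi)$ is the complex Lie algebra of $\mathbb C^*$-invariant holomorphic vector fields on the total space of $L$ with zero infinitesimal action on $\phi$. Suppose that $(\Sigma,L,\phi)$ admits a solution $(\omega,h)$ of the gravitating vortex equations. Then $\mathfrak g$ is a (finite-dimensional) reductive complex Lie algebra. More precisely: 1. If $g(\Sigma)>0$, then the group $\operatorname{Aut}(\Sigma,L,\phi)$ is discrete and $\mathfrak g=0$. 2. If $g(\Sigma)=0$, let $K\subset\operatorname{Aut}(\Sigma,L,\phi)$ be the subgroup of those automorphisms that preserve $h$ and cover automorphisms of $\Sigma$ preserving $\omega$, and let $\mathfrak k\subset\mathfrak g$ be the set of those $y\in\mathfrak g$ with zero infinitesimal action on $h$ and on $\omega$ (the Lie algebra of $K$). Then $K$ is compact, $\mathfrak k$ is a real Lie subalgebra of $\mathfrak g$, and $\mathfrak g$ is the complexification of $\mathfrak k$: the map $\mathbb C\otimes_{\mathbb R}\mathfrak k\to\mathfrak g$, $a\otimes y\mapsto a\,y$, is an isomorphism of complex Lie algebras. -/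

import Mathlib

open scoped Manifold ContDiff Topology TensorProduct
open VectorField

namespace GravVortex

lemma lieBracket_of_related {E F : Type*} [NormedAddCommGroup E] [NormedSpace ℂ E]
    [NormedAddCommGroup F] [NormedSpace ℂ F] {f : E → F} {v w : E → E} {V W : F → F} {x : E}
    (hf : ContDiffAt ℂ ω f x) (hv : DifferentiableAt ℂ v x) (hw : DifferentiableAt ℂ w x)
    (hV : DifferentiableAt ℂ V (f x)) (hW : DifferentiableAt ℂ W (f x))
    (hvV : ∀ᶠ z in 𝓝 x, V (f z) = fderiv ℂ f z (v z))
    (hwW : ∀ᶠ z in 𝓝 x, W (f z) = fderiv ℂ f z (w z)) :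
    lieBracket ℂ V W (f x) = fderiv ℂ f x (lieBracket ℂ v w x) := by
  have hs : IsSymmSndFDerivAt ℂ f x := hf.isSymmSndFDerivAt (by simp)
  have hf1 : DifferentiableAt ℂ f x := hf.differentiableAt (by simp)
  have hf2 : DifferentiableAt ℂ (fderiv ℂ f) x :=
    (hf.fderiv_right (m := 1) (by simp)).differentiableAt (by simp)
  have key : ∀ {u : E → E} {U : F → F}, DifferentiableAt ℂ u x → DifferentiableAt ℂ U (f x) →
      (∀ᶠ z in 𝓝 x, U (f z) = fderiv ℂ f z (u z)) → ∀ a : E,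
      fderiv ℂ U (f x) (fderiv ℂ f x a) =
        fderiv ℂ (fderiv ℂ f) x a (u x) + fderiv ℂ f x (fderiv ℂ u x a) := by
    intro u U hu hU h a
    have h1 : fderiv ℂ (fun z => U (f z)) x = fderiv ℂ (fun z => fderiv ℂ f z (u z)) x :=
      Filter.EventuallyEq.fderiv_eq h
    have h2 := congrArg (fun T => T a) h1
    simp only [fderiv_fun_comp x hU hf1, fderiv_clm_apply hf2 hu] at h2
    simpa [add_comm] using h2
  simp only [lieBracket_eq, hvV.self_of_nhds, hwW.self_of_nhds, key hw hW hwW, key hv hV hvV,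
    map_sub, hs.eq (v x) (w x)]
  abel

section
variable {E H M E' H' M' : Type*} [NormedAddCommGroup E] [NormedSpace ℂ E] [CompleteSpace E]
  [TopologicalSpace H] {I : ModelWithCorners ℂ E H} [I.Boundaryless]
  [TopologicalSpace M] [ChartedSpace H M] [IsManifold I ω M]
  [NormedAddCommGroup E'] [NormedSpace ℂ E'] [CompleteSpace E'] [TopologicalSpace H']
  {I' : ModelWithCorners ℂ E' H'} [I'.Boundaryless]
  [TopologicalSpace M'] [ChartedSpace H' M'] [IsManifold I' ω M']

/-- The coordinate expression of a vector field in the preferred chart at `x₀`. -/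
noncomputable def chartField (V : Π x : M, TangentSpace I x) (x₀ : M) : E → E :=
  fun z => mpullbackWithin 𝓘(ℂ, E) I (extChartAt I x₀).symm V (Set.range I) z

lemma chartField_eq (V : Π x : M, TangentSpace I x) (x₀ : M) {z : E}
    (hz : z ∈ (extChartAt I x₀).target) :
    chartField V x₀ z =
      (mfderiv I 𝓘(ℂ, E) (extChartAt I x₀) ((extChartAt I x₀).symm z)
        (V ((extChartAt I x₀).symm z)) : E) := by
  rw [chartField, mpullbackWithin_apply]
  have h : (mfderivWithin 𝓘(ℂ, E) I (extChartAt I x₀).symm (Set.range I) z).inverse =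
      mfderiv I 𝓘(ℂ, E) (extChartAt I x₀) ((extChartAt I x₀).symm z) := by
    apply ContinuousLinearMap.inverse_eq
    · exact mfderivWithin_extChartAt_symm_comp_mfderiv_extChartAt hz
    · exact mfderiv_extChartAt_comp_mfderivWithin_extChartAt_symm hz
  rw [h]
  rfl

lemma mlieBracket_eq_extChartAt (V W : Π x : M, TangentSpace I x) (x₀ : M) :
    mlieBracket I V W x₀ = (mfderiv I 𝓘(ℂ, E) (extChartAt I x₀) x₀).inverse
      (lieBracket (E := E) ℂ (chartField V x₀) (chartField W x₀) (extChartAt I x₀ x₀)) := by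
  have h : (extChartAt I x₀).symm ⁻¹' Set.univ ∩ Set.range I = Set.univ := by
    simp [I.range_eq_univ]
  rw [← mlieBracketWithin_univ, mlieBracketWithin_apply, ← lieBracketWithin_univ]
  exact congrArg (fun s : Set E => (mfderiv I 𝓘(ℂ, E) (extChartAt I x₀) x₀).inverse
    (lieBracketWithin (E := E) ℂ (chartField V x₀) (chartField W x₀) s (extChartAt I x₀ x₀))) h

lemma differentiableAt_chartField {u : Π x : M, TangentSpace I x} {x₀ : M}
    (hu : MDifferentiableAt I I.tangent (fun x => (⟨x, u x⟩ : TangentBundle I M)) x₀) :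
    DifferentiableAt ℂ (chartField u x₀) (extChartAt I x₀ x₀) := by
  have h : (extChartAt I x₀).symm ⁻¹' Set.univ ∩ Set.range I = Set.univ := by
    simp [I.range_eq_univ]
  have h1 : DifferentiableWithinAt ℂ (chartField u x₀)
      ((extChartAt I x₀).symm ⁻¹' Set.univ ∩ Set.range I) (extChartAt I x₀ x₀) :=
    (mdifferentiableWithinAt_univ.2 hu).differentiableWithinAt_mpullbackWithin_vectorField
  rwa [h, differentiableWithinAt_univ] at h1

lemma mlieBracket_of_related {f : M → M'} (hf : ContMDiff I I' ω f)
    {v w : Π x : M, TangentSpace I x} {V W : Π x : M', TangentSpace I' x} {x₀ : M}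
    (hv : MDifferentiableAt I I.tangent (fun x => (⟨x, v x⟩ : TangentBundle I M)) x₀)
    (hw : MDifferentiableAt I I.tangent (fun x => (⟨x, w x⟩ : TangentBundle I M)) x₀)
    (hV : MDifferentiableAt I' I'.tangent (fun x => (⟨x, V x⟩ : TangentBundle I' M')) (f x₀))
    (hW : MDifferentiableAt I' I'.tangent (fun x => (⟨x, W x⟩ : TangentBundle I' M')) (f x₀))
    (hvV : ∀ x, V (f x) = mfderiv I I' f x (v x))
    (hwW : ∀ x, W (f x) = mfderiv I I' f x (w x)) :
    mlieBracket I' V W (f x₀) = mfderiv I I' f x₀ (mlieBracket I v w x₀) := by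
  set e := extChartAt I x₀ with he
  set e' := extChartAt I' (f x₀) with he'
  set F : E → E' := e' ∘ f ∘ e.symm with hF
  have hFz : F (e x₀) = e' (f x₀) := by simp [F, e]
  have hfd : MDifferentiable I I' f := hf.mdifferentiable (by simp)
  have hU : ∀ᶠ z in 𝓝 (e x₀), z ∈ e.target ∧ f (e.symm z) ∈ e'.source := by
    have h1 : ∀ᶠ z in 𝓝 (e x₀), z ∈ e.target := extChartAt_target_mem_nhds x₀
    have h2 : ContinuousAt (fun z => f (e.symm z)) (e x₀) := by
      refine ContinuousAt.comp (g := f) ?_ (continuousAt_extChartAt_symm x₀)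
      exact hf.continuous.continuousAt
    have h3 : e'.source ∈ 𝓝 (f (e.symm (e x₀))) := by
      simp only [e, e', extChartAt_to_inv]
      exact extChartAt_source_mem_nhds _
    exact h1.and (h2.eventually h3)
  have hchain : ∀ y : M, y ∈ e.source → f y ∈ e'.source → ∀ t : TangentSpace I y,
      fderiv ℂ F (e y) (mfderiv I 𝓘(ℂ, E) e y t) =
        mfderiv I' 𝓘(ℂ, E') e' (f y) (mfderiv I I' f y t) := by
    intro y hy hy' t
    have hy1 : y ∈ (chartAt H x₀).source := by simpa [e] using hy
    have hy2 : f y ∈ (chartAt H' (f x₀)).source := by simpa [e'] using hy'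
    have hed : MDifferentiableAt I 𝓘(ℂ, E) e y := mdifferentiableAt_extChartAt hy1
    have hed' : MDifferentiableAt I' 𝓘(ℂ, E') e' (f y) := mdifferentiableAt_extChartAt hy2
    have hesd : MDifferentiableAt 𝓘(ℂ, E) I e.symm (e y) := by
      have := mdifferentiableWithinAt_extChartAt_symm (I := I) (x := x₀) (e.map_source hy)
      rwa [I.range_eq_univ, mdifferentiableWithinAt_univ] at this
    have hFd : MDifferentiableAt 𝓘(ℂ, E) 𝓘(ℂ, E') F (e y) := by
      have h1 : MDifferentiableAt 𝓘(ℂ, E) I' (f ∘ e.symm) (e y) :=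
        MDifferentiableAt.comp (e y) (hfd _) hesd
      refine MDifferentiableAt.comp (g := e') (I' := I') (e y) ?_ h1
      simp only [Function.comp_apply, e.left_inv hy]
      exact hed'
    have hc1 : mfderiv I 𝓘(ℂ, E') (F ∘ e) y t = fderiv ℂ F (e y) (mfderiv I 𝓘(ℂ, E) e y t) := by
      rw [mfderiv_comp y hFd hed, mfderiv_eq_fderiv]
      rfl
    have hc2 : mfderiv I 𝓘(ℂ, E') (e' ∘ f) y t =
        mfderiv I' 𝓘(ℂ, E') e' (f y) (mfderiv I I' f y t) := by
      rw [mfderiv_comp y hed' (hfd y)]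
      rfl
    have hEq : F ∘ e =ᶠ[𝓝 y] e' ∘ f := by
      have : e.source ∈ 𝓝 y := by
        simpa [e] using (chartAt H x₀).open_source.mem_nhds hy1
      filter_upwards [this] with p hp
      simp [F, e.left_inv hp]
    have hc3 : (mfderiv I 𝓘(ℂ, E') (F ∘ e) y : E →L[ℂ] E') = mfderiv I 𝓘(ℂ, E') (e' ∘ f) y :=
      hEq.mfderiv_eq
    have hc4 := congrArg (fun T : E →L[ℂ] E' => T t) hc3
    exact hc1.symm.trans (hc4.trans hc2)
  have hrel : ∀ {u : Π x : M, TangentSpace I x} {U : Π x : M', TangentSpace I' x},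
      (∀ x, U (f x) = mfderiv I I' f x (u x)) → ∀ᶠ z in 𝓝 (e x₀),
      chartField U (f x₀) (F z) =
        fderiv ℂ F z (chartField u x₀ z) := by
    intro u U h
    filter_upwards [hU] with z hz
    have hFt : F z ∈ e'.target := e'.map_source hz.2
    have h1 := chartField_eq U (f x₀) hFt
    have h2 := chartField_eq u x₀ hz.1
    refine h1.trans ?_
    refine Eq.trans ?_ (congrArg (fderiv ℂ F z) h2).symm
    have h3 : e'.symm (F z) = f (e.symm z) := e'.left_inv hz.2
    let G : M' → E' := fun y => mfderiv I' 𝓘(ℂ, E') e' y (U y)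
    have h4 : G (e'.symm (F z)) = G (f (e.symm z)) := by rw [h3]
    refine h4.trans ?_
    have h5 := hchain (e.symm z) (e.map_target hz.1) hz.2 (u (e.symm z))
    rw [e.right_inv hz.1] at h5
    refine Eq.trans ?_ h5.symm
    change mfderiv I' 𝓘(ℂ, E') e' (f (e.symm z)) (U (f (e.symm z))) = _
    rw [h]
  have hx₀ : x₀ ∈ e.source := mem_extChartAt_source x₀
  have hfx₀ : f x₀ ∈ e'.source := mem_extChartAt_source (f x₀)
  have hFc : ContDiffAt ℂ ω F (e x₀) := by
    have := (contMDiffAt_iff.1 (hf x₀)).2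
    rwa [I.range_eq_univ, contDiffWithinAt_univ] at this
  have hV' := differentiableAt_chartField hV
  have hW' := differentiableAt_chartField hW
  rw [← he', ← hFz] at hV' hW'
  have hmain := lieBracket_of_related hFc (differentiableAt_chartField hv)
    (differentiableAt_chartField hw) hV' hW' (hrel hvV) (hrel hwW)
  rw [hFz] at hmain
  rw [mlieBracket_eq_extChartAt V W, mlieBracket_eq_extChartAt v w]
  have hinv : (mfderiv I 𝓘(ℂ, E) e x₀).IsInvertible := isInvertible_mfderiv_extChartAt hx₀
  have hinv' : (mfderiv I' 𝓘(ℂ, E') e' (f x₀)).IsInvertible :=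
    isInvertible_mfderiv_extChartAt hfx₀
  refine (hinv'.inverse_apply_eq).2 ?_
  refine hmain.trans (Eq.trans ?_ (hchain x₀ hx₀ hfx₀ _))
  refine congrArg (fderiv ℂ F (e x₀)) ?_
  exact (hinv.inverse_apply_eq.1 rfl)
end

section HolomorphicVectorFields

variable {E H : Type*} [NormedAddCommGroup E] [NormedSpace ℂ E] [TopologicalSpace H]
  (I : ModelWithCorners ℂ E H) (M : Type*) [TopologicalSpace M] [ChartedSpace H M]
  [IsManifold I ω M]

/-- Global holomorphic (that is, complex analytic) vector fields on a complex manifold. -/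
abbrev HolVectorField := Cₛ^ω⟮I; E, (TangentSpace I : M → Type _)⟯

variable {I M}

lemma HolVectorField.mdifferentiableAt (y : HolVectorField I M) (p : M) :
    MDifferentiableAt I I.tangent (fun x => (⟨x, y x⟩ : TangentBundle I M)) p :=
  (y.contMDiff p).mdifferentiableAt (by simp)

variable [CompleteSpace E]

noncomputable instance : Bracket (HolVectorField I M) (HolVectorField I M) where
  bracket y z := ⟨mlieBracket I y z, fun p => by
    have h := ContMDiffWithinAt.mlieBracketWithin_vectorField (n := ω) (m := ω)
      (y.contMDiff p).contMDiffWithinAt (z.contMDiff p).contMDiffWithinAt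
      (uniqueMDiffOn_univ (I := I)) (Set.mem_univ p) (by simp)
    rw [contMDiffWithinAt_univ] at h
    exact h⟩

lemma HolVectorField.bracket_apply (y z : HolVectorField I M) (p : M) :
    ⁅y, z⁆ p = mlieBracket I y z p := rfl

/-- Holomorphic vector fields form a Lie ring under the Lie bracket of vector fields. -/
noncomputable instance : LieRing (HolVectorField I M) where
  add_lie x y z := by
    ext p
    exact mlieBracket_add_left (x.mdifferentiableAt p) (y.mdifferentiableAt p)
  lie_add x y z := by
    ext p
    exact mlieBracket_add_right (y.mdifferentiableAt p) (z.mdifferentiableAt p)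
  lie_self x := by
    ext p
    exact congrFun (mlieBracket_self (I := I) (V := fun q => x q)) p
  leibniz_lie x y z := by
    ext p
    exact leibniz_identity_mlieBracket_apply ((x.contMDiff p).of_le le_top)
      ((y.contMDiff p).of_le le_top) ((z.contMDiff p).of_le le_top)

noncomputable instance : LieAlgebra ℂ (HolVectorField I M) where
  lie_smul c x y := by
    ext p
    exact mlieBracket_const_smul_right (y.mdifferentiableAt p)

end HolomorphicVectorFields

/-- A finite-dimensional complex Lie algebra is reductive if its radical is its centre. -/
def IsReductive (𝔤 : Type*) [LieRing 𝔤] [LieAlgebra ℂ 𝔤] : Prop :=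
  Module.Finite ℂ 𝔤 ∧ LieAlgebra.radical ℂ 𝔤 = LieAlgebra.center ℂ 𝔤

/-- The compact-open topology on a group of homeomorphisms. -/
instance homeoCompactOpen (Y : Type*) [TopologicalSpace Y] : TopologicalSpace (Y ≃ₜ Y) :=
  TopologicalSpace.induced (fun σ : Y ≃ₜ Y => (⟨σ, σ.continuous⟩ : C(Y, Y))) inferInstance

section RiemannSurface

variable (X : Type*) [TopologicalSpace X] [ChartedSpace ℂ X] [IsManifold 𝓘(ℂ) ω X]

/-- Global holomorphic 1-forms on a Riemann surface. -/
abbrev HolOneForm := Cₛ^ω⟮𝓘(ℂ); ℂ →L[ℂ] ℂ,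
  fun x : X => TangentSpace 𝓘(ℂ) x →L[ℂ] Bundle.Trivial X ℂ x⟯

/-- The genus of a compact Riemann surface: the dimension of its space of holomorphic 1-forms. -/
noncomputable def genus : ℕ∞ := Cardinal.toENat (Module.rank ℂ (HolOneForm X))

end RiemannSurface

section LineBundle

variable {X : Type*} [TopologicalSpace X] [ChartedSpace ℂ X]
  (L : X → Type*) [TopologicalSpace (Bundle.TotalSpace ℂ L)]
  [∀ x, TopologicalSpace (L x)] [∀ x, AddCommGroup (L x)] [∀ x, Module ℂ (L x)]
  [FiberBundle ℂ L] [VectorBundle ℂ ℂ L]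

/-- The total space of a line bundle is modelled on `ℂ × ℂ`. -/
noncomputable abbrev totalModel : ModelWithCorners ℂ (ℂ × ℂ) (ModelProd ℂ ℂ) := 𝓘(ℂ).prod 𝓘(ℂ)

/-- The same model, regarded as a real model: it is used for real smoothness. -/
noncomputable abbrev totalModelReal : ModelWithCorners ℝ (ℂ × ℂ) (ModelProd ℂ ℂ) :=
  𝓘(ℝ, ℂ).prod 𝓘(ℝ, ℂ)

/-- A smooth hermitian metric on a complex line bundle, given by its squared norm `v ↦ |v|²`.
On a complex line a hermitian inner product is the same thing as such a function. -/
structure HermitianMetric where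
  normSq : Bundle.TotalSpace ℂ L → ℝ
  normSq_smul : ∀ (c : ℂ) (x : X) (v : L x), normSq ⟨x, c • v⟩ = ‖c‖ ^ 2 * normSq ⟨x, v⟩
  normSq_pos : ∀ (x : X) (v : L x), v ≠ 0 → 0 < normSq ⟨x, v⟩
  smooth : ContMDiff totalModelReal 𝓘(ℝ, ℝ) ∞ normSq

variable {L}

/-- The squared norm `|s|²` of the local holomorphic frame `s` given by the preferred
trivialization at `x`, as a function of the coordinate `z` of the preferred chart at `x`. For the
tangent bundle, `s` is the coordinate vector field of the chart. -/
noncomputable def HermitianMetric.weight (h : HermitianMetric L) (x : X) (z : ℂ) : ℝ :=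
  h.normSq ⟨(chartAt ℂ x).symm z,
    (trivializationAt ℂ L x).symm ((chartAt ℂ x).symm z) (1 : ℂ)⟩

/-- The function `κ` with `i F_h = κ (i/2) dz ∧ dz̄` at `x`, in the coordinate `z` of the
preferred chart at `x`, where `F_h = ∂̄∂ log |s|²` is the curvature of the Chern connection:
`κ = - (1/2) Δ₀ log |s|²`, with `Δ₀` the flat Laplacian of the coordinate. -/
noncomputable def HermitianMetric.curvature (h : HermitianMetric L) (x : X) : ℝ :=
  -(1 / 2) * Laplacian.laplacian (fun z : ℂ => Real.log (h.weight x z)) (chartAt ℂ x x)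

variable (X) in
/-- A Kähler metric on a Riemann surface is a hermitian metric on its tangent bundle. In a
coordinate `z` in which the coordinate vector field has squared norm `ρ`, its Kähler form is the
area form `ρ (i/2) dz ∧ dz̄`. -/
abbrev KahlerMetric [IsManifold 𝓘(ℂ) ω X] :=
  HermitianMetric (TangentSpace 𝓘(ℂ) : X → Type)

/-- The density `ρ` of the Kähler form, at the point `x`. -/
noncomputable def density [IsManifold 𝓘(ℂ) ω X] (g : KahlerMetric X) (x : X) : ℝ :=
  g.weight x (chartAt ℂ x x)

/-- `i Λ_ω F_h`, where `Λ_ω` is the contraction with the Kähler form, so that `Λ_ω ω = 1`. -/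
noncomputable def contractedCurvature [IsManifold 𝓘(ℂ) ω X] (g : KahlerMetric X)
    (h : HermitianMetric L) (x : X) : ℝ :=
  h.curvature x / density g x

/-- The Laplace operator `Δ_ω f = 2 i Λ_ω ∂̄∂ f = - ρ⁻¹ Δ₀ f`. -/
noncomputable def kahlerLaplacian [IsManifold 𝓘(ℂ) ω X] (g : KahlerMetric X) (f : X → ℝ)
    (x : X) : ℝ :=
  -(Laplacian.laplacian (fun z : ℂ => f ((chartAt ℂ x).symm z)) (chartAt ℂ x x) / density g x)

/-- The scalar curvature `S_ω`, normalized so that its integral is `2π χ(X)`: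
`S_ω = - (2ρ)⁻¹ Δ₀ log ρ`. -/
noncomputable def scalarCurvature [IsManifold 𝓘(ℂ) ω X] (g : KahlerMetric X) (x : X) : ℝ :=
  -(Laplacian.laplacian (fun z : ℂ => Real.log (g.weight x z)) (chartAt ℂ x x) /
    (2 * density g x))

variable (L) in
/-- Global holomorphic sections of `L`. -/
abbrev HolSection := Cₛ^ω⟮𝓘(ℂ); ℂ, L⟯

/-- The function `|φ|_h²` on the surface. -/
noncomputable def HermitianMetric.sectionNormSq (h : HermitianMetric L) (φ : HolSection L) (x : X) : ℝ :=
  h.normSq ⟨x, φ x⟩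

/-- The gravitating vortex equations for a Kähler metric `g` and a hermitian metric `h`:
`i Λ_ω F_h + (1/2) (|φ|_h² - τ) = 0` and `S_ω + α (Δ_ω + τ) (|φ|_h² - τ) = c`. -/
def IsGravitatingVortex [IsManifold 𝓘(ℂ) ω X] (τ α c : ℝ) (φ : HolSection L)
    (g : KahlerMetric X) (h : HermitianMetric L) : Prop :=
  ∀ x : X,
    contractedCurvature g h x + (1 / 2) * (h.sectionNormSq φ x - τ) = 0 ∧
    scalarCurvature g x
      + α * (kahlerLaplacian g (fun x' => h.sectionNormSq φ x' - τ) x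
        + τ * (h.sectionNormSq φ x - τ)) = c

/-- The order of vanishing of a section at a point. -/
noncomputable def vanishingOrder (φ : HolSection L) (x : X) : ℕ :=
  analyticOrderNatAt
    (fun z : ℂ => (trivializationAt ℂ L x
      ⟨(chartAt ℂ x).symm z, φ ((chartAt ℂ x).symm z)⟩).2)
    (chartAt ℂ x x)

/-- The degree of the divisor of a section. If `X` is compact and connected and `φ ≠ 0`, this is
the degree `c₁(L)` of the line bundle `L`. -/
noncomputable def divisorDegree (φ : HolSection L) : ℕ := ∑ᶠ x, vanishingOrder φ x

/-- Fibrewise multiplication by `c` on the total space. -/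
def fiberScale (c : ℂ) (p : Bundle.TotalSpace ℂ L) : Bundle.TotalSpace ℂ L := ⟨p.1, c • p.2⟩

/-- The image of a section in the total space. -/
def sectionGraph (φ : HolSection L) : Set (Bundle.TotalSpace ℂ L) :=
  Set.range fun x => (⟨x, φ x⟩ : Bundle.TotalSpace ℂ L)

variable (L) in
/-- The group `Aut(X, L)` of `ℂ*`-equivariant biholomorphic maps of the total space of `L`. -/
def autPair : Subgroup (Bundle.TotalSpace ℂ L ≃ₜ Bundle.TotalSpace ℂ L) where
  carrier := {σ | ContMDiff totalModel totalModel ω σ ∧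
    ContMDiff totalModel totalModel ω σ.symm ∧
    ∀ (c : ℂˣ) (p : Bundle.TotalSpace ℂ L), σ (fiberScale (c : ℂ) p) = fiberScale (c : ℂ) (σ p)}
  mul_mem' := by
    rintro σ τ ⟨h1, h2, h3⟩ ⟨k1, k2, k3⟩
    refine ⟨h1.comp k1, k2.comp h2, fun c p => ?_⟩
    change σ (τ _) = fiberScale (c : ℂ) (σ (τ p))
    rw [k3, h3]
  one_mem' := ⟨contMDiff_id, contMDiff_id, fun _ _ => rfl⟩
  inv_mem' := by
    rintro σ ⟨h1, h2, h3⟩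
    refine ⟨h2, h1, fun c p => ?_⟩
    change σ.symm _ = fiberScale (c : ℂ) (σ.symm p)
    rw [Homeomorph.symm_apply_eq, h3, Homeomorph.apply_symm_apply]

/-- The group `Aut(X, L, φ)`: the isotropy group of `φ` in `Aut(X, L)`. An automorphism acts on
sections by transport of their graphs. -/
def autTriple (φ : HolSection L) :
    Subgroup (Bundle.TotalSpace ℂ L ≃ₜ Bundle.TotalSpace ℂ L) where
  carrier := {σ | σ ∈ autPair L ∧ σ '' sectionGraph φ = sectionGraph φ}
  mul_mem' := by
    rintro σ τ ⟨h1, h2⟩ ⟨k1, k2⟩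
    refine ⟨mul_mem h1 k1, ?_⟩
    change (fun p => σ (τ p)) '' _ = _
    rw [← Set.image_image, k2, h2]
  one_mem' := ⟨one_mem _, Set.image_id _⟩
  inv_mem' := by
    rintro σ ⟨h1, h2⟩
    refine ⟨inv_mem h1, ?_⟩
    change σ.symm '' _ = _
    conv_lhs => rw [← h2]
    simp [Set.image_image]

/-- The map of the base covered by an automorphism of the line bundle. -/
def baseMap (σ : Bundle.TotalSpace ℂ L ≃ₜ Bundle.TotalSpace ℂ L) (x : X) : X :=
  (σ ⟨x, 0⟩).1

lemma apply_zero_of_mem_autPair {σ : Bundle.TotalSpace ℂ L ≃ₜ Bundle.TotalSpace ℂ L}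
    (hσ : σ ∈ autPair L) (x : X) : σ ⟨x, 0⟩ = ⟨baseMap σ x, 0⟩ := by
  have h := hσ.2.2 (Units.mk0 2 two_ne_zero) ⟨x, 0⟩
  have h0 : fiberScale (L := L) ((Units.mk0 (2 : ℂ) two_ne_zero : ℂˣ) : ℂ) ⟨x, 0⟩ = ⟨x, 0⟩ := by
    simp [fiberScale]
  rw [h0] at h
  unfold baseMap
  generalize σ ⟨x, 0⟩ = p at h
  rcases p with ⟨b, v⟩
  simp only [fiberScale, Bundle.TotalSpace.mk.injEq, heq_eq_eq, true_and, Units.val_mk0,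
    two_smul] at h
  have hv : v = 0 := by simpa using h
  rw [hv]

lemma baseMap_mul {σ τ : Bundle.TotalSpace ℂ L ≃ₜ Bundle.TotalSpace ℂ L}
    (hτ : τ ∈ autPair L) : baseMap (σ * τ) = baseMap σ ∘ baseMap τ := by
  funext x
  change (σ (τ ⟨x, 0⟩)).1 = _
  rw [apply_zero_of_mem_autPair hτ]
  rfl

lemma baseMap_one : baseMap (1 : Bundle.TotalSpace ℂ L ≃ₜ Bundle.TotalSpace ℂ L) = id := rfl

lemma mdifferentiable_baseMap [ContMDiffVectorBundle ω ℂ L 𝓘(ℂ)]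
    {σ : Bundle.TotalSpace ℂ L ≃ₜ Bundle.TotalSpace ℂ L}
    (hσ : σ ∈ autPair L) : MDifferentiable 𝓘(ℂ) 𝓘(ℂ) (baseMap σ) := by
  have h : ContMDiff 𝓘(ℂ) 𝓘(ℂ) ω (baseMap σ) :=
    (Bundle.contMDiff_proj L).comp (hσ.1.comp (Bundle.contMDiff_zeroSection ℂ L))
  exact h.mdifferentiable (by simp)

/-- The isotropy group of `(ω, h)` in `Aut(X, L, φ)`: the automorphisms that preserve the
hermitian metric `h` and cover an isometry of the Kähler metric `g`. -/
def isometryGroup [IsManifold 𝓘(ℂ) ω X] [ContMDiffVectorBundle ω ℂ L 𝓘(ℂ)]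
    (φ : HolSection L) (g : KahlerMetric X) (h : HermitianMetric L) :
    Subgroup (Bundle.TotalSpace ℂ L ≃ₜ Bundle.TotalSpace ℂ L) where
  carrier := {σ | σ ∈ autTriple φ ∧ (∀ p, h.normSq (σ p) = h.normSq p) ∧
    ∀ v : TangentBundle 𝓘(ℂ) X, g.normSq (tangentMap 𝓘(ℂ) 𝓘(ℂ) (baseMap σ) v) = g.normSq v}
  mul_mem' := by
    rintro σ τ ⟨h1, h2, h3⟩ ⟨k1, k2, k3⟩
    refine ⟨mul_mem h1 k1, fun p => (h2 (τ p)).trans (k2 p), fun v => ?_⟩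
    rw [baseMap_mul k1.1, tangentMap_comp (mdifferentiable_baseMap h1.1)
      (mdifferentiable_baseMap k1.1), Function.comp_apply, h3, k3]
  one_mem' := ⟨one_mem _, fun _ => rfl, fun v => by rw [baseMap_one, tangentMap_id]; rfl⟩
  inv_mem' := by
    rintro σ ⟨h1, h2, h3⟩
    have h4 := inv_mem h1
    refine ⟨h4, fun p => ?_, fun v => ?_⟩
    · rw [← h2]
      exact congrArg h.normSq (σ.apply_symm_apply p)
    · rw [← h3, ← Function.comp_apply (f := tangentMap 𝓘(ℂ) 𝓘(ℂ) (baseMap σ)),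
        ← tangentMap_comp (mdifferentiable_baseMap h1.1) (mdifferentiable_baseMap h4.1),
        ← baseMap_mul h4.1, mul_inv_cancel, baseMap_one, tangentMap_id]
      rfl

lemma contMDiff_fiberScale [ContMDiffVectorBundle ω ℂ L 𝓘(ℂ)] (c : ℂ) :
    ContMDiff totalModel totalModel ω (fiberScale (L := L) c) := by
  intro p
  rw [Bundle.contMDiffAt_totalSpace]
  refine ⟨Bundle.contMDiffAt_proj L, ?_⟩
  have h1 : ContMDiffAt totalModel 𝓘(ℂ) ω
      (fun q : Bundle.TotalSpace ℂ L => (trivializationAt ℂ L p.1 q).2) p :=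
    (Bundle.contMDiffAt_totalSpace.1 (contMDiffAt_id (x := p) (n := ω))).2
  have h0 : ContMDiffAt totalModel 𝓘(ℂ) ω (fun _ : Bundle.TotalSpace ℂ L => c) p :=
    contMDiffAt_const
  have h2 : ContMDiffAt totalModel 𝓘(ℂ) ω
      (fun q : Bundle.TotalSpace ℂ L => c • (trivializationAt ℂ L p.1 q).2) p :=
    h0.smul h1
  refine h2.congr_of_eventuallyEq ?_
  have h3 : Bundle.TotalSpace.proj ⁻¹' (trivializationAt ℂ L p.1).baseSet ∈ 𝓝 p :=
    ((trivializationAt ℂ L p.1).open_baseSet.preimage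
      (FiberBundle.continuous_proj ℂ L)).mem_nhds (FiberBundle.mem_baseSet_trivializationAt' p.1)
  filter_upwards [h3] with q hq
  exact ((trivializationAt ℂ L p.1).linear ℂ hq).map_smul c q.2

variable [IsManifold 𝓘(ℂ) ω X] [ContMDiffVectorBundle ω ℂ L 𝓘(ℂ)]

/-- The vector field along a section obtained by projecting a vector field on the total space. -/
noncomputable def projAlong (φ : HolSection L)
    (y : HolVectorField totalModel (Bundle.TotalSpace ℂ L)) (x : X) : TangentSpace 𝓘(ℂ) x :=
  mfderiv totalModel 𝓘(ℂ) (Bundle.TotalSpace.proj : Bundle.TotalSpace ℂ L → X) ⟨x, φ x⟩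
    (y ⟨x, φ x⟩)

lemma mdifferentiableAt_projAlong (φ : HolSection L)
    (y : HolVectorField totalModel (Bundle.TotalSpace ℂ L)) (x : X) :
    MDifferentiableAt 𝓘(ℂ) 𝓘(ℂ).tangent
      (fun x => (⟨x, projAlong φ y x⟩ : TangentBundle 𝓘(ℂ) X)) x := by
  have h1 : ContMDiff totalModel.tangent 𝓘(ℂ).tangent ω (tangentMap totalModel 𝓘(ℂ)
      (Bundle.TotalSpace.proj : Bundle.TotalSpace ℂ L → X)) :=
    (Bundle.contMDiff_proj (n := ω) (IB := 𝓘(ℂ)) L).contMDiff_tangentMap le_rfl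
  have h2 := h1.comp (y.contMDiff.comp φ.contMDiff)
  exact (h2 x).mdifferentiableAt (by simp)

variable (L) in
/-- The Lie algebra of `Aut(X, L)`: the `ℂ*`-invariant holomorphic vector fields on the total
space of `L`. -/
noncomputable def lieAutPair :
    LieSubalgebra ℂ (HolVectorField totalModel (Bundle.TotalSpace ℂ L)) where
  carrier := {y | ∀ (c : ℂˣ) (p : Bundle.TotalSpace ℂ L),
    y (fiberScale (c : ℂ) p) = mfderiv totalModel totalModel (fiberScale (L := L) (c : ℂ)) p (y p)}
  add_mem' := by
    intro y z hy hz c p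
    exact (congrArg₂ (· + ·) (hy c p) (hz c p)).trans (ContinuousLinearMap.map_add _ _ _).symm
  zero_mem' := fun c p => (ContinuousLinearMap.map_zero _).symm
  smul_mem' := by
    intro a y hy c p
    exact (congrArg (a • ·) (hy c p)).trans (ContinuousLinearMap.map_smul _ _ _).symm
  lie_mem' := by
    intro y z hy hz c p
    exact mlieBracket_of_related (contMDiff_fiberScale (c : ℂ)) (y.mdifferentiableAt _)
      (z.mdifferentiableAt _) (y.mdifferentiableAt _) (z.mdifferentiableAt _) (hy c) (hz c)

/-- The Lie algebra of `Aut(X, L, φ)`: the vector fields in the Lie algebra of `Aut(X, L)` with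
zero infinitesimal action on `φ`, that is, `y = dφ(y̌)` along the section `φ`, where `y̌` is the
vector field on `X` covered by `y`. -/
noncomputable def lieAutTriple (φ : HolSection L) :
    LieSubalgebra ℂ (HolVectorField totalModel (Bundle.TotalSpace ℂ L)) where
  carrier := {y | y ∈ lieAutPair L ∧ ∀ x : X,
    y ⟨x, φ x⟩ = mfderiv 𝓘(ℂ) totalModel (fun x' => (⟨x', φ x'⟩ : Bundle.TotalSpace ℂ L)) x
      (projAlong φ y x)}
  add_mem' := by
    rintro y z ⟨hy, hy'⟩ ⟨hz, hz'⟩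
    refine ⟨add_mem hy hz, fun x => ?_⟩
    have h : projAlong φ (y + z) x = projAlong φ y x + projAlong φ z x :=
      ContinuousLinearMap.map_add _ _ _
    rw [h]
    exact (congrArg₂ (· + ·) (hy' x) (hz' x)).trans (ContinuousLinearMap.map_add _ _ _).symm
  zero_mem' := by
    refine ⟨zero_mem _, fun x => ?_⟩
    have h : projAlong φ 0 x = 0 := ContinuousLinearMap.map_zero _
    rw [h]
    exact (ContinuousLinearMap.map_zero _).symm
  smul_mem' := by
    rintro a y ⟨hy, hy'⟩
    refine ⟨(lieAutPair L).smul_mem a hy, fun x => ?_⟩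
    have h : projAlong φ (a • y) x = a • projAlong φ y x := ContinuousLinearMap.map_smul _ _ _
    rw [h]
    exact (congrArg (a • ·) (hy' x)).trans (ContinuousLinearMap.map_smul _ _ _).symm
  lie_mem' := by
    rintro y z ⟨hy, hy'⟩ ⟨hz, hz'⟩
    refine ⟨(lieAutPair L).lie_mem hy hz, fun x => ?_⟩
    have h1 := mlieBracket_of_related φ.contMDiff (mdifferentiableAt_projAlong φ y x)
      (mdifferentiableAt_projAlong φ z x) (y.mdifferentiableAt _) (z.mdifferentiableAt _) hy' hz'
    have h2 : projAlong φ ⁅y, z⁆ x = mlieBracket 𝓘(ℂ) (projAlong φ y) (projAlong φ z) x := by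
      refine (congrArg (mfderiv totalModel 𝓘(ℂ)
        (Bundle.TotalSpace.proj : Bundle.TotalSpace ℂ L → X) ⟨x, φ x⟩) h1).trans ?_
      have hp : MDifferentiableAt totalModel 𝓘(ℂ)
          (Bundle.TotalSpace.proj : Bundle.TotalSpace ℂ L → X) ⟨x, φ x⟩ :=
        ((Bundle.contMDiff_proj (n := ω) (IB := 𝓘(ℂ)) L) _).mdifferentiableAt (by simp)
      have hs : MDifferentiableAt 𝓘(ℂ) totalModel
          (fun x' => (⟨x', φ x'⟩ : Bundle.TotalSpace ℂ L)) x :=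
        (φ.contMDiff x).mdifferentiableAt (by simp)
      have h3 := mfderiv_comp x hp hs
      have h4 : mfderiv 𝓘(ℂ) 𝓘(ℂ) ((Bundle.TotalSpace.proj : Bundle.TotalSpace ℂ L → X) ∘
          fun x' => (⟨x', φ x'⟩ : Bundle.TotalSpace ℂ L)) x = ContinuousLinearMap.id ℂ _ :=
        mfderiv_id
      have h5 := h3.symm.trans h4
      exact congrArg (fun T : ℂ →L[ℂ] ℂ =>
        T (mlieBracket 𝓘(ℂ) (projAlong φ y) (projAlong φ z) x)) h5
    rw [h2]
    exact h1

noncomputable instance (φ : HolSection L) : LieAlgebra ℝ (lieAutTriple φ) where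
  lie_smul a y z := lie_smul (a : ℂ) y z

/-- The vector field `y̌` on `X` covered by an invariant vector field `y` on the total space. -/
noncomputable def coveredField (y : HolVectorField totalModel (Bundle.TotalSpace ℂ L)) (x : X) :
    TangentSpace 𝓘(ℂ) x :=
  mfderiv totalModel 𝓘(ℂ) (Bundle.TotalSpace.proj : Bundle.TotalSpace ℂ L → X) ⟨x, 0⟩ (y ⟨x, 0⟩)

/-- `y` has zero infinitesimal action on `h` and on `ω`: the real derivative of the squared norm
of `h` along `y` vanishes, and the Lie derivative of `ω` along `y̌` vanishes. If `y̌` has the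
coordinate expression `f` and `ω = ρ (i/2) dz ∧ dz̄`, then this Lie
derivative is `(dρ(f) + 2 ρ Re f') (i/2) dz ∧ dz̄`. -/
def IsInfinitesimalIsometry (g : KahlerMetric X) (h : HermitianMetric L)
    (y : HolVectorField totalModel (Bundle.TotalSpace ℂ L)) : Prop :=
  (∀ p : Bundle.TotalSpace ℂ L, mfderiv totalModelReal 𝓘(ℝ, ℝ) h.normSq p (y p : ℂ × ℂ) = 0) ∧
  ∀ x : X, fderiv ℝ (g.weight x) (chartAt ℂ x x)
      (chartField (coveredField y) x (chartAt ℂ x x)) +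
    2 * density g x * (deriv (chartField (coveredField y) x) (chartAt ℂ x x)).re = 0

end LineBundle

end GravVortex

set_option linter.unusedSectionVars false

namespace GravVortex

open ComplexConjugate

section Wirtinger

/-- The Wirtinger derivative `∂f/∂z`. -/
noncomputable def dz (f : ℂ → ℂ) (z : ℂ) : ℂ :=
  (1 / 2) * (fderiv ℝ f z 1 - Complex.I * fderiv ℝ f z Complex.I)

/-- The Wirtinger derivative `∂f/∂z̄`. -/
noncomputable def dzb (f : ℂ → ℂ) (z : ℂ) : ℂ :=
  (1 / 2) * (fderiv ℝ f z 1 + Complex.I * fderiv ℝ f z Complex.I)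

variable {f g : ℂ → ℂ} {z : ℂ} {U : Set ℂ}

lemma fderiv_real_apply (f : ℂ → ℂ) (z v : ℂ) :
    fderiv ℝ f z v = dz f z * v + dzb f z * conj v := by
  have h : v = v.re • (1 : ℂ) + v.im • Complex.I := by
    simp [Complex.re_add_im]
  have h2 : fderiv ℝ f z v = v.re • fderiv ℝ f z 1 + v.im • fderiv ℝ f z Complex.I := by
    conv_lhs => rw [h]
    rw [map_add, map_smul, map_smul]
  rw [h2, dz, dzb]
  apply Complex.ext
  · simp; ring
  · simp; ring

lemma Filter.EventuallyEq.dz_eq (h : f =ᶠ[𝓝 z] g) : dz f z = dz g z := by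
  rw [dz, dz, h.fderiv_eq]

lemma Filter.EventuallyEq.dzb_eq (h : f =ᶠ[𝓝 z] g) : dzb f z = dzb g z := by
  rw [dzb, dzb, h.fderiv_eq]

lemma dz_congr (hU : IsOpen U) (h : ∀ z ∈ U, f z = g z) (hz : z ∈ U) : dz f z = dz g z :=
  Filter.EventuallyEq.dz_eq (Filter.eventuallyEq_of_mem (hU.mem_nhds hz) h)

lemma dzb_congr (hU : IsOpen U) (h : ∀ z ∈ U, f z = g z) (hz : z ∈ U) : dzb f z = dzb g z :=
  Filter.EventuallyEq.dzb_eq (Filter.eventuallyEq_of_mem (hU.mem_nhds hz) h)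

lemma dz_add (hf : DifferentiableAt ℝ f z) (hg : DifferentiableAt ℝ g z) :
    dz (fun z => f z + g z) z = dz f z + dz g z := by
  simp only [dz, fderiv_fun_add hf hg, add_apply]; ring

lemma dzb_add (hf : DifferentiableAt ℝ f z) (hg : DifferentiableAt ℝ g z) :
    dzb (fun z => f z + g z) z = dzb f z + dzb g z := by
  simp only [dzb, fderiv_fun_add hf hg, add_apply]; ring

lemma dz_sub (hf : DifferentiableAt ℝ f z) (hg : DifferentiableAt ℝ g z) :
    dz (fun z => f z - g z) z = dz f z - dz g z := by
  simp only [dz, fderiv_fun_sub hf hg, sub_apply]; ring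

lemma dzb_sub (hf : DifferentiableAt ℝ f z) (hg : DifferentiableAt ℝ g z) :
    dzb (fun z => f z - g z) z = dzb f z - dzb g z := by
  simp only [dzb, fderiv_fun_sub hf hg, sub_apply]; ring

lemma dz_mul (hf : DifferentiableAt ℝ f z) (hg : DifferentiableAt ℝ g z) :
    dz (fun z => f z * g z) z = dz f z * g z + f z * dz g z := by
  simp only [dz, fderiv_fun_mul hf hg, add_apply,
    smul_apply, smul_eq_mul]; ring

lemma dzb_mul (hf : DifferentiableAt ℝ f z) (hg : DifferentiableAt ℝ g z) :
    dzb (fun z => f z * g z) z = dzb f z * g z + f z * dzb g z := by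
  simp only [dzb, fderiv_fun_mul hf hg, add_apply,
    smul_apply, smul_eq_mul]; ring

@[simp] lemma dz_const (c z : ℂ) : dz (fun _ => c) z = 0 := by simp [dz]

@[simp] lemma dzb_const (c z : ℂ) : dzb (fun _ => c) z = 0 := by simp [dzb]

lemma dz_const_mul (c : ℂ) (hf : DifferentiableAt ℝ f z) :
    dz (fun z => c * f z) z = c * dz f z := by
  rw [dz_mul (differentiableAt_const c) hf]; simp

lemma dzb_const_mul (c : ℂ) (hf : DifferentiableAt ℝ f z) :
    dzb (fun z => c * f z) z = c * dzb f z := by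
  rw [dzb_mul (differentiableAt_const c) hf]; simp

lemma differentiableAt_conj_comp (hf : DifferentiableAt ℝ f z) :
    DifferentiableAt ℝ (fun z => conj (f z)) z :=
  Complex.conjCLE.differentiableAt.comp z hf

lemma contDiffOn_conj_comp (hf : ContDiffOn ℝ ∞ f U) :
    ContDiffOn ℝ ∞ (fun z => conj (f z)) U :=
  Complex.conjCLE.contDiff.comp_contDiffOn hf

lemma fderiv_conj_comp (hf : DifferentiableAt ℝ f z) (v : ℂ) :
    fderiv ℝ (fun z => conj (f z)) z v = conj (fderiv ℝ f z v) := by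
  have h : HasFDerivAt (fun z => conj (f z))
      ((Complex.conjCLE : ℂ →L[ℝ] ℂ).comp (fderiv ℝ f z)) z :=
    Complex.conjCLE.hasFDerivAt.comp z hf.hasFDerivAt
  rw [h.fderiv]; rfl

lemma dz_conj (hf : DifferentiableAt ℝ f z) :
    dz (fun z => conj (f z)) z = conj (dzb f z) := by
  simp only [dz, dzb, fderiv_conj_comp hf]
  simp only [map_mul, map_add, map_div₀, map_one, Complex.conj_ofNat, Complex.conj_I]
  ring

lemma dzb_conj (hf : DifferentiableAt ℝ f z) :
    dzb (fun z => conj (f z)) z = conj (dz f z) := by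
  simp only [dz, dzb, fderiv_conj_comp hf]
  simp only [map_mul, map_sub, map_div₀, map_one, Complex.conj_ofNat, Complex.conj_I]
  ring

lemma contDiffOn_fderiv_apply (hU : IsOpen U) (hf : ContDiffOn ℝ ∞ f U) (v : ℂ) :
    ContDiffOn ℝ ∞ (fun z => fderiv ℝ f z v) U :=
  (hf.fderiv_of_isOpen hU (by simp)).clm_apply contDiffOn_const

lemma contDiffOn_dz (hU : IsOpen U) (hf : ContDiffOn ℝ ∞ f U) : ContDiffOn ℝ ∞ (dz f) U :=
  contDiffOn_const.mul ((contDiffOn_fderiv_apply hU hf 1).sub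
    (contDiffOn_const.mul (contDiffOn_fderiv_apply hU hf Complex.I)))

lemma contDiffOn_dzb (hU : IsOpen U) (hf : ContDiffOn ℝ ∞ f U) : ContDiffOn ℝ ∞ (dzb f) U :=
  contDiffOn_const.mul ((contDiffOn_fderiv_apply hU hf 1).add
    (contDiffOn_const.mul (contDiffOn_fderiv_apply hU hf Complex.I)))

lemma ContDiffOn.differentiableAt_of_isOpen (hU : IsOpen U) (hf : ContDiffOn ℝ ∞ f U)
    (hz : z ∈ U) : DifferentiableAt ℝ f z :=
  (hf.contDiffAt (hU.mem_nhds hz)).differentiableAt (by simp)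

lemma fderiv_fderiv_apply (hU : IsOpen U) (hf : ContDiffOn ℝ ∞ f U) (hz : z ∈ U) (v w : ℂ) :
    fderiv ℝ (fun z => fderiv ℝ f z v) z w = fderiv ℝ (fderiv ℝ f) z w v := by
  have h : DifferentiableAt ℝ (fderiv ℝ f) z :=
    ((hf.fderiv_of_isOpen (m := ∞) hU (by simp)).contDiffAt (hU.mem_nhds hz)).differentiableAt
      (by simp)
  rw [fderiv_clm_apply h (differentiableAt_const v)]
  simp

lemma fderiv_fderiv_symm (hU : IsOpen U) (hf : ContDiffOn ℝ ∞ f U) (hz : z ∈ U) (v w : ℂ) :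
    fderiv ℝ (fderiv ℝ f) z w v = fderiv ℝ (fderiv ℝ f) z v w :=
  ((hf.contDiffAt (hU.mem_nhds hz)).isSymmSndFDerivAt
    (by simpa using WithTop.coe_le_coe.2 (le_top : (2 : ℕ∞) ≤ ⊤))).eq w v

lemma fderiv_dz_apply (hU : IsOpen U) (hf : ContDiffOn ℝ ∞ f U) (hz : z ∈ U) (v : ℂ) :
    fderiv ℝ (dz f) z v = (1 / 2) * (fderiv ℝ (fderiv ℝ f) z v 1 -
      Complex.I * fderiv ℝ (fderiv ℝ f) z v Complex.I) := by
  have h1 := ContDiffOn.differentiableAt_of_isOpen hU (contDiffOn_fderiv_apply hU hf 1) hz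
  have h2 := ContDiffOn.differentiableAt_of_isOpen hU
    (contDiffOn_fderiv_apply hU hf Complex.I) hz
  have h3 : HasFDerivAt (dz f) ((1 / 2 : ℂ) • (fderiv ℝ (fun z => fderiv ℝ f z 1) z -
      Complex.I • fderiv ℝ (fun z => fderiv ℝ f z Complex.I) z)) z :=
    (h1.hasFDerivAt.sub (h2.hasFDerivAt.const_mul _)).const_mul _
  rw [h3.fderiv]
  simp [fderiv_fderiv_apply hU hf hz]

lemma fderiv_dzb_apply (hU : IsOpen U) (hf : ContDiffOn ℝ ∞ f U) (hz : z ∈ U) (v : ℂ) :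
    fderiv ℝ (dzb f) z v = (1 / 2) * (fderiv ℝ (fderiv ℝ f) z v 1 +
      Complex.I * fderiv ℝ (fderiv ℝ f) z v Complex.I) := by
  have h1 := ContDiffOn.differentiableAt_of_isOpen hU (contDiffOn_fderiv_apply hU hf 1) hz
  have h2 := ContDiffOn.differentiableAt_of_isOpen hU
    (contDiffOn_fderiv_apply hU hf Complex.I) hz
  have h3 : HasFDerivAt (dzb f) ((1 / 2 : ℂ) • (fderiv ℝ (fun z => fderiv ℝ f z 1) z +
      Complex.I • fderiv ℝ (fun z => fderiv ℝ f z Complex.I) z)) z :=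
    (h1.hasFDerivAt.add (h2.hasFDerivAt.const_mul _)).const_mul _
  rw [h3.fderiv]
  simp [fderiv_fderiv_apply hU hf hz, mul_add]

lemma dz_dzb_comm (hU : IsOpen U) (hf : ContDiffOn ℝ ∞ f U) (hz : z ∈ U) :
    dz (dzb f) z = dzb (dz f) z := by
  rw [dz, dzb, fderiv_dzb_apply hU hf hz, fderiv_dzb_apply hU hf hz, fderiv_dz_apply hU hf hz,
    fderiv_dz_apply hU hf hz, fderiv_fderiv_symm hU hf hz 1 Complex.I]
  ring

lemma dzb_eq_zero_of_differentiableAt (hf : DifferentiableAt ℂ f z) : dzb f z = 0 := by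
  have h : fderiv ℝ f z = (fderiv ℂ f z).restrictScalars ℝ :=
    (hf.hasFDerivAt.restrictScalars ℝ).fderiv
  have h2 : fderiv ℂ f z Complex.I = Complex.I * fderiv ℂ f z 1 := by
    rw [← smul_eq_mul, ← map_smul]; simp
  rw [dzb, h]
  simp only [ContinuousLinearMap.coe_restrictScalars']
  rw [h2, ← mul_assoc, Complex.I_mul_I]; ring

lemma dz_eq_deriv (hf : DifferentiableAt ℂ f z) : dz f z = deriv f z := by
  have h : fderiv ℝ f z = (fderiv ℂ f z).restrictScalars ℝ :=
    (hf.hasFDerivAt.restrictScalars ℝ).fderiv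
  have h2 : fderiv ℂ f z Complex.I = Complex.I * fderiv ℂ f z 1 := by
    rw [← smul_eq_mul, ← map_smul]; simp
  rw [dz, h]
  simp only [ContinuousLinearMap.coe_restrictScalars']
  rw [h2, ← mul_assoc, Complex.I_mul_I, fderiv_apply_one_eq_deriv]; ring

lemma differentiableAt_of_dzb_eq_zero (hf : DifferentiableAt ℝ f z) (h : dzb f z = 0) :
    DifferentiableAt ℂ f z := by
  have h1 : HasFDerivAt f ((ContinuousLinearMap.toSpanSingleton ℂ (dz f z))) z := by
    refine HasFDerivAt.of_isLittleO ?_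
    have h2 := hf.hasFDerivAt.isLittleO
    refine h2.congr_left fun w => ?_
    simp [fderiv_real_apply f z, h, mul_comm]
  exact h1.differentiableAt

/-- The chain rule for a holomorphic inner function. -/
lemma fderiv_comp_holomorphic {T : ℂ → ℂ} (hT : DifferentiableAt ℂ T z)
    (hf : DifferentiableAt ℝ f (T z)) (v : ℂ) :
    fderiv ℝ (fun z => f (T z)) z v = fderiv ℝ f (T z) (deriv T z * v) := by
  have h : HasFDerivAt (fun z => f (T z))
      ((fderiv ℝ f (T z)).comp ((fderiv ℂ T z).restrictScalars ℝ)) z :=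
    hf.hasFDerivAt.comp z (hT.hasFDerivAt.restrictScalars ℝ)
  rw [h.fderiv]
  simp [mul_comm]

lemma dz_comp {T : ℂ → ℂ} (hT : DifferentiableAt ℂ T z) (hf : DifferentiableAt ℝ f (T z)) :
    dz (fun z => f (T z)) z = dz f (T z) * deriv T z := by
  rw [dz, fderiv_comp_holomorphic hT hf, fderiv_comp_holomorphic hT hf,
    fderiv_real_apply, fderiv_real_apply]
  simp only [map_mul, map_one, Complex.conj_I]
  linear_combination (-(1/2) * dz f (T z) * deriv T z
    + (1/2) * dzb f (T z) * conj (deriv T z)) * Complex.I_mul_I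

lemma dzb_comp {T : ℂ → ℂ} (hT : DifferentiableAt ℂ T z) (hf : DifferentiableAt ℝ f (T z)) :
    dzb (fun z => f (T z)) z = dzb f (T z) * conj (deriv T z) := by
  rw [dzb, fderiv_comp_holomorphic hT hf, fderiv_comp_holomorphic hT hf,
    fderiv_real_apply, fderiv_real_apply]
  simp only [map_mul, map_one, Complex.conj_I]
  linear_combination ((1/2) * dz f (T z) * deriv T z
    - (1/2) * dzb f (T z) * conj (deriv T z)) * Complex.I_mul_I

lemma contDiffOn_of_differentiableOn (hU : IsOpen U) (hf : DifferentiableOn ℂ f U) :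
    ContDiffOn ℝ ∞ f U :=
  (hf.contDiffOn hU).restrict_scalars ℝ

/-- The Laplacian of a real function in terms of Wirtinger derivatives. -/
lemma laplacian_eq_dzb_dz {r : ℂ → ℝ} (hU : IsOpen U) (hr : ContDiffOn ℝ ∞ r U) (hz : z ∈ U) :
    ((Laplacian.laplacian r z : ℝ) : ℂ) = 4 * dzb (dz (fun z => (r z : ℂ))) z := by
  have hrc : ContDiffOn ℝ ∞ (fun z => (r z : ℂ)) U :=
    Complex.ofRealCLM.contDiff.comp_contDiffOn hr
  have h0 : (Laplacian.laplacian (Complex.ofRealCLM ∘ r) z : ℂ) =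
      Complex.ofRealCLM (Laplacian.laplacian r z) :=
    ContDiffAt.laplacian_CLM_comp_left ((hr.contDiffAt (hU.mem_nhds hz)).of_le
      (WithTop.coe_le_coe.2 (le_top : (2 : ℕ∞) ≤ ⊤)))
  have h1 : ((Laplacian.laplacian r z : ℝ) : ℂ) =
      Laplacian.laplacian (fun z => (r z : ℂ)) z := h0.symm
  rw [h1, InnerProductSpace.laplacian_eq_iteratedFDeriv_complexPlane]
  simp only [iteratedFDeriv_two_apply]
  rw [dzb, fderiv_dz_apply hU hrc hz, fderiv_dz_apply hU hrc hz,
    fderiv_fderiv_symm hU hrc hz 1 Complex.I]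
  simp only [Matrix.cons_val_zero, Matrix.cons_val_one]
  linear_combination (fderiv ℝ (fderiv ℝ (fun z => (r z : ℂ))) z Complex.I Complex.I) * Complex.I_mul_I

lemma dzb_ofReal {r : ℂ → ℝ} (hr : DifferentiableAt ℝ r z) :
    dzb (fun z => (r z : ℂ)) z = conj (dz (fun z => (r z : ℂ)) z) := by
  have h : DifferentiableAt ℝ (fun z => (r z : ℂ)) z := Complex.ofRealCLM.differentiableAt.comp z hr
  rw [← dzb_conj h]; simp

lemma fderiv_ofReal_apply {r : ℂ → ℝ} (hr : DifferentiableAt ℝ r z) (v : ℂ) :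
    ((fderiv ℝ r z v : ℝ) : ℂ) = fderiv ℝ (fun z => (r z : ℂ)) z v := by
  have h : HasFDerivAt (fun z => (r z : ℂ)) (Complex.ofRealCLM.comp (fderiv ℝ r z)) z :=
    Complex.ofRealCLM.hasFDerivAt.comp z hr.hasFDerivAt
  rw [h.fderiv]; rfl

lemma fderiv_eq_two_mul_re_dz {r : ℂ → ℝ} (hr : DifferentiableAt ℝ r z) (v : ℂ) :
    fderiv ℝ r z v = 2 * (dz (fun z => (r z : ℂ)) z * v).re := by
  have h := fderiv_ofReal_apply hr v
  rw [fderiv_real_apply, dzb_ofReal hr, ← map_mul] at h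
  have h2 := congrArg Complex.re h
  simp only [Complex.ofReal_re, Complex.add_re, Complex.conj_re] at h2
  rw [h2]; ring

lemma dz_cexp (hf : DifferentiableAt ℝ f z) :
    dz (fun z => Complex.exp (f z)) z = Complex.exp (f z) * dz f z := by
  have h : HasFDerivAt (fun z => Complex.exp (f z)) (Complex.exp (f z) • fderiv ℝ f z) z :=
    hf.hasFDerivAt.cexp
  rw [dz, dz, h.fderiv]; simp; ring

lemma dzb_cexp (hf : DifferentiableAt ℝ f z) :
    dzb (fun z => Complex.exp (f z)) z = Complex.exp (f z) * dzb f z := by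
  have h : HasFDerivAt (fun z => Complex.exp (f z)) (Complex.exp (f z) • fderiv ℝ f z) z :=
    hf.hasFDerivAt.cexp
  rw [dzb, dzb, h.fderiv]; simp; ring

end Wirtinger

/-- A holomorphic atlas on a surface: a chart around every point, with holomorphic transitions. -/
structure HolAtlas (X : Type*) [TopologicalSpace X] where
  chart : X → OpenPartialHomeomorph X ℂ
  mem_source : ∀ x, x ∈ (chart x).source
  holo : ∀ x y, DifferentiableOn ℂ (fun z => chart y ((chart x).symm z))
    ((chart x).target ∩ (chart x).symm ⁻¹' (chart y).source)

namespace HolAtlas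

variable {X : Type*} [TopologicalSpace X] (A : HolAtlas X)

/-- The centre of the chart at `x`. -/
noncomputable def center (x : X) : ℂ := A.chart x x

/-- The transition map from the chart at `x` to the chart at `y`. -/
noncomputable def tr (x y : X) (z : ℂ) : ℂ := A.chart y ((A.chart x).symm z)

/-- The domain of the transition map. -/
noncomputable def overlap (x y : X) : Set ℂ := (A.chart x).target ∩ (A.chart x).symm ⁻¹' (A.chart y).source

variable {A} {x y w : X} {z : ℂ}

lemma center_mem (x : X) : A.center x ∈ (A.chart x).target :=
  (A.chart x).map_source (A.mem_source x)

lemma symm_center (x : X) : (A.chart x).symm (A.center x) = x :=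
  (A.chart x).left_inv (A.mem_source x)

lemma isOpen_overlap (x y : X) : IsOpen (A.overlap x y) :=
  (A.chart x).isOpen_inter_preimage_symm (A.chart y).open_source

lemma differentiableOn_tr (x y : X) : DifferentiableOn ℂ (A.tr x y) (A.overlap x y) := A.holo x y

lemma differentiableAt_tr (hz : z ∈ A.overlap x y) : DifferentiableAt ℂ (A.tr x y) z :=
  (differentiableOn_tr x y).differentiableAt ((isOpen_overlap x y).mem_nhds hz)

lemma tr_mem_target (hz : z ∈ A.overlap x y) : A.tr x y z ∈ (A.chart y).target :=
  (A.chart y).map_source hz.2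

lemma symm_tr (hz : z ∈ A.overlap x y) : (A.chart y).symm (A.tr x y z) = (A.chart x).symm z :=
  (A.chart y).left_inv hz.2

lemma tr_mem (hz : z ∈ A.overlap x y) : A.tr x y z ∈ A.overlap y x := by
  refine ⟨tr_mem_target hz, ?_⟩
  rw [Set.mem_preimage, symm_tr hz]
  exact (A.chart x).map_target hz.1

lemma tr_tr (hz : z ∈ A.overlap x y) : A.tr y x (A.tr x y z) = z := by
  rw [tr, symm_tr hz]; exact (A.chart x).right_inv hz.1

lemma deriv_tr_mul (hz : z ∈ A.overlap x y) :
    deriv (A.tr y x) (A.tr x y z) * deriv (A.tr x y) z = 1 := by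
  have h1 : (fun z => A.tr y x (A.tr x y z)) =ᶠ[𝓝 z] fun z => z :=
    Filter.eventuallyEq_of_mem ((isOpen_overlap x y).mem_nhds hz) fun _ h => tr_tr h
  have h2 := h1.deriv_eq
  have h3 := ((differentiableAt_tr (tr_mem hz)).hasDerivAt.comp z
    (differentiableAt_tr hz).hasDerivAt).deriv
  exact h3.symm.trans (h2.trans (deriv_id z))

lemma deriv_tr_ne_zero (hz : z ∈ A.overlap x y) : deriv (A.tr x y) z ≠ 0 :=
  right_ne_zero_of_mul_eq_one (deriv_tr_mul hz)

lemma continuousOn_tr (x y : X) : ContinuousOn (A.tr x y) (A.overlap x y) :=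
  (differentiableOn_tr x y).continuousOn

variable (A) in
/-- A smooth section of the `k`-th power of the canonical bundle tensor the `l`-th power of its
conjugate, as a family of coordinate expressions. -/
structure IsForm (k l : ℤ) (F : X → ℂ → ℂ) : Prop where
  smooth : ∀ x, ContDiffOn ℝ ∞ (F x) (A.chart x).target
  trans : ∀ x y, ∀ z ∈ A.overlap x y, F x z =
    F y (A.tr x y z) * deriv (A.tr x y) z ^ k * conj (deriv (A.tr x y) z) ^ l

variable (A) in
/-- The family of coordinate expressions of a function. -/
noncomputable def fn (f : X → ℂ) (x : X) (z : ℂ) : ℂ := f ((A.chart x).symm z)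

variable (A) in
/-- The coefficients of a form at the centres of the charts. -/
noncomputable def val (F : X → ℂ → ℂ) (x : X) : ℂ := F x (A.center x)

namespace IsForm

variable {k l k' l' : ℤ} {F G : X → ℂ → ℂ}

lemma differentiableAt (hF : A.IsForm k l F) (hz : z ∈ (A.chart x).target) :
    DifferentiableAt ℝ (F x) z :=
  ContDiffOn.differentiableAt_of_isOpen (A.chart x).open_target (hF.smooth x) hz

lemma mul (hF : A.IsForm k l F) (hG : A.IsForm k' l' G) :
    A.IsForm (k + k') (l + l') (fun x z => F x z * G x z) where
  smooth x := (hF.smooth x).mul (hG.smooth x)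
  trans x y z hz := by
    have h := deriv_tr_ne_zero hz
    have h' : conj (deriv (A.tr x y) z) ≠ 0 := by simpa using h
    rw [hF.trans x y z hz, hG.trans x y z hz, zpow_add₀ h, zpow_add₀ h']; ring

lemma add (hF : A.IsForm k l F) (hG : A.IsForm k l G) :
    A.IsForm k l (fun x z => F x z + G x z) where
  smooth x := (hF.smooth x).add (hG.smooth x)
  trans x y z hz := by rw [hF.trans x y z hz, hG.trans x y z hz]; ring

lemma sub (hF : A.IsForm k l F) (hG : A.IsForm k l G) :
    A.IsForm k l (fun x z => F x z - G x z) where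
  smooth x := (hF.smooth x).sub (hG.smooth x)
  trans x y z hz := by rw [hF.trans x y z hz, hG.trans x y z hz]; ring

lemma const_mul (c : ℂ) (hF : A.IsForm k l F) : A.IsForm k l (fun x z => c * F x z) where
  smooth x := contDiffOn_const.mul (hF.smooth x)
  trans x y z hz := by rw [hF.trans x y z hz]; ring

lemma zero : A.IsForm k l (fun _ _ => 0) where
  smooth x := contDiffOn_const
  trans x y z hz := by simp

lemma const (c : ℂ) : A.IsForm 0 0 (fun _ _ => c) where
  smooth x := contDiffOn_const
  trans x y z hz := by simp

lemma cconj (hF : A.IsForm k l F) : A.IsForm l k (fun x z => conj (F x z)) where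
  smooth x := contDiffOn_conj_comp (hF.smooth x)
  trans x y z hz := by
    rw [hF.trans x y z hz]; simp only [map_mul, map_zpow₀, Complex.conj_conj]; ring

lemma inv (hF : A.IsForm k l F) (h0 : ∀ x, ∀ z ∈ (A.chart x).target, F x z ≠ 0) :
    A.IsForm (-k) (-l) (fun x z => (F x z)⁻¹) where
  smooth x := (hF.smooth x).inv (h0 x)
  trans x y z hz := by
    rw [hF.trans x y z hz, mul_inv, mul_inv, zpow_neg, zpow_neg]

lemma congr (hF : A.IsForm k l F) (h : ∀ x, ∀ z ∈ (A.chart x).target, G x z = F x z) :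
    A.IsForm k l G where
  smooth x := (hF.smooth x).congr (h x)
  trans x y z hz := by
    rw [h x z hz.1, h y _ (tr_mem_target hz), hF.trans x y z hz]

lemma cast (hF : A.IsForm k l F) (hk : k = k') (hl : l = l') : A.IsForm k' l' F := by
  subst hk hl; exact hF

lemma dzb (hF : A.IsForm k 0 F) : A.IsForm k 1 (fun x z => dzb (F x) z) where
  smooth x := contDiffOn_dzb (A.chart x).open_target (hF.smooth x)
  trans x y z hz := by
    have hT := differentiableAt_tr hz
    have hd : DifferentiableAt ℂ (fun z => deriv (A.tr x y) z ^ k) z :=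
      (((differentiableOn_tr x y).deriv (isOpen_overlap x y)).differentiableAt
        ((isOpen_overlap x y).mem_nhds hz)).zpow (Or.inl (deriv_tr_ne_zero hz))
    have hFd := hF.differentiableAt (tr_mem_target hz)
    have hc : DifferentiableAt ℝ (fun z => F y (A.tr x y z)) z :=
      hFd.comp z (hT.restrictScalars ℝ)
    rw [dzb_congr (isOpen_overlap x y) (fun z hz => (hF.trans x y z hz)) hz]
    simp only [zpow_zero, mul_one]
    rw [dzb_mul hc (hd.restrictScalars ℝ), dzb_comp hT hFd,
      dzb_eq_zero_of_differentiableAt hd, zpow_one]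
    ring

lemma dz (hF : A.IsForm 0 l F) : A.IsForm 1 l (fun x z => dz (F x) z) := by
  refine (hF.cconj.dzb.cconj).congr fun x z hz => ?_
  have := hF.cconj.differentiableAt hz
  rw [← dz_conj this]; simp

lemma fn_val (hF : A.IsForm 0 0 F) (hz : z ∈ (A.chart x).target) :
    F x z = A.val F ((A.chart x).symm z) := by
  have h : z ∈ A.overlap x ((A.chart x).symm z) := ⟨hz, A.mem_source _⟩
  rw [hF.trans x _ z h]; simp [val, tr, center]

end IsForm

lemma val_trans {k l : ℤ} {F : X → ℂ → ℂ} (hF : A.IsForm k l F) (hz : z ∈ (A.chart x).target) :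
    F x z = A.val F ((A.chart x).symm z) * deriv (A.tr x ((A.chart x).symm z)) z ^ k *
      conj (deriv (A.tr x ((A.chart x).symm z)) z) ^ l :=
  hF.trans x _ z ⟨hz, A.mem_source _⟩

lemma isForm_fn {f : X → ℂ} (h : ∀ x, ContDiffOn ℝ ∞ (A.fn f x) (A.chart x).target) :
    A.IsForm 0 0 (A.fn f) where
  smooth := h
  trans x y z hz := by simp [fn, symm_tr hz]

lemma val_fn (f : X → ℂ) (x : X) : A.val (A.fn f) x = f x := by
  simp [val, fn, symm_center]

/-- A form vanishes at the centre of each chart iff it vanishes. -/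
lemma IsForm.eq_zero_iff {k l : ℤ} {F : X → ℂ → ℂ} (hF : A.IsForm k l F)
    (hz : z ∈ (A.chart x).target) : F x z = 0 ↔ A.val F ((A.chart x).symm z) = 0 := by
  have h := deriv_tr_ne_zero (A := A) (x := x) (y := (A.chart x).symm z) (z := z)
    ⟨hz, A.mem_source _⟩
  rw [val_trans hF hz]
  simp [zpow_ne_zero, h]

lemma continuous_val {F : X → ℂ → ℂ} (hF : A.IsForm 0 0 F) : Continuous (A.val F) := by
  rw [continuous_iff_continuousAt]
  intro x
  have h1 : ContinuousAt (fun y => F x (A.chart x y)) x :=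
    ContinuousAt.comp (g := F x)
      ((hF.smooth x).continuousOn.continuousAt ((A.chart x).open_target.mem_nhds (center_mem x)))
      ((A.chart x).continuousAt (A.mem_source x))
  refine h1.congr ?_
  filter_upwards [(A.chart x).open_source.mem_nhds (A.mem_source x)] with y hy
  rw [hF.fn_val ((A.chart x).map_source hy), (A.chart x).left_inv hy]

lemma nhdsNE_neBot (A : HolAtlas X) (x : X) : (𝓝[≠] x).NeBot := by
  have h1 : (𝓝[≠] (A.chart x x)).NeBot := inferInstance
  rw [← mem_closure_iff_nhdsWithin_neBot] at h1 ⊢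
  rw [mem_closure_iff] at h1 ⊢
  intro O hO hx
  obtain ⟨z, hz1, hz2⟩ := h1 _ ((A.chart x).isOpen_inter_preimage_symm hO)
    ⟨center_mem x, by rw [Set.mem_preimage]; erw [symm_center]; exact hx⟩
  refine ⟨(A.chart x).symm z, hz1.2, fun h => hz2 ?_⟩
  rw [Set.mem_singleton_iff] at h ⊢
  rw [← (A.chart x).right_inv hz1.1, h]

/-- A set that is locally the zero set of a holomorphic function, near a point, either contains
a neighbourhood or is isolated. -/
lemma eventually_mem_or_eventually_notMem {Z : Set X} {F : ℂ → ℂ}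
    (hF : AnalyticAt ℂ F (A.center x))
    (h : ∀ᶠ z in 𝓝 (A.center x), (A.chart x).symm z ∈ Z ↔ F z = 0) :
    (∀ᶠ y in 𝓝 x, y ∈ Z) ∨ ∀ᶠ y in 𝓝[≠] x, y ∉ Z := by
  have hc : Filter.Tendsto (A.chart x) (𝓝 x) (𝓝 (A.center x)) :=
    (A.chart x).continuousAt (A.mem_source x)
  have hs : ∀ᶠ y in 𝓝 x, y ∈ (A.chart x).source :=
    (A.chart x).open_source.mem_nhds (A.mem_source x)
  rcases hF.eventually_eq_zero_or_eventually_ne_zero with h0 | h0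
  · left
    filter_upwards [hc.eventually (h.and h0), hs] with y hy hys
    rw [(A.chart x).left_inv hys] at hy
    exact hy.1.2 hy.2
  · right
    rw [eventually_nhdsWithin_iff] at h0 ⊢
    filter_upwards [hc.eventually (h.and h0), hs] with y hy hys hne hyZ
    rw [(A.chart x).left_inv hys] at hy
    refine hy.2 (fun hyx => hne ?_) (hy.1.1 hyZ)
    exact (A.chart x).injOn hys (A.mem_source x) hyx

/-- The identity theorem. -/
lemma eq_univ_of_interior_nonempty [PreconnectedSpace X] {Z : Set X}
    (h : ∀ x, ∃ F : ℂ → ℂ, AnalyticAt ℂ F (A.center x) ∧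
      ∀ᶠ z in 𝓝 (A.center x), (A.chart x).symm z ∈ Z ↔ F z = 0)
    (hne : (interior Z).Nonempty) : Z = Set.univ := by
  have hcl : IsClopen (interior Z) := by
    refine ⟨isClosed_of_closure_subset fun x hx => ?_, isOpen_interior⟩
    obtain ⟨F, hF, hFZ⟩ := h x
    rcases eventually_mem_or_eventually_notMem hF hFZ with h0 | h0
    · exact mem_interior_iff_mem_nhds.2 h0
    · exfalso
      rw [eventually_nhdsWithin_iff] at h0
      obtain ⟨O, hO, hOo, hxO⟩ := eventually_nhds_iff.1 h0
      obtain ⟨y, hyO, hyZ⟩ := mem_closure_iff.1 hx O hOo hxO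
      have := A.nhdsNE_neBot y
      have h1 : ∀ᶠ q in 𝓝[≠] y, q ∈ O ∧ q ∈ interior Z :=
        nhdsWithin_le_nhds ((hOo.inter isOpen_interior).mem_nhds ⟨hyO, hyZ⟩)
      have hyx : y = x := by
        by_contra hne
        exact hO y hyO hne (interior_subset hyZ)
      obtain ⟨q, hq, hqy⟩ := (h1.and self_mem_nhdsWithin).exists
      exact hO q hq.1 (fun h => hqy (by rw [hyx]; exact h)) (interior_subset hq.2)
  have h2 := hcl.eq_univ hne
  exact Set.eq_univ_of_univ_subset (h2 ▸ interior_subset)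

lemma eventually_notMem_of_ne_univ [PreconnectedSpace X] {Z : Set X}
    (h : ∀ x, ∃ F : ℂ → ℂ, AnalyticAt ℂ F (A.center x) ∧
      ∀ᶠ z in 𝓝 (A.center x), (A.chart x).symm z ∈ Z ↔ F z = 0)
    (hne : Z ≠ Set.univ) (x : X) : ∀ᶠ y in 𝓝[≠] x, y ∉ Z := by
  obtain ⟨F, hF, hFZ⟩ := h x
  refine (eventually_mem_or_eventually_notMem hF hFZ).resolve_left fun h0 => hne ?_
  exact eq_univ_of_interior_nonempty h ⟨x, mem_interior_iff_mem_nhds.2 h0⟩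

/-- A smooth form is holomorphic if it is killed by `∂̄`. -/
def IsHol (A : HolAtlas X) (F : X → ℂ → ℂ) : Prop :=
  ∀ x, DifferentiableOn ℂ (F x) (A.chart x).target

lemma IsForm.isHol {k l : ℤ} {F : X → ℂ → ℂ} (hF : A.IsForm k l F)
    (h : ∀ x, ∀ z ∈ (A.chart x).target, GravVortex.dzb (F x) z = 0) : A.IsHol F := fun x z hz =>
  (differentiableAt_of_dzb_eq_zero (hF.differentiableAt hz) (h x z hz)).differentiableWithinAt

lemma IsHol.analyticAt {F : X → ℂ → ℂ} (hF : A.IsHol F) (hz : z ∈ (A.chart x).target) :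
    AnalyticAt ℂ (F x) z :=
  (hF x).analyticAt ((A.chart x).open_target.mem_nhds hz)

lemma IsForm.locally_zero_set {k l : ℤ} {F : X → ℂ → ℂ} (hF : A.IsForm k l F) (hh : A.IsHol F)
    (x : X) : ∃ f : ℂ → ℂ, AnalyticAt ℂ f (A.center x) ∧
      ∀ᶠ z in 𝓝 (A.center x), (A.chart x).symm z ∈ {y | A.val F y = 0} ↔ f z = 0 := by
  refine ⟨F x, hh.analyticAt (center_mem x), ?_⟩
  filter_upwards [(A.chart x).open_target.mem_nhds (center_mem x)] with z hz
  exact (hF.eq_zero_iff hz).symm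

/-- The identity theorem for holomorphic forms. -/
lemma IsForm.val_eq_zero [PreconnectedSpace X] {k l : ℤ} {F : X → ℂ → ℂ} (hF : A.IsForm k l F)
    (hh : A.IsHol F) {x₀ : X} (h0 : ∀ᶠ y in 𝓝 x₀, A.val F y = 0) (x : X) : A.val F x = 0 := by
  have := eq_univ_of_interior_nonempty (hF.locally_zero_set hh)
    ⟨x₀, mem_interior_iff_mem_nhds.2 h0⟩
  exact (Set.eq_univ_iff_forall.1 this) x

lemma IsForm.eventually_val_ne_zero [PreconnectedSpace X] {k l : ℤ} {F : X → ℂ → ℂ}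
    (hF : A.IsForm k l F) (hh : A.IsHol F) {x₁ : X} (h1 : A.val F x₁ ≠ 0) (x : X) :
    ∀ᶠ y in 𝓝[≠] x, A.val F y ≠ 0 := by
  refine eventually_notMem_of_ne_univ (hF.locally_zero_set hh) (fun h => h1 ?_) x
  exact (Set.eq_univ_iff_forall.1 h) x₁

/-- Holomorphic functions on a compact connected surface are constant. -/
lemma eq_of_isHol [CompactSpace X] [PreconnectedSpace X] {f : X → ℂ}
    (hf : A.IsHol (A.fn f)) (x y : X) : f x = f y := by
  have hloc : ∀ p, ∀ᶠ q in 𝓝 p, f q = A.fn f p (A.chart p q) := fun p => by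
    filter_upwards [(A.chart p).open_source.mem_nhds (A.mem_source p)] with q hq
    rw [fn, (A.chart p).left_inv hq]
  have hcA : ∀ p, Filter.Tendsto (A.chart p) (𝓝 p) (𝓝 (A.center p)) := fun p =>
    (A.chart p).continuousAt (A.mem_source p)
  have hcont : Continuous f := continuous_iff_continuousAt.2 fun p => by
    have h1 : ContinuousAt (A.fn f p) (A.center p) :=
      (hf.analyticAt (center_mem p)).continuousAt
    have h2 : Filter.Tendsto (fun q => A.fn f p (A.chart p q)) (𝓝 p)
        (𝓝 (A.fn f p (A.center p))) := h1.tendsto.comp (hcA p)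
    rw [show A.fn f p (A.center p) = f p by rw [fn, symm_center]] at h2
    exact h2.congr' ((hloc p).mono fun _ h => h.symm)
  obtain ⟨m, -, hm⟩ := isCompact_univ.exists_isMaxOn ⟨x, Set.mem_univ x⟩
    (hcont.norm.continuousOn (s := Set.univ))
  have hcl : IsClopen {p | f p = f m} := by
    refine ⟨isClosed_eq hcont continuous_const, isOpen_iff_mem_nhds.2 fun p hp => ?_⟩
    have h1 : ∀ᶠ z in 𝓝 (A.center p), A.fn f p z = A.fn f p (A.center p) := by
      refine Complex.eventually_eq_of_isLocalMax_norm ?_ ?_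
      · filter_upwards [(A.chart p).open_target.mem_nhds (center_mem p)] with z hz
        exact (hf.analyticAt hz).differentiableAt
      · refine Filter.Eventually.of_forall fun z => ?_
        have h3 : ‖f ((A.chart p).symm z)‖ ≤ ‖f m‖ := hm (Set.mem_univ _)
        change ‖f ((A.chart p).symm z)‖ ≤ ‖f ((A.chart p).symm (A.center p))‖
        rw [symm_center, show f p = f m from hp]; exact h3
    filter_upwards [hloc p, (hcA p).eventually h1] with q hq1 hq2
    rw [hq1, hq2, fn, symm_center]; exact hp
  have := hcl.eq_univ ⟨m, rfl⟩
  have h1 := fun q => (Set.eq_univ_iff_forall.1 this) q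
  exact (h1 x).trans (h1 y).symm

end HolAtlas

section LocalEquations

/-- `f` is real differentiable at `z`, with Wirtinger derivatives `p` and `q`. -/
structure HasW (f : ℂ → ℂ) (z p q : ℂ) : Prop where
  diff : DifferentiableAt ℝ f z
  dz_eq : dz f z = p
  dzb_eq : dzb f z = q

namespace HasW

variable {f g : ℂ → ℂ} {z p q p' q' : ℂ} {U : Set ℂ}

lemma add (hf : HasW f z p q) (hg : HasW g z p' q') :
    HasW (fun z => f z + g z) z (p + p') (q + q') :=
  ⟨hf.diff.add hg.diff, by rw [dz_add hf.diff hg.diff, hf.dz_eq, hg.dz_eq],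
    by rw [dzb_add hf.diff hg.diff, hf.dzb_eq, hg.dzb_eq]⟩

lemma sub (hf : HasW f z p q) (hg : HasW g z p' q') :
    HasW (fun z => f z - g z) z (p - p') (q - q') :=
  ⟨hf.diff.sub hg.diff, by rw [dz_sub hf.diff hg.diff, hf.dz_eq, hg.dz_eq],
    by rw [dzb_sub hf.diff hg.diff, hf.dzb_eq, hg.dzb_eq]⟩

lemma mul (hf : HasW f z p q) (hg : HasW g z p' q') :
    HasW (fun z => f z * g z) z (p * g z + f z * p') (q * g z + f z * q') :=
  ⟨hf.diff.mul hg.diff, by rw [dz_mul hf.diff hg.diff, hf.dz_eq, hg.dz_eq],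
    by rw [dzb_mul hf.diff hg.diff, hf.dzb_eq, hg.dzb_eq]⟩

lemma const (c : ℂ) : HasW (fun _ => c) z 0 0 :=
  ⟨differentiableAt_const c, dz_const c z, dzb_const c z⟩

lemma cconj (hf : HasW f z p q) : HasW (fun z => conj (f z)) z (conj q) (conj p) :=
  ⟨differentiableAt_conj_comp hf.diff, by rw [dz_conj hf.diff, hf.dzb_eq],
    by rw [dzb_conj hf.diff, hf.dz_eq]⟩

lemma cexp (hf : HasW f z p q) :
    HasW (fun z => Complex.exp (f z)) z (Complex.exp (f z) * p) (Complex.exp (f z) * q) :=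
  ⟨hf.diff.cexp, by rw [dz_cexp hf.diff, hf.dz_eq], by rw [dzb_cexp hf.diff, hf.dzb_eq]⟩

lemma of_diff (hf : DifferentiableAt ℝ f z) : HasW f z (dz f z) (dzb f z) := ⟨hf, rfl, rfl⟩

lemma of_hol (hf : DifferentiableAt ℂ f z) : HasW f z (dz f z) 0 :=
  ⟨hf.restrictScalars ℝ, rfl, dzb_eq_zero_of_differentiableAt hf⟩

lemma of_smooth (hU : IsOpen U) (hf : ContDiffOn ℝ ∞ f U) (hz : z ∈ U) :
    HasW f z (dz f z) (dzb f z) := of_diff (ContDiffOn.differentiableAt_of_isOpen hU hf hz)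

lemma dz_of_smooth (hU : IsOpen U) (hf : ContDiffOn ℝ ∞ f U) (hz : z ∈ U) :
    HasW (dz f) z (dz (dz f) z) (dzb (dz f) z) := of_smooth hU (contDiffOn_dz hU hf) hz

lemma dzb_of_smooth (hU : IsOpen U) (hf : ContDiffOn ℝ ∞ f U) (hz : z ∈ U) :
    HasW (dzb f) z (dzb (dz f) z) (dzb (dzb f) z) :=
  ⟨ContDiffOn.differentiableAt_of_isOpen hU (contDiffOn_dzb hU hf) hz, dz_dzb_comm hU hf hz, rfl⟩

lemma congr (hU : IsOpen U) (hf : HasW f z p q) (h : ∀ z ∈ U, g z = f z) (hz : z ∈ U) :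
    HasW g z p q :=
  ⟨hf.diff.congr_of_eventuallyEq (Filter.eventuallyEq_of_mem (hU.mem_nhds hz) h),
    (dz_congr hU h hz).trans hf.dz_eq, (dzb_congr hU h hz).trans hf.dzb_eq⟩

end HasW

/-- The gravitating vortex equations in a coordinate: `ρ = exp Λ` is the density of the Kähler
form, `φ` the section and `ψ` the logarithm of the hermitian metric in a holomorphic frame. -/
structure LocalVortex (τ α c : ℝ) (U : Set ℂ) (ρ Λ φ ψ u : ℂ → ℂ) : Prop where
  isOpen : IsOpen U
  smooth_rho : ContDiffOn ℝ ∞ ρ U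
  smooth_lam : ContDiffOn ℝ ∞ Λ U
  hol_phi : DifferentiableOn ℂ φ U
  smooth_psi : ContDiffOn ℝ ∞ ψ U
  rho_eq : ∀ z ∈ U, ρ z = Complex.exp (Λ z)
  conj_lam : ∀ z ∈ U, conj (Λ z) = Λ z
  conj_psi : ∀ z ∈ U, conj (ψ z) = ψ z
  u_eq : ∀ z ∈ U, u z = φ z * conj (φ z) * Complex.exp (ψ z)
  eq_vortex : ∀ z ∈ U, dzb (dz ψ) z = -(1 / 4) * ρ z * (τ - u z)
  eq_gravity : ∀ z ∈ U, dzb (dz Λ) z = -2 * α * dzb (dz u) z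
    - 1 / 2 * α * τ * ρ z * (τ - u z) - c / 2 * ρ z

/-- An infinitesimal automorphism `a ∂_z + b w ∂_w` of the section, with its potential `θ` and its
divergence `d`. -/
structure LocalField (U : Set ℂ) (Λ φ ψ a b θ d : ℂ → ℂ) : Prop where
  hol_a : DifferentiableOn ℂ a U
  hol_b : DifferentiableOn ℂ b U
  preserves : ∀ z ∈ U, b z * φ z = a z * dz φ z
  theta_eq : ∀ z ∈ U, θ z = b z + a z * dz ψ z
  d_eq : ∀ z ∈ U, d z = dz a z + a z * dz Λ z

namespace LocalVortex

variable {τ α c : ℝ} {U : Set ℂ} {ρ Λ φ ψ u : ℂ → ℂ} {z : ℂ}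

lemma hasW_rho (H : LocalVortex τ α c U ρ Λ φ ψ u) (hz : z ∈ U) :
    HasW ρ z (ρ z * dz Λ z) (ρ z * dzb Λ z) := by
  rw [H.rho_eq z hz]
  exact (HasW.of_smooth H.isOpen H.smooth_lam hz).cexp.congr H.isOpen H.rho_eq hz

lemma conj_rho (H : LocalVortex τ α c U ρ Λ φ ψ u) (hz : z ∈ U) : conj (ρ z) = ρ z := by
  rw [H.rho_eq z hz, ← Complex.exp_conj, H.conj_lam z hz]

lemma conj_u (H : LocalVortex τ α c U ρ Λ φ ψ u) (hz : z ∈ U) : conj (u z) = u z := by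
  rw [H.u_eq z hz]
  simp only [map_mul, Complex.conj_conj, ← Complex.exp_conj, H.conj_psi z hz]; ring

lemma dzb_real {f : ℂ → ℂ} (hU : IsOpen U) (hf : DifferentiableAt ℝ f z)
    (h : ∀ z ∈ U, conj (f z) = f z) (hz : z ∈ U) : dzb f z = conj (dz f z) := by
  rw [← dzb_conj hf]; exact dzb_congr hU (fun z hz => (h z hz).symm) hz

/-- The covariant derivative of the section. -/
noncomputable def nabla (φ ψ : ℂ → ℂ) (z : ℂ) : ℂ := dz φ z + dz ψ z * φ z

lemma smooth_phi (H : LocalVortex τ α c U ρ Λ φ ψ u) : ContDiffOn ℝ ∞ φ U :=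
  contDiffOn_of_differentiableOn H.isOpen H.hol_phi

lemma hasW_phi (H : LocalVortex τ α c U ρ Λ φ ψ u) (hz : z ∈ U) : HasW φ z (dz φ z) 0 :=
  HasW.of_hol (H.hol_phi.differentiableAt (H.isOpen.mem_nhds hz))

lemma hasW_psi (H : LocalVortex τ α c U ρ Λ φ ψ u) (hz : z ∈ U) :
    HasW ψ z (dz ψ z) (conj (dz ψ z)) := by
  have h := HasW.of_smooth H.isOpen H.smooth_psi hz
  rwa [dzb_real H.isOpen h.diff H.conj_psi hz] at h

lemma dz_phi_hol (H : LocalVortex τ α c U ρ Λ φ ψ u) (hz : z ∈ U) :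
    DifferentiableAt ℂ (dz φ) z := by
  have h : DifferentiableOn ℂ (deriv φ) U := H.hol_phi.deriv H.isOpen
  refine (h.differentiableAt (H.isOpen.mem_nhds hz)).congr_of_eventuallyEq ?_
  filter_upwards [H.isOpen.mem_nhds hz] with w hw
  exact dz_eq_deriv (H.hol_phi.differentiableAt (H.isOpen.mem_nhds hw))

lemma hasW_u (H : LocalVortex τ α c U ρ Λ φ ψ u) (hz : z ∈ U) :
    HasW u z (conj (φ z) * Complex.exp (ψ z) * nabla φ ψ z)
      (φ z * Complex.exp (ψ z) * conj (nabla φ ψ z)) := by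
  have h := (((H.hasW_phi hz).mul (H.hasW_phi hz).cconj).mul (H.hasW_psi hz).cexp).congr
    H.isOpen H.u_eq hz
  refine ⟨h.diff, h.dz_eq.trans ?_, h.dzb_eq.trans ?_⟩
  · simp only [nabla, map_zero]; ring
  · simp only [nabla, map_add, map_mul]; ring

lemma dzb_dz_u (H : LocalVortex τ α c U ρ Λ φ ψ u) (hz : z ∈ U) :
    dzb (dz u) z = Complex.exp (ψ z) * nabla φ ψ z * conj (nabla φ ψ z)
      - 1 / 4 * ρ z * u z * (τ - u z) := by
  have hN : HasW (nabla φ ψ) z _ _ := (HasW.of_hol (H.dz_phi_hol hz)).add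
    ((HasW.dz_of_smooth H.isOpen H.smooth_psi hz).mul (H.hasW_phi hz))
  have h := (((H.hasW_phi hz).cconj.mul (H.hasW_psi hz).cexp).mul hN).congr
    H.isOpen (fun z hz => (H.hasW_u hz).dz_eq) hz
  rw [h.dzb_eq, H.eq_vortex z hz, H.u_eq z hz]
  simp only [nabla, map_add, map_mul]
  ring

variable {a b θ d : ℂ → ℂ}

lemma hasW_a (H : LocalVortex τ α c U ρ Λ φ ψ u) (F : LocalField U Λ φ ψ a b θ d) (hz : z ∈ U) :
    HasW a z (dz a z) 0 := HasW.of_hol (F.hol_a.differentiableAt (H.isOpen.mem_nhds hz))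

lemma theta_mul_phi (F : LocalField U Λ φ ψ a b θ d) (hz : z ∈ U) :
    θ z * φ z = a z * nabla φ ψ z := by
  rw [F.theta_eq z hz, nabla]; linear_combination F.preserves z hz

lemma a_mul_dz_u (H : LocalVortex τ α c U ρ Λ φ ψ u) (F : LocalField U Λ φ ψ a b θ d)
    (hz : z ∈ U) : a z * dz u z = θ z * u z := by
  rw [(H.hasW_u hz).dz_eq, H.u_eq z hz]
  linear_combination (-conj (φ z) * Complex.exp (ψ z)) * theta_mul_phi F hz

lemma dzb_theta (H : LocalVortex τ α c U ρ Λ φ ψ u) (F : LocalField U Λ φ ψ a b θ d)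
    (hz : z ∈ U) : dzb θ z = -(1 / 4) * ρ z * (τ - u z) * a z := by
  have h := ((HasW.of_hol (F.hol_b.differentiableAt (H.isOpen.mem_nhds hz))).add
    ((H.hasW_a F hz).mul (HasW.dz_of_smooth H.isOpen H.smooth_psi hz))).congr
    H.isOpen F.theta_eq hz
  rw [h.dzb_eq, H.eq_vortex z hz]; ring

lemma smooth_theta (H : LocalVortex τ α c U ρ Λ φ ψ u) (F : LocalField U Λ φ ψ a b θ d) :
    ContDiffOn ℝ ∞ θ U :=
  ((contDiffOn_of_differentiableOn H.isOpen F.hol_b).add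
    ((contDiffOn_of_differentiableOn H.isOpen F.hol_a).mul
      (contDiffOn_dz H.isOpen H.smooth_psi))).congr F.theta_eq

lemma smooth_d (H : LocalVortex τ α c U ρ Λ φ ψ u) (F : LocalField U Λ φ ψ a b θ d) :
    ContDiffOn ℝ ∞ d U := by
  have ha := contDiffOn_of_differentiableOn H.isOpen F.hol_a
  exact ((contDiffOn_dz H.isOpen ha).add
    (ha.mul (contDiffOn_dz H.isOpen H.smooth_lam))).congr F.d_eq

lemma smooth_u (H : LocalVortex τ α c U ρ Λ φ ψ u) : ContDiffOn ℝ ∞ u U :=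
  ((H.smooth_phi.mul (contDiffOn_conj_comp H.smooth_phi)).mul H.smooth_psi.cexp).congr H.u_eq

lemma hasW_theta (H : LocalVortex τ α c U ρ Λ φ ψ u) (F : LocalField U Λ φ ψ a b θ d)
    (hz : z ∈ U) : HasW θ z (dz θ z) (-(1 / 4) * ρ z * (τ - u z) * a z) := by
  have h := HasW.of_smooth H.isOpen (H.smooth_theta F) hz
  rwa [H.dzb_theta F hz] at h

lemma hasW_w (H : LocalVortex τ α c U ρ Λ φ ψ u) (hz : z ∈ U) :
    HasW (fun z => (τ - u z : ℂ)) z (-(conj (φ z) * Complex.exp (ψ z) * nabla φ ψ z))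
      (-(φ z * Complex.exp (ψ z) * conj (nabla φ ψ z))) := by
  simpa using (HasW.const (τ : ℂ)).sub (H.hasW_u hz)

lemma dz_a_hol (H : LocalVortex τ α c U ρ Λ φ ψ u) (F : LocalField U Λ φ ψ a b θ d)
    (hz : z ∈ U) : DifferentiableAt ℂ (dz a) z := by
  have h : DifferentiableOn ℂ (deriv a) U := F.hol_a.deriv H.isOpen
  refine (h.differentiableAt (H.isOpen.mem_nhds hz)).congr_of_eventuallyEq ?_
  filter_upwards [H.isOpen.mem_nhds hz] with w hw
  exact dz_eq_deriv (F.hol_a.differentiableAt (H.isOpen.mem_nhds hw))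

/-- The divergence differs from `2 α (τ - u) θ` by a potential of `-(c/2) ρ a`. -/
lemma dzb_d (H : LocalVortex τ α c U ρ Λ φ ψ u) (F : LocalField U Λ φ ψ a b θ d)
    (hz : z ∈ U) :
    dzb d z = 2 * α * dzb (fun z => (τ - u z) * θ z) z - c / 2 * ρ z * a z := by
  have h := ((HasW.of_hol (H.dz_a_hol F hz)).add
    ((H.hasW_a F hz).mul (HasW.dz_of_smooth H.isOpen H.smooth_lam hz))).congr
    H.isOpen F.d_eq hz
  rw [h.dzb_eq, ((H.hasW_w hz).mul (H.hasW_theta F hz)).dzb_eq, H.eq_gravity z hz,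
    H.dzb_dz_u hz]
  linear_combination (2 * α * Complex.exp (ψ z) * conj (nabla φ ψ z)) * theta_mul_phi F hz

/-- The derivative of `E`, the failure of `a' ∂_z` to have the conjugate potential. -/
lemma dz_defect (H : LocalVortex τ α c U ρ Λ φ ψ u) (F : LocalField U Λ φ ψ a b θ d)
    {a' E η : ℂ → ℂ} (ha' : ContDiffOn ℝ ∞ a' U)
    (hE : ∀ z ∈ U, E z = dzb (fun z => conj (θ z)) z + 1 / 4 * (τ - u z) * ρ z * a' z)
    (hη : ∀ z ∈ U, η z = dz a' z + a' z * dz Λ z - conj (d z)) (hz : z ∈ U) :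
    dz E z = 1 / 4 * ρ z * Complex.exp (ψ z) * conj (φ z) *
        (φ z * conj (θ z) - a' z * nabla φ ψ z) + 1 / 4 * (τ - u z) * ρ z * η z := by
  have hθ := H.hasW_theta F hz
  have hW := H.hasW_w hz
  have hρ := H.hasW_rho hz
  have ha := H.hasW_a F hz
  have hA := HasW.of_smooth H.isOpen ha' hz
  have hΛr : dzb Λ z = conj (dz Λ z) := dzb_real H.isOpen
    (HasW.of_smooth H.isOpen H.smooth_lam hz).diff H.conj_lam hz
  have hθs := contDiffOn_conj_comp (H.smooth_theta F)
  have hθb : ∀ z ∈ U, dz (fun z => conj (θ z)) z =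
      -(1 / 4) * ρ z * (τ - u z) * conj (a z) := fun z hz => by
    rw [dz_conj (H.hasW_theta F hz).diff, H.dzb_theta F hz]
    simp only [map_mul, map_neg, map_sub, H.conj_rho hz, H.conj_u hz, Complex.conj_ofReal,
      map_div₀, map_one, Complex.conj_ofNat]
  -- mixed second derivative of the conjugate potential
  have hmix : HasW (dz (fun z => conj (θ z))) z _ _ :=
    (((((HasW.const (-(1 / 4) : ℂ)).mul hρ).mul hW).mul ha.cconj)).congr H.isOpen hθb hz
  have hE0 : HasW (dzb (fun z => conj (θ z))) z _ _ := HasW.dzb_of_smooth H.isOpen hθs hz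
  have hEW : HasW E z _ _ := (hE0.add ((((HasW.const (1 / 4 : ℂ)).mul hW).mul hρ).mul hA)).congr
    H.isOpen hE hz
  have hGeq := theta_mul_phi F hz
  have hGc : conj (θ z) * conj (φ z) = conj (a z) * conj (nabla φ ψ z) := by
    rw [← map_mul, hGeq, map_mul]
  rw [hEW.dz_eq, hmix.dzb_eq, hη z hz, F.d_eq z hz, hΛr]
  simp only [map_add, map_mul]
  linear_combination (-(1 / 4) * ρ z * Complex.exp (ψ z) * φ z) * hGc

/-- The fundamental identity, for an arbitrary smooth vector field `a' ∂_z` which is a candidate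
for the conjugate field. -/
lemma dz_current (H : LocalVortex τ α c U ρ Λ φ ψ u) (F : LocalField U Λ φ ψ a b θ d)
    {a' E η : ℂ → ℂ} (ha' : ContDiffOn ℝ ∞ a' U)
    (hE : ∀ z ∈ U, E z = dzb (fun z => conj (θ z)) z + 1 / 4 * (τ - u z) * ρ z * a' z)
    (hη : ∀ z ∈ U, η z = dz a' z + a' z * dz Λ z - conj (d z))
    (hc : ∀ z ∈ U, dzb (fun z => conj (d z)) z =
      2 * α * dzb (fun z => (τ - u z) * conj (θ z)) z - c / 2 * ρ z * a' z) (hz : z ∈ U) :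
    dz (fun z => ρ z * dzb a' z * conj (a' z) + 8 * α * (E z * θ z)) z =
      ρ z * (dzb a' z * conj (dzb a' z)) + 8 * α * (E z * conj (E z)) +
      2 * α * ρ z * Complex.exp (ψ z) * ((φ z * conj (θ z) - a' z * nabla φ ψ z) *
        conj (φ z * conj (θ z) - a' z * nabla φ ψ z)) +
      ρ z * dzb η z * conj (a' z) + 2 * α * (τ - u z) * θ z * ρ z * η z := by
  have hθ := H.hasW_theta F hz
  have hW := H.hasW_w hz
  have hρ := H.hasW_rho hz
  have ha := H.hasW_a F hz
  have hd := HasW.of_smooth H.isOpen (H.smooth_d F) hz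
  have hA := HasW.of_smooth H.isOpen ha' hz
  have hB := HasW.dzb_of_smooth H.isOpen ha' hz
  have hAz := HasW.dz_of_smooth H.isOpen ha' hz
  have hΛz := HasW.dz_of_smooth H.isOpen H.smooth_lam hz
  have hcρ := H.conj_rho hz
  have hcu := H.conj_u hz
  have hθs := contDiffOn_conj_comp (H.smooth_theta F)
  have hEη : HasW η z _ _ := ((hAz.add (hA.mul hΛz)).sub hd.cconj).congr H.isOpen hη hz
  have hE0 : HasW (dzb (fun z => conj (θ z))) z _ _ := HasW.dzb_of_smooth H.isOpen hθs hz
  have hEW : HasW E z _ _ := (hE0.add ((((HasW.const (1 / 4 : ℂ)).mul hW).mul hρ).mul hA)).congr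
    H.isOpen hE hz
  have hdz : dz θ z = conj (E z) - 1 / 4 * (τ - u z) * ρ z * conj (a' z) := by
    rw [hE z hz, dzb_conj hθ.diff]
    simp only [map_add, map_mul, map_sub, hcρ, hcu, Complex.conj_ofReal,
      map_div₀, map_one, Complex.conj_ofNat, Complex.conj_conj]
    ring
  have hJ := ((hρ.mul hB).mul hA.cconj).add ((HasW.const (8 * α : ℂ)).mul (hEW.mul hθ))
  have hρB : ρ z * dzb (dz a') z + ρ z * dz Λ z * dzb a' z = ρ z * dzb η z +
      ρ z * (2 * α * (τ - u z) * E z - 2 * α * Complex.exp (ψ z) * conj (nabla φ ψ z) *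
        (φ z * conj (θ z) - a' z * nabla φ ψ z)) := by
    have h1 := hc z hz
    rw [(hW.mul hθ.cconj).dzb_eq, hd.cconj.dzb_eq] at h1
    rw [hEη.dzb_eq, H.eq_gravity z hz, H.dzb_dz_u hz, h1, hdz]
    simp only [map_sub, map_mul, Complex.conj_conj, hcρ, hcu, Complex.conj_ofReal, map_div₀,
      map_one, Complex.conj_ofNat]
    ring
  have hEdz := hEW.dz_eq
  rw [hJ.dz_eq, ← hEdz, H.dz_defect F ha' hE hη hz, hdz]
  simp only [map_sub, map_mul, Complex.conj_conj]
  linear_combination conj (a' z) * hρB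

end LocalVortex

end LocalEquations

end GravVortex

namespace GravVortex

open ComplexConjugate MeasureTheory
open scoped ENNReal

section MeasurableMaps

variable {X : Type*} [TopologicalSpace X] [MeasurableSpace X] [BorelSpace X]

lemma measurableSet_image_chart (e : OpenPartialHomeomorph X ℂ) {E : Set X}
    (hE : MeasurableSet E) (hs : E ⊆ e.source) : MeasurableSet (e '' E) := by
  have h1 : e '' E = Subtype.val '' ((e.target.domRestrict e.symm) ⁻¹' E) := by
    ext z
    constructor
    · rintro ⟨p, hp, rfl⟩
      exact ⟨⟨e p, e.map_source (hs hp)⟩, by simpa [e.left_inv (hs hp)] using hp, rfl⟩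
    · rintro ⟨⟨w, hw⟩, h1, rfl⟩
      exact ⟨e.symm w, h1, e.right_inv hw⟩
  rw [h1]
  refine MeasurableSet.subtype_image e.open_target.measurableSet ?_
  exact (continuousOn_iff_continuous_domRestrict.1 e.symm.continuousOn).measurable hE

lemma aemeasurable_chart_symm (e : OpenPartialHomeomorph X ℂ) {S : Set ℂ} (hS : MeasurableSet S)
    (hs : S ⊆ e.target) : AEMeasurable e.symm (volume.restrict S) :=
  (e.symm.continuousOn.mono hs).aemeasurable hS

end MeasurableMaps

lemma det_fderiv_complex {f : ℂ → ℂ} {z : ℂ} :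
    |((fderiv ℂ f z).restrictScalars ℝ : ℂ →L[ℝ] ℂ).det| = ‖deriv f z‖ ^ 2 := by
  have h : (((fderiv ℂ f z).restrictScalars ℝ : ℂ →L[ℝ] ℂ) : ℂ →ₗ[ℝ] ℂ) =
      Algebra.lmul ℝ ℂ (deriv f z) := by
    ext
    simp [mul_comm]
  have h2 : ((fderiv ℂ f z).restrictScalars ℝ : ℂ →L[ℝ] ℂ).det = Algebra.norm ℝ (deriv f z) := by
    rw [Algebra.norm_apply, ← h]
  rw [h2, Algebra.norm_complex_apply, Complex.normSq_eq_norm_sq, abs_of_nonneg (by positivity)]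

namespace HolAtlas

variable {X : Type*} [TopologicalSpace X] {A : HolAtlas X}

variable (A) in
/-- A positive density: a smooth positive `(1,1)`-form. -/
structure IsDensity (R : X → ℂ → ℝ) : Prop where
  form : A.IsForm 1 1 (fun x z => (R x z : ℂ))
  pos : ∀ x, ∀ z ∈ (A.chart x).target, 0 < R x z

namespace IsDensity

variable {R : X → ℂ → ℝ} {x y : X} {z : ℂ}

lemma trans (hR : A.IsDensity R) (hz : z ∈ A.overlap x y) :
    R x z = R y (A.tr x y z) * ‖deriv (A.tr x y) z‖ ^ 2 := by
  have h := hR.form.trans x y z hz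
  rw [zpow_one, zpow_one, mul_assoc, Complex.mul_conj, Complex.normSq_eq_norm_sq] at h
  exact_mod_cast h

lemma continuousOn (hR : A.IsDensity R) (x : X) : ContinuousOn (R x) (A.chart x).target := by
  have h := Complex.continuous_re.comp_continuousOn (hR.form.smooth x).continuousOn
  exact h.congr fun z _ => (Complex.ofReal_re _).symm

lemma lintegral_image (hR : A.IsDensity R) [MeasurableSpace X] [BorelSpace X]
    {E : Set X} (hE : MeasurableSet E) (hx : E ⊆ (A.chart x).source)
    (hy : E ⊆ (A.chart y).source) :
    ∫⁻ z in A.chart x '' E, ENNReal.ofReal (R x z) =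
      ∫⁻ z in A.chart y '' E, ENNReal.ofReal (R y z) := by
  have hm := measurableSet_image_chart (A.chart x) hE hx
  have hov : ∀ z ∈ A.chart x '' E, z ∈ A.overlap x y := by
    rintro _ ⟨p, hp, rfl⟩
    refine ⟨(A.chart x).map_source (hx hp), ?_⟩
    rw [Set.mem_preimage, (A.chart x).left_inv (hx hp)]; exact hy hp
  have him : A.chart y '' E = A.tr x y '' (A.chart x '' E) := by
    rw [Set.image_image]
    refine Set.image_congr fun p hp => ?_
    rw [tr, (A.chart x).left_inv (hx hp)]
  rw [him, lintegral_image_eq_lintegral_abs_det_fderiv_mul volume hm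
    (f' := fun z => (fderiv ℂ (A.tr x y) z).restrictScalars ℝ)]
  · refine setLIntegral_congr_fun hm fun z hz => ?_
    rw [det_fderiv_complex, hR.trans (hov z hz), ← ENNReal.ofReal_mul (by positivity), mul_comm]
  · intro z hz
    exact ((differentiableAt_tr (hov z hz)).hasFDerivAt.restrictScalars ℝ).hasFDerivWithinAt
  · intro z hz z' hz' h
    rw [← tr_tr (hov z hz), h, tr_tr (hov z' hz')]

end IsDensity

variable (A) in
/-- `μ` is the measure defined by the density `R`. -/
def IsVolume [MeasurableSpace X] (R : X → ℂ → ℝ) (μ : Measure X) : Prop :=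
  ∀ x, ∀ E : Set X, MeasurableSet E → E ⊆ (A.chart x).source →
    μ E = ∫⁻ z in A.chart x '' E, ENNReal.ofReal (R x z)

lemma exists_isVolume [CompactSpace X] [Nonempty X] [MeasurableSpace X] [BorelSpace X]
    {R : X → ℂ → ℝ} (hR : A.IsDensity R) : ∃ μ : Measure X, A.IsVolume R μ := by
  obtain ⟨t, ht⟩ := isCompact_univ.elim_finite_subcover (fun x => (A.chart x).source)
    (fun x => (A.chart x).open_source) fun x _ => Set.mem_iUnion.2 ⟨x, A.mem_source x⟩
  have htne : (t : Set X).Nonempty := by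
    obtain ⟨x⟩ := ‹Nonempty X›
    obtain ⟨i, hi⟩ := Set.mem_iUnion.1 (ht (Set.mem_univ x))
    obtain ⟨hi, -⟩ := Set.mem_iUnion.1 hi
    exact ⟨i, hi⟩
  obtain ⟨f, hf⟩ := t.countable_toSet.exists_eq_range htne
  set S : ℕ → Set X := fun n => (A.chart (f n)).source with hS
  have hSm : ∀ n, MeasurableSet (S n) := fun n => (A.chart (f n)).open_source.measurableSet
  have hPm : ∀ n, MeasurableSet (disjointed S n) := fun n => MeasurableSet.disjointed hSm n
  have hPs : ∀ n, disjointed S n ⊆ (A.chart (f n)).source := fun n => disjointed_subset S n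
  have hSu : ⋃ n, S n = Set.univ := by
    refine Set.eq_univ_of_univ_subset fun x hx => ?_
    obtain ⟨i, hi⟩ := Set.mem_iUnion.1 (ht hx)
    obtain ⟨hi, hxi⟩ := Set.mem_iUnion.1 hi
    have : i ∈ (t : Set X) := hi
    rw [hf] at this
    obtain ⟨n, rfl⟩ := this
    exact Set.mem_iUnion.2 ⟨n, hxi⟩
  have him : ∀ n, MeasurableSet (A.chart (f n) '' disjointed S n) := fun n =>
    measurableSet_image_chart _ (hPm n) (hPs n)
  have hit : ∀ n, A.chart (f n) '' disjointed S n ⊆ (A.chart (f n)).target := by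
    rintro n _ ⟨p, hp, rfl⟩; exact (A.chart (f n)).map_source (hPs n hp)
  refine ⟨Measure.sum fun n => Measure.map (A.chart (f n)).symm
    ((volume.restrict (A.chart (f n) '' disjointed S n)).withDensity
      fun z => ENNReal.ofReal (R (f n) z)), fun x E hE hxE => ?_⟩
  rw [Measure.sum_apply _ hE]
  have hxi : ∀ n, E ∩ disjointed S n ⊆ (A.chart x).source := fun n p hp => hxE hp.1
  have hterm : ∀ n, Measure.map (A.chart (f n)).symm
      ((volume.restrict (A.chart (f n) '' disjointed S n)).withDensity
      fun z => ENNReal.ofReal (R (f n) z)) E =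
      ∫⁻ z in A.chart x '' (E ∩ disjointed S n), ENNReal.ofReal (R x z) := by
    intro n
    have hae : AEMeasurable (A.chart (f n)).symm
      ((volume.restrict (A.chart (f n) '' disjointed S n)).withDensity
      fun z => ENNReal.ofReal (R (f n) z)) :=
      (aemeasurable_chart_symm _ (him n) (hit n)).mono_ac (withDensity_absolutelyContinuous _ _)
    have hEn := measurableSet_image_chart (A.chart (f n)) (hE.inter (hPm n))
      (fun p hp => hPs n hp.2)
    have hset : (A.chart (f n)).symm ⁻¹' E ∩ A.chart (f n) '' disjointed S n =
        A.chart (f n) '' (E ∩ disjointed S n) := by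
      ext z
      constructor
      · rintro ⟨h1, p, hp, rfl⟩
        rw [Set.mem_preimage, (A.chart (f n)).left_inv (hPs n hp)] at h1
        exact ⟨p, ⟨h1, hp⟩, rfl⟩
      · rintro ⟨p, hp, rfl⟩
        refine ⟨?_, p, hp.2, rfl⟩
        rw [Set.mem_preimage, (A.chart (f n)).left_inv (hPs n hp.2)]; exact hp.1
    rw [Measure.map_apply_of_aemeasurable hae hE, withDensity_apply' _ _,
      Measure.restrict_restrict' (him n), hset,
      hR.lintegral_image (hE.inter (hPm n)) (fun p hp => hPs n hp.2) (hxi n)]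
  simp_rw [hterm]
  rw [← lintegral_iUnion (fun n => measurableSet_image_chart _ (hE.inter (hPm n)) (hxi n))]
  · congr 2
    rw [← Set.image_iUnion, ← Set.inter_iUnion, iUnion_disjointed, hSu, Set.inter_univ]
  · intro m n hmn
    refine Set.disjoint_left.2 ?_
    rintro _ ⟨p, hp, rfl⟩ ⟨q, hq, hpq⟩
    have : q = p := (A.chart x).injOn (hxi n hq) (hxi m hp) hpq
    subst this
    exact Set.disjoint_left.1 (disjoint_disjointed S hmn) hp.2 hq.2

namespace IsVolume

variable [MeasurableSpace X] [BorelSpace X] {R : X → ℂ → ℝ} {μ : Measure X} {x : X}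

lemma restrict_eq (hμ : A.IsVolume R μ) (x : X) :
    μ.restrict (A.chart x).source = Measure.map (A.chart x).symm
      ((volume.restrict (A.chart x).target).withDensity fun z => ENNReal.ofReal (R x z)) := by
  ext E hE
  have hae : AEMeasurable (A.chart x).symm
      ((volume.restrict (A.chart x).target).withDensity
      fun z => ENNReal.ofReal (R x z)) :=
    (aemeasurable_chart_symm _ (A.chart x).open_target.measurableSet subset_rfl).mono_ac
      (withDensity_absolutelyContinuous _ _)
  have hset : (A.chart x).symm ⁻¹' E ∩ (A.chart x).target =
        A.chart x '' (E ∩ (A.chart x).source) := by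
    rw [Set.inter_comm E, (A.chart x).image_source_inter_eq', Set.inter_comm]
  rw [Measure.restrict_apply hE, hμ x _ (hE.inter (A.chart x).open_source.measurableSet)
    Set.inter_subset_right, Measure.map_apply_of_aemeasurable hae hE, withDensity_apply' _ _,
    Measure.restrict_restrict' (A.chart x).open_target.measurableSet, hset]

lemma setIntegral_eq (hμ : A.IsVolume R μ) (hR : A.IsDensity R) (x : X) {f : X → ℂ}
    (hf : AEStronglyMeasurable f μ) :
    ∫ p in (A.chart x).source, f p ∂μ =
      ∫ z in (A.chart x).target, f ((A.chart x).symm z) * R x z := by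
  have hae : AEMeasurable (A.chart x).symm
      ((volume.restrict (A.chart x).target).withDensity
      fun z => ENNReal.ofReal (R x z)) :=
    (aemeasurable_chart_symm _ (A.chart x).open_target.measurableSet subset_rfl).mono_ac
      (withDensity_absolutelyContinuous _ _)
  have hRm : AEMeasurable (fun z => (R x z).toNNReal) (volume.restrict (A.chart x).target) :=
    ((hR.continuousOn x).aemeasurable (A.chart x).open_target.measurableSet).real_toNNReal
  rw [hμ.restrict_eq x, integral_map hae (by rw [← hμ.restrict_eq x]; exact hf.restrict)]
  change ∫ z, f ((A.chart x).symm z) ∂((volume.restrict (A.chart x).target).withDensity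
      fun z => ((R x z).toNNReal : ℝ≥0∞)) = _
  rw [integral_withDensity_eq_integral_smul₀ hRm]
  refine setIntegral_congr_fun (A.chart x).open_target.measurableSet fun z hz => ?_
  simp only [NNReal.smul_def, Real.coe_toNNReal _ (hR.pos x z hz).le]
  rw [Complex.real_smul, mul_comm]

lemma exists_measure_lt_top (hμ : A.IsVolume R μ) (hR : A.IsDensity R) (x : X) :
    ∃ s ∈ 𝓝 x, μ s < ⊤ := by
  obtain ⟨r, hr, hsub⟩ := Metric.nhds_basis_closedBall.mem_iff.1
    ((A.chart x).open_target.mem_nhds (center_mem x))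
  have hcomp : IsCompact (Metric.closedBall (A.center x) r) := isCompact_closedBall _ _
  have hopen := (A.chart x).isOpen_inter_preimage (Metric.isOpen_ball (x := A.center x) (ε := r))
  refine ⟨_, hopen.mem_nhds ⟨A.mem_source x, Metric.mem_ball_self hr⟩, ?_⟩
  rw [hμ x _ hopen.measurableSet Set.inter_subset_left]
  have h1 : A.chart x '' ((A.chart x).source ∩ A.chart x ⁻¹' Metric.ball (A.center x) r) ⊆
      Metric.closedBall (A.center x) r := by
    rintro _ ⟨p, hp, rfl⟩; exact Metric.ball_subset_closedBall hp.2
  obtain ⟨C, hC⟩ := hcomp.bddAbove_image ((hR.continuousOn x).mono hsub)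
  refine (lintegral_mono_set h1).trans_lt ?_
  refine lt_of_le_of_lt (setLIntegral_mono (g := fun _ => ENNReal.ofReal C) measurable_const
    fun z hz => ENNReal.ofReal_le_ofReal (hC ⟨z, hz, rfl⟩)) ?_
  rw [setLIntegral_const]
  exact ENNReal.mul_lt_top ENNReal.ofReal_lt_top hcomp.measure_lt_top

lemma isFiniteMeasure [CompactSpace X] (hμ : A.IsVolume R μ) (hR : A.IsDensity R) :
    IsFiniteMeasure μ := by
  have : IsLocallyFiniteMeasure μ := ⟨fun x => hμ.exists_measure_lt_top hR x⟩
  infer_instance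

/-- A nonempty open set has positive measure. -/
lemma measure_pos (hμ : A.IsVolume R μ) (hR : A.IsDensity R) {O : Set X} (hO : IsOpen O)
    (hne : O.Nonempty) : 0 < μ O := by
  obtain ⟨x, hx⟩ := hne
  refine lt_of_lt_of_le ?_ (measure_mono (Set.inter_subset_left (s := O)
    (t := (A.chart x).source)))
  have hm := (hO.inter (A.chart x).open_source).measurableSet
  rw [hμ x _ hm Set.inter_subset_right]
  have hmi := measurableSet_image_chart (A.chart x) hm Set.inter_subset_right
  have hio : IsOpen (A.chart x '' (O ∩ (A.chart x).source)) :=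
    (A.chart x).isOpen_image_of_subset_source (hO.inter (A.chart x).open_source)
      Set.inter_subset_right
  have hsub : A.chart x '' (O ∩ (A.chart x).source) ⊆ (A.chart x).target := by
    rintro _ ⟨p, hp, rfl⟩; exact (A.chart x).map_source hp.2
  have hae : AEMeasurable (fun z => ENNReal.ofReal (R x z))
      (volume.restrict (A.chart x '' (O ∩ (A.chart x).source))) :=
    (((hR.continuousOn x).mono hsub).aemeasurable hmi).ennreal_ofReal
  rw [pos_iff_ne_zero, Ne, lintegral_eq_zero_iff' hae]
  intro h0
  have h1 : ∀ᵐ z ∂(volume.restrict (A.chart x '' (O ∩ (A.chart x).source))), False := by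
    filter_upwards [h0, ae_restrict_mem hmi] with z hz hzm
    have := hR.pos x z (hsub hzm)
    simp only [Pi.zero_apply, ENNReal.ofReal_eq_zero] at hz
    linarith
  rw [Filter.eventually_false_iff_eq_bot, ae_eq_bot, Measure.restrict_eq_zero] at h1
  exact (hio.measure_pos volume ⟨_, x, ⟨hx, A.mem_source x⟩, rfl⟩).ne' h1

lemma isOpenPosMeasure (hμ : A.IsVolume R μ) (hR : A.IsDensity R) : μ.IsOpenPosMeasure :=
  ⟨fun _ hO hne => (hμ.measure_pos hR hO hne).ne'⟩

end IsVolume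

end HolAtlas

end GravVortex

namespace GravVortex

open ComplexConjugate MeasureTheory

section Plane

variable {f : ℂ → ℂ}

lemma contDiff_mul_of_tsupport {χ f : ℂ → ℂ} {U : Set ℂ} (hU : IsOpen U) (hχ : ContDiff ℝ ∞ χ)
    (hs : tsupport χ ⊆ U) (hf : ContDiffOn ℝ ∞ f U) : ContDiff ℝ ∞ (fun z => χ z * f z) := by
  rw [contDiff_iff_contDiffAt]
  intro z
  by_cases hz : z ∈ tsupport χ
  · exact hχ.contDiffAt.mul (hf.contDiffAt (hU.mem_nhds (hs hz)))
  · have h := (isClosed_tsupport χ).isOpen_compl.mem_nhds hz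
    refine contDiffAt_const (c := (0 : ℂ)) |>.congr_of_eventuallyEq ?_
    filter_upwards [h] with w hw
    rw [image_eq_zero_of_notMem_tsupport hw, zero_mul]

lemma integral_fderiv_eq_zero (hf : ContDiff ℝ ∞ f) (hs : HasCompactSupport f) (v : ℂ) :
    ∫ z, fderiv ℝ f z v = 0 := by
  have hc : Continuous fun z => fderiv ℝ f z v :=
    (hf.continuous_fderiv (by simp)).clm_apply continuous_const
  have hcs : HasCompactSupport fun z => fderiv ℝ f z v := hs.fderiv_apply ℝ v
  have h := integral_mul_fderiv_eq_neg_fderiv_mul_of_integrable (μ := (volume : Measure ℂ))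
    (f := fun _ : ℂ => (1 : ℂ)) (g := f) (v := v) (by simp)
    (by simpa using hc.integrable_of_hasCompactSupport hcs)
    (by simpa using hf.continuous.integrable_of_hasCompactSupport hs)
    (fun _ _ => differentiableAt_const _) (fun z _ => (hf.differentiable (by simp)).differentiableAt)
  simpa using h

lemma integral_dz_eq_zero (hf : ContDiff ℝ ∞ f) (hs : HasCompactSupport f) :
    ∫ z, dz f z = 0 := by
  have hc : ∀ v, Continuous fun z => fderiv ℝ f z v := fun v =>
    (hf.continuous_fderiv (by simp)).clm_apply continuous_const
  have hi : ∀ v, Integrable fun z => fderiv ℝ f z v := fun v =>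
    (hc v).integrable_of_hasCompactSupport (hs.fderiv_apply ℝ v)
  simp only [dz]
  rw [integral_const_mul, integral_sub (hi 1) ((hi _).const_mul _), integral_const_mul,
    integral_fderiv_eq_zero hf hs, integral_fderiv_eq_zero hf hs]
  simp

lemma tsupport_dz_subset : tsupport (dz f) ⊆ tsupport f := by
  refine closure_minimal (fun z hz => ?_) (isClosed_tsupport f)
  by_contra h
  apply hz
  have h2 : f =ᶠ[𝓝 z] fun _ => 0 := by
    filter_upwards [(isClosed_tsupport f).isOpen_compl.mem_nhds h] with w hw
    exact image_eq_zero_of_notMem_tsupport hw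
  rw [Filter.EventuallyEq.dz_eq h2, dz_const]

end Plane

namespace HolAtlas

variable {X : Type*} [TopologicalSpace X] {A : HolAtlas X}

open Classical in
variable (A) in
/-- Extension by zero of a function on the plane supported in the target of a chart. -/
noncomputable def ext (x : X) (χ : ℂ → ℂ) (p : X) : ℂ :=
  if p ∈ (A.chart x).source then χ (A.chart x p) else 0

section ext

variable {x y : X} {χ : ℂ → ℂ} {p : X} {z : ℂ}

lemma ext_of_mem (hp : p ∈ (A.chart x).source) : A.ext x χ p = χ (A.chart x p) := if_pos hp

lemma fn_ext_self (hz : z ∈ (A.chart x).target) : A.fn (A.ext x χ) x z = χ z := by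
  rw [fn, ext_of_mem ((A.chart x).map_target hz), (A.chart x).right_inv hz]

lemma isForm_ext [T2Space X] (hχ : ContDiff ℝ ∞ χ) (hc : HasCompactSupport χ)
    (hs : tsupport χ ⊆ (A.chart x).target) : A.IsForm 0 0 (A.fn (A.ext x χ)) := by
  have hK : IsClosed ((A.chart x).symm '' tsupport χ) :=
    (hc.isCompact.image_of_continuousOn ((A.chart x).symm.continuousOn.mono hs)).isClosed
  refine isForm_fn fun y z hz => ?_
  refine ContDiffAt.contDiffWithinAt ?_
  by_cases hp : (A.chart y).symm z ∈ (A.chart x).source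
  · have hov : z ∈ A.overlap y x := ⟨hz, hp⟩
    have hT : ContDiffAt ℝ ∞ (A.tr y x) z :=
      (contDiffOn_of_differentiableOn (isOpen_overlap y x) (differentiableOn_tr y x)).contDiffAt
        ((isOpen_overlap y x).mem_nhds hov)
    refine (hχ.contDiffAt.comp z hT).congr_of_eventuallyEq ?_
    filter_upwards [(isOpen_overlap y x).mem_nhds hov] with w hw
    rw [fn, ext_of_mem hw.2]; rfl
  · refine (contDiffAt_const (c := (0 : ℂ))).congr_of_eventuallyEq ?_
    have hcont : ContinuousAt (A.chart y).symm z := (A.chart y).continuousAt_symm hz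
    have hn : (A.chart y).symm z ∉ (A.chart x).symm '' tsupport χ := by
      rintro ⟨w, hw, hwz⟩
      exact hp (hwz ▸ (A.chart x).map_target (hs hw))
    filter_upwards [hcont.preimage_mem_nhds (hK.isOpen_compl.mem_nhds hn)] with w hw
    rw [fn, ext]
    split_ifs with h
    · refine image_eq_zero_of_notMem_tsupport fun h2 => hw ⟨_, h2, ?_⟩
      exact (A.chart x).left_inv h
    · rfl

end ext

/-- The integral of a `(1,1)`-form `F (i/2) dz ∧ dz̄`, with respect to the measure of `R`. -/
noncomputable def formIntegral [MeasurableSpace X] (A : HolAtlas X) (R : X → ℂ → ℝ)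
    (μ : Measure X) (F : X → ℂ → ℂ) : ℂ :=
  ∫ p, A.val (fun x z => F x z / R x z) p ∂μ

/-- Forms supported in a chart vanish outside of it. -/
lemma val_dz_ext_mul_eq_zero [T2Space X] {J : X → ℂ → ℂ} {x y : X} {χ : ℂ → ℂ}
    (hc : HasCompactSupport χ) (hs : tsupport χ ⊆ (A.chart x).target)
    (hy : y ∉ (A.chart x).source) :
    A.val (fun y z => dz (fun w => A.fn (A.ext x χ) y w * J y w) z) y = 0 := by
  have hK : IsClosed ((A.chart x).symm '' tsupport χ) :=
    (hc.isCompact.image_of_continuousOn ((A.chart x).symm.continuousOn.mono hs)).isClosed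
  have hn : y ∉ (A.chart x).symm '' tsupport χ := by
    rintro ⟨w, hw, rfl⟩
    exact hy ((A.chart x).map_target (hs hw))
  have hcont : Filter.Tendsto (A.chart y).symm (𝓝 (A.center y)) (𝓝 y) := by
    have := (A.chart y).continuousAt_symm (center_mem y)
    rwa [ContinuousAt, symm_center] at this
  have h2 : (fun w => A.fn (A.ext x χ) y w * J y w) =ᶠ[𝓝 (A.center y)] fun _ => 0 := by
    filter_upwards [hcont.eventually (hK.isOpen_compl.mem_nhds hn)] with w hw
    rw [fn, ext]
    split_ifs with h
    · have h3 : χ (A.chart x ((A.chart y).symm w)) = 0 :=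
        image_eq_zero_of_notMem_tsupport fun h2 => hw ⟨_, h2, (A.chart x).left_inv h⟩
      rw [h3, zero_mul]
    · rw [zero_mul]
  rw [val, Filter.EventuallyEq.dz_eq h2, dz_const]

namespace IsDensity

variable {R : X → ℂ → ℝ} {F G : X → ℂ → ℂ} {x : X}

lemma ne_zero (hR : A.IsDensity R) {z : ℂ} (hz : z ∈ (A.chart x).target) : (R x z : ℂ) ≠ 0 :=
  Complex.ofReal_ne_zero.2 (hR.pos x z hz).ne'

lemma isForm_div (hR : A.IsDensity R) {k l : ℤ} (hF : A.IsForm k l F) :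
    A.IsForm (k - 1) (l - 1) (fun x z => F x z / R x z) :=
  ((hF.mul (hR.form.inv fun x z hz => hR.ne_zero hz)).congr
    fun x z hz => div_eq_mul_inv _ _).cast (by ring) (by ring)

lemma continuous_div (hR : A.IsDensity R) (hF : A.IsForm 1 1 F) :
    Continuous (A.val (fun x z => F x z / R x z)) :=
  continuous_val ((hR.isForm_div hF).cast (by ring) (by ring))

variable [CompactSpace X] [MeasurableSpace X] [BorelSpace X] {μ : Measure X}

lemma integrable_of_continuous (hR : A.IsDensity R) (hμ : A.IsVolume R μ) {E : Type*}
    [NormedAddCommGroup E] [SecondCountableTopology E] {f : X → E}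
    (hf : Continuous f) : Integrable f μ := by
  have := hμ.isFiniteMeasure hR
  borelize E
  obtain ⟨C, hC⟩ := (isCompact_range hf).isBounded.exists_norm_le
  exact Integrable.of_bound hf.aestronglyMeasurable C
    (Filter.Eventually.of_forall fun x => hC _ ⟨x, rfl⟩)

lemma integrable (hR : A.IsDensity R) (hμ : A.IsVolume R μ) (hF : A.IsForm 1 1 F) :
    Integrable (A.val (fun x z => F x z / R x z)) μ :=
  hR.integrable_of_continuous hμ (hR.continuous_div hF)

lemma formIntegral_add (hR : A.IsDensity R) (hμ : A.IsVolume R μ) (hF : A.IsForm 1 1 F)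
    (hG : A.IsForm 1 1 G) : A.formIntegral R μ (fun x z => F x z + G x z) =
      A.formIntegral R μ F + A.formIntegral R μ G := by
  rw [formIntegral, formIntegral, formIntegral, ← integral_add (hR.integrable hμ hF) (hR.integrable hμ hG)]
  simp only [val, add_div]

lemma formIntegral_sub (hR : A.IsDensity R) (hμ : A.IsVolume R μ) (hF : A.IsForm 1 1 F)
    (hG : A.IsForm 1 1 G) : A.formIntegral R μ (fun x z => F x z - G x z) =
      A.formIntegral R μ F - A.formIntegral R μ G := by
  rw [formIntegral, formIntegral, formIntegral, ← integral_sub (hR.integrable hμ hF) (hR.integrable hμ hG)]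
  simp only [val, sub_div]

lemma formIntegral_const_mul (c : ℂ) : A.formIntegral R μ (fun x z => c * F x z) =
      c * A.formIntegral R μ F := by
  rw [formIntegral, formIntegral, ← integral_const_mul]
  simp only [val, mul_div_assoc]

lemma formIntegral_congr (h : ∀ x, F x (A.center x) = G x (A.center x)) :
    A.formIntegral R μ F = A.formIntegral R μ G := by
  simp only [formIntegral, val, h]

/-- The integral of a form supported in a chart. -/
lemma formIntegral_eq (hR : A.IsDensity R) (hμ : A.IsVolume R μ) (hF : A.IsForm 1 1 F) (x : X)
    (h0 : ∀ y ∉ (A.chart x).source, A.val F y = 0) :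
    A.formIntegral R μ F = ∫ z in (A.chart x).target, F x z := by
  have h1 : A.formIntegral R μ F =
      ∫ p in (A.chart x).source, A.val (fun x z => F x z / R x z) p ∂μ := by
    rw [formIntegral, setIntegral_eq_integral_of_forall_compl_eq_zero]
    intro p hp
    have := h0 p hp
    simp only [val] at this ⊢
    rw [this, zero_div]
  rw [h1, hμ.setIntegral_eq hR x (hR.continuous_div hF).aestronglyMeasurable]
  refine setIntegral_congr_fun (A.chart x).open_target.measurableSet fun z hz => ?_
  have h2 := ((hR.isForm_div hF).cast (show (1 - 1 : ℤ) = 0 by ring)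
    (show (1 - 1 : ℤ) = 0 by ring)).fn_val hz
  rw [← h2, div_mul_cancel₀ _ (hR.ne_zero hz)]

lemma formIntegral_dz_ext_mul [T2Space X] (hR : A.IsDensity R) (hμ : A.IsVolume R μ)
    {J : X → ℂ → ℂ} (hJ : A.IsForm 0 1 J) (x : X) {χ : ℂ → ℂ} (hχ : ContDiff ℝ ∞ χ)
    (hc : HasCompactSupport χ) (hs : tsupport χ ⊆ (A.chart x).target) :
    A.formIntegral R μ (fun y z => dz (fun w => A.fn (A.ext x χ) y w * J y w) z) = 0 := by
  have hform : A.IsForm 0 1 (fun y w => A.fn (A.ext x χ) y w * J y w) :=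
    ((isForm_ext hχ hc hs).mul hJ).cast (by ring) (by ring)
  rw [hR.formIntegral_eq hμ hform.dz x]
  · have h1 : ∀ z ∈ (A.chart x).target, dz (fun w => A.fn (A.ext x χ) x w * J x w) z =
        dz (fun w => χ w * J x w) z := fun z hz =>
      dz_congr (A.chart x).open_target (fun z hz => by rw [fn_ext_self hz]) hz
    rw [setIntegral_congr_fun (A.chart x).open_target.measurableSet h1]
    have hsm := contDiff_mul_of_tsupport (A.chart x).open_target hχ hs (hJ.smooth x)
    have hcs : HasCompactSupport (fun w => χ w * J x w) := hc.mul_right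
    rw [setIntegral_eq_integral_of_forall_compl_eq_zero, integral_dz_eq_zero hsm hcs]
    intro z hz
    refine image_eq_zero_of_notMem_tsupport fun h => hz (hs ?_)
    exact (tsupport_mul_subset_left (f := χ) (g := J x)) (tsupport_dz_subset h)
  · exact fun y hy => val_dz_ext_mul_eq_zero hc hs hy

end IsDensity

/-- A smooth bump function around the centre of each chart. -/
lemma exists_bump (A : HolAtlas X) (x : X) {O : Set ℂ} (hO : O ∈ 𝓝 (A.center x)) :
    ∃ χ : ℂ → ℝ, ContDiff ℝ ∞ χ ∧ HasCompactSupport χ ∧ tsupport χ ⊆ O ∧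
      (∀ z, 0 ≤ χ z) ∧ ∀ᶠ z in 𝓝 (A.center x), χ z = 1 := by
  obtain ⟨r, hr, hsub⟩ := Metric.nhds_basis_closedBall.mem_iff.1 hO
  let b : ContDiffBump (A.center x) := ⟨r / 2, r, by linarith, by linarith⟩
  refine ⟨b, b.contDiff, b.hasCompactSupport, ?_, fun z => b.nonneg, b.eventuallyEq_one⟩
  rw [b.tsupport_eq]; exact hsub

/-- Stokes' theorem. -/
theorem formIntegral_dz [CompactSpace X] [T2Space X] [MeasurableSpace X] [BorelSpace X]
    {R : X → ℂ → ℝ} {μ : Measure X} (hR : A.IsDensity R) (hμ : A.IsVolume R μ) {J : X → ℂ → ℂ}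
    (hJ : A.IsForm 0 1 J) : A.formIntegral R μ (fun x z => dz (J x) z) = 0 := by
  choose χ h1 h2 h3 h4 h5 using fun x => A.exists_bump x ((A.chart x).open_target.mem_nhds (center_mem x))
  have hcs : ∀ x, ContDiff ℝ ∞ fun z => (χ x z : ℂ) := fun x =>
    Complex.ofRealCLM.contDiff.comp (h1 x)
  have hcc : ∀ x, HasCompactSupport fun z => (χ x z : ℂ) := fun x =>
    (h2 x).comp_left (g := fun r : ℝ => (r : ℂ)) rfl
  have hct : ∀ x, tsupport (fun z => (χ x z : ℂ)) ⊆ (A.chart x).target := fun x =>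
    (closure_mono (Function.support_comp_subset (g := fun r : ℝ => (r : ℂ)) rfl (χ x))).trans (h3 x)
  have hN : ∀ x, {p | p ∈ (A.chart x).source ∧ χ x (A.chart x p) = 1} ∈ 𝓝 x := fun x => by
    have hc : Filter.Tendsto (A.chart x) (𝓝 x) (𝓝 (A.center x)) :=
      (A.chart x).continuousAt (A.mem_source x)
    filter_upwards [(A.chart x).open_source.mem_nhds (A.mem_source x), hc.eventually (h5 x)]
      with p hp hp'
    exact ⟨hp, hp'⟩
  obtain ⟨t, -, ht⟩ := isCompact_univ.elim_nhds_subcover _ fun x _ => hN x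
  set β : X → X → ℂ := fun x => A.ext x fun z => (χ x z : ℂ) with hβ
  have hβf : ∀ x, A.IsForm 0 0 (A.fn (β x)) := fun x => isForm_ext (hcs x) (hcc x) (hct x)
  have hβr : ∀ x p, ∃ r : ℝ, 0 ≤ r ∧ β x p = r := fun x p => by
    simp only [β, ext]
    split_ifs
    · exact ⟨_, h4 x _, rfl⟩
    · exact ⟨0, le_rfl, by simp⟩
  choose b hb hbβ using hβr
  set S : X → ℂ := fun p => ∑ i ∈ t, β i p with hS
  have hSne : ∀ p, S p ≠ 0 := fun p => by
    have h6 : S p = ((∑ i ∈ t, b i p : ℝ) : ℂ) := by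
      simp only [S, hbβ, Complex.ofReal_sum]
    rw [h6, Complex.ofReal_ne_zero]
    obtain ⟨i, hi, hip, hip'⟩ := Set.mem_iUnion₂.1 (ht (Set.mem_univ p))
    have h7 : β i p = 1 := by simp only [β]; rw [ext_of_mem hip, hip', Complex.ofReal_one]
    have h8 : b i p = 1 := by rw [hbβ] at h7; exact_mod_cast h7
    have h9 := Finset.single_le_sum (f := fun i => b i p) (fun j _ => hb j p) hi
    simp only [h8] at h9
    linarith
  have hSf : A.IsForm 0 0 (A.fn S) := by
    refine isForm_fn fun x => ?_
    have : A.fn S x = fun z => ∑ i ∈ t, A.fn (β i) x z := rfl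
    rw [this]
    exact ContDiffOn.sum fun i _ => (hβf i).smooth x
  have hJS : A.IsForm 0 1 (fun x z => (A.fn S x z)⁻¹ * J x z) :=
    ((hSf.inv fun x z _ => hSne _).mul hJ).cast (by ring) (by ring)
  have hsum : ∀ x, dz (J x) (A.center x) =
      ∑ i ∈ t, dz (fun w => A.fn (β i) x w * ((A.fn S x w)⁻¹ * J x w)) (A.center x) := by
    intro x
    have hd : ∀ i, DifferentiableAt ℝ
        (fun w => A.fn (β i) x w * ((A.fn S x w)⁻¹ * J x w)) (A.center x) := fun i =>
      ((hβf i).differentiableAt (center_mem x)).mul (hJS.differentiableAt (center_mem x))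
    have h10 : dz (J x) (A.center x) =
        dz (fun w => ∑ i ∈ t, A.fn (β i) x w * ((A.fn S x w)⁻¹ * J x w)) (A.center x) := by
      congr 1
      funext w
      rw [← Finset.sum_mul, ← mul_assoc]
      have : ∑ i ∈ t, A.fn (β i) x w = A.fn S x w := rfl
      rw [this, mul_inv_cancel₀ (show A.fn S x w ≠ 0 from hSne _), one_mul]
    rw [h10]
    simp only [dz]
    rw [fderiv_fun_sum fun i _ => hd i]
    simp only [sum_apply, Finset.mul_sum, ← Finset.sum_sub_distrib]
  rw [formIntegral]
  have h11 : ∀ p, A.val (fun x z => dz (J x) z / R x z) p = ∑ i ∈ t,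
      A.val (fun x z => dz (fun w => A.fn (β i) x w * ((A.fn S x w)⁻¹ * J x w)) z / R x z) p := by
    intro p
    simp only [val]
    rw [hsum, Finset.sum_div]
  simp_rw [h11]
  rw [integral_finsetSum]
  · exact Finset.sum_eq_zero fun i _ =>
      hR.formIntegral_dz_ext_mul hμ hJS i (hcs i) (hcc i) (hct i)
  · intro i _
    exact hR.integrable hμ ((((hβf i).mul hJS).cast (by ring) (by ring)).dz)

theorem formIntegral_dzb [CompactSpace X] [T2Space X] [MeasurableSpace X] [BorelSpace X]
    {R : X → ℂ → ℝ} {μ : Measure X} (hR : A.IsDensity R) (hμ : A.IsVolume R μ) {J : X → ℂ → ℂ}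
    (hJ : A.IsForm 1 0 J) : A.formIntegral R μ (fun x z => dzb (J x) z) = 0 := by
  have h := formIntegral_dz hR hμ hJ.cconj
  have h2 : A.formIntegral R μ (fun x z => dz (fun w => conj (J x w)) z) =
      conj (A.formIntegral R μ (fun x z => dzb (J x) z)) := by
    rw [formIntegral, formIntegral, ← integral_conj]
    congr 1
    funext p
    simp only [val]
    rw [dz_conj (hJ.differentiableAt (center_mem p)), map_div₀, Complex.conj_ofReal]
  rw [h2] at h
  simpa using h

end HolAtlas

end GravVortex

namespace GravVortex

open ComplexConjugate MeasureTheory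

section Weyl

lemma hasFDerivAt_comp_normSq {Q : ℝ → ℝ} {q : ℝ} {w : ℂ}
    (hQ : HasDerivAt Q q (Complex.normSq w)) :
    HasFDerivAt (fun w : ℂ => ((Q (Complex.normSq w) : ℝ) : ℂ))
      (Complex.ofRealCLM.comp (q • ((2 * w.re) • Complex.reCLM + (2 * w.im) • Complex.imCLM))) w := by
  have h1 : HasFDerivAt (fun w : ℂ => Complex.normSq w)
      ((2 * w.re) • Complex.reCLM + (2 * w.im) • Complex.imCLM) w := by
    have hre : HasFDerivAt (fun w : ℂ => w.re) Complex.reCLM w := Complex.reCLM.hasFDerivAt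
    have him : HasFDerivAt (fun w : ℂ => w.im) Complex.imCLM w := Complex.imCLM.hasFDerivAt
    have h := (hre.mul hre).add (him.mul him)
    refine (h.congr_of_eventuallyEq (Filter.Eventually.of_forall fun w => ?_)).congr_fderiv ?_
    · simp [Complex.normSq_apply]
    · ext; simp; ring_nf
  exact Complex.ofRealCLM.hasFDerivAt.comp w (hQ.comp_hasFDerivAt w h1)

lemma hasW_comp_normSq {Q : ℝ → ℝ} {q : ℝ} {w : ℂ} (hQ : HasDerivAt Q q (Complex.normSq w)) :
    HasW (fun w : ℂ => ((Q (Complex.normSq w) : ℝ) : ℂ)) w (q * conj w) (q * w) := by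
  have h := hasFDerivAt_comp_normSq hQ
  refine ⟨h.differentiableAt, ?_, ?_⟩
  · rw [dz, h.fderiv]
    apply Complex.ext <;> simp <;> ring
  · rw [dzb, h.fderiv]
    apply Complex.ext <;> simp <;> ring

lemma contDiff_comp_normSq {Q : ℝ → ℝ} (hQ : ContDiff ℝ ∞ Q) :
    ContDiff ℝ ∞ (fun w : ℂ => ((Q (Complex.normSq w) : ℝ) : ℂ)) := by
  have h1 : ContDiff ℝ ∞ (fun w : ℂ => Complex.normSq w) := by
    have hre : ContDiff ℝ ∞ (fun w : ℂ => w.re) := Complex.reCLM.contDiff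
    have him : ContDiff ℝ ∞ (fun w : ℂ => w.im) := Complex.imCLM.contDiff
    have h := (hre.mul hre).add (him.mul him)
    rwa [show (fun w : ℂ => Complex.normSq w) = fun w : ℂ => w.re * w.re + w.im * w.im from
      funext Complex.normSq_apply]
  exact Complex.ofRealCLM.contDiff.comp (hQ.comp h1)

/-- A radial function of vanishing integral, supported away from the origin, is `∂̄` of a
compactly supported function. -/
lemma exists_dzb_eq_radial {p : ℝ → ℝ} (hp : ContDiff ℝ ∞ p) {ε S : ℝ} (hε : 0 < ε)
    (h0 : ∀ t ∉ Set.Icc ε S, p t = 0) (hint : ∫ t, p t = 0) :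
    ∃ χ : ℂ → ℂ, ContDiff ℝ ∞ χ ∧ (∀ w, S < Complex.normSq w → χ w = 0) ∧
      ∀ w, dzb χ w = p (Complex.normSq w) := by
  set Q : ℝ → ℝ := fun s => ∫ t in (0 : ℝ)..s, p t with hQ
  have hQd : ∀ s, HasDerivAt Q (p s) s := fun s =>
    intervalIntegral.integral_hasDerivAt_right (hp.continuous.intervalIntegrable _ _)
      (hp.continuous.stronglyMeasurableAtFilter _ _) hp.continuous.continuousAt
  have hQs : ContDiff ℝ ∞ Q := by
    rw [contDiff_infty_iff_deriv]
    exact ⟨fun s => (hQd s).differentiableAt, by rwa [show deriv Q = p from funext fun s => (hQd s).deriv]⟩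
  have hQ0 : ∀ s, s < ε → Q s = 0 := fun s hs => by
    refine intervalIntegral.integral_zero_ae (Filter.Eventually.of_forall fun t ht => h0 t ?_)
    rcases Set.mem_uIoc.1 ht with h | h
    · exact fun h2 => by linarith [h.2, h2.1]
    · exact fun h2 => by linarith [h.2, h2.1]
  have hQS : ∀ s, 0 ≤ s → S < s → Q s = 0 := fun s hs0 hs => by
    rw [hQ]
    simp only
    rw [intervalIntegral.integral_of_le hs0, setIntegral_eq_integral_of_forall_compl_eq_zero, hint]
    intro t ht
    refine h0 t fun h2 => ht ⟨by linarith [h2.1], by linarith [h2.2]⟩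
  have hzero : ∀ w : ℂ, Complex.normSq w < ε → (fun w : ℂ => (Q (Complex.normSq w) : ℂ) * w⁻¹) =ᶠ[𝓝 w]
      fun _ => 0 := fun w hw => by
    filter_upwards [(isOpen_lt Complex.continuous_normSq continuous_const).mem_nhds hw] with v hv
    rw [hQ0 _ hv]; simp
  refine ⟨fun w => (Q (Complex.normSq w) : ℂ) * w⁻¹, ?_, ?_, ?_⟩
  · rw [contDiff_iff_contDiffAt]
    intro w
    by_cases hw : w = 0
    · exact contDiffAt_const.congr_of_eventuallyEq (hzero w (by simpa [hw] using hε))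
    · exact (contDiff_comp_normSq hQs).contDiffAt.mul
        (contDiffAt_inv ℂ hw |>.restrict_scalars ℝ)
  · intro w hw
    simp only [hQS _ (Complex.normSq_nonneg w) hw]; simp
  · intro w
    by_cases hw : w = 0
    · rw [Filter.EventuallyEq.dzb_eq (hzero w (by simpa [hw] using hε)), dzb_const, h0, Complex.ofReal_zero]
      simp only [hw, map_zero]
      exact fun h => by linarith [h.1]
    · have h1 := (hasW_comp_normSq (hQd (Complex.normSq w))).mul
        (HasW.of_hol (differentiableAt_inv hw))
      rw [h1.dzb_eq]
      field_simp
      ring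

variable {G : ℂ → ℂ} {c : ℂ} {r : ℝ}

/-- `G` is weakly holomorphic in the ball. -/
def WeaklyHol (G : ℂ → ℂ) (c : ℂ) (r : ℝ) : Prop :=
  ∀ χ : ℂ → ℂ, ContDiff ℝ ∞ χ → HasCompactSupport χ → tsupport χ ⊆ Metric.ball c r →
    ∫ z, G z * dzb χ z = 0

lemma normSq_sub_eq (z w : ℂ) : Complex.normSq (w - z) = dist w z ^ 2 := by
  rw [Complex.normSq_eq_norm_sq, dist_eq_norm]

lemma WeaklyHol.integral_radial_eq_zero (hG : WeaklyHol G c r) {p : ℝ → ℝ} (hp : ContDiff ℝ ∞ p)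
    {ε S : ℝ} (hε : 0 < ε) (hr : 0 < r) (hS : S < (r / 2) ^ 2)
    (h0 : ∀ t ∉ Set.Icc ε S, p t = 0) (hint : ∫ t, p t = 0) {z : ℂ}
    (hz : z ∈ Metric.ball c (r / 2)) : ∫ w, G w * p (Complex.normSq (w - z)) = 0 := by
  obtain ⟨χ, h1, h2, h3⟩ := exists_dzb_eq_radial hp hε h0 hint
  have hsub : tsupport (fun w => χ (w - z)) ⊆ Metric.closedBall z (Real.sqrt S) := by
    refine closure_minimal (fun w hw => ?_) Metric.isClosed_closedBall
    by_contra h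
    refine hw (h2 _ ?_)
    rw [Metric.mem_closedBall, not_le] at h
    rw [normSq_sub_eq]
    exact (Real.lt_sq_of_sqrt_lt h)
  have hsq : Real.sqrt S < r / 2 := by
    rw [Real.sqrt_lt' (by positivity)]; exact hS
  have h4 := hG (fun w => χ (w - z)) (h1.comp (contDiff_id.sub contDiff_const))
    (HasCompactSupport.of_support_subset_isCompact (isCompact_closedBall z (Real.sqrt S))
      ((subset_tsupport _).trans hsub))
    (hsub.trans fun w hw => by
      rw [Metric.mem_closedBall] at hw
      rw [Metric.mem_ball] at hz ⊢
      linarith [dist_triangle w z c])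
  rw [← h4]
  congr 1
  funext w
  have hT : DifferentiableAt ℂ (fun w => w - z) w := differentiableAt_id.sub_const z
  rw [dzb_comp (f := χ) hT ((h1.differentiable (by simp)).differentiableAt), h3]
  simp

lemma integrable_mul_radial (hG : Integrable G) {p : ℝ → ℝ} (hp : Continuous p) {C : ℝ}
    (hC : ∀ t, |p t| ≤ C) (z : ℂ) : Integrable fun w => G w * p (Complex.normSq (w - z)) := by
  refine hG.mul_bdd (c := C) ?_ ?_
  · exact (Complex.continuous_ofReal.comp (hp.comp
      (Complex.continuous_normSq.comp (continuous_id.sub continuous_const)))).aestronglyMeasurable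
  · exact Filter.Eventually.of_forall fun w => by simpa using hC _

lemma bounded_of_compact {p : ℝ → ℝ} (hp : Continuous p) {ε S : ℝ}
    (h0 : ∀ t ∉ Set.Icc ε S, p t = 0) : ∃ C, ∀ t, |p t| ≤ C := by
  have : HasCompactSupport p := HasCompactSupport.intro isCompact_Icc h0
  obtain ⟨C, hC⟩ := hp.bounded_above_of_compact_support this
  exact ⟨C, fun t => hC t⟩

lemma WeaklyHol.integral_radial_eq (hG : WeaklyHol G c r) (hGi : Integrable G)
    {p p₀ : ℝ → ℝ} (hp : ContDiff ℝ ∞ p) (hp₀ : ContDiff ℝ ∞ p₀)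
    {ε S : ℝ} (hε : 0 < ε) (hr : 0 < r) (hS : S < (r / 2) ^ 2)
    (h0 : ∀ t ∉ Set.Icc ε S, p t = 0) (h0' : ∀ t ∉ Set.Icc ε S, p₀ t = 0) (hint : ∫ t, p₀ t = 1)
    {z : ℂ} (hz : z ∈ Metric.ball c (r / 2)) :
    ∫ w, G w * p (Complex.normSq (w - z)) =
      ((∫ t, p t : ℝ) : ℂ) * ∫ w, G w * p₀ (Complex.normSq (w - z)) := by
  obtain ⟨C, hC⟩ := bounded_of_compact hp.continuous h0
  obtain ⟨C₀, hC₀⟩ := bounded_of_compact hp₀.continuous h0'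
  set m : ℝ := ∫ t, p t with hm
  have hpi : Integrable p := hp.continuous.integrable_of_hasCompactSupport
    (HasCompactSupport.intro isCompact_Icc h0)
  have hpi₀ : Integrable p₀ := hp₀.continuous.integrable_of_hasCompactSupport
    (HasCompactSupport.intro isCompact_Icc h0')
  have h := hG.integral_radial_eq_zero (p := fun t => p t - m * p₀ t)
    (hp.sub (contDiff_const.mul hp₀)) hε hr hS
    (fun t ht => by rw [h0 t ht, h0' t ht]; ring)
    (by rw [integral_sub hpi (hpi₀.const_mul _), integral_const_mul, hint]; ring) hz
  have h2 : (fun w => G w * ((p (Complex.normSq (w - z)) - m * p₀ (Complex.normSq (w - z)) : ℝ) : ℂ)) =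
      fun w => G w * p (Complex.normSq (w - z)) - m * (G w * p₀ (Complex.normSq (w - z))) := by
    funext w; push_cast; ring
  rw [h2, integral_sub (integrable_mul_radial hGi hp.continuous hC z)
    ((integrable_mul_radial hGi hp₀.continuous hC₀ z).const_mul _), integral_const_mul] at h
  linear_combination h

/-- Averages of a weakly holomorphic function over balls do not depend on the radius. -/
lemma WeaklyHol.setIntegral_ball_eq (hG : WeaklyHol G c r) (hGi : Integrable G)
    {p₀ : ℝ → ℝ} (hp₀ : ContDiff ℝ ∞ p₀) {ε₀ S₀ : ℝ} (hε₀ : 0 < ε₀) (hr : 0 < r)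
    (hS₀ : S₀ < (r / 2) ^ 2) (h0' : ∀ t ∉ Set.Icc ε₀ S₀, p₀ t = 0) (hint : ∫ t, p₀ t = 1)
    {z : ℂ} (hz : z ∈ Metric.ball c (r / 2)) {s : ℝ} (hs : 0 < s) (hsr : s ≤ r / 2) :
    ∫ w in Metric.ball z s, G w = ((s ^ 2 : ℝ) : ℂ) * ∫ w, G w * p₀ (Complex.normSq (w - z)) := by
  set K : ℂ := ∫ w, G w * p₀ (Complex.normSq (w - z)) with hK
  have hs2 : 0 < s ^ 2 := by positivity
  -- bumps approximating the indicator function of `(0, s²)`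
  let b : ℕ → ContDiffBump (s ^ 2 / 2 : ℝ) := fun n =>
    ⟨s ^ 2 / 2 * (1 - 1 / ((n : ℝ) + 2)), s ^ 2 / 2 * (1 - 1 / ((n : ℝ) + 3)), by
      have : 1 / ((n : ℝ) + 2) < 1 := by
        rw [div_lt_one (by positivity)]; linarith [(n.cast_nonneg : (0 : ℝ) ≤ n)]
      have : 0 < 1 - 1 / ((n : ℝ) + 2) := by linarith
      positivity, by
      have : 1 / ((n : ℝ) + 3) < 1 / ((n : ℝ) + 2) := by
        apply one_div_lt_one_div_of_lt <;> linarith [(n.cast_nonneg : (0 : ℝ) ≤ n)]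
      have h2 : 0 < s ^ 2 / 2 := by positivity
      exact mul_lt_mul_of_pos_left (by linarith) h2⟩
  have hrOut : ∀ n, (b n).rOut = s ^ 2 / 2 * (1 - 1 / ((n : ℝ) + 3)) := fun n => rfl
  have hrOutlt : ∀ n, (b n).rOut < s ^ 2 / 2 := fun n => by
    rw [hrOut]
    have : 0 < 1 / ((n : ℝ) + 3) := by positivity
    nlinarith
  have hbnd : ∀ n t, |b n t| ≤ 1 := fun n t => by
    rw [abs_of_nonneg (b n).nonneg]; exact (b n).le_one
  have hbzero : ∀ n t, t ∉ Set.Ioo 0 (s ^ 2) → b n t = 0 := fun n t ht => by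
    refine (b n).zero_of_le_dist ?_
    rw [Real.dist_eq]
    by_contra h
    rw [not_le] at h
    have := (abs_lt.1 (h.trans (hrOutlt n)))
    exact ht ⟨by linarith [this.1], by linarith [this.2]⟩
  have hbone : ∀ t ∈ Set.Ioo 0 (s ^ 2), ∀ᶠ n in Filter.atTop, b n t = 1 := fun t ht => by
    have hlim : Filter.Tendsto (fun n : ℕ => s ^ 2 / 2 * (1 - 1 / ((n : ℝ) + 2))) Filter.atTop
        (𝓝 (s ^ 2 / 2 * (1 - 0))) := by
      refine tendsto_const_nhds.mul (tendsto_const_nhds.sub ?_)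
      exact tendsto_const_nhds.div_atTop (Filter.tendsto_atTop_add_const_right _ _
        tendsto_natCast_atTop_atTop)
    have hd : dist t (s ^ 2 / 2) < s ^ 2 / 2 * (1 - 0) := by
      rw [Real.dist_eq, abs_lt]; constructor <;> linarith [ht.1, ht.2]
    filter_upwards [hlim.eventually (lt_mem_nhds hd)] with n hn
    exact (b n).one_of_mem_closedBall (Metric.mem_closedBall.2 hn.le)
  have hsupp : ∀ n, ∀ t ∉ Set.Icc (s ^ 2 / 2 - (b n).rOut) (s ^ 2 / 2 + (b n).rOut), b n t = 0 :=
    fun n t ht => by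
    refine (b n).zero_of_le_dist ?_
    by_contra h
    rw [not_le, Real.dist_eq, abs_lt] at h
    exact ht ⟨by linarith [h.1], by linarith [h.2]⟩
  have heq : ∀ n, ∫ w, G w * (b n (Complex.normSq (w - z)) : ℝ) = ((∫ t, b n t : ℝ) : ℂ) * K := by
    intro n
    refine hG.integral_radial_eq hGi (b n).contDiff hp₀
      (ε := min ε₀ (s ^ 2 / 2 - (b n).rOut)) (S := max S₀ (s ^ 2 / 2 + (b n).rOut))
      (lt_min hε₀ (by linarith [hrOutlt n])) hr (max_lt hS₀ ?_) ?_ ?_ hint hz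
    · have : s ^ 2 ≤ (r / 2) ^ 2 := by gcongr
      linarith [hrOutlt n]
    · exact fun t ht => hsupp n t fun h => ht ⟨(min_le_right _ _).trans h.1, h.2.trans (le_max_right _ _)⟩
    · exact fun t ht => h0' t fun h => ht ⟨(min_le_left _ _).trans h.1, h.2.trans (le_max_left _ _)⟩
  have hlim1 : Filter.Tendsto (fun n => ∫ w, G w * (b n (Complex.normSq (w - z)) : ℝ)) Filter.atTop
      (𝓝 (∫ w, (Metric.ball z s \ {z}).indicator G w)) := by
    refine tendsto_integral_of_dominated_convergence (fun w => ‖G w‖) (fun n => ?_) hGi.norm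
      (fun n => Filter.Eventually.of_forall fun w => ?_) (Filter.Eventually.of_forall fun w => ?_)
    · exact (integrable_mul_radial hGi (b n).continuous (hbnd n) z).aestronglyMeasurable
    · rw [norm_mul, Complex.norm_real, Real.norm_eq_abs]
      exact mul_le_of_le_one_right (norm_nonneg _) (hbnd n _)
    · have hiff : w ∈ Metric.ball z s \ {z} ↔ Complex.normSq (w - z) ∈ Set.Ioo 0 (s ^ 2) := by
        rw [normSq_sub_eq, Set.mem_sdiff, Metric.mem_ball, Set.mem_Ioo, Set.mem_singleton_iff,
          sq_lt_sq₀ dist_nonneg hs.le, and_comm, ← ne_eq, ← dist_pos]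
        exact and_congr_left fun _ => ⟨fun h => by positivity, fun h =>
          dist_nonneg.lt_of_ne' (sq_pos_iff.1 h)⟩
      by_cases hw : w ∈ Metric.ball z s \ {z}
      · rw [Set.indicator_of_mem hw]
        refine tendsto_const_nhds.congr' ?_
        filter_upwards [hbone _ (hiff.1 hw)] with n hn
        rw [hn]; simp
      · rw [Set.indicator_of_notMem hw]
        refine tendsto_const_nhds.congr fun n => ?_
        rw [hbzero n _ fun h => hw (hiff.2 h)]; simp
  have hlim2 : Filter.Tendsto (fun n => ∫ t, b n t) Filter.atTop
      (𝓝 (∫ t, (Set.Ioo 0 (s ^ 2)).indicator (fun _ => (1 : ℝ)) t)) := by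
    refine tendsto_integral_of_dominated_convergence
      ((Set.Ioo 0 (s ^ 2)).indicator fun _ => (1 : ℝ)) (fun n => ?_) ?_
      (fun n => Filter.Eventually.of_forall fun t => ?_) (Filter.Eventually.of_forall fun t => ?_)
    · exact (b n).continuous.aestronglyMeasurable
    · rw [integrable_indicator_iff measurableSet_Ioo]
      exact integrableOn_const (by simp)
    · by_cases ht : t ∈ Set.Ioo 0 (s ^ 2)
      · rw [Set.indicator_of_mem ht]; exact hbnd n t
      · rw [Set.indicator_of_notMem ht, hbzero n t ht]; simp
    · by_cases ht : t ∈ Set.Ioo 0 (s ^ 2)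
      · rw [Set.indicator_of_mem ht]
        exact tendsto_const_nhds.congr' ((hbone t ht).mono fun n hn => hn.symm)
      · rw [Set.indicator_of_notMem ht]
        exact tendsto_const_nhds.congr fun n => (hbzero n t ht).symm
  have hI : ∫ t, (Set.Ioo 0 (s ^ 2)).indicator (fun _ => (1 : ℝ)) t = s ^ 2 := by
    rw [integral_indicator measurableSet_Ioo]; simp [hs2.le]
  have hball : ∫ w, (Metric.ball z s \ {z}).indicator G w = ∫ w in Metric.ball z s, G w := by
    rw [integral_indicator (measurableSet_ball.diff (measurableSet_singleton z))]
    refine setIntegral_congr_set ?_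
    exact sdiff_null_ae_eq_self (by simp)
  rw [hI] at hlim2
  rw [hball] at hlim1
  simp_rw [heq] at hlim1
  exact tendsto_nhds_unique hlim1
    (((Complex.continuous_ofReal.tendsto _).comp hlim2).mul tendsto_const_nhds)

/-- Weyl's lemma for the Cauchy–Riemann operator. -/
theorem WeaklyHol.exists_hol (hG : WeaklyHol G c r) (hGi : Integrable G) (hr : 0 < r) :
    ∃ g : ℂ → ℂ, DifferentiableOn ℂ g (Metric.ball c (r / 2)) ∧
      ∀ᵐ z, z ∈ Metric.ball c (r / 2) → G z = g z := by
  let b : ContDiffBump (r ^ 2 / 16 : ℝ) := ⟨r ^ 2 / 64, r ^ 2 / 32, by positivity, by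
    have : 0 < r ^ 2 := by positivity
    linarith⟩
  have hr2 : 0 < r ^ 2 := by positivity
  set p₀ : ℝ → ℝ := b.normed volume with hp₀
  have hs₀ : ContDiff ℝ ∞ p₀ := b.contDiff_normed
  have hzero : ∀ t ∉ Set.Icc (r ^ 2 / 32) (3 * r ^ 2 / 32), p₀ t = 0 := fun t ht => by
    rw [hp₀, b.normed_def, b.zero_of_le_dist, zero_div]
    by_contra h
    rw [not_le, Real.dist_eq, abs_lt] at h
    have h1 : b.rOut = r ^ 2 / 32 := rfl
    rw [h1] at h
    exact ht ⟨by linarith [h.1], by linarith [h.2]⟩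
  have hint : ∫ t, p₀ t = 1 := b.integral_normed
  have hS₀ : 3 * r ^ 2 / 32 < (r / 2) ^ 2 := by nlinarith
  set k : ℂ → ℂ := fun w => (p₀ (Complex.normSq w) : ℂ) with hk
  have hks : ContDiff ℝ ∞ k := contDiff_comp_normSq hs₀
  have hkz : ∀ w : ℂ, w ∉ Metric.closedBall 0 (r / 2) → k w = 0 := fun w hw => by
    simp only [hk]
    rw [hzero, Complex.ofReal_zero]
    intro h
    rw [Complex.normSq_eq_norm_sq] at h
    rw [mem_closedBall_zero_iff, not_le] at hw
    have : (r / 2) ^ 2 < ‖w‖ ^ 2 := by gcongr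
    linarith [h.2]
  have hkc : HasCompactSupport k := HasCompactSupport.intro (isCompact_closedBall 0 (r / 2)) hkz
  have hsymm : ∀ z w : ℂ, Complex.normSq (w - z) = Complex.normSq (z - w) := fun z w => by
    rw [← Complex.normSq_neg]; congr 1; ring
  set L := ContinuousLinearMap.mul ℝ ℂ with hL
  set F : ℂ → ℂ := convolution G k L volume with hF
  have hFz : ∀ z, F z = ∫ w, G w * p₀ (Complex.normSq (w - z)) := fun z => by
    simp only [hF, convolution, hL, ContinuousLinearMap.mul_apply', hk]
    congr 1; funext w; rw [hsymm]
  have hFd : ∀ z, HasFDerivAt F ((convolution G (fderiv ℝ k) (L.precompR ℂ) volume) z) z := fun z =>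
    hkc.hasFDerivAt_convolution_right L hGi.locallyIntegrable (hks.of_le (by simp)) z
  have hFv : ∀ z v, fderiv ℝ F z v = ∫ w, G w * fderiv ℝ k (z - w) v := fun z v => by
    rw [(hFd z).fderiv, convolution_precompR_apply L hGi.locallyIntegrable (hkc.fderiv ℝ)
      (hks.continuous_fderiv (by simp))]
    rfl
  refine ⟨fun z => (Real.pi : ℂ)⁻¹ * F z, fun z hz => ?_, ?_⟩
  · have hdb : dzb F z = 0 := by
      have hi : ∀ v, Integrable fun w => G w * fderiv ℝ k (z - w) v := fun v => by
        have hc : Continuous fun w => fderiv ℝ k (z - w) v :=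
          ((hks.continuous_fderiv (by simp)).comp (continuous_const.sub continuous_id)).clm_apply
            continuous_const
        have hcs : HasCompactSupport fun w => fderiv ℝ k w v := hkc.fderiv_apply ℝ v
        obtain ⟨C, hC⟩ := ((hks.continuous_fderiv (by simp)).clm_apply
          (continuous_const (y := v))).bounded_above_of_compact_support hcs
        exact hGi.mul_bdd (c := C) hc.aestronglyMeasurable
          (Filter.Eventually.of_forall fun w => hC _)
      have h1 : dzb F z = ∫ w, G w * dzb k (z - w) := by
        rw [dzb, hFv, hFv, ← integral_const_mul, ← integral_add (hi 1) ((hi _).const_mul _),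
          ← integral_const_mul]
        congr 1; funext w; rw [dzb]; ring
      have hsub : tsupport (fun w => k (z - w)) ⊆ Metric.closedBall z (Real.sqrt (3 * r ^ 2 / 32)) := by
        refine closure_minimal (fun w hw => ?_) Metric.isClosed_closedBall
        by_contra h
        refine hw ?_
        simp only [hk]
        rw [hzero, Complex.ofReal_zero]
        intro h2
        rw [Metric.mem_closedBall, not_le] at h
        have h3 := Real.lt_sq_of_sqrt_lt h
        rw [← normSq_sub_eq, hsymm] at h3
        linarith [h2.2]
      have hsq : Real.sqrt (3 * r ^ 2 / 32) < r / 2 := by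
        rw [Real.sqrt_lt' (by positivity)]; exact hS₀
      have h2 := hG (fun w => k (z - w)) (hks.comp (contDiff_const.sub contDiff_id))
        (HasCompactSupport.of_support_subset_isCompact (isCompact_closedBall z _)
          ((subset_tsupport _).trans hsub))
        (hsub.trans fun w hw => by
          rw [Metric.mem_closedBall] at hw
          rw [Metric.mem_ball] at hz ⊢
          linarith [dist_triangle w z c])
      have h3 : ∀ w, dzb (fun w => k (z - w)) w = -dzb k (z - w) := fun w => by
        have hT : HasDerivAt (fun w => z - w) (-1) w := by
          simpa using (hasDerivAt_id w).const_sub z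
        rw [dzb_comp hT.differentiableAt (hks.differentiable (by simp)).differentiableAt, hT.deriv]
        simp
      simp only [h3, mul_neg, integral_neg, neg_eq_zero] at h2
      rw [h1, h2]
    exact ((differentiableAt_of_dzb_eq_zero (hFd z).differentiableAt hdb).const_mul _).differentiableWithinAt
  · filter_upwards [IsUnifLocDoublingMeasure.ae_tendsto_average (volume : Measure ℂ)
      hGi.locallyIntegrable 1] with z hz hzb
    have h1 := hz (ι := ℝ) (l := 𝓝[>] (0 : ℝ)) (fun _ => z) (fun s => s) Filter.tendsto_id (by
      filter_upwards [self_mem_nhdsWithin] with s hs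
      rw [one_mul]; exact Metric.mem_closedBall_self (le_of_lt hs))
    refine tendsto_nhds_unique h1 (tendsto_const_nhds.congr' ?_)
    have h2 : ∀ᶠ s : ℝ in 𝓝[>] (0 : ℝ), s < r / 2 :=
      nhdsWithin_le_nhds (gt_mem_nhds (by positivity))
    filter_upwards [self_mem_nhdsWithin, h2] with s hs hs2
    have hs0 : (0 : ℝ) < s := hs
    have hsm : ∫ w in Metric.closedBall z s, G w = ∫ w in Metric.ball z s, G w :=
      setIntegral_congr_set (by
        rw [← Metric.ball_union_sphere]
        exact union_ae_eq_left_of_ae_eq_empty (ae_eq_empty.2 (Measure.addHaar_sphere _ z s)))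
    have h3 := hG.setIntegral_ball_eq hGi hs₀ (by positivity) hr hS₀ hzero hint hzb hs0 hs2.le
    rw [setAverage_eq, hsm, h3, ← hFz, Measure.real, Complex.volume_closedBall]
    simp only [ENNReal.toReal_mul, ENNReal.toReal_pow, ENNReal.toReal_ofReal hs0.le,
      ENNReal.coe_toReal, NNReal.coe_real_pi, Complex.real_smul]
    push_cast
    have hsc : (s : ℂ) ≠ 0 := by exact_mod_cast hs0.ne'
    have hpi : (Real.pi : ℂ) ≠ 0 := by exact_mod_cast Real.pi_ne_zero
    field_simp

end Weyl

end GravVortex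

namespace GravVortex

open ComplexConjugate MeasureTheory
open scoped ENNReal InnerProductSpace

namespace HolAtlas

variable {X : Type*} [TopologicalSpace X] {A : HolAtlas X}
  [MeasurableSpace X] [BorelSpace X] {R : X → ℂ → ℝ} {μ : Measure X} {x : X}

namespace IsVolume

lemma ae_of_chart (hμ : A.IsVolume R μ) {N : Set X} (hN : IsOpen N)
    (hNs : N ⊆ (A.chart x).source) {G : X → ℂ} (hG : Measurable G) {g : ℂ → ℂ}
    (hg : ContinuousOn g (A.chart x '' N))
    (h : ∀ᵐ z, z ∈ A.chart x '' N → G ((A.chart x).symm z) = g z) :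
    ∀ᵐ p ∂μ, p ∈ N → G p = g (A.chart x p) := by
  classical
  have hF : Measurable (N.piecewise (fun p => g (A.chart x p)) fun _ => 0) :=
    ContinuousOn.measurable_piecewise (hg.comp ((A.chart x).continuousOn.mono hNs)
      fun p hp => ⟨p, hp, rfl⟩) continuousOn_const hN.measurableSet
  have hE : MeasurableSet (N ∩ {p | ¬ G p = N.piecewise (fun p => g (A.chart x p)) (fun _ => 0) p}) :=
    hN.measurableSet.inter (measurableSet_eq_fun hG hF).compl
  have h2 : {p | ¬ (p ∈ N → G p = g (A.chart x p))} =
      N ∩ {p | ¬ G p = N.piecewise (fun p => g (A.chart x p)) (fun _ => 0) p} := by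
    ext p
    simp only [Set.mem_ofPred_eq, Set.mem_inter_iff, Classical.not_imp]
    exact and_congr_right fun hp => by rw [Set.piecewise_eq_of_mem _ _ _ hp]
  rw [ae_iff, h2, hμ x _ hE (Set.inter_subset_left.trans hNs)]
  refine setLIntegral_measure_zero _ _ (measure_mono_null ?_ (ae_iff.1 h))
  rintro _ ⟨p, ⟨hp, hp2⟩, rfl⟩
  rw [Set.mem_ofPred_eq, Set.piecewise_eq_of_mem _ _ _ hp] at hp2
  simp only [Set.mem_ofPred_eq, Classical.not_imp]
  refine ⟨⟨p, hp, rfl⟩, ?_⟩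
  rwa [(A.chart x).left_inv (hNs hp)]

lemma integrableOn_symm (hμ : A.IsVolume R μ) (hR : A.IsDensity R) {K : Set ℂ} (hK : IsCompact K)
    (hKt : K ⊆ (A.chart x).target) {G : X → ℂ} (hG : Integrable G μ) :
    IntegrableOn (fun z => G ((A.chart x).symm z)) K := by
  have hae : AEMeasurable (A.chart x).symm
      ((volume.restrict (A.chart x).target).withDensity
      fun z => ENNReal.ofReal (R x z)) :=
    (aemeasurable_chart_symm _ (A.chart x).open_target.measurableSet subset_rfl).mono_ac
      (withDensity_absolutelyContinuous _ _)
  have hRm : AEMeasurable (fun z => (R x z).toNNReal) (volume.restrict (A.chart x).target) :=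
    ((hR.continuousOn x).aemeasurable (A.chart x).open_target.measurableSet).real_toNNReal
  have h1 := hG.restrict (s := (A.chart x).source)
  rw [hμ.restrict_eq x] at h1
  have h2 := h1.comp_aemeasurable hae
  have h3 : Integrable (G ∘ (A.chart x).symm) ((volume.restrict (A.chart x).target).withDensity
      fun z => ((R x z).toNNReal : ℝ≥0∞)) := h2
  rw [integrable_withDensity_iff_integrable_smul₀ hRm] at h3
  have h4 : IntegrableOn (fun z => (R x z).toNNReal • (G ∘ (A.chart x).symm) z) K :=
    IntegrableOn.mono_set h3 hKt
  have h5 : ContinuousOn (fun z => ((R x z : ℂ))⁻¹) K :=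
    ((Complex.continuous_ofReal.comp_continuousOn (hR.continuousOn x)).inv₀
      fun z hz => hR.ne_zero hz).mono hKt
  refine (h4.mul_continuousOn h5 hK).congr_fun (fun z hz => ?_) hK.measurableSet
  have h6 := hR.ne_zero (hKt hz)
  simp only [NNReal.smul_def, Real.coe_toNNReal _ (hR.pos x z (hKt hz)).le, Function.comp_apply]
  rw [Complex.real_smul]
  field_simp

end IsVolume

/-- An integrable function orthogonal to the derivatives of all `(0,1)`-forms is constant. -/
lemma ae_eq_const_of_forall_integral_eq_zero [CompactSpace X] [ConnectedSpace X] [T2Space X]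
    (hR : A.IsDensity R) (hμ : A.IsVolume R μ) {G : X → ℂ} (hG : Measurable G)
    (hGi : Integrable G μ) (h0 : ∀ β, A.IsForm 1 0 β →
      ∫ p, G p * A.val (fun x z => dzb (β x) z / R x z) p ∂μ = 0) :
    ∃ K : ℂ, ∀ᵐ p ∂μ, G p = K := by
  have hloc : ∀ q : X, ∃ r > 0, ∃ g : ℂ → ℂ, Metric.ball (A.center q) r ⊆ (A.chart q).target ∧
      DifferentiableOn ℂ g (Metric.ball (A.center q) r) ∧
      ∀ᵐ z, z ∈ Metric.ball (A.center q) r → G ((A.chart q).symm z) = g z := by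
    intro q
    obtain ⟨b, hb1, hb2, hb3, -, hb5⟩ := A.exists_bump q ((A.chart q).open_target.mem_nhds (center_mem q))
    obtain ⟨r, hr, hrs⟩ := Metric.nhds_basis_closedBall.mem_iff.1
      (Filter.inter_mem hb5 ((A.chart q).open_target.mem_nhds (center_mem q)))
    set c := A.center q with hc
    set H : ℂ → ℂ := (Metric.closedBall c r).indicator fun z => G ((A.chart q).symm z) with hH
    have hHi : Integrable H := by
      rw [integrable_indicator_iff Metric.isClosed_closedBall.measurableSet]
      exact hμ.integrableOn_symm hR (isCompact_closedBall c r) (hrs.trans Set.inter_subset_right) hGi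
    have hHw : WeaklyHol H c r := by
      intro χ h1 h2 h3
      have hχt : tsupport χ ⊆ (A.chart q).target := fun z hz =>
        (hrs (Metric.ball_subset_closedBall (h3 hz))).2
      set κ : ℂ → ℂ := fun z => (b z : ℂ) * z with hκ
      have hκs : ContDiff ℝ ∞ κ := (Complex.ofRealCLM.contDiff.comp hb1).mul contDiff_id
      have hκc : HasCompactSupport κ :=
        HasCompactSupport.mul_right (hb2.comp_left (g := fun r : ℝ => (r : ℂ)) rfl)
      have hκt : tsupport κ ⊆ (A.chart q).target := by
        refine (closure_mono fun z hz => ?_).trans hb3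
        intro hz0
        apply hz
        simp only [κ, hz0, Complex.ofReal_zero, zero_mul]
      have hβ : A.IsForm 1 0 (fun x z => A.fn (A.ext q χ) x z * dz (A.fn (A.ext q κ) x) z) :=
        ((isForm_ext h1 h2 hχt).mul (isForm_ext hκs hκc hκt).dz).cast (by ring) (by ring)
      have hβq : ∀ z ∈ (A.chart q).target,
          A.fn (A.ext q χ) q z * dz (A.fn (A.ext q κ) q) z = χ z := by
        intro z hz
        rw [fn_ext_self hz]
        by_cases hzb : z ∈ Metric.ball c r
        · have h4 : dz (A.fn (A.ext q κ) q) z = dz (fun w => w) z := by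
            refine dz_congr Metric.isOpen_ball (fun w hw => ?_) hzb
            have hw2 := hrs (Metric.ball_subset_closedBall hw)
            have hw3 : b w = 1 := hw2.1
            rw [fn_ext_self hw2.2]
            simp only [κ, hw3, Complex.ofReal_one, one_mul]
          rw [h4, dz_eq_deriv differentiableAt_fun_id]
          simp
        · rw [image_eq_zero_of_notMem_tsupport fun h => hzb (h3 h), zero_mul]
      have h5 := h0 _ hβ
      have hform := hR.isForm_div hβ.dzb
      have h6 : ∫ p, G p * A.val (fun x z => dzb (fun z => A.fn (A.ext q χ) x z *
          dz (A.fn (A.ext q κ) x) z) z / R x z) p ∂μ =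
          ∫ z in (A.chart q).target, G ((A.chart q).symm z) * dzb χ z := by
        rw [← setIntegral_eq_integral_of_forall_compl_eq_zero (s := (A.chart q).source)]
        · have hm : AEStronglyMeasurable (fun p => G p * A.val (fun x z => dzb (fun z => A.fn (A.ext q χ) x z *
            dz (A.fn (A.ext q κ) x) z) z / R x z) p) μ :=
            hGi.aestronglyMeasurable.mul
              (continuous_val (hform.cast (by ring) (by ring))).aestronglyMeasurable
          rw [hμ.setIntegral_eq hR q hm]
          refine setIntegral_congr_fun (A.chart q).open_target.measurableSet fun z hz => ?_
          have h7 := (hform.cast (show (1 - 1 : ℤ) = 0 by ring)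
            (show (1 - 1 : ℤ) = 0 by ring)).fn_val hz
          rw [← h7, mul_assoc, div_mul_cancel₀ _ (hR.ne_zero hz)]
          congr 1
          exact dzb_congr (A.chart q).open_target hβq hz
        · intro p hp
          have h8 : A.val (fun y z => dz (fun w => A.fn (A.ext q fun z => conj (χ z)) y w *
              conj (dz (A.fn (A.ext q κ) y) w)) z) p = 0 := by
            refine val_dz_ext_mul_eq_zero (h2.comp_left (g := conj) (map_zero _)) ?_ hp
            exact (closure_mono (Function.support_comp_subset (g := conj) (map_zero _) χ)).trans hχt
          have h9 : (fun w => A.fn (A.ext q fun z => conj (χ z)) p w *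
              conj (dz (A.fn (A.ext q κ) p) w)) = fun w => conj (A.fn (A.ext q χ) p w *
              dz (A.fn (A.ext q κ) p) w) := by
            funext w
            simp only [fn, ext, map_mul]
            split_ifs <;> simp
          rw [val, h9, dz_conj (hβ.differentiableAt (center_mem p)), map_eq_zero] at h8
          simp only [val]
          rw [h8]; simp
      rw [h6] at h5
      rw [← h5, ← integral_indicator (A.chart q).open_target.measurableSet]
      congr 1
      funext z
      by_cases hz : z ∈ tsupport χ
      · rw [Set.indicator_of_mem (hχt hz), hH, Set.indicator_of_mem (Metric.ball_subset_closedBall (h3 hz))]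
      · have h10 : dzb χ z = 0 := by
          have h11 : χ =ᶠ[𝓝 z] fun _ => 0 := by
            filter_upwards [(isClosed_tsupport χ).isOpen_compl.mem_nhds hz] with w hw
            exact image_eq_zero_of_notMem_tsupport hw
          rw [Filter.EventuallyEq.dzb_eq h11, dzb_const]
        change _ * dzb χ z = _
        rw [h10, mul_zero]
        by_cases hz2 : z ∈ (A.chart q).target
        · rw [Set.indicator_of_mem hz2, h10, mul_zero]
        · rw [Set.indicator_of_notMem hz2]
    obtain ⟨g, hg1, hg2⟩ := hHw.exists_hol hHi hr
    have hsub : Metric.ball c (r / 2) ⊆ Metric.closedBall c r :=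
      (Metric.ball_subset_ball (by linarith)).trans Metric.ball_subset_closedBall
    refine ⟨r / 2, by positivity, g, fun z hz => (hrs (hsub hz)).2, hg1, ?_⟩
    filter_upwards [hg2] with z hz hzb
    rw [← hz hzb, hH, Set.indicator_of_mem (hsub hzb)]
  choose r hr g hsub hg hGg using hloc
  set N : X → Set X := fun q => (A.chart q).source ∩ A.chart q ⁻¹' Metric.ball (A.center q) (r q) with hN
  have hNo : ∀ q, IsOpen (N q) := fun q => (A.chart q).isOpen_inter_preimage Metric.isOpen_ball
  have hNq : ∀ q, q ∈ N q := fun q => ⟨A.mem_source q, Metric.mem_ball_self (hr q)⟩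
  have hNs : ∀ q, N q ⊆ (A.chart q).source := fun q => Set.inter_subset_left
  have hNi : ∀ q, A.chart q '' N q ⊆ Metric.ball (A.center q) (r q) := by
    rintro q _ ⟨p, hp, rfl⟩; exact hp.2
  have hae : ∀ q, ∀ᵐ p ∂μ, p ∈ N q → G p = g q (A.chart q p) := fun q =>
    hμ.ae_of_chart (hNo q) (hNs q) hG ((hg q).continuousOn.mono (hNi q))
      ((hGg q).mono fun z hz h => hz (hNi q h))
  have hpos := hμ.isOpenPosMeasure hR
  have hcont : ∀ q, ContinuousOn (fun p => g q (A.chart q p)) (N q) := fun q =>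
    (hg q).continuousOn.comp ((A.chart q).continuousOn.mono (hNs q)) fun p hp => hp.2
  have hagree : ∀ q q', ∀ p ∈ N q ∩ N q', g q (A.chart q p) = g q' (A.chart q' p) := by
    intro q q'
    refine Measure.eqOn_open_of_ae_eq (μ := μ) ?_ ((hNo q).inter (hNo q'))
      ((hcont q).mono Set.inter_subset_left) ((hcont q').mono Set.inter_subset_right)
    rw [Filter.EventuallyEq, ae_restrict_iff' ((hNo q).inter (hNo q')).measurableSet]
    filter_upwards [hae q, hae q'] with p h1 h2 hp
    rw [← h1 hp.1, ← h2 hp.2]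
  set f : X → ℂ := fun p => g p (A.center p) with hf
  have hfN : ∀ q, ∀ p ∈ N q, f p = g q (A.chart q p) := fun q p hp =>
    hagree p q p ⟨hNq p, hp⟩
  have hhol : A.IsHol (A.fn f) := by
    intro x z hz
    set p := (A.chart x).symm z with hp
    have hov : z ∈ A.overlap x p := ⟨hz, A.mem_source p⟩
    have hO : IsOpen ((A.chart x).target ∩ (A.chart x).symm ⁻¹' N p) :=
      (A.chart x).isOpen_inter_preimage_symm (hNo p)
    have h1 : A.fn f x =ᶠ[𝓝 z] fun w => g p (A.tr x p w) := by
      filter_upwards [hO.mem_nhds ⟨hz, hNq p⟩] with w hw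
      exact hfN p _ hw.2
    have h2 : DifferentiableAt ℂ (fun w => g p (A.tr x p w)) z := by
      refine DifferentiableAt.comp (g := g p) z ?_ (differentiableAt_tr hov)
      have h3 : A.tr x p z = A.center p := rfl
      rw [h3]
      exact (hg p).differentiableAt (Metric.ball_mem_nhds _ (hr p))
    exact (h2.congr_of_eventuallyEq h1).differentiableWithinAt
  obtain ⟨x₀⟩ : Nonempty X := inferInstance
  refine ⟨f x₀, ?_⟩
  obtain ⟨t, -, ht⟩ := isCompact_univ.elim_nhds_subcover N fun x _ => (hNo x).mem_nhds (hNq x)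
  have hall : ∀ᵐ p ∂μ, ∀ q ∈ t, p ∈ N q → G p = g q (A.chart q p) :=
    (ae_ball_iff t.countable_toSet).2 fun q _ => hae q
  filter_upwards [hall] with p hp
  obtain ⟨q, hq, hpq⟩ := Set.mem_iUnion₂.1 (ht (Set.mem_univ p))
  rw [hp q hq hpq, ← hfN q p hpq]
  exact eq_of_isHol hhol _ _

/-- A function of vanishing integral is approximated by derivatives of `(1,0)`-forms. -/
theorem exists_approx [CompactSpace X] [ConnectedSpace X] [T2Space X]
    (hR : A.IsDensity R) (hμ : A.IsVolume R μ) {f : X → ℂ} (hf : A.IsForm 0 0 (A.fn f))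
    (hint : ∫ p, f p ∂μ = 0) {ε : ℝ} (hε : 0 < ε) :
    ∃ β, A.IsForm 1 0 β ∧
      ∫ p, ‖A.val (fun x z => dzb (β x) z / R x z) p - f p‖ ^ 2 ∂μ < ε := by
  have hfin := hμ.isFiniteMeasure hR
  have hfc : Continuous f := by
    have := continuous_val hf
    rwa [show A.val (A.fn f) = f from funext fun p => val_fn f p] at this
  have hD : ∀ β, A.IsForm 1 0 β → Continuous (A.val (fun x z => dzb (β x) z / R x z)) :=
    fun β hβ => continuous_val ((hR.isForm_div hβ.dzb).cast (by ring) (by ring))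
  have hmem : ∀ u : X → ℂ, Continuous u → MemLp u 2 μ := fun u hu => by
    obtain ⟨C, hC⟩ := (isCompact_range hu).isBounded.exists_norm_le
    exact MemLp.of_bound hu.aestronglyMeasurable C
      (Filter.Eventually.of_forall fun x => hC _ ⟨x, rfl⟩)
  let S : Submodule ℂ (Lp ℂ 2 μ) :=
    { carrier := {s | ∃ β, A.IsForm 1 0 β ∧ s =ᵐ[μ] A.val (fun x z => dzb (β x) z / R x z)}
      add_mem' := by
        rintro s t ⟨β, hβ, hs⟩ ⟨γ, hγ, ht⟩
        refine ⟨_, hβ.add hγ, (Lp.coeFn_add s t).trans ?_⟩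
        filter_upwards [hs, ht] with p h1 h2
        simp only [Pi.add_apply, h1, h2, val]
        rw [dzb_add (hβ.differentiableAt (center_mem p)) (hγ.differentiableAt (center_mem p)), add_div]
      zero_mem' := by
        refine ⟨_, IsForm.zero, (Lp.coeFn_zero ℂ 2 μ).trans ?_⟩
        filter_upwards with p
        simp [val, dzb_const]
      smul_mem' := by
        rintro c s ⟨β, hβ, hs⟩
        refine ⟨_, hβ.const_mul c, (Lp.coeFn_smul c s).trans ?_⟩
        filter_upwards [hs] with p h1
        simp only [Pi.smul_apply, h1, val, smul_eq_mul]
        rw [dzb_const_mul c (hβ.differentiableAt (center_mem p)), mul_div_assoc] }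
  set F : Lp ℂ 2 μ := (hmem f hfc).toLp f with hF
  have hFm : F ∈ S.topologicalClosure := by
    rw [← Submodule.orthogonal_orthogonal_eq_closure, Submodule.mem_orthogonal]
    intro G hG
    rw [Submodule.mem_orthogonal] at hG
    have hGi : Integrable G μ := (Lp.memLp G).integrable (by norm_num)
    have hGm : Measurable (fun p => conj (G p)) :=
      Complex.continuous_conj.measurable.comp (Lp.stronglyMeasurable G).measurable
    obtain ⟨K, hK⟩ := ae_eq_const_of_forall_integral_eq_zero hR hμ hGm
      ((Complex.conjCLE.toContinuousLinearMap).integrable_comp hGi) fun β hβ => by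
        have h1 := hG _ (show (hmem _ (hD β hβ)).toLp _ ∈ S from
          ⟨β, hβ, MemLp.coeFn_toLp _⟩)
        rw [← inner_conj_symm, map_eq_zero, L2.inner_def] at h1
        rw [← h1]
        refine integral_congr_ae ?_
        filter_upwards [MemLp.coeFn_toLp (hmem _ (hD β hβ))] with p hp
        rw [hp, RCLike.inner_apply, mul_comm]
    rw [L2.inner_def]
    have h2 : ∫ p, ⟪G p, F p⟫_ℂ ∂μ = ∫ p, K * f p ∂μ := by
      refine integral_congr_ae ?_
      filter_upwards [MemLp.coeFn_toLp (hmem f hfc), hK] with p hp hk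
      rw [hp, RCLike.inner_apply, hk, mul_comm]
    rw [h2, integral_const_mul, hint, mul_zero]
  obtain ⟨s, ⟨β, hβ, hs⟩, hd⟩ := Metric.mem_closure_iff.1 hFm (Real.sqrt ε) (Real.sqrt_pos.2 hε)
  refine ⟨β, hβ, ?_⟩
  have h3 : ‖F - s‖ ^ 2 < ε := by
    rw [dist_eq_norm] at hd
    exact (Real.lt_sqrt (norm_nonneg _)).1 hd
  refine lt_of_eq_of_lt ?_ h3
  have h4 : ((‖F - s‖ ^ 2 : ℝ) : ℂ) = ⟪F - s, F - s⟫_ℂ := by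
    rw [inner_self_eq_norm_sq_to_K]; simp
  rw [L2.inner_def] at h4
  have h5 : ∫ p, ⟪(F - s : Lp ℂ 2 μ) p, (F - s : Lp ℂ 2 μ) p⟫_ℂ ∂μ =
      ∫ p, ((‖A.val (fun x z => dzb (β x) z / R x z) p - f p‖ ^ 2 : ℝ) : ℂ) ∂μ := by
    refine integral_congr_ae ?_
    filter_upwards [MemLp.coeFn_toLp (hmem f hfc), hs, Lp.coeFn_sub F s] with p h1 h2 h6
    rw [h6, Pi.sub_apply, h1, h2, inner_self_eq_norm_sq_to_K, norm_sub_rev]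
    simp
  rw [h5, integral_complex_ofReal] at h4
  exact_mod_cast h4.symm

end HolAtlas

end GravVortex

namespace GravVortex

open ComplexConjugate

section MaximumPrinciple

variable {U : Set ℂ} {r : ℂ → ℝ} {z : ℂ}

lemma fderiv_fderiv_nonneg_of_isLocalMin (hr : ContDiffAt ℝ 2 r z) (h : IsLocalMin r z) (v : ℂ) :
    0 ≤ fderiv ℝ (fderiv ℝ r) z v v := by
  set T : ℝ → ℂ := fun t => z + t • v with hT
  have hTd : ∀ t, HasDerivAt T v t := fun t =>
    (((hasDerivAt_id t).smul_const v).const_add z).congr_deriv (one_smul _ _)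
  have hT0 : T 0 = z := by simp [T]
  have hTt : Filter.Tendsto T (𝓝 0) (𝓝 z) := by
    have := (hTd 0).continuousAt.tendsto; rwa [hT0] at this
  have h1 : ∀ᶠ w in 𝓝 z, DifferentiableAt ℝ r w := by
    filter_upwards [hr.eventually (by simp)] with w hw
    exact hw.differentiableAt (by simp)
  have h2 : deriv (fun t => r (T t)) =ᶠ[𝓝 0] fun t => fderiv ℝ r (T t) v := by
    filter_upwards [hTt.eventually h1] with t ht
    exact (ht.hasFDerivAt.comp_hasDerivAt t (hTd t)).deriv
  have h3 : HasDerivAt (fun t => fderiv ℝ r (T t) v) (fderiv ℝ (fderiv ℝ r) z v v) 0 := by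
    have h4 : HasFDerivAt (fderiv ℝ r) (fderiv ℝ (fderiv ℝ r) z) (T 0) := by
      rw [hT0]
      exact ((hr.fderiv_right (m := 1) (by norm_num)).differentiableAt (by simp)).hasFDerivAt
    exact (h4.comp_hasDerivAt 0 (hTd 0)).clm_apply (hasDerivAt_const 0 v) |>.congr_deriv (by simp)
  have h5 : deriv (deriv fun t => r (T t)) 0 = fderiv ℝ (fderiv ℝ r) z v v := by
    rw [h2.deriv_eq, h3.deriv]
  have hmin : IsLocalMin (fun t => r (T t)) 0 := by
    filter_upwards [hTt.eventually h] with t ht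
    rwa [hT0]
  by_contra hneg
  rw [not_le, ← h5] at hneg
  have hcont : ContinuousAt (fun t => r (T t)) 0 := by
    refine ContinuousAt.comp (g := r) ?_ (hTd 0).continuousAt
    rw [hT0]; exact hr.continuousAt
  have hmax := isLocalMax_of_deriv_deriv_neg hneg hmin.deriv_eq_zero hcont
  have hconst : (fun t => r (T t)) =ᶠ[𝓝 0] fun _ => r (T 0) := by
    filter_upwards [hmin, hmax] with t h1 h2
    exact le_antisymm h2 h1
  have h6 : deriv (fun t => r (T t)) =ᶠ[𝓝 0] fun _ => 0 := by
    filter_upwards [hconst.eventuallyEq_nhds] with t ht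
    rw [ht.deriv_eq]; simp
  rw [h6.deriv_eq] at hneg
  simp at hneg

lemma re_dzb_dz_nonneg_of_isLocalMin (hU : IsOpen U) (hr : ContDiffOn ℝ ∞ r U) (hz : z ∈ U)
    (h : IsLocalMin r z) : 0 ≤ (dzb (dz fun z => (r z : ℂ)) z).re := by
  have hr2 : ContDiffAt ℝ 2 r z := (hr.contDiffAt (hU.mem_nhds hz)).of_le
    (WithTop.coe_le_coe.2 (le_top : (2 : ℕ∞) ≤ ⊤))
  have h1 := congrArg Complex.re (laplacian_eq_dzb_dz hU hr hz)
  rw [Complex.ofReal_re, InnerProductSpace.laplacian_eq_iteratedFDeriv_complexPlane] at h1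
  simp only [iteratedFDeriv_two_apply, Matrix.cons_val_zero, Matrix.cons_val_one] at h1
  have h2 := fderiv_fderiv_nonneg_of_isLocalMin hr2 h 1
  have h3 := fderiv_fderiv_nonneg_of_isLocalMin hr2 h Complex.I
  have h4 : (4 * dzb (dz fun z => (r z : ℂ)) z).re = 4 * (dzb (dz fun z => (r z : ℂ)) z).re := by
    rw [Complex.mul_re]; simp
  rw [h4] at h1
  linarith

/-- Hopf's barrier. -/
noncomputable def barrier (k s : ℝ) (c z : ℂ) : ℝ :=
  Real.exp (-(k * Complex.normSq (z - c))) - Real.exp (-(k * s ^ 2))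

lemma contDiff_barrier (k s : ℝ) (c : ℂ) : ContDiff ℝ ∞ (barrier k s c) := by
  have h1 : ContDiff ℝ ∞ (fun w : ℂ => Complex.normSq (w - c)) := by
    have hre : ContDiff ℝ ∞ (fun w : ℂ => (w - c).re) :=
      Complex.reCLM.contDiff.comp (contDiff_id.sub contDiff_const)
    have him : ContDiff ℝ ∞ (fun w : ℂ => (w - c).im) :=
      Complex.imCLM.contDiff.comp (contDiff_id.sub contDiff_const)
    have h := (hre.mul hre).add (him.mul him)
    rwa [show (fun w : ℂ => Complex.normSq (w - c)) = fun w : ℂ =>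
      (w - c).re * (w - c).re + (w - c).im * (w - c).im from
      funext fun w => Complex.normSq_apply _]
  exact ((contDiff_const.mul h1).neg.exp).sub contDiff_const

lemma dzb_dz_barrier (k s : ℝ) (c z : ℂ) :
    dzb (dz fun z => (barrier k s c z : ℂ)) z =
      (((k ^ 2 * Complex.normSq (z - c) - k) * Real.exp (-(k * Complex.normSq (z - c))) : ℝ) : ℂ) := by
  have hQ : ∀ t, HasDerivAt (fun t => Real.exp (-(k * t))) (-k * Real.exp (-(k * t))) t := fun t => by
    have := (((hasDerivAt_id t).const_mul k).neg).exp
    simpa [mul_comm] using this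
  have hT : ∀ w, DifferentiableAt ℂ (fun w => w - c) w := fun w => differentiableAt_fun_id.sub_const c
  have hdz : ∀ w, dz (fun w => w - c) w = 1 := fun w => by
    rw [dz_eq_deriv (hT w)]; simp
  have h1 : ∀ w, HasW (fun w => ((Real.exp (-(k * Complex.normSq (w - c))) : ℝ) : ℂ)) w
      (-k * Real.exp (-(k * Complex.normSq (w - c))) * conj (w - c))
      (-k * Real.exp (-(k * Complex.normSq (w - c))) * (w - c)) := fun w => by
    have h := hasW_comp_normSq (hQ (Complex.normSq (w - c)))
    refine ⟨h.diff.comp w ((hT w).restrictScalars ℝ), ?_, ?_⟩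
    · rw [dz_comp (f := fun w => ((Real.exp (-(k * Complex.normSq w)) : ℝ) : ℂ)) (hT w) h.diff, h.dz_eq]
      simp
    · rw [dzb_comp (f := fun w => ((Real.exp (-(k * Complex.normSq w)) : ℝ) : ℂ)) (hT w) h.diff, h.dzb_eq]
      simp
  have h2 : (dz fun z => (barrier k s c z : ℂ)) =
      fun w => -(k : ℂ) * ((Real.exp (-(k * Complex.normSq (w - c))) : ℝ) : ℂ) * conj (w - c) := by
    funext w
    have h3 := ((h1 w).sub (HasW.const ((Real.exp (-(k * s ^ 2)) : ℝ) : ℂ))).dz_eq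
    rw [sub_zero] at h3
    rw [← h3]
    congr 1
    funext w
    simp [barrier]
  have hc : HasW (fun w => conj (w - c)) z 0 1 := by
    have := (HasW.of_hol (hT z)).cconj
    rw [hdz] at this
    simpa using this
  rw [h2, (((HasW.const (-(k : ℂ))).mul (h1 z)).mul hc).dzb_eq]
  have h4 := Complex.mul_conj (z - c)
  push_cast
  linear_combination ((k : ℂ) ^ 2 * Complex.exp (-(k * (Complex.normSq (z - c) : ℂ)))) * h4

/-- The strong maximum principle: a nonnegative supersolution which vanishes at a point vanishes
nearby. -/
theorem eventually_eq_zero_of_supersolution {V : ℂ → ℝ} {C : ℝ} (hC : 0 ≤ C) (hU : IsOpen U)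
    (hV : ContDiffOn ℝ ∞ V U) (hpos : ∀ z ∈ U, 0 ≤ V z)
    (hsup : ∀ z ∈ U, (dzb (dz fun z => (V z : ℂ)) z).re ≤ C * V z) {z₀ : ℂ} (hz₀ : z₀ ∈ U)
    (h0 : V z₀ = 0) : ∀ᶠ z in 𝓝 z₀, V z = 0 := by
  obtain ⟨r, hr, hrU⟩ := Metric.nhds_basis_closedBall.mem_iff.1 (hU.mem_nhds hz₀)
  filter_upwards [Metric.ball_mem_nhds z₀ (half_pos hr)] with z₁ hz₁
  by_contra hne
  have hz₁r : dist z₁ z₀ < r / 2 := hz₁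
  have hVc : ContinuousOn V (Metric.closedBall z₀ r) := hV.continuousOn.mono hrU
  -- the zero nearest to `z₁`
  have hZc : IsCompact (Metric.closedBall z₀ r ∩ V ⁻¹' {0}) :=
    (isCompact_closedBall z₀ r).of_isClosed_subset
      (hVc.preimage_isClosed_of_isClosed Metric.isClosed_closedBall isClosed_singleton)
      Set.inter_subset_left
  obtain ⟨z₂, hz₂, hmin⟩ := hZc.exists_isMinOn ⟨z₀, Metric.mem_closedBall_self hr.le, h0⟩
    (f := fun z => dist z z₁) (by fun_prop)
  set s := dist z₂ z₁ with hs
  have hs1 : s ≤ dist z₀ z₁ := hmin ⟨Metric.mem_closedBall_self hr.le, h0⟩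
  rw [dist_comm z₀] at hs1
  have hs0 : 0 < s := dist_pos.2 fun h => hne (h ▸ hz₂.2)
  have hball : Metric.closedBall z₁ s ⊆ Metric.ball z₀ r := fun z hz => by
    rw [Metric.mem_closedBall] at hz
    rw [Metric.mem_ball]
    linarith [dist_triangle z z₁ z₀]
  have hVpos : ∀ z, dist z z₁ < s → V z ≠ 0 := fun z hz h => by
    have h1 := hmin (show z ∈ Metric.closedBall z₀ r ∩ V ⁻¹' {0} from
      ⟨Metric.ball_subset_closedBall (hball hz.le), h⟩)
    exact absurd hz (not_lt.2 h1)
  have hUb : Metric.closedBall z₁ s ⊆ U := fun z hz => hrU (Metric.ball_subset_closedBall (hball hz))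
  -- the barrier
  obtain ⟨k, hk0, hk⟩ : ∃ k : ℝ, 0 < k ∧ C < k ^ 2 * (s / 2) ^ 2 - k := by
    refine ⟨(C + 1) * (1 + 4 / s ^ 2), by positivity, ?_⟩
    have h1 : ((C + 1) * (1 + 4 / s ^ 2)) ^ 2 * (s / 2) ^ 2 - (C + 1) * (1 + 4 / s ^ 2) =
        (C + 1) * (1 + 4 / s ^ 2) * ((C + 1) * (s ^ 2 / 4) + C) := by
      field_simp; ring
    rw [h1]
    have h2 : (C + 1) * (1 + 4 / s ^ 2) * ((C + 1) * (s ^ 2 / 4) + C) =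
        (C + 1) * ((C + 1) * (s ^ 2 / 4) + C + (C + 1) + C * (4 / s ^ 2)) := by
      field_simp; ring
    rw [h2]
    have h3 : 0 ≤ C * (4 / s ^ 2) := by positivity
    have h4 : 0 ≤ (C + 1) * (s ^ 2 / 4) := by positivity
    nlinarith
  obtain ⟨m, hm0, hm⟩ : ∃ m > 0, ∀ z ∈ Metric.closedBall z₁ (s / 2), m ≤ V z := by
    have hsub : Metric.closedBall z₁ (s / 2) ⊆ Metric.closedBall z₁ s :=
      Metric.closedBall_subset_closedBall (by linarith)
    obtain ⟨p, hp, hpm⟩ := (isCompact_closedBall z₁ (s / 2)).exists_isMinOn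
      ⟨z₁, Metric.mem_closedBall_self (by positivity)⟩ (hV.continuousOn.mono (hsub.trans hUb))
    refine ⟨V p, lt_of_le_of_ne (hpos p (hUb (hsub hp))) (Ne.symm (hVpos p ?_)), fun z hz => hpm hz⟩
    rw [Metric.mem_closedBall] at hp; linarith
  set h := barrier k s z₁ with hh
  have hhle : ∀ z, h z ≤ Real.exp (-(k * Complex.normSq (z - z₁))) := fun z =>
    sub_le_self _ (Real.exp_pos _).le
  have hh1 : ∀ z, h z ≤ 1 := fun z => (hhle z).trans (Real.exp_le_one_iff.2 (by
    have := Complex.normSq_nonneg (z - z₁)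
    have : 0 ≤ k * Complex.normSq (z - z₁) := by positivity
    linarith))
  have hhs : ∀ z, dist z z₁ = s → h z = 0 := fun z hz => by
    simp only [h, barrier, normSq_sub_eq, hz, sub_self]
  set W : ℂ → ℝ := fun z => V z - m * h z with hW
  have hWs : ContDiffOn ℝ ∞ W U := hV.sub (contDiffOn_const.mul (contDiff_barrier k s z₁).contDiffOn)
  have hWnn : ∀ z ∈ Metric.closedBall z₁ s, 0 ≤ W z := by
    obtain ⟨p, hp, hpm⟩ := (isCompact_closedBall z₁ s).exists_isMinOn
      ⟨z₁, Metric.mem_closedBall_self hs0.le⟩ (hWs.continuousOn.mono hUb)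
    suffices hWp : 0 ≤ W p from fun z hz => hWp.trans (hpm hz)
    by_contra hneg
    rw [not_le] at hneg
    have hpU := hUb hp
    have hp1 : ¬ dist p z₁ ≤ s / 2 := fun hle => by
      have h1 := hm p hle
      have h2 := mul_le_of_le_one_right hm0.le (hh1 p)
      simp only [W] at hneg
      linarith
    have hp2 : dist p z₁ < s := by
      refine lt_of_le_of_ne hp fun heq => ?_
      have h1 := hpos p hpU
      simp only [W, hhs p heq, mul_zero, sub_zero] at hneg
      linarith
    have hloc : IsLocalMin W p := by
      filter_upwards [Metric.isOpen_ball.mem_nhds (show p ∈ Metric.ball z₁ s from hp2)] with z hz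
      exact hpm (Metric.ball_subset_closedBall hz)
    have h1 := re_dzb_dz_nonneg_of_isLocalMin hU hWs hpU hloc
    have hVC : ContDiffOn ℝ ∞ (fun z => (V z : ℂ)) U := Complex.ofRealCLM.contDiff.comp_contDiffOn hV
    have hbC : ContDiffOn ℝ ∞ (fun z => (h z : ℂ)) U :=
      Complex.ofRealCLM.contDiff.comp_contDiffOn (contDiff_barrier k s z₁).contDiffOn
    have h2 : dzb (dz fun z => (W z : ℂ)) p =
        dzb (dz fun z => (V z : ℂ)) p - m * dzb (dz fun z => (h z : ℂ)) p := by
      have h3 : ∀ z ∈ U, dz (fun z => (W z : ℂ)) z =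
          dz (fun z => (V z : ℂ)) z - m * dz (fun z => (h z : ℂ)) z := fun z hz => by
        have h4 := ((HasW.of_smooth hU hVC hz).sub ((HasW.const (m : ℂ)).mul
          (HasW.of_smooth hU hbC hz))).dz_eq
        simp only [zero_mul, zero_add] at h4
        rw [← h4]
        congr 1; funext z; simp [W]
      have h5 := (((HasW.dz_of_smooth hU hVC hpU).sub ((HasW.const (m : ℂ)).mul
          (HasW.dz_of_smooth hU hbC hpU))).congr hU h3 hpU).dzb_eq
      rw [h5]; ring
    rw [h2, hh, dzb_dz_barrier, Complex.sub_re, Complex.re_ofReal_mul, Complex.ofReal_re] at h1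
    have h3 := hsup p hpU
    have h4 : (s / 2) ^ 2 ≤ Complex.normSq (p - z₁) := by
      rw [normSq_sub_eq]
      exact pow_le_pow_left₀ (by positivity) (not_le.1 hp1).le 2
    have h5 : C < k ^ 2 * Complex.normSq (p - z₁) - k := by
      have : k ^ 2 * (s / 2) ^ 2 ≤ k ^ 2 * Complex.normSq (p - z₁) := by gcongr
      linarith
    have h6 : C * h p ≤ (k ^ 2 * Complex.normSq (p - z₁) - k) *
        Real.exp (-(k * Complex.normSq (p - z₁))) :=
      (mul_le_mul_of_nonneg_left (hhle p) hC).trans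
        (mul_le_mul_of_nonneg_right h5.le (Real.exp_pos _).le)
    have h7 := mul_le_mul_of_nonneg_left h6 hm0.le
    rcases hC.eq_or_lt with rfl | hC'
    · have h8 : 0 < m * ((k ^ 2 * Complex.normSq (p - z₁) - k) *
          Real.exp (-(k * Complex.normSq (p - z₁)))) :=
        mul_pos hm0 (mul_pos h5 (Real.exp_pos _))
      linarith
    · have h8 : C * W p < 0 := mul_neg_of_pos_of_neg hC' hneg
      have h9 : C * W p = C * V p - m * (C * h p) := by simp only [W]; ring
      linarith
  -- the derivative at the boundary point
  have hz₂U : z₂ ∈ U := hrU hz₂.1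
  have hVd : HasFDerivAt V (fderiv ℝ V z₂) z₂ :=
    (ContDiffOn.differentiableOn hV (by simp) |>.differentiableAt (hU.mem_nhds hz₂U)).hasFDerivAt
  have hVmin : IsLocalMin V z₂ := by
    filter_upwards [hU.mem_nhds hz₂U] with z hz
    rw [show V z₂ = 0 from hz₂.2]; exact hpos z hz
  rw [hVmin.fderiv_eq_zero] at hVd
  set T : ℝ → ℂ := fun t => z₂ + t • (z₁ - z₂) with hT
  have hTd : HasDerivAt T (z₁ - z₂) 0 :=
    (((hasDerivAt_id (0 : ℝ)).smul_const (z₁ - z₂)).const_add z₂).congr_deriv (one_smul _ _)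
  have hT0 : T 0 = z₂ := by simp [T]
  have hV1 : HasDerivAt (fun t => V (T t)) 0 0 := by
    have := HasFDerivAt.comp_hasDerivAt (0 : ℝ) (by rw [hT0]; exact hVd) hTd
    exact this
  have hdT : ∀ t, Complex.normSq (T t - z₁) = (1 - t) ^ 2 * s ^ 2 := fun t => by
    have : T t - z₁ = ((1 - t : ℝ) : ℂ) * (z₂ - z₁) := by simp [T]; ring
    rw [this, map_mul, normSq_sub_eq, Complex.normSq_ofReal]; ring
  have hh2 : HasDerivAt (fun t => m * h (T t)) (m * (2 * k * s ^ 2 * Real.exp (-(k * s ^ 2)))) 0 := by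
    have h1 : HasDerivAt (fun t : ℝ => -(k * ((1 - t) ^ 2 * s ^ 2))) (2 * k * s ^ 2) 0 := by
      have := ((((hasDerivAt_id (0 : ℝ)).const_sub 1).pow 2).mul_const (s ^ 2)).const_mul k |>.neg
      refine this.congr_deriv ?_
      simp; ring
    have h2 := ((h1.exp).sub_const (Real.exp (-(k * s ^ 2)))).const_mul m
    refine (h2.congr_of_eventuallyEq (Filter.Eventually.of_forall fun t => ?_)).congr_deriv ?_
    · simp only [h, barrier, hdT]
    · simp only [sub_zero, one_pow, one_mul]; ring
  have hle : ∀ᶠ t in 𝓝[>] (0 : ℝ), m * h (T t) ≤ V (T t) := by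
    have h1 : ∀ᶠ t in 𝓝[>] (0 : ℝ), t < 1 := nhdsWithin_le_nhds (gt_mem_nhds one_pos)
    filter_upwards [self_mem_nhdsWithin, h1] with t ht ht1
    have ht0 : (0 : ℝ) < t := ht
    have h2 := hWnn (T t) (by
      rw [Metric.mem_closedBall]
      refine abs_le_of_sq_le_sq' ?_ hs0.le |>.2
      rw [← normSq_sub_eq, hdT]
      have : (1 - t) ^ 2 ≤ 1 := by nlinarith
      nlinarith [sq_nonneg s])
    simp only [W] at h2
    linarith
  have hdiff : HasDerivAt (fun t => V (T t) - m * h (T t))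
      (0 - m * (2 * k * s ^ 2 * Real.exp (-(k * s ^ 2)))) 0 := hV1.sub hh2
  have h0' : V (T 0) - m * h (T 0) = 0 := by
    rw [hT0, hhs z₂ rfl, show V z₂ = 0 from hz₂.2]; ring
  have hsl := (hasDerivAt_iff_tendsto_slope.1 hdiff).mono_left
    (nhdsWithin_mono (0 : ℝ) (fun t (ht : t ∈ Set.Ioi (0 : ℝ)) => ne_of_gt ht))
  have hge := ge_of_tendsto hsl (b := 0) (by
    filter_upwards [self_mem_nhdsWithin, hle] with t ht ht2
    have ht0 : (0 : ℝ) < t := ht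
    rw [slope_def_field, h0']
    exact div_nonneg (by linarith) (by linarith))
  have : 0 < m * (2 * k * s ^ 2 * Real.exp (-(k * s ^ 2))) := by positivity
  linarith

end MaximumPrinciple

end GravVortex

namespace GravVortex

open ComplexConjugate MeasureTheory

namespace HolAtlas

variable {X : Type*} [TopologicalSpace X] {A : HolAtlas X}

variable (A) in
/-- A solution of the gravitating vortex equations, in coordinates. -/
structure IsVortex (τ α c : ℝ) (R : X → ℂ → ℝ) (Λ φ ψ : X → ℂ → ℂ) (u : X → ℂ) : Prop where
  density : A.IsDensity R
  loc : ∀ x, LocalVortex τ α c (A.chart x).target (fun z => (R x z : ℂ)) (Λ x) (φ x) (ψ x)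
    (A.fn u x)
  exists_zero : ∃ p, u p = 0

variable (A) in
/-- An infinitesimal automorphism, in coordinates. -/
structure IsField (Λ φ ψ a b : X → ℂ → ℂ) (θ d : X → ℂ) : Prop where
  form : A.IsForm (-1) 0 a
  loc : ∀ x, LocalField (A.chart x).target (Λ x) (φ x) (ψ x) (a x) (b x) (A.fn θ x) (A.fn d x)

variable {τ α c : ℝ} {R : X → ℂ → ℝ} {Λ φ ψ a b : X → ℂ → ℂ} {u θ d : X → ℂ} {x : X} {z : ℂ}

namespace IsVortex

lemma form_u (H : A.IsVortex τ α c R Λ φ ψ u) : A.IsForm 0 0 (A.fn u) :=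
  isForm_fn fun x => (H.loc x).smooth_u

lemma ofReal_re_u (H : A.IsVortex τ α c R Λ φ ψ u) (p : X) : ((u p).re : ℂ) = u p := by
  have h := (H.loc p).conj_u (center_mem p)
  rw [fn, symm_center] at h
  exact Complex.conj_eq_iff_re.1 h

lemma continuous_u (H : A.IsVortex τ α c R Λ φ ψ u) : Continuous u := by
  have := continuous_val H.form_u
  rwa [show A.val (A.fn u) = u from funext fun p => val_fn u p] at this

lemma re_dzb_dz_le (H : A.IsVortex τ α c R Λ φ ψ u) (hz : z ∈ (A.chart x).target) :
    (dzb (dz fun z => ((τ - (A.fn u x z).re : ℝ) : ℂ)) z).re ≤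
      1 / 4 * R x z * (A.fn u x z).re * (τ - (A.fn u x z).re) := by
  have hloc := H.loc x
  have h1 : ∀ z ∈ (A.chart x).target,
      dz (fun z => ((τ - (A.fn u x z).re : ℝ) : ℂ)) z = (-1) * dz (A.fn u x) z := fun z hz => by
    have h2 : ∀ w, ((τ - (A.fn u x w).re : ℝ) : ℂ) = τ - A.fn u x w := fun w => by
      rw [Complex.ofReal_sub]; congr 1; exact H.ofReal_re_u _
    simp only [h2]
    have := (hloc.hasW_w hz).dz_eq
    rw [this, (hloc.hasW_u hz).dz_eq]; ring
  have h3 := dzb_congr (A.chart x).open_target h1 hz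
  rw [dzb_const_mul _ (ContDiffOn.differentiableAt_of_isOpen (A.chart x).open_target
    (contDiffOn_dz (A.chart x).open_target hloc.smooth_u) hz), hloc.dzb_dz_u hz] at h3
  have h4 := Complex.conj_eq_iff_re.1 (hloc.conj_psi z hz)
  have h5 : A.fn u x z = ((A.fn u x z).re : ℂ) := (H.ofReal_re_u _).symm
  rw [← h4, ← Complex.ofReal_exp, mul_assoc, Complex.mul_conj] at h3
  rw [h3]
  rw [h5]
  simp only [Complex.ofReal_re]
  have h6 : (-1 * (((Real.exp (ψ x z).re : ℝ) : ℂ) * (Complex.normSq (LocalVortex.nabla (φ x) (ψ x) z) : ℂ) -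
      1 / 4 * (R x z : ℂ) * ((A.fn u x z).re : ℂ) * (τ - ((A.fn u x z).re : ℂ)))) =
      ((-(Real.exp (ψ x z).re * Complex.normSq (LocalVortex.nabla (φ x) (ψ x) z)) +
        1 / 4 * R x z * (A.fn u x z).re * (τ - (A.fn u x z).re) : ℝ) : ℂ) := by
    push_cast; ring
  rw [h6, Complex.ofReal_re]
  have := mul_nonneg (Real.exp_pos (ψ x z).re).le
    (Complex.normSq_nonneg (LocalVortex.nabla (φ x) (ψ x) z))
  linarith

lemma contDiffOn_w (H : A.IsVortex τ α c R Λ φ ψ u) (x : X) :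
    ContDiffOn ℝ ∞ (fun z => τ - (A.fn u x z).re) (A.chart x).target :=
  contDiffOn_const.sub (Complex.reCLM.contDiff.comp_contDiffOn (H.loc x).smooth_u)

/-- The norm of the section is bounded by the parameter. -/
lemma u_re_le [CompactSpace X] (H : A.IsVortex τ α c R Λ φ ψ u) (hτ : 0 < τ) (p : X) :
    (u p).re ≤ τ := by
  obtain ⟨m, -, hm⟩ := isCompact_univ.exists_isMaxOn ⟨p, Set.mem_univ p⟩
    ((Complex.continuous_re.comp H.continuous_u).continuousOn (s := Set.univ))
  have hm' : ∀ q, (u q).re ≤ (u m).re := fun q => hm (Set.mem_univ q)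
  refine (hm' p).trans ?_
  by_contra hlt
  rw [not_le] at hlt
  have hloc : IsLocalMin (fun z => τ - (A.fn u m z).re) (A.center m) := by
    refine Filter.Eventually.of_forall fun z => ?_
    simp only [fn, symm_center]
    linarith [hm' ((A.chart m).symm z)]
  have h1 := re_dzb_dz_nonneg_of_isLocalMin (A.chart m).open_target (H.contDiffOn_w m)
    (center_mem m) hloc
  have h2 := H.re_dzb_dz_le (center_mem m)
  simp only [fn, symm_center] at h1 h2
  have h3 := H.density.pos m _ (center_mem m)
  have h4 : 0 < 1 / 4 * R m (A.center m) * (u m).re := by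
    have : 0 < (u m).re := hτ.trans hlt
    positivity
  nlinarith

/-- The norm of the section is strictly less than the parameter. -/
lemma u_re_lt [CompactSpace X] [ConnectedSpace X] (H : A.IsVortex τ α c R Λ φ ψ u) (hτ : 0 < τ)
    (p : X) : (u p).re < τ := by
  have hre : Continuous fun p => (u p).re := Complex.continuous_re.comp H.continuous_u
  refine lt_of_le_of_ne (H.u_re_le hτ p) fun heq => ?_
  have hcl : IsClopen {p | (u p).re = τ} := by
    refine ⟨isClosed_eq hre continuous_const, isOpen_iff_mem_nhds.2 fun q hq => ?_⟩
    obtain ⟨r, hr, hsub⟩ := Metric.nhds_basis_closedBall.mem_iff.1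
      ((A.chart q).open_target.mem_nhds (center_mem q))
    have hcont : ContinuousOn (fun z => 1 / 4 * R q z * (A.fn u q z).re)
        (Metric.closedBall (A.center q) r) :=
      (((continuousOn_const.mul (H.density.continuousOn q)).mul
        (Complex.continuous_re.comp_continuousOn (H.loc q).smooth_u.continuousOn))).mono hsub
    obtain ⟨C, hC⟩ := (isCompact_closedBall (A.center q) r).bddAbove_image hcont
    have hsub' := Metric.ball_subset_closedBall.trans hsub
    have h1 := eventually_eq_zero_of_supersolution (V := fun z => τ - (A.fn u q z).re)
      (C := max C 0) (le_max_right _ _) Metric.isOpen_ball ((H.contDiffOn_w q).mono hsub')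
      (fun z _ => sub_nonneg.2 (H.u_re_le hτ _)) (fun z hz => ?_) (Metric.mem_ball_self hr) ?_
    · have hc : Filter.Tendsto (A.chart q) (𝓝 q) (𝓝 (A.center q)) :=
        (A.chart q).continuousAt (A.mem_source q)
      filter_upwards [hc.eventually h1, (A.chart q).open_source.mem_nhds (A.mem_source q)]
        with y hy hys
      rw [fn, (A.chart q).left_inv hys] at hy
      exact (sub_eq_zero.1 hy).symm
    · refine (H.re_dzb_dz_le (hsub' hz)).trans ?_
      exact mul_le_mul_of_nonneg_right ((hC ⟨z, Metric.ball_subset_closedBall hz, rfl⟩).trans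
        (le_max_left _ _)) (sub_nonneg.2 (H.u_re_le hτ _))
    · simp only [fn, symm_center]
      exact sub_eq_zero.2 (Eq.symm hq)
  obtain ⟨p₀, hp₀⟩ := H.exists_zero
  have h2 := Set.eq_univ_iff_forall.1 (hcl.eq_univ ⟨p, heq⟩) p₀
  rw [Set.mem_ofPred_eq, hp₀, Complex.zero_re] at h2
  exact hτ.ne h2

lemma w_ne_zero [CompactSpace X] [ConnectedSpace X] (H : A.IsVortex τ α c R Λ φ ψ u) (hτ : 0 < τ)
    (p : X) : (τ : ℂ) - u p ≠ 0 := by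
  rw [← H.ofReal_re_u p, ← Complex.ofReal_sub, Complex.ofReal_ne_zero]
  exact (sub_pos.2 (H.u_re_lt hτ p)).ne'

lemma dz_rho_mul (H : A.IsVortex τ α c R Λ φ ψ u) {f : ℂ → ℂ} (hz : z ∈ (A.chart x).target)
    (hf : DifferentiableAt ℝ f z) :
    dz (fun z => R x z * f z) z = R x z * (dz f z + f z * dz (Λ x) z) := by
  have h := (((H.loc x).hasW_rho hz).mul (HasW.of_diff hf)).dz_eq
  rw [h]; ring

lemma dzb_lam (H : A.IsVortex τ α c R Λ φ ψ u) (hz : z ∈ (A.chart x).target) :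
    dzb (Λ x) z = conj (dz (Λ x) z) :=
  LocalVortex.dzb_real (A.chart x).open_target
    (HasW.of_smooth (A.chart x).open_target (H.loc x).smooth_lam hz).diff (H.loc x).conj_lam hz

end IsVortex

/-- The failure of `a'` to have the potential conjugate to `θ`. -/
noncomputable def defect (A : HolAtlas X) (τ : ℝ) (R : X → ℂ → ℝ) (u θ : X → ℂ)
    (a' : X → ℂ → ℂ) (x : X) (z : ℂ) : ℂ :=
  dzb (fun z => conj (A.fn θ x z)) z + 1 / 4 * (τ - A.fn u x z) * R x z * a' x z

/-- The failure of `a'` to have the divergence conjugate to `d`. -/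
noncomputable def divDefect (A : HolAtlas X) (Λ : X → ℂ → ℂ) (d : X → ℂ) (a' : X → ℂ → ℂ)
    (x : X) (z : ℂ) : ℂ :=
  dz (a' x) z + a' x z * dz (Λ x) z - conj (A.fn d x z)

namespace IsField

lemma form_theta (H : A.IsVortex τ α c R Λ φ ψ u) (F : A.IsField Λ φ ψ a b θ d) :
    A.IsForm 0 0 (A.fn θ) := isForm_fn fun x => (H.loc x).smooth_theta (F.loc x)

lemma form_d (H : A.IsVortex τ α c R Λ φ ψ u) (F : A.IsField Λ φ ψ a b θ d) :
    A.IsForm 0 0 (A.fn d) := isForm_fn fun x => (H.loc x).smooth_d (F.loc x)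

lemma form_w (H : A.IsVortex τ α c R Λ φ ψ u) :
    A.IsForm 0 0 (fun x z => (τ : ℂ) - A.fn u x z) := (IsForm.const _).sub H.form_u

lemma form_defect (H : A.IsVortex τ α c R Λ φ ψ u) (F : A.IsField Λ φ ψ a b θ d)
    {a' : X → ℂ → ℂ} (ha' : A.IsForm (-1) 0 a') : A.IsForm 0 1 (A.defect τ R u θ a') :=
  (((F.form_theta H).cconj.dzb).add (((((IsForm.const (1 / 4 : ℂ)).mul (form_w H)).mul
    H.density.form).mul ha').cast (by ring) (by ring)))

lemma form_divDefect (H : A.IsVortex τ α c R Λ φ ψ u) (F : A.IsField Λ φ ψ a b θ d)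
    {a' : X → ℂ → ℂ} (ha' : A.IsForm (-1) 0 a') : A.IsForm 0 0 (A.divDefect Λ d a') := by
  have h1 : A.IsForm 0 1 (fun x z => (R x z : ℂ) * a' x z) :=
    (H.density.form.mul ha').cast (by ring) (by ring)
  refine ((((H.density.isForm_div h1.dz).cast (by ring) (by ring)).sub
    (F.form_d H).cconj).congr fun x z hz => ?_)
  rw [H.dz_rho_mul hz (ha'.differentiableAt hz), mul_div_cancel_left₀ _ (H.density.ne_zero hz)]
  rfl

/-- The equation linking the potential and the divergence of a candidate for the conjugate
field. -/
def Linked (A : HolAtlas X) (τ α c : ℝ) (R : X → ℂ → ℝ) (u θ d : X → ℂ) (a' : X → ℂ → ℂ) : Prop :=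
  ∀ x, ∀ z ∈ (A.chart x).target, dzb (fun z => conj (A.fn d x z)) z =
    2 * α * dzb (fun z => (τ - A.fn u x z) * conj (A.fn θ x z)) z - c / 2 * R x z * a' x z

lemma pointwise_identity (H : A.IsVortex τ α c R Λ φ ψ u) (F : A.IsField Λ φ ψ a b θ d)
    {a' : X → ℂ → ℂ} (ha' : A.IsForm (-1) 0 a') (hc : Linked A τ α c R u θ d a') {K : ℂ}
    (hz : z ∈ (A.chart x).target)
    (hK : A.divDefect Λ d a' x z *
      (A.fn d x z - 2 * α * ((τ - A.fn u x z) * A.fn θ x z) - K) = 0) :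
    ∃ n : ℝ, 0 ≤ n ∧
    dz (fun z => R x z * dzb (a' x) z * conj (a' x z) +
        8 * α * (A.defect τ R u θ a' x z * A.fn θ x z)) z -
      dzb (fun z => R x z * A.divDefect Λ d a' x z * conj (a' x z)) z +
      K * (dz (fun z => R x z * a' x z) z - dzb (fun z => R x z * conj (a x z)) z) =
    R x z * (dzb (a' x) z * conj (dzb (a' x) z)) +
      8 * α * (A.defect τ R u θ a' x z * conj (A.defect τ R u θ a' x z)) +
      2 * α * R x z * n -
      R x z * (A.divDefect Λ d a' x z * conj (A.divDefect Λ d a' x z)) := by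
  have hloc := H.loc x
  have hU := (A.chart x).open_target
  have h1 := hloc.dz_current (F.loc x) (a' := a' x) (E := A.defect τ R u θ a' x)
    (η := A.divDefect Λ d a' x) (ha'.smooth x) (fun z _ => rfl) (fun z _ => rfl) (hc x) hz
  have hψ := Complex.conj_eq_iff_re.1 (hloc.conj_psi z hz)
  refine ⟨Real.exp (ψ x z).re * Complex.normSq
    (φ x z * conj (A.fn θ x z) - a' x z * LocalVortex.nabla (φ x) (ψ x) z),
    mul_nonneg (Real.exp_pos _).le (Complex.normSq_nonneg _), ?_⟩
  rw [Complex.ofReal_mul, Complex.ofReal_exp, hψ, ← Complex.mul_conj]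
  have hηd := (F.form_divDefect H ha').differentiableAt hz
  have had := ha'.differentiableAt hz
  have hρ : HasW (fun z => (R x z : ℂ)) z _ _ := hloc.hasW_rho hz
  have h2 := ((hρ.mul (HasW.of_diff hηd)).mul (HasW.of_diff had).cconj).dzb_eq
  have h3 := (hρ.mul (HasW.of_diff had)).dz_eq
  have h4 := (hρ.mul (hloc.hasW_a (F.loc x) hz).cconj).dzb_eq
  rw [H.dzb_lam hz] at h2 h4
  have hd := (F.loc x).d_eq z hz
  have hη : A.divDefect Λ d a' x z = dz (a' x) z + a' x z * dz (Λ x) z - conj (A.fn d x z) := rfl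
  have hηc : conj (A.divDefect Λ d a' x z) =
      conj (dz (a' x) z) + conj (a' x z) * conj (dz (Λ x) z) - A.fn d x z := by
    rw [hη]; simp only [map_sub, map_add, map_mul, Complex.conj_conj]
  have hdc : conj (A.fn d x z) = conj (dz (a x) z) + conj (a x z) * conj (dz (Λ x) z) := by
    rw [hd]; simp only [map_add, map_mul]
  rw [h1, h2, h3, h4, hηc]
  linear_combination (-(R x z : ℂ)) * hK - K * R x z * hη + K * R x z * hdc

end IsField

section Norms

/-- The squared norm of a `(1,0)`- or `(0,1)`-form with respect to a density. -/
noncomputable def sqNorm (A : HolAtlas X) (R : X → ℂ → ℝ) (F : X → ℂ → ℂ) (p : X) : ℝ :=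
  ‖A.val F p‖ ^ 2 / R p (A.center p)

lemma continuous_norm_sq {k l : ℤ} {F : X → ℂ → ℂ} (hF : A.IsForm k l F) (h : k + l = 0) :
    Continuous fun p => ‖A.val F p‖ ^ 2 := by
  have h1 := continuous_val ((hF.mul hF.cconj).cast h (by omega))
  refine (Complex.continuous_re.comp h1).congr fun p => ?_
  simp only [Function.comp_apply, val, Complex.mul_conj, Complex.ofReal_re,
    Complex.normSq_eq_norm_sq]

lemma continuous_sqNorm {k l : ℤ} {F : X → ℂ → ℂ} (hR : A.IsDensity R) (hF : A.IsForm k l F)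
    (h : k + l = 1) : Continuous (A.sqNorm R F) := by
  have h1 := hR.continuous_div ((hF.mul hF.cconj).cast h (by omega))
  refine (Complex.continuous_re.comp h1).congr fun p => ?_
  simp only [Function.comp_apply, sqNorm, val, Complex.mul_conj, ← Complex.ofReal_div,
    Complex.ofReal_re, Complex.normSq_eq_norm_sq]

variable [CompactSpace X] [MeasurableSpace X] [BorelSpace X] {μ : Measure X}

lemma re_formIntegral {F : X → ℂ → ℂ} (hR : A.IsDensity R) (hμ : A.IsVolume R μ)
    (hF : A.IsForm 1 1 F) :
    (A.formIntegral R μ F).re = ∫ p, (A.val (fun x z => F x z / R x z) p).re ∂μ :=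
  (Complex.reCLM.integral_comp_comm (hR.integrable hμ hF)).symm

/-- A form which is weakly approximated by forms of small norm vanishes. -/
lemma eq_zero_of_approx [T2Space X] (hR : A.IsDensity R) (hμ : A.IsVolume R μ) {k l : ℤ}
    (hkl : k + l = 0) {P M : X → ℂ → ℂ} (hP : A.IsForm k l P) (hM : A.IsForm 1 0 M) {C : ℝ}
    (hC : 0 ≤ C) (h : ∀ ε > 0, ∃ Q E, A.IsForm k l Q ∧ A.IsForm 0 1 E ∧
      ∫ p, ‖A.val Q p‖ ^ 2 ∂μ ≤ ε ∧ ∫ p, A.sqNorm R E p ∂μ ≤ C * ε ∧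
      A.formIntegral R μ (fun x z => R x z * (P x z * conj (P x z))) =
        A.formIntegral R μ (fun x z => R x z * (Q x z * conj (P x z)) + E x z * M x z)) :
    ∀ x, ∀ z ∈ (A.chart x).target, P x z = 0 := by
  have hPc := continuous_norm_sq hP hkl
  have hPi : Integrable (fun p => ‖A.val P p‖ ^ 2) μ := hR.integrable_of_continuous hμ hPc
  set I := ∫ p, ‖A.val P p‖ ^ 2 ∂μ with hI
  set m := ∫ p, A.sqNorm R M p ∂μ with hm
  have hMi : Integrable (A.sqNorm R M) μ :=
    hR.integrable_of_continuous hμ (continuous_sqNorm hR hM (by norm_num))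
  have hRc : ∀ p, 0 < R p (A.center p) := fun p => hR.pos p _ (center_mem p)
  have hm0 : 0 ≤ m := integral_nonneg fun p => div_nonneg (by positivity) (hRc p).le
  have hI0 : 0 ≤ I := integral_nonneg fun p => by positivity
  have key : ∀ δ > 0, I ≤ δ ^ 2 + δ * (m + C) := by
    intro δ hδ
    obtain ⟨Q, E, hQ, hE, hQ1, hE1, hid⟩ := h (δ ^ 2) (by positivity)
    have hEi : Integrable (A.sqNorm R E) μ :=
      hR.integrable_of_continuous hμ (continuous_sqNorm hR hE (by norm_num))
    have hQi : Integrable (fun p => ‖A.val Q p‖ ^ 2) μ :=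
      hR.integrable_of_continuous hμ (continuous_norm_sq hQ hkl)
    have hf1 : A.IsForm 1 1 (fun x z => (R x z : ℂ) * (P x z * conj (P x z))) :=
      (hR.form.mul (hP.mul hP.cconj)).cast (by omega) (by omega)
    have hf2 : A.IsForm 1 1 (fun x z => (R x z : ℂ) * (Q x z * conj (P x z)) + E x z * M x z) :=
      ((hR.form.mul (hQ.mul hP.cconj)).cast (by omega) (by omega)).add
        ((hE.mul hM).cast (by ring) (by ring))
    have h1 := congrArg Complex.re hid
    rw [re_formIntegral hR hμ hf1, re_formIntegral hR hμ hf2] at h1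
    have h2 : ∫ p, (A.val (fun x z => R x z * (P x z * conj (P x z)) / R x z) p).re ∂μ = I := by
      rw [hI]
      congr 1
      funext p
      simp only [val]
      rw [mul_div_cancel_left₀ _ (hR.ne_zero (center_mem p)), Complex.mul_conj, Complex.ofReal_re,
        Complex.normSq_eq_norm_sq]
    rw [h2] at h1
    have h3 : ∫ p, (A.val (fun x z => (R x z * (Q x z * conj (P x z)) + E x z * M x z) / R x z) p).re ∂μ
        ≤ ∫ p, (1 / 2 * ‖A.val Q p‖ ^ 2 + 1 / 2 * ‖A.val P p‖ ^ 2 +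
          (1 / (2 * δ) * A.sqNorm R E p + δ / 2 * A.sqNorm R M p)) ∂μ := by
      refine integral_mono (Complex.reCLM.integrable_comp (hR.integrable hμ hf2))
        (((hQi.const_mul _).add (hPi.const_mul _)).add ((hEi.const_mul _).add (hMi.const_mul _)))
        fun p => ?_
      simp only [val]
      have hr := hRc p
      rw [add_div, mul_div_cancel_left₀ _ (hR.ne_zero (center_mem p)), Complex.add_re]
      refine add_le_add ?_ ?_
      · refine (Complex.re_le_norm _).trans ?_
        rw [norm_mul, RCLike.norm_conj]
        nlinarith [sq_nonneg (‖Q p (A.center p)‖ - ‖P p (A.center p)‖)]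
      · refine (Complex.re_le_norm _).trans ?_
        rw [norm_div, norm_mul, Complex.norm_real, Real.norm_of_nonneg hr.le]
        simp only [sqNorm, val]
        have h4 : 1 / (2 * δ) * (‖E p (A.center p)‖ ^ 2 / R p (A.center p)) +
            δ / 2 * (‖M p (A.center p)‖ ^ 2 / R p (A.center p)) =
            (‖E p (A.center p)‖ ^ 2 / (2 * δ) + δ / 2 * ‖M p (A.center p)‖ ^ 2) / R p (A.center p) := by
          field_simp
        rw [h4]
        gcongr
        have h5 : ‖E p (A.center p)‖ ^ 2 / (2 * δ) + δ / 2 * ‖M p (A.center p)‖ ^ 2 =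
            ((‖E p (A.center p)‖ - δ * ‖M p (A.center p)‖) ^ 2) / (2 * δ) +
              ‖E p (A.center p)‖ * ‖M p (A.center p)‖ := by
          field_simp; ring
        rw [h5]
        have : 0 ≤ ((‖E p (A.center p)‖ - δ * ‖M p (A.center p)‖) ^ 2) / (2 * δ) := by positivity
        linarith
    rw [← h1, integral_add (f := fun p => 1 / 2 * ‖A.val Q p‖ ^ 2 + 1 / 2 * ‖A.val P p‖ ^ 2)
      (g := fun p => 1 / (2 * δ) * A.sqNorm R E p + δ / 2 * A.sqNorm R M p)
      ((hQi.const_mul _).add (hPi.const_mul _)) ((hEi.const_mul _).add (hMi.const_mul _)),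
      integral_add (hQi.const_mul _) (hPi.const_mul _),
      integral_add (hEi.const_mul _) (hMi.const_mul _), integral_const_mul, integral_const_mul,
      integral_const_mul, integral_const_mul, ← hI, ← hm] at h3
    have h6 : 1 / (2 * δ) * ∫ p, A.sqNorm R E p ∂μ ≤ 1 / (2 * δ) * (C * δ ^ 2) := by gcongr
    have h7 : 1 / (2 * δ) * (C * δ ^ 2) = C * δ / 2 := by field_simp
    linarith
  have hIz : I = 0 := by
    by_contra hne
    have hIp : 0 < I := lt_of_le_of_ne hI0 (Ne.symm hne)
    set D := 1 + m + C with hD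
    have hDp : 0 < D := by linarith
    set δ := min 1 (I / (2 * D)) with hδ
    have hδp : 0 < δ := lt_min one_pos (by positivity)
    have h1 := key δ hδp
    have h2 : δ ≤ 1 := min_le_left _ _
    have h3 : δ * D ≤ I / 2 := by
      have : δ ≤ I / (2 * D) := min_le_right _ _
      calc δ * D ≤ I / (2 * D) * D := by gcongr
        _ = I / 2 := by field_simp
    have h4 : δ ^ 2 ≤ δ := by nlinarith
    have h5 : δ * D = δ + δ * (m + C) := by rw [hD]; ring
    linarith
  have hpos := hμ.isOpenPosMeasure hR
  have h0 : (fun p => ‖A.val P p‖ ^ 2) =ᵐ[μ] 0 :=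
    (integral_eq_zero_iff_of_nonneg (fun p => by positivity) hPi).1 hIz
  have h1 := (Continuous.ae_eq_iff_eq μ hPc continuous_const).1 h0
  intro x z hz
  rw [hP.eq_zero_iff hz]
  have : ‖A.val P ((A.chart x).symm z)‖ ^ 2 = 0 := congrFun h1 ((A.chart x).symm z)
  exact norm_eq_zero.1 ((pow_eq_zero_iff two_ne_zero).1 this)

end Norms

namespace IsField

variable [CompactSpace X] [T2Space X] [MeasurableSpace X] [BorelSpace X] {μ : Measure X}

/-- The basic estimate. -/
lemma integral_le (H : A.IsVortex τ α c R Λ φ ψ u) (F : A.IsField Λ φ ψ a b θ d)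
    (hμ : A.IsVolume R μ) (hα : 0 < α)
    {a' : X → ℂ → ℂ} (ha' : A.IsForm (-1) 0 a') (hc : Linked A τ α c R u θ d a') {K : ℂ}
    (hK : ∀ x, ∀ z ∈ (A.chart x).target, A.divDefect Λ d a' x z *
      (A.fn d x z - 2 * α * ((τ - A.fn u x z) * A.fn θ x z) - K) = 0) :
    ∫ p, ‖A.val (fun x z => dzb (a' x) z) p‖ ^ 2 ∂μ +
      8 * α * ∫ p, A.sqNorm R (A.defect τ R u θ a') p ∂μ ≤
      ∫ p, ‖A.val (A.divDefect Λ d a') p‖ ^ 2 ∂μ := by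
  have hR := H.density
  have hη := F.form_divDefect H ha'
  have hE := F.form_defect H ha'
  have hJ1 : A.IsForm 0 1 (fun x z => R x z * dzb (a' x) z * conj (a' x z) +
        8 * α * (A.defect τ R u θ a' x z * A.fn θ x z)) :=
    (((hR.form.mul ha'.dzb).mul ha'.cconj).cast (by ring) (by ring)).add
      (((hE.mul (F.form_theta H)).const_mul (8 * α)).cast (by ring) (by ring))
  have hJ2 : A.IsForm 1 0 (fun x z => R x z * A.divDefect Λ d a' x z * conj (a' x z)) :=
    ((hR.form.mul hη).mul ha'.cconj).cast (by ring) (by ring)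
  have hJ3 : A.IsForm 0 1 (fun x z => (R x z : ℂ) * a' x z) :=
    (hR.form.mul ha').cast (by ring) (by ring)
  have hJ4 : A.IsForm 1 0 (fun x z => (R x z : ℂ) * conj (a x z)) :=
    (hR.form.mul F.form.cconj).cast (by ring) (by ring)
  have hform := (hJ1.dz.sub hJ2.dzb).add ((hJ3.dz.sub hJ4.dzb).const_mul K)
  have h0 := hR.formIntegral_add hμ (hJ1.dz.sub hJ2.dzb) ((hJ3.dz.sub hJ4.dzb).const_mul K)
  rw [hR.formIntegral_sub hμ hJ1.dz hJ2.dzb, IsDensity.formIntegral_const_mul,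
    hR.formIntegral_sub hμ hJ3.dz hJ4.dzb, formIntegral_dz hR hμ hJ1, formIntegral_dz hR hμ hJ3,
    formIntegral_dzb hR hμ hJ2, formIntegral_dzb hR hμ hJ4] at h0
  have h1 := congrArg Complex.re h0
  rw [re_formIntegral hR hμ hform] at h1
  have i1 : Integrable (fun p => ‖A.val (fun x z => dzb (a' x) z) p‖ ^ 2) μ :=
    hR.integrable_of_continuous hμ (continuous_norm_sq ha'.dzb (by norm_num))
  have i2 : Integrable (A.sqNorm R (A.defect τ R u θ a')) μ :=
    hR.integrable_of_continuous hμ (continuous_sqNorm hR hE (by norm_num))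
  have i3 : Integrable (fun p => ‖A.val (A.divDefect Λ d a') p‖ ^ 2) μ :=
    hR.integrable_of_continuous hμ (continuous_norm_sq hη (by norm_num))
  have h2 := integral_mono ((i1.add (i2.const_mul (8 * α))).sub i3)
    (Complex.reCLM.integrable_comp (hR.integrable hμ hform)) fun p => ?_
  · have h3 := integral_sub (i1.add (i2.const_mul (8 * α))) i3
    have h4 := integral_add i1 (i2.const_mul (8 * α))
    rw [integral_const_mul] at h4
    simp only [Pi.sub_apply, Pi.add_apply] at h2 h3
    rw [h3, h4] at h2
    simp only [Complex.reCLM_apply] at h2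
    rw [h1] at h2
    simp at h2
    linarith
  · simp only [Pi.sub_apply, Pi.add_apply, Complex.reCLM_apply, val, sqNorm]
    obtain ⟨n, hn, h3⟩ := F.pointwise_identity H ha' hc (center_mem p) (hK p _ (center_mem p))
    rw [h3]
    have hr := hR.pos p _ (center_mem p)
    have hrc : (R p (A.center p) : ℂ) ≠ 0 := hR.ne_zero (center_mem p)
    simp only [Complex.mul_conj, Complex.normSq_eq_norm_sq]
    have h4 : ((R p (A.center p) : ℂ) * ((‖dzb (a' p) (A.center p)‖ ^ 2 : ℝ) : ℂ) +
        8 * α * ((‖A.defect τ R u θ a' p (A.center p)‖ ^ 2 : ℝ) : ℂ) + 2 * α * R p (A.center p) * n -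
        R p (A.center p) * ((‖A.divDefect Λ d a' p (A.center p)‖ ^ 2 : ℝ) : ℂ)) / R p (A.center p) =
        ((‖dzb (a' p) (A.center p)‖ ^ 2 +
          8 * α * (‖A.defect τ R u θ a' p (A.center p)‖ ^ 2 / R p (A.center p)) + 2 * α * n -
          ‖A.divDefect Λ d a' p (A.center p)‖ ^ 2 : ℝ) : ℂ) := by
      push_cast
      field_simp
    rw [h4, Complex.ofReal_re]
    have : 0 ≤ 2 * α * n := by positivity
    linarith

end IsField

end HolAtlas

end GravVortex

namespace GravVortex

open ComplexConjugate MeasureTheory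

namespace HolAtlas

variable {X : Type*} [TopologicalSpace X] {A : HolAtlas X}
variable {τ α c : ℝ} {R : X → ℂ → ℝ} {Λ φ ψ a b : X → ℂ → ℂ} {u θ d : X → ℂ} {x : X} {z : ℂ}

namespace IsField

lemma hasW_potential (H : A.IsVortex τ α c R Λ φ ψ u) (F : A.IsField Λ φ ψ a b θ d)
    (hz : z ∈ (A.chart x).target) :
    dzb (fun z => A.fn d x z - 2 * α * ((τ - A.fn u x z) * A.fn θ x z)) z =
      -(c / 2) * R x z * a x z := by
  have h1 := ((HasW.of_diff ((F.form_d H).differentiableAt hz)).sub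
    ((HasW.const (2 * α : ℂ)).mul (HasW.of_diff
      (((form_w H).differentiableAt hz).fun_mul ((F.form_theta H).differentiableAt hz))))).dzb_eq
  have h2 : dzb (A.fn d x) z = 2 * α * dzb (fun z => (τ - A.fn u x z) * A.fn θ x z) z -
      c / 2 * R x z * a x z := (H.loc x).dzb_d (F.loc x) hz
  refine h1.trans ?_
  rw [h2]; ring

lemma form_potential (H : A.IsVortex τ α c R Λ φ ψ u) (F : A.IsField Λ φ ψ a b θ d) :
    A.IsForm 0 0 (fun x z => A.fn d x z - 2 * α * ((τ - A.fn u x z) * A.fn θ x z)) :=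
  (F.form_d H).sub ((((form_w H).mul (F.form_theta H)).const_mul (2 * α)).cast (by ring) (by ring))

lemma conj_potential (H : A.IsVortex τ α c R Λ φ ψ u) (x : X) (z : ℂ) :
    conj (A.fn d x z - 2 * α * ((τ - A.fn u x z) * A.fn θ x z)) =
      conj (A.fn d x z) - 2 * α * ((τ - A.fn u x z) * conj (A.fn θ x z)) := by
  have h : conj (A.fn u x z) = A.fn u x z := Complex.conj_eq_iff_re.2 (H.ofReal_re_u _)
  simp only [map_sub, map_mul, h, Complex.conj_ofReal, Complex.conj_ofNat]

/-- The link between potential and divergence, in terms of the potential of the field. -/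
lemma linked_iff (H : A.IsVortex τ α c R Λ φ ψ u) (F : A.IsField Λ φ ψ a b θ d)
    {a' : X → ℂ → ℂ} (h : ∀ x, ∀ z ∈ (A.chart x).target,
      dzb (fun z => conj (A.fn d x z - 2 * α * ((τ - A.fn u x z) * A.fn θ x z))) z =
        -(c / 2) * R x z * a' x z) : Linked A τ α c R u θ d a' := by
  intro x z hz
  have h1 := h x z hz
  simp only [conj_potential H] at h1
  have h2 := ((HasW.of_diff ((F.form_d H).cconj.differentiableAt hz)).sub
    ((HasW.const (2 * α : ℂ)).mul (HasW.of_diff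
      (((form_w H).differentiableAt hz).fun_mul ((F.form_theta H).cconj.differentiableAt hz))))).dzb_eq
  have h3 := h2.symm.trans h1
  linear_combination h3

variable [CompactSpace X] [T2Space X] [ConnectedSpace X] [MeasurableSpace X] [BorelSpace X]
  {μ : Measure X}

/-- Approximate candidates for the conjugate field. -/
lemma exists_candidate (H : A.IsVortex τ α c R Λ φ ψ u) (F : A.IsField Λ φ ψ a b θ d)
    (hμ : A.IsVolume R μ) {ε : ℝ} (hε : 0 < ε) :
    ∃ (a' : X → ℂ → ℂ) (K : ℂ), A.IsForm (-1) 0 a' ∧ Linked A τ α c R u θ d a' ∧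
      (∀ x, ∀ z ∈ (A.chart x).target, A.divDefect Λ d a' x z *
        (A.fn d x z - 2 * α * ((τ - A.fn u x z) * A.fn θ x z) - K) = 0) ∧
      ∫ p, ‖A.val (A.divDefect Λ d a') p‖ ^ 2 ∂μ < ε := by
  have hR := H.density
  have hpot := F.form_potential H
  have hda : ∀ x, ∀ z ∈ (A.chart x).target, dz (fun z => R x z * a x z) z = R x z * A.fn d x z :=
    fun x z hz => by
      rw [H.dz_rho_mul hz (F.form.differentiableAt hz), (F.loc x).d_eq z hz]
  by_cases hc : c = 0
  · -- the potential is constant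
    have hconst : ∃ K, ∀ x, ∀ z ∈ (A.chart x).target,
        A.fn d x z - 2 * α * ((τ - A.fn u x z) * A.fn θ x z) = K := by
      set f : X → ℂ := fun p => d p - 2 * α * ((τ - u p) * θ p) with hf
      have hhol : A.IsHol (A.fn f) := hpot.isHol fun x z hz => by
        rw [F.hasW_potential H hz, hc]; simp
      obtain ⟨x₀⟩ : Nonempty X := inferInstance
      exact ⟨f x₀, fun x z hz => eq_of_isHol hhol _ _⟩
    obtain ⟨K, hK⟩ := hconst
    have hint : ∫ p, d p ∂μ = 0 := by
      have h1 : A.IsForm 0 1 (fun x z => (R x z : ℂ) * a x z) :=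
        (hR.form.mul F.form).cast (by ring) (by ring)
      have h2 := formIntegral_dz hR hμ h1
      rw [formIntegral] at h2
      rw [← h2]
      congr 1
      funext p
      simp only [val]
      rw [hda p _ (center_mem p), mul_div_cancel_left₀ _ (hR.ne_zero (center_mem p)), fn, symm_center]
    obtain ⟨β, hβ, hβε⟩ := exists_approx hR hμ (F.form_d H) hint hε
    have ha' : A.IsForm (-1) 0 (fun x z => conj (β x z) / R x z) :=
      (hR.isForm_div hβ.cconj).cast (by ring) (by ring)
    refine ⟨_, K, ha', F.linked_iff H fun x z hz => ?_, fun x z hz => ?_, ?_⟩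
    · have h1 : ∀ w ∈ (A.chart x).target,
          conj (A.fn d x w - 2 * α * ((τ - A.fn u x w) * A.fn θ x w)) = conj K :=
        fun w hw => by rw [hK x w hw]
      rw [dzb_congr (A.chart x).open_target h1 hz, dzb_const, hc]; simp
    · rw [hK x z hz, sub_self, mul_zero]
    · refine lt_of_eq_of_lt ?_ hβε
      congr 1
      funext p
      congr 1
      have hp := center_mem (A := A) p
      have h1 : dz (fun z => R p z * (conj (β p z) / R p z)) (A.center p) =
          conj (dzb (β p) (A.center p)) := by
        rw [← dz_conj (hβ.differentiableAt hp)]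
        exact dz_congr (A.chart p).open_target
          (fun w hw => mul_div_cancel₀ _ (hR.ne_zero hw)) hp
      rw [H.dz_rho_mul hp (ha'.differentiableAt hp)] at h1
      have h2 : A.val (A.divDefect Λ d fun x z => conj (β x z) / R x z) p =
          conj (A.val (fun x z => dzb (β x) z / R x z) p - d p) := by
        simp only [val, divDefect, map_sub, map_div₀, Complex.conj_ofReal]
        rw [← h1, mul_div_cancel_left₀ _ (hR.ne_zero hp), fn, symm_center]
      rw [h2, RCLike.norm_conj]
  · have hcc : (c : ℂ) ≠ 0 := Complex.ofReal_ne_zero.2 hc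
    have ha' : A.IsForm (-1) 0 (fun x z => (-(2 / c) * dzb (fun z => conj (A.fn d x z -
        2 * α * ((τ - A.fn u x z) * A.fn θ x z))) z) / R x z) :=
      (hR.isForm_div (hpot.cconj.dzb.const_mul (-(2 / c)))).cast (by ring) (by ring)
    have hη : ∀ x, ∀ z ∈ (A.chart x).target, A.divDefect Λ d (fun x z => (-(2 / c) *
        dzb (fun z => conj (A.fn d x z -
        2 * α * ((τ - A.fn u x z) * A.fn θ x z))) z) / R x z) x z = 0 := fun x z hz => by
      have hU := (A.chart x).open_target
      have h1 := H.dz_rho_mul hz (ha'.differentiableAt hz)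
      rw [dz_congr hU (fun w hw => mul_div_cancel₀ _ (hR.ne_zero hw)) hz] at h1
      have h2 := HasW.dzb_of_smooth hU (hpot.cconj.smooth x) hz
      rw [((HasW.const (-(2 / c) : ℂ)).mul h2).dz_eq] at h1
      have h3 : ∀ w ∈ (A.chart x).target, dz (fun z => conj (A.fn d x z -
        2 * α * ((τ - A.fn u x z) * A.fn θ x z))) w = -(c / 2) * conj (R x w * a x w) :=
          fun w hw => by
        rw [dz_conj (hpot.differentiableAt hw), F.hasW_potential H hw]
        simp only [map_mul, map_neg, map_div₀, Complex.conj_ofReal, Complex.conj_ofNat]; ring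
      have hRa : A.IsForm 0 1 (fun x z => (R x z : ℂ) * a x z) :=
        (hR.form.mul F.form).cast (by ring) (by ring)
      rw [dzb_congr hU h3 hz, dzb_const_mul _ (hRa.cconj.differentiableAt hz),
        dzb_conj (hRa.differentiableAt hz), hda x z hz, map_mul, Complex.conj_ofReal] at h1
      rw [divDefect]
      refine mul_left_cancel₀ (hR.ne_zero hz) ?_
      rw [mul_sub, ← h1]
      field_simp
      ring
    refine ⟨_, 0, ha', F.linked_iff H fun x z hz => ?_, fun x z hz => ?_, ?_⟩
    · rw [mul_assoc, mul_div_cancel₀ _ (hR.ne_zero hz)]; field_simp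
    · rw [hη x z hz, zero_mul]
    · refine lt_of_eq_of_lt ?_ hε
      have : ∀ p, ‖A.val (A.divDefect Λ d fun x z => (-(2 / c) *
        dzb (fun z => conj (A.fn d x z -
        2 * α * ((τ - A.fn u x z) * A.fn θ x z))) z) / R x z) p‖ ^ 2 = 0 := fun p => by
        rw [val, hη p _ (center_mem p)]; simp
      simp only [this, integral_zero]

/-- The conjugate field. -/
theorem exists_conj_field (H : A.IsVortex τ α c R Λ φ ψ u) (F : A.IsField Λ φ ψ a b θ d)
    (hτ : 0 < τ) (hα : 0 < α) :
    ∃ a' : X → ℂ → ℂ, A.IsForm (-1) 0 a' ∧ A.IsHol a' ∧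
      (∀ x, ∀ z ∈ (A.chart x).target, A.defect τ R u θ a' x z = 0) ∧
      (∀ x, ∀ z ∈ (A.chart x).target, A.divDefect Λ d a' x z = 0) := by
  have hR := H.density
  obtain ⟨μ, hμ⟩ := exists_isVolume hR
  have hwform := form_w H
  have hw0 : ∀ x, ∀ z ∈ (A.chart x).target, (τ : ℂ) - A.fn u x z ≠ 0 := fun x z _ =>
    H.w_ne_zero hτ _
  have hwR : A.IsForm 1 1 (fun x z => ((τ : ℂ) - A.fn u x z) * R x z) :=
    (hwform.mul hR.form).cast (by ring) (by ring)
  have hwR0 : ∀ x, ∀ z ∈ (A.chart x).target, ((τ : ℂ) - A.fn u x z) * R x z ≠ 0 :=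
    fun x z hz => mul_ne_zero (hw0 x z hz) (hR.ne_zero hz)
  set â : X → ℂ → ℂ := fun x z =>
    -4 * dzb (fun z => conj (A.fn θ x z)) z * (((τ : ℂ) - A.fn u x z) * R x z)⁻¹ with hâ
  have hâf : A.IsForm (-1) 0 â :=
    ((((F.form_theta H).cconj.dzb).const_mul (-4)).mul (hwR.inv hwR0)).cast (by ring) (by ring)
  have hE0 : ∀ x, ∀ z ∈ (A.chart x).target, A.defect τ R u θ â x z = 0 := fun x z hz => by
    have h1 := hw0 x z hz
    have h2 := hR.ne_zero hz
    simp only [defect, â]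
    field_simp
    ring
  have hdiff : ∀ a' : X → ℂ → ℂ, ∀ x, ∀ z ∈ (A.chart x).target,
      A.defect τ R u θ a' x z = 1 / 4 * (τ - A.fn u x z) * R x z * (a' x z - â x z) :=
    fun a' x z hz => by
      have h1 := hE0 x z hz
      simp only [defect] at h1 ⊢
      linear_combination h1
  have happrox : ∀ ε > 0, ∃ a' : X → ℂ → ℂ, A.IsForm (-1) 0 a' ∧
      ∫ p, ‖A.val (fun x z => dzb (a' x) z) p‖ ^ 2 ∂μ ≤ ε ∧
      ∫ p, A.sqNorm R (A.defect τ R u θ a') p ∂μ ≤ 1 / (8 * α) * ε ∧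
      ∫ p, ‖A.val (A.divDefect Λ d a') p‖ ^ 2 ∂μ ≤ ε := by
    intro ε hε
    obtain ⟨a', K, ha', hl, hK, hint⟩ := F.exists_candidate H hμ hε
    have h1 := F.integral_le H hμ hα ha' hl hK
    have h2 : 0 ≤ ∫ p, ‖A.val (fun x z => dzb (a' x) z) p‖ ^ 2 ∂μ :=
      integral_nonneg fun p => by positivity
    have h3 : 0 ≤ ∫ p, A.sqNorm R (A.defect τ R u θ a') p ∂μ :=
      integral_nonneg fun p => div_nonneg (by positivity) (hR.pos p _ (center_mem p)).le
    refine ⟨a', ha', ?_, ?_, hint.le⟩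
    · have : 0 ≤ 8 * α * ∫ p, A.sqNorm R (A.defect τ R u θ a') p ∂μ := by positivity
      linarith
    · rw [one_div, ← div_eq_inv_mul, le_div_iff₀ (by positivity)]
      linarith
  have hB : ∀ x, ∀ z ∈ (A.chart x).target, dzb (â x) z = 0 := by
    have hκ : A.IsForm 2 0 (fun x z => (R x z : ℂ) * conj (dzb (â x) z)) :=
      (hR.form.mul hâf.dzb.cconj).cast (by ring) (by ring)
    have hM : A.IsForm 1 0 (fun x z => 4 * dzb (fun z => (R x z : ℂ) * conj (dzb (â x) z)) z *
        (((τ : ℂ) - A.fn u x z) * R x z)⁻¹) :=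
      ((hκ.dzb.const_mul 4).mul (hwR.inv hwR0)).cast (by ring) (by ring)
    refine eq_zero_of_approx hR hμ (k := -1) (l := 1) (by norm_num) hâf.dzb hM
      (C := 1 / (8 * α)) (by positivity) fun ε hε => ?_
    obtain ⟨a', ha', h1, h2, -⟩ := happrox ε hε
    refine ⟨_, _, ha'.dzb, F.form_defect H ha', h1, h2, ?_⟩
    have hJ : A.IsForm 1 0 (fun x z => (â x z - a' x z) * (R x z * conj (dzb (â x) z))) :=
      ((hâf.sub ha').mul hκ).cast (by ring) (by ring)
    have h3 := formIntegral_dzb hR hμ hJ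
    have hf : A.IsForm 1 1 (fun x z => R x z * (dzb (a' x) z * conj (dzb (â x) z)) +
        A.defect τ R u θ a' x z * (4 * dzb (fun z => (R x z : ℂ) * conj (dzb (â x) z)) z *
        (((τ : ℂ) - A.fn u x z) * R x z)⁻¹)) :=
      ((hR.form.mul (ha'.dzb.mul hâf.dzb.cconj)).cast (by ring) (by ring)).add
        (((F.form_defect H ha').mul hM).cast (by ring) (by ring))
    have h4 := hR.formIntegral_add hμ hf hJ.dzb
    rw [h3, add_zero] at h4
    rw [← h4]
    refine IsDensity.formIntegral_congr fun p => ?_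
    have hp := center_mem (A := A) p
    have h5 := (((HasW.of_diff (hâf.differentiableAt hp)).sub
      (HasW.of_diff (ha'.differentiableAt hp))).mul (HasW.of_diff (hκ.differentiableAt hp))).dzb_eq
    rw [h5, hdiff a' p _ hp]
    have h6 := hw0 p _ hp
    have h7 := hR.ne_zero hp
    field_simp
    ring
  have hη : ∀ x, ∀ z ∈ (A.chart x).target, A.divDefect Λ d â x z = 0 := by
    have hηf := F.form_divDefect H hâf
    have hM : A.IsForm 1 0 (fun x z => 4 * dz (fun z => conj (A.divDefect Λ d â x z)) z *
        ((τ : ℂ) - A.fn u x z)⁻¹) :=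
      ((hηf.cconj.dz.const_mul 4).mul (hwform.inv hw0)).cast (by ring) (by ring)
    refine eq_zero_of_approx hR hμ (k := 0) (l := 0) (by norm_num) hηf hM
      (C := 1 / (8 * α)) (by positivity) fun ε hε => ?_
    obtain ⟨a', ha', -, h2, h1⟩ := happrox ε hε
    have hηf' := F.form_divDefect H ha'
    refine ⟨_, _, hηf', F.form_defect H ha', h1, h2, ?_⟩
    have hRd : A.IsForm 0 1 (fun x z => R x z * (â x z - a' x z)) :=
      (hR.form.mul (hâf.sub ha')).cast (by ring) (by ring)
    have hJ : A.IsForm 0 1 (fun x z => R x z * (â x z - a' x z) * conj (A.divDefect Λ d â x z)) :=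
      (hRd.mul hηf.cconj).cast (by ring) (by ring)
    have h3 := formIntegral_dz hR hμ hJ
    have hf : A.IsForm 1 1 (fun x z => R x z * (A.divDefect Λ d a' x z * conj (A.divDefect Λ d â x z)) +
        A.defect τ R u θ a' x z * (4 * dz (fun z => conj (A.divDefect Λ d â x z)) z *
        ((τ : ℂ) - A.fn u x z)⁻¹)) :=
      ((hR.form.mul (hηf'.mul hηf.cconj)).cast (by ring) (by ring)).add
        (((F.form_defect H ha').mul hM).cast (by ring) (by ring))
    have h4 := hR.formIntegral_add hμ hf hJ.dz
    rw [h3, add_zero] at h4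
    rw [← h4]
    refine IsDensity.formIntegral_congr fun p => ?_
    have hp := center_mem (A := A) p
    have h5 := ((HasW.of_diff (hRd.differentiableAt hp)).mul
      (HasW.of_diff (hηf.cconj.differentiableAt hp))).dz_eq
    have h8 := H.dz_rho_mul hp ((hâf.sub ha').differentiableAt hp)
    rw [dz_sub (hâf.differentiableAt hp) (ha'.differentiableAt hp)] at h8
    rw [h5, h8, hdiff a' p _ hp]
    have h6 := hw0 p _ hp
    have h7 := hR.ne_zero hp
    have h9 : A.divDefect Λ d â p (A.center p) - A.divDefect Λ d a' p (A.center p) =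
        dz (â p) (A.center p) - dz (a' p) (A.center p) +
          (â p (A.center p) - a' p (A.center p)) * dz (Λ p) (A.center p) := by
      simp only [divDefect]; ring
    rw [← h9]
    field_simp
    ring
  exact ⟨â, hâf, hâf.isHol hB, hE0, hη⟩

end IsField

end HolAtlas

end GravVortex

namespace GravVortex

open ComplexConjugate MeasureTheory

/-- A holomorphic function with real values is locally constant. -/
lemma eventually_eq_of_real {f : ℂ → ℂ} {z₀ : ℂ} (hf : AnalyticAt ℂ f z₀)
    (h : ∀ᶠ z in 𝓝 z₀, (f z).im = 0) : ∀ᶠ z in 𝓝 z₀, f z = f z₀ := by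
  refine hf.eventually_constant_or_nhds_le_map_nhds.resolve_right fun hle => ?_
  have h1 : {w : ℂ | w.im = 0} ∈ 𝓝 (f z₀) := hle (Filter.mem_map.2 h)
  obtain ⟨r, hr, hsub⟩ := Metric.mem_nhds_iff.1 h1
  have h2 : f z₀ + (r / 2 : ℝ) * Complex.I ∈ Metric.ball (f z₀) r := by
    rw [Metric.mem_ball, dist_eq_norm]
    have : f z₀ + (r / 2 : ℝ) * Complex.I - f z₀ = (r / 2 : ℝ) * Complex.I := by ring
    rw [this, norm_mul, Complex.norm_I, mul_one, Complex.norm_real, Real.norm_of_nonneg (by positivity)]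
    linarith
  have h3 : (f z₀ + (r / 2 : ℝ) * Complex.I).im = 0 := hsub h2
  have h4 : (f z₀).im = 0 := h.self_of_nhds
  simp only [Complex.add_im, Complex.mul_im, Complex.ofReal_re, Complex.I_im, mul_one,
    Complex.ofReal_im, Complex.I_re, mul_zero, add_zero, h4, zero_add] at h3
  linarith

namespace HolAtlas

variable {X : Type*} [TopologicalSpace X] {A : HolAtlas X}
variable {τ α c : ℝ} {R : X → ℂ → ℝ} {Λ φ ψ a b : X → ℂ → ℂ} {u θ d : X → ℂ} {x : X} {z : ℂ}

lemma eventually_val_eq_zero {k l : ℤ} {F : X → ℂ → ℂ} (hF : A.IsForm k l F)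
    (h : ∀ᶠ z in 𝓝 (A.center x), F x z = 0) : ∀ᶠ y in 𝓝 x, A.val F y = 0 := by
  have hc : Filter.Tendsto (A.chart x) (𝓝 x) (𝓝 (A.center x)) :=
    (A.chart x).continuousAt (A.mem_source x)
  filter_upwards [hc.eventually h, (A.chart x).open_source.mem_nhds (A.mem_source x)] with y hy hys
  rw [hF.eq_zero_iff ((A.chart x).map_source hys), (A.chart x).left_inv hys] at hy
  exact hy

lemma eventually_chart_symm {P : X → Prop} (h : ∀ᶠ y in 𝓝 x, P y) :
    ∀ᶠ z in 𝓝 (A.center x), P ((A.chart x).symm z) := by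
  have hc : Filter.Tendsto (A.chart x).symm (𝓝 (A.center x)) (𝓝 x) := by
    have := (A.chart x).continuousAt_symm (center_mem x)
    rwa [ContinuousAt, symm_center] at this
  exact hc.eventually h

lemma IsVortex.eventually_u_ne_zero [PreconnectedSpace X] (H : A.IsVortex τ α c R Λ φ ψ u)
    (hu : ∃ p, u p ≠ 0) (x : X) : ∀ᶠ y in 𝓝[≠] x, u y ≠ 0 := by
  refine A.eventually_notMem_of_ne_univ (Z := {y | u y = 0}) (fun x => ⟨φ x, ?_, ?_⟩) ?_ x
  · exact (H.loc x).hol_phi.analyticAt ((A.chart x).open_target.mem_nhds (center_mem x))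
  · filter_upwards [(A.chart x).open_target.mem_nhds (center_mem x)] with z hz
    have h : u ((A.chart x).symm z) = _ := (H.loc x).u_eq z hz
    change u ((A.chart x).symm z) = 0 ↔ _
    rw [h]
    simp [Complex.exp_ne_zero]
  · obtain ⟨p, hp⟩ := hu
    exact fun h => hp ((Set.eq_univ_iff_forall.1 h) p)

/-- Continuous functions which agree where the section does not vanish agree. -/
lemma IsVortex.eq_of_forall_ne_zero [PreconnectedSpace X] (H : A.IsVortex τ α c R Λ φ ψ u)
    (hu : ∃ p, u p ≠ 0) {f : X → ℂ} (hf : Continuous f) (h : ∀ p, u p ≠ 0 → f p = 0) (p : X) :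
    f p = 0 := by
  have := A.nhdsNE_neBot p
  have h1 : Filter.Tendsto f (𝓝[≠] p) (𝓝 (f p)) := hf.continuousAt.tendsto.mono_left nhdsWithin_le_nhds
  have h2 : f =ᶠ[𝓝[≠] p] fun _ => 0 := (H.eventually_u_ne_zero hu p).mono fun y hy => h y hy
  exact tendsto_nhds_unique (h1.congr' h2) tendsto_const_nhds

namespace IsField

lemma isHol (F : A.IsField Λ φ ψ a b θ d) : A.IsHol a := fun x => (F.loc x).hol_a

lemma continuous_theta (H : A.IsVortex τ α c R Λ φ ψ u) (F : A.IsField Λ φ ψ a b θ d) :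
    Continuous θ := by
  have := continuous_val (F.form_theta H)
  rwa [show A.val (A.fn θ) = θ from funext fun p => val_fn θ p] at this

lemma mul_dz_u (H : A.IsVortex τ α c R Λ φ ψ u) (F : A.IsField Λ φ ψ a b θ d) (p : X) :
    A.val a p * A.val (fun x z => dz (A.fn u x) z) p = θ p * u p := by
  have h := (H.loc p).a_mul_dz_u (F.loc p) (center_mem p)
  rwa [fn, fn, symm_center] at h

lemma theta_eq_zero [PreconnectedSpace X] (H : A.IsVortex τ α c R Λ φ ψ u)
    (hu : ∃ p, u p ≠ 0) (F : A.IsField Λ φ ψ a b θ d) (ha : ∀ p, A.val a p = 0) (p : X) :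
    θ p = 0 := by
  refine H.eq_of_forall_ne_zero hu (F.continuous_theta H) (fun q hq => ?_) p
  have h := F.mul_dz_u H q
  rw [ha, zero_mul] at h
  exact (mul_eq_zero.1 h.symm).resolve_right hq

/-- A point where nothing vanishes. -/
lemma exists_ne_zero [CompactSpace X] [ConnectedSpace X] (H : A.IsVortex τ α c R Λ φ ψ u)
    (hτ : 0 < τ) (hu : ∃ p, u p ≠ 0) (F : A.IsField Λ φ ψ a b θ d) {p : X} (ha : A.val a p ≠ 0) :
    ∃ q, A.val a q ≠ 0 ∧ u q ≠ 0 ∧ θ q ≠ 0 := by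
  have := A.nhdsNE_neBot p
  have h1 : ∃ᶠ y in 𝓝[≠] p, θ y ≠ 0 := by
    intro hz
    simp only [ne_eq, not_not] at hz
    have h2 : Filter.Tendsto θ (𝓝[≠] p) (𝓝 (θ p)) :=
      (F.continuous_theta H).continuousAt.tendsto.mono_left nhdsWithin_le_nhds
    have h3 : θ p = 0 := tendsto_nhds_unique (h2.congr' hz) tendsto_const_nhds
    have h4 : ∀ᶠ y in 𝓝 p, θ y = 0 := by
      rw [eventually_nhdsWithin_iff] at hz
      filter_upwards [hz] with y hy
      by_cases hyp : y = p
      · rw [hyp, h3]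
      · exact hy hyp
    have h5 : A.fn θ p =ᶠ[𝓝 (A.center p)] fun _ => 0 := eventually_chart_symm h4
    have h6 := (H.loc p).dzb_theta (F.loc p) (center_mem p)
    rw [Filter.EventuallyEq.dzb_eq h5, dzb_const] at h6
    have h7 := mul_ne_zero (mul_ne_zero (mul_ne_zero (by norm_num : (-(1 / 4) : ℂ) ≠ 0)
      (H.density.ne_zero (center_mem p))) (H.w_ne_zero hτ ((A.chart p).symm (A.center p)))) ha
    exact h7 h6.symm
  obtain ⟨q, hq1, hq2, hq3⟩ := (h1.and_eventually ((F.form.eventually_val_ne_zero F.isHol ha p).and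
    (H.eventually_u_ne_zero hu p))).exists
  exact ⟨q, hq2, hq3, hq1⟩

lemma eventually_ne_zero (H : A.IsVortex τ α c R Λ φ ψ u) (F : A.IsField Λ φ ψ a b θ d) {q : X}
    (ha : A.val a q ≠ 0) (hu : u q ≠ 0) (hθ : θ q ≠ 0) :
    ∀ᶠ z in 𝓝 (A.center q), z ∈ (A.chart q).target ∧ a q z ≠ 0 ∧ A.fn u q z ≠ 0 ∧
      A.fn θ q z ≠ 0 := by
  have hac : ContinuousAt (a q) (A.center q) := (F.isHol.analyticAt (center_mem q)).continuousAt
  filter_upwards [(A.chart q).open_target.mem_nhds (center_mem q), hac.eventually_ne ha,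
    eventually_chart_symm (H.continuous_u.continuousAt.eventually_ne hu),
    eventually_chart_symm ((F.continuous_theta H).continuousAt.eventually_ne hθ)]
    with z h1 h2 h3 h4
  exact ⟨h1, h2, h3, h4⟩

/-- Two infinitesimal automorphisms with imaginary potentials are proportional over the reals. -/
theorem exists_real_relation [CompactSpace X] [ConnectedSpace X]
    (H : A.IsVortex τ α c R Λ φ ψ u) (hτ : 0 < τ) (hu : ∃ p, u p ≠ 0)
    (F : A.IsField Λ φ ψ a b θ d) {a₂ b₂ : X → ℂ → ℂ} {θ₂ d₂ : X → ℂ}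
    (F₂ : A.IsField Λ φ ψ a₂ b₂ θ₂ d₂) (h1 : ∀ p, (θ p).re = 0) (h2 : ∀ p, (θ₂ p).re = 0)
    (hne : ∃ p, A.val a p ≠ 0) : ∃ t : ℝ, ∀ p, A.val a₂ p = t * A.val a p := by
  obtain ⟨p, hp⟩ := hne
  obtain ⟨q, hq1, hq2, hq3⟩ := F.exists_ne_zero H hτ hu hp
  have hev := F.eventually_ne_zero H hq1 hq2 hq3
  have han : AnalyticAt ℂ (fun z => a₂ q z / a q z) (A.center q) :=
    (F₂.isHol.analyticAt (center_mem q)).div (F.isHol.analyticAt (center_mem q)) hq1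
  have him : ∀ᶠ z in 𝓝 (A.center q), (a₂ q z / a q z).im = 0 := by
    filter_upwards [hev] with z hz
    obtain ⟨hz1, hz2, hz3, hz4⟩ := hz
    have h3 := (H.loc q).a_mul_dz_u (F.loc q) hz1
    have h4 := (H.loc q).a_mul_dz_u (F₂.loc q) hz1
    have h5 : a₂ q z / a q z = A.fn θ₂ q z / A.fn θ q z := by
      rw [div_eq_div_iff hz2 hz4]
      refine mul_right_cancel₀ hz3 ?_
      linear_combination a q z * h4 - a₂ q z * h3
    have h6 : A.fn θ q z = ((A.fn θ q z).im : ℂ) * Complex.I := by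
      apply Complex.ext <;> simp [fn, h1]
    have h7 : A.fn θ₂ q z = ((A.fn θ₂ q z).im : ℂ) * Complex.I := by
      apply Complex.ext <;> simp [fn, h2]
    rw [h5, h6, h7, mul_div_mul_right _ _ Complex.I_ne_zero, ← Complex.ofReal_div, Complex.ofReal_im]
  have hconst := eventually_eq_of_real han him
  set t : ℝ := (a₂ q (A.center q) / a q (A.center q)).re with ht
  have htc : a₂ q (A.center q) / a q (A.center q) = t := by
    apply Complex.ext
    · simp [t]
    · rw [him.self_of_nhds]; simp
  refine ⟨t, fun p => ?_⟩
  have hform : A.IsForm (-1) 0 (fun x z => a₂ x z - t * a x z) := F₂.form.sub (F.form.const_mul t)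
  have h8 := hform.val_eq_zero (fun x => (F₂.isHol x).sub ((F.isHol x).const_mul (t : ℂ)))
    (x₀ := q) (eventually_val_eq_zero hform (by
      filter_upwards [hconst, hev] with z hz hz2
      rw [htc, div_eq_iff hz2.2.1] at hz
      rw [hz, sub_self])) p
  exact sub_eq_zero.1 h8

/-- A complex multiple of any infinitesimal automorphism is an infinitesimal isometry. -/
theorem exists_multiple [CompactSpace X] [ConnectedSpace X] [T2Space X]
    (H : A.IsVortex τ α c R Λ φ ψ u) (hτ : 0 < τ) (hα : 0 < α) (hu : ∃ p, u p ≠ 0)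
    (F : A.IsField Λ φ ψ a b θ d) :
    ∃ l : ℂ, l ≠ 0 ∧ ∀ p, (l * θ p).re = 0 ∧ (l * d p).re = 0 := by
  by_cases ha : ∀ p, A.val a p = 0
  · refine ⟨1, one_ne_zero, fun p => ⟨by rw [F.theta_eq_zero H hu ha]; simp, ?_⟩⟩
    have h1 := (F.loc p).d_eq _ (center_mem p)
    have h2 : ∀ z ∈ (A.chart p).target, a p z = 0 := fun z hz => by
      rw [F.form.eq_zero_iff hz]; exact ha _
    rw [dz_congr (A.chart p).open_target h2 (center_mem p), dz_const, h2 _ (center_mem p), fn,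
      symm_center] at h1
    rw [h1]; simp
  push Not at ha
  obtain ⟨p₀, hp₀⟩ := ha
  borelize X
  obtain ⟨a', ha', hhol, hE, hη⟩ := F.exists_conj_field H hτ hα
  obtain ⟨q, hq1, hq2, hq3⟩ := F.exists_ne_zero H hτ hu hp₀
  have hev := F.eventually_ne_zero H hq1 hq2 hq3
  have hrel : ∀ x, ∀ z ∈ (A.chart x).target, A.fn u x z ≠ 0 →
      a x z * conj (A.fn θ x z) = a' x z * A.fn θ x z := by
    intro x z hz hz3
    have h1 := (H.loc x).dz_defect (F.loc x) (a' := a' x) (E := A.defect τ R u θ a' x)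
      (η := A.divDefect Λ d a' x) (ha'.smooth x) (fun z _ => rfl) (fun z _ => rfl) hz
    rw [dz_congr (A.chart x).open_target (hE x) hz, dz_const, hη x z hz, mul_zero, add_zero] at h1
    have h2 : conj (φ x z) * Complex.exp (ψ x z) *
        (φ x z * conj (A.fn θ x z) - a' x z * LocalVortex.nabla (φ x) (ψ x) z) = 0 := by
      have h3 := H.density.ne_zero hz
      have h4 : 1 / 4 * (R x z : ℂ) * (conj (φ x z) * Complex.exp (ψ x z) *
        (φ x z * conj (A.fn θ x z) - a' x z * LocalVortex.nabla (φ x) (ψ x) z)) = 0 := by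
        rw [h1]; ring
      exact (mul_eq_zero.1 h4).resolve_left (mul_ne_zero (by norm_num) h3)
    have h3 := (H.loc x).a_mul_dz_u (F.loc x) hz
    have h4 := ((H.loc x).hasW_u hz).dz_eq
    have h5 := (H.loc x).u_eq z hz
    refine mul_right_cancel₀ hz3 ?_
    linear_combination a x z * h2 + a' x z * h3 + a x z * conj (A.fn θ x z) * h5 - a x z * a' x z * h4
  have han : AnalyticAt ℂ (fun z => a' q z / a q z) (A.center q) :=
    (hhol.analyticAt (center_mem q)).div (F.isHol.analyticAt (center_mem q)) hq1
  have hnorm : ∀ᶠ z in 𝓝 (A.center q), ‖a' q z / a q z‖ = 1 := by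
    filter_upwards [hev] with z hz
    obtain ⟨hz1, hz2, hz3, hz4⟩ := hz
    have h5 : a' q z / a q z = conj (A.fn θ q z) / A.fn θ q z := by
      rw [div_eq_div_iff hz2 hz4, ← hrel q z hz1 hz3]; ring
    rw [h5, norm_div, RCLike.norm_conj, div_self (norm_ne_zero_iff.2 hz4)]
  have hconst : ∀ᶠ z in 𝓝 (A.center q), a' q z / a q z = a' q (A.center q) / a q (A.center q) := by
    refine Complex.eventually_eq_of_isLocalMax_norm
      (han.eventually_analyticAt.mono fun z hz => hz.differentiableAt) ?_
    filter_upwards [hnorm] with z hz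
    simp only [Function.comp_apply]
    rw [hz, hnorm.self_of_nhds]
  set s : ℂ := a' q (A.center q) / a q (A.center q) with hs
  have hs1 : ‖s‖ = 1 := hnorm.self_of_nhds
  have hform : A.IsForm (-1) 0 (fun x z => a' x z - s * a x z) := ha'.sub (F.form.const_mul s)
  have hzero := hform.val_eq_zero (fun x => (hhol x).sub ((F.isHol x).const_mul s))
    (x₀ := q) (eventually_val_eq_zero hform (by
      filter_upwards [hconst, hev] with z hz hz2
      rw [div_eq_iff hz2.2.1] at hz
      rw [hz, sub_self]))
  have has : ∀ x, ∀ z ∈ (A.chart x).target, a' x z = s * a x z := fun x z hz =>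
    sub_eq_zero.1 ((hform.eq_zero_iff hz).2 (hzero _))
  have hθs : ∀ p, conj (θ p) = s * θ p := by
    set f : X → ℂ := fun p => conj (θ p) - s * θ p with hf
    have hff : A.IsForm 0 0 (A.fn f) := (F.form_theta H).cconj.sub ((F.form_theta H).const_mul s)
    have hfh : A.IsHol (A.fn f) := hff.isHol fun x z hz => by
      have h1 := ((HasW.of_diff ((F.form_theta H).cconj.differentiableAt hz)).sub
        ((HasW.const s).mul (HasW.of_diff ((F.form_theta H).differentiableAt hz)))).dzb_eq
      have h2 := hE x z hz
      have h3 := (H.loc x).dzb_theta (F.loc x) hz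
      have h4 : dzb (A.fn f x) z = dzb (fun z => conj (A.fn θ x z)) z - (0 * A.fn θ x z +
        s * dzb (A.fn θ x) z) := h1
      rw [h4, h3]
      rw [defect, has x z hz] at h2
      linear_combination h2
    intro p
    have h5 := eq_of_isHol hfh p q
    have h6 := hrel q _ (center_mem q) (by rwa [fn, symm_center])
    rw [has q _ (center_mem q), fn, symm_center, mul_comm s, mul_assoc] at h6
    have h7 : f q = 0 := sub_eq_zero.2 (mul_left_cancel₀ hq1 h6)
    rw [h7] at h5
    exact sub_eq_zero.1 h5
  have hds : ∀ p, conj (d p) = s * d p := fun p => by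
    have h1 := hη p _ (center_mem p)
    have h2 := (F.loc p).d_eq _ (center_mem p)
    rw [divDefect, dz_congr (A.chart p).open_target (has p) (center_mem p),
      dz_const_mul s (F.form.differentiableAt (center_mem p)), has p _ (center_mem p)] at h1
    rw [fn, symm_center] at h1 h2
    rw [h2]
    rw [h2] at h1
    linear_combination -h1
  obtain ⟨l, hl⟩ := IsAlgClosed.exists_pow_nat_eq (-s) (n := 2) (by norm_num)
  have hl1 : l * conj l = 1 := by
    have : ‖l‖ ^ 2 = 1 := by rw [← norm_pow, hl, norm_neg, hs1]
    rw [Complex.mul_conj, Complex.normSq_eq_norm_sq, this, Complex.ofReal_one]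
  have hre : ∀ w : ℂ, conj w = s * w → (l * w).re = 0 := fun w hw => by
    have h1 : l * w + conj (l * w) = 0 := by
      rw [map_mul, hw]
      linear_combination (-(l * w)) * hl1 + (-(conj l) * w) * (-hl)
    rw [Complex.add_conj] at h1
    have : (2 * (l * w).re : ℝ) = 0 := by exact_mod_cast h1
    linarith
  exact ⟨l, fun h => by rw [h, zero_mul] at hl1; exact zero_ne_one hl1,
    fun p => ⟨hre _ (hθs p), hre _ (hds p)⟩⟩

end IsField

end HolAtlas

end GravVortex

namespace GravVortex

open ComplexConjugate

section LineBundleCharts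

variable {X : Type*} [TopologicalSpace X] [ChartedSpace ℂ X]
  (L : X → Type*) [TopologicalSpace (Bundle.TotalSpace ℂ L)]
  [∀ x, TopologicalSpace (L x)] [∀ x, AddCommGroup (L x)] [∀ x, Module ℂ (L x)]
  [FiberBundle ℂ L] [VectorBundle ℂ ℂ L]

/-- The chart of the total space of a line bundle given by the preferred chart of the base and the
preferred trivialization at `x`. -/
noncomputable abbrev totalChart (x : X) : PartialEquiv (Bundle.TotalSpace ℂ L) (ℂ × ℂ) :=
  extChartAt totalModel (⟨x, 0⟩ : Bundle.TotalSpace ℂ L)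

/-- The domain of the coordinate over which the preferred frame at `x` is defined. -/
def frameDomain (x : X) : Set ℂ :=
  (chartAt ℂ x).target ∩ (chartAt ℂ x).symm ⁻¹' (trivializationAt ℂ L x).baseSet

variable {L} {x y : X} {z w : ℂ}

lemma isOpen_frameDomain (x : X) : IsOpen (frameDomain L x) :=
  (chartAt ℂ x).isOpen_inter_preimage_symm (trivializationAt ℂ L x).open_baseSet

lemma center_mem_frameDomain (x : X) : chartAt ℂ x x ∈ frameDomain L x := by
  refine ⟨mem_chart_target ℂ x, ?_⟩
  rw [Set.mem_preimage, (chartAt ℂ x).left_inv (mem_chart_source ℂ x)]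
  exact FiberBundle.mem_baseSet_trivializationAt' x

lemma extChartAt_totalSpace (p : Bundle.TotalSpace ℂ L) :
    extChartAt totalModel p = totalChart L p.1 := by
  simp only [totalChart, extChartAt, FiberBundle.chartedSpace_chartAt]

lemma totalChart_source (x : X) : (totalChart L x).source =
    {p | p.1 ∈ (chartAt ℂ x).source ∧ p.1 ∈ (trivializationAt ℂ L x).baseSet} := by
  ext p
  simp only [totalChart, mfld_simps, FiberBundle.chartedSpace_chartAt, Bundle.Trivialization.mem_source]
  constructor
  · rintro ⟨h1, h2⟩
    refine ⟨?_, h1⟩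
    rwa [(trivializationAt ℂ L x).coe_fst' h1] at h2
  · rintro ⟨h1, h2⟩
    refine ⟨h2, ?_⟩
    rwa [(trivializationAt ℂ L x).coe_fst' h2]

lemma totalChart_apply {p : Bundle.TotalSpace ℂ L} (hp : p ∈ (totalChart L x).source) :
    totalChart L x p = (chartAt ℂ x p.1, (trivializationAt ℂ L x p).2) := by
  rw [totalChart_source] at hp
  simp only [totalChart, mfld_simps, FiberBundle.chartedSpace_chartAt]
  rw [(trivializationAt ℂ L x).coe_fst' hp.2]

lemma totalChart_symm_apply (hz : z ∈ frameDomain L x) :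
    (totalChart L x).symm (z, w) = ⟨(chartAt ℂ x).symm z,
      (trivializationAt ℂ L x).symm ((chartAt ℂ x).symm z) w⟩ := by
  simp only [totalChart, mfld_simps, FiberBundle.chartedSpace_chartAt]
  exact ((trivializationAt ℂ L x).mk_symm hz.2 w).symm

lemma totalChart_target (x : X) : (totalChart L x).target = frameDomain L x ×ˢ Set.univ := by
  ext ⟨z, w⟩
  simp only [totalChart, mfld_simps, FiberBundle.chartedSpace_chartAt, frameDomain]
  simp only [Bundle.Trivialization.mem_target]
  exact ⟨fun h => ⟨h.1.1, h.2⟩, fun h => ⟨⟨h.1, Set.mem_univ _⟩, h.2⟩⟩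

lemma mk_mem_totalChart_target (hz : z ∈ frameDomain L x) : (z, w) ∈ (totalChart L x).target := by
  rw [totalChart_target]; exact ⟨hz, Set.mem_univ _⟩

/-- The domain of the change of frames. -/
def frameOverlap (L : X → Type*) [TopologicalSpace (Bundle.TotalSpace ℂ L)]
    [∀ x, TopologicalSpace (L x)] [FiberBundle ℂ L] (x y : X) : Set ℂ :=
  frameDomain L x ∩ (chartAt ℂ x).symm ⁻¹' ((chartAt ℂ y).source ∩ (trivializationAt ℂ L y).baseSet)

/-- The holomorphic transition function between the preferred frames at `x` and at `y`. -/
noncomputable def frameChange (L : X → Type*) [TopologicalSpace (Bundle.TotalSpace ℂ L)]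
    [∀ x, TopologicalSpace (L x)] [∀ x, AddCommGroup (L x)] [∀ x, Module ℂ (L x)]
    [FiberBundle ℂ L] [VectorBundle ℂ ℂ L] (x y : X) (z : ℂ) : ℂ :=
  (trivializationAt ℂ L y ⟨(chartAt ℂ x).symm z,
    (trivializationAt ℂ L x).symm ((chartAt ℂ x).symm z) (1 : ℂ)⟩).2

lemma isOpen_frameOverlap (x y : X) : IsOpen (frameOverlap L x y) := by
  have h := (chartAt ℂ x).isOpen_inter_preimage_symm
    ((chartAt ℂ y).open_source.inter (trivializationAt ℂ L y).open_baseSet)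
  have : frameOverlap L x y = frameDomain L x ∩ ((chartAt ℂ x).target ∩ (chartAt ℂ x).symm ⁻¹'
      ((chartAt ℂ y).source ∩ (trivializationAt ℂ L y).baseSet)) := by
    ext z
    exact ⟨fun h => ⟨h.1, h.1.1, h.2⟩, fun h => ⟨h.1, h.2.2⟩⟩
  rw [this]
  exact (isOpen_frameDomain x).inter h

lemma symm_mem_totalChart_source (hz : z ∈ frameOverlap L x y) :
    (totalChart L x).symm (z, w) ∈ (totalChart L y).source := by
  rw [totalChart_symm_apply hz.1, totalChart_source]
  exact hz.2

lemma trivializationAt_symm_eq_smul {p : X} (hp : p ∈ (trivializationAt ℂ L x).baseSet) (w : ℂ) :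
    (trivializationAt ℂ L x).symm p w = w • (trivializationAt ℂ L x).symm p (1 : ℂ) := by
  have := (trivializationAt ℂ L x).symmₗ ℂ p |>.map_smul w (1 : ℂ)
  simpa [Bundle.Trivialization.coe_symmₗ, hp] using this

lemma totalChart_symm_transition (hz : z ∈ frameOverlap L x y) :
    totalChart L y ((totalChart L x).symm (z, w)) =
      (chartAt ℂ y ((chartAt ℂ x).symm z), frameChange L x y z * w) := by
  rw [totalChart_apply (symm_mem_totalChart_source hz), totalChart_symm_apply hz.1]
  refine Prod.ext rfl ?_
  have h1 : (trivializationAt ℂ L x).symm ((chartAt ℂ x).symm z) w =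
      w • (trivializationAt ℂ L x).symm ((chartAt ℂ x).symm z) (1 : ℂ) :=
    trivializationAt_symm_eq_smul hz.1.2 w
  simp only [frameChange, h1]
  rw [mul_comm]
  exact ((trivializationAt ℂ L y).linear ℂ hz.2.2).map_smul w _

lemma differentiableOn_transition [IsManifold 𝓘(ℂ) ω X] (x y : X) :
    DifferentiableOn ℂ (fun z => chartAt ℂ y ((chartAt ℂ x).symm z))
      ((chartAt ℂ x).target ∩ (chartAt ℂ x).symm ⁻¹' (chartAt ℂ y).source) := by
  have h := (contDiffOn_ext_coord_change (I := 𝓘(ℂ)) (n := ω) y x).differentiableOn (by simp)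
  simpa [PartialEquiv.trans_source, Function.comp_def] using h

lemma differentiableAt_totalTransition [IsManifold 𝓘(ℂ) ω X] [ContMDiffVectorBundle ω ℂ L 𝓘(ℂ)]
    (hz : z ∈ frameOverlap L x y) :
    DifferentiableAt ℂ (totalChart L y ∘ (totalChart L x).symm) (z, w) := by
  have h := contDiffWithinAt_ext_coord_change (I := totalModel) (n := ω)
    (⟨y, 0⟩ : Bundle.TotalSpace ℂ L) ⟨x, 0⟩ (y := (z, w)) (by
      rw [PartialEquiv.trans_source, PartialEquiv.symm_source]
      exact ⟨mk_mem_totalChart_target hz.1, symm_mem_totalChart_source hz⟩)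
  rw [ModelWithCorners.range_eq_univ, contDiffWithinAt_univ] at h
  exact h.differentiableAt (by simp)

lemma differentiableOn_frameChange [IsManifold 𝓘(ℂ) ω X] [ContMDiffVectorBundle ω ℂ L 𝓘(ℂ)]
    (x y : X) : DifferentiableOn ℂ (frameChange L x y) (frameOverlap L x y) := by
  intro z hz
  have h1 : DifferentiableAt ℂ
      (fun z => (totalChart L y ((totalChart L x).symm (z, (1 : ℂ)))).2) z :=
    DifferentiableAt.snd (DifferentiableAt.comp (g := totalChart L y ∘ (totalChart L x).symm)
      (f := fun z => (z, (1 : ℂ))) z (differentiableAt_totalTransition (w := 1) hz)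
      (differentiableAt_fun_id.prodMk (differentiableAt_const (1 : ℂ))))
  refine (h1.congr_of_eventuallyEq ?_).differentiableWithinAt
  filter_upwards [(isOpen_frameOverlap x y).mem_nhds hz] with v hv
  rw [totalChart_symm_transition hv, mul_one]

lemma frameChange_ne_zero (hz : z ∈ frameOverlap L x y) : frameChange L x y z ≠ 0 := by
  intro h
  have h1 := totalChart_symm_transition (w := 1) hz
  have h2 := totalChart_symm_transition (w := 0) hz
  rw [h, zero_mul] at h1
  rw [h, zero_mul, ← h1] at h2
  have h3 := (totalChart L y).injOn (symm_mem_totalChart_source hz)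
    (symm_mem_totalChart_source hz) h2
  have h4 := (totalChart L x).symm.injOn (mk_mem_totalChart_target hz.1)
    (mk_mem_totalChart_target hz.1) h3
  simp at h4

variable (L) in
/-- The atlas of the base whose charts are restricted to the domains of the preferred frames. -/
noncomputable def lineAtlas [IsManifold 𝓘(ℂ) ω X] : HolAtlas X where
  chart x := (chartAt ℂ x).restrOpen (trivializationAt ℂ L x).baseSet
    (trivializationAt ℂ L x).open_baseSet
  mem_source x := ⟨mem_chart_source ℂ x, FiberBundle.mem_baseSet_trivializationAt' x⟩
  holo x y := by
    refine (differentiableOn_transition x y).mono ?_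
    rintro z ⟨hz1, hz2⟩
    exact ⟨hz1.1, hz2.1⟩

section Atlas
variable [IsManifold 𝓘(ℂ) ω X]

lemma lineAtlas_tr (x y : X) :
    (lineAtlas L).tr x y = fun z => chartAt ℂ y ((chartAt ℂ x).symm z) := rfl

end Atlas

lemma totalSpace_mk_eq_symm {p : X} (hp : p ∈ (chartAt ℂ x).source ∧ p ∈ (trivializationAt ℂ L x).baseSet)
    (v : L p) : (totalChart L x).symm (chartAt ℂ x p, (trivializationAt ℂ L x ⟨p, v⟩).2) = ⟨p, v⟩ := by
  have h : (⟨p, v⟩ : Bundle.TotalSpace ℂ L) ∈ (totalChart L x).source := by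
    rw [totalChart_source]; exact hp
  have h1 := (totalChart L x).left_inv h
  rwa [totalChart_apply h] at h1

namespace HermitianMetric

variable (h : HermitianMetric L)

lemma normSq_totalChart_symm (hz : z ∈ frameDomain L x) :
    h.normSq ((totalChart L x).symm (z, w)) = ‖w‖ ^ 2 * h.weight x z := by
  rw [totalChart_symm_apply hz, weight, ← h.normSq_smul]
  rw [trivializationAt_symm_eq_smul hz.2]

lemma weight_eq_totalChart (hz : z ∈ frameDomain L x) :
    h.weight x z = h.normSq ((totalChart L x).symm (z, 1)) := by
  rw [normSq_totalChart_symm h hz]; simp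

lemma normSq_eq {p : X} (hp : p ∈ (chartAt ℂ x).source ∧ p ∈ (trivializationAt ℂ L x).baseSet)
    (v : L p) : h.normSq ⟨p, v⟩ =
      ‖(trivializationAt ℂ L x ⟨p, v⟩).2‖ ^ 2 * h.weight x (chartAt ℂ x p) := by
  rw [← normSq_totalChart_symm, totalSpace_mk_eq_symm hp]
  refine ⟨(chartAt ℂ x).map_source hp.1, ?_⟩
  rw [Set.mem_preimage, (chartAt ℂ x).left_inv hp.1]
  exact hp.2

lemma weight_pos (hz : z ∈ frameDomain L x) : 0 < h.weight x z := by
  refine h.normSq_pos _ _ fun h0 => ?_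
  have h1 := (trivializationAt ℂ L x).apply_mk_symm hz.2 (1 : ℂ)
  rw [h0] at h1
  have h2 := (trivializationAt ℂ L x).zeroSection ℂ hz.2
  have h3 := h2.symm.trans h1
  exact zero_ne_one (congrArg Prod.snd h3)

lemma weight_transition (hz : z ∈ frameOverlap L x y) :
    h.weight x z = ‖frameChange L x y z‖ ^ 2 *
      h.weight y (chartAt ℂ y ((chartAt ℂ x).symm z)) := by
  have hy := (totalChart L y).map_source (symm_mem_totalChart_source (w := 1) hz)
  rw [totalChart_symm_transition hz, totalChart_target] at hy
  rw [weight_eq_totalChart h hz.1, ← normSq_totalChart_symm h hy.1]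
  congr 1
  have h1 := (totalChart L y).left_inv (symm_mem_totalChart_source (w := 1) hz)
  rw [totalChart_symm_transition hz, mul_one] at h1
  exact h1.symm

lemma contDiffAt_weight_center (x : X) : ContDiffAt ℝ ∞ (h.weight x) (chartAt ℂ x x) := by
  have hb := FiberBundle.mem_baseSet_trivializationAt' (F := ℂ) (E := L) x
  set p : Bundle.TotalSpace ℂ L := ⟨x, (trivializationAt ℂ L x).symm x (1 : ℂ)⟩
  have h1 := (contMDiffAt_iff.1 (h.smooth p)).2
  rw [ModelWithCorners.range_eq_univ, contDiffWithinAt_univ] at h1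
  have h2 : totalChart L x p = (chartAt ℂ x x, (1 : ℂ)) := by
    rw [totalChart_apply (by rw [totalChart_source]; exact ⟨mem_chart_source ℂ x, hb⟩),
      (trivializationAt ℂ L x).apply_mk_symm hb]
  have h3 : ContDiffAt ℝ ∞ (fun q => h.normSq ((totalChart L x).symm q)) (totalChart L x p) := by
    have e1 : ∀ q, (extChartAt totalModelReal p).symm q = (totalChart L x).symm q := fun q => by
      simp only [totalChart, mfld_simps, FiberBundle.chartedSpace_chartAt]
      rfl
    have e2 : extChartAt totalModelReal p p = totalChart L x p := by
      rw [totalChart_apply (by rw [totalChart_source]; exact ⟨mem_chart_source ℂ x, hb⟩)]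
      simp only [mfld_simps, FiberBundle.chartedSpace_chartAt]
      rfl
    rw [← e2]
    refine h1.congr_of_eventuallyEq (Filter.Eventually.of_forall fun q => ?_)
    change h.normSq ((totalChart L x).symm q) = h.normSq ((extChartAt totalModelReal p).symm q)
    rw [e1]
  rw [h2] at h3
  have h4 : ContDiffAt ℝ ∞ (fun z => h.normSq ((totalChart L x).symm (z, (1 : ℂ))))
      (chartAt ℂ x x) :=
    ContDiffAt.comp (g := fun q => h.normSq ((totalChart L x).symm q))
      (f := fun z => (z, (1 : ℂ))) _ h3 (contDiffAt_id.prodMk contDiffAt_const)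
  refine h4.congr_of_eventuallyEq ?_
  filter_upwards [(isOpen_frameDomain x).mem_nhds (center_mem_frameDomain (L := L) x)] with z hz
  exact h.weight_eq_totalChart hz

lemma self_mem_frameOverlap (hz : z ∈ frameDomain L x) :
    z ∈ frameOverlap L x ((chartAt ℂ x).symm z) :=
  ⟨hz, mem_chart_source ℂ _, FiberBundle.mem_baseSet_trivializationAt' _⟩

lemma contDiffOn_weight [IsManifold 𝓘(ℂ) ω X] [ContMDiffVectorBundle ω ℂ L 𝓘(ℂ)] (x : X) :
    ContDiffOn ℝ ∞ (h.weight x) (frameDomain L x) := by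
  intro z hz
  have ho := self_mem_frameOverlap hz
  set y := (chartAt ℂ x).symm z
  have hU : IsOpen (frameOverlap L x y) := isOpen_frameOverlap x y
  have hT : ContDiffAt ℝ ∞ (fun z => chartAt ℂ y ((chartAt ℂ x).symm z)) z :=
    (contDiffOn_of_differentiableOn hU ((HolAtlas.differentiableOn_tr (A := lineAtlas L) x y))).contDiffAt
      (hU.mem_nhds ho)
  have ht : ContDiffAt ℝ ∞ (frameChange L x y) z :=
    (contDiffOn_of_differentiableOn hU (differentiableOn_frameChange x y)).contDiffAt
      (hU.mem_nhds ho)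
  have hw : ContDiffAt ℝ ∞ (fun z => h.weight y (chartAt ℂ y ((chartAt ℂ x).symm z))) z :=
    ContDiffAt.comp (g := h.weight y) z (h.contDiffAt_weight_center y) hT
  refine (((ht.norm_sq ℝ).mul hw).congr_of_eventuallyEq ?_).contDiffWithinAt
  filter_upwards [hU.mem_nhds ho] with v hv
  exact h.weight_transition hv

end HermitianMetric

section Tangent
variable [IsManifold 𝓘(ℂ) ω X]

lemma frameDomain_tangent (x : X) :
    frameDomain (TangentSpace 𝓘(ℂ) : X → Type) x = (chartAt ℂ x).target := by
  ext z
  refine ⟨fun h => h.1, fun h => ⟨h, ?_⟩⟩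
  rw [Set.mem_preimage, TangentBundle.trivializationAt_baseSet]
  exact (chartAt ℂ x).map_target h

lemma frameOverlap_subset_tangent (x y : X) :
    frameOverlap L x y ⊆ frameOverlap (TangentSpace 𝓘(ℂ) : X → Type) x y := by
  rintro z ⟨⟨h1, h2⟩, h3, h4⟩
  refine ⟨?_, h3, ?_⟩
  · rw [frameDomain_tangent]; exact h1
  · rw [TangentBundle.trivializationAt_baseSet]; exact h3

lemma frameChange_tangent (hz : z ∈ frameOverlap (TangentSpace 𝓘(ℂ) : X → Type) x y) :
    frameChange (TangentSpace 𝓘(ℂ) : X → Type) x y z =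
      deriv (fun z => chartAt ℂ y ((chartAt ℂ x).symm z)) z := by
  set p := (chartAt ℂ x).symm z with hp
  have hx : p ∈ (chartAt ℂ x).source := (chartAt ℂ x).map_target hz.1.1
  have hy : p ∈ (chartAt ℂ y).source := hz.2.1
  have h1 : frameChange (TangentSpace 𝓘(ℂ) : X → Type) x y z =
      (tangentBundleCore 𝓘(ℂ) X).coordChange (achart ℂ x) (achart ℂ y) p 1 := by
    rw [frameChange, ← hp]
    have := (tangentBundleCore 𝓘(ℂ) X).coordChange_comp (achart ℂ x) (achart ℂ p) (achart ℂ y) p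
      ⟨⟨hx, mem_chart_source ℂ p⟩, hy⟩ 1
    rw [← this]
    have h := (tangentBundleCore 𝓘(ℂ) X).localTriv_symm_apply (i := achart ℂ x) (b := p) hx 1
    exact congrArg (fun v => ((tangentBundleCore 𝓘(ℂ) X).localTriv (achart ℂ y) ⟨p, v⟩).2) h
  rw [h1, tangentBundleCore_coordChange_achart]
  have h2 : extChartAt 𝓘(ℂ) x p = z := (chartAt ℂ x).right_inv hz.1.1
  rw [h2, ModelWithCorners.range_eq_univ, fderivWithin_univ]
  rfl

end Tangent

end LineBundleCharts

/-- The logarithms of two densities that differ by the squared norm of a holomorphic function have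
Wirtinger derivatives that differ by its logarithmic derivative. -/
lemma dz_log_transition {U V : Set ℂ} {f g : ℂ → ℝ} {t T : ℂ → ℂ} {z : ℂ} (hU : IsOpen U)
    (hV : IsOpen V) (hg : ContDiffOn ℝ ∞ g V) (hg0 : ∀ z ∈ V, 0 < g z)
    (ht : DifferentiableOn ℂ t U) (ht0 : ∀ z ∈ U, t z ≠ 0) (hT : DifferentiableOn ℂ T U)
    (hTV : ∀ z ∈ U, T z ∈ V) (h : ∀ z ∈ U, f z = ‖t z‖ ^ 2 * g (T z)) (hz : z ∈ U) :
    dz (fun z => (Real.log (f z) : ℂ)) z =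
      deriv t z / t z + dz (fun z => (Real.log (g z) : ℂ)) (T z) * deriv T z := by
  have hlog : ContDiffOn ℝ ∞ (fun z => (Real.log (g z) : ℂ)) V :=
    Complex.ofRealCLM.contDiff.comp_contDiffOn (hg.log fun z hz => (hg0 z hz).ne')
  have hgT : DifferentiableAt ℝ (fun z => (Real.log (g z) : ℂ)) (T z) :=
    ContDiffOn.differentiableAt_of_isOpen hV hlog (hTV z hz)
  have hTd := hT.differentiableAt (hU.mem_nhds hz)
  have htd := ht.differentiableAt (hU.mem_nhds hz)
  have hgTd : DifferentiableAt ℝ (fun z => (Real.log (g (T z)) : ℂ)) z :=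
    DifferentiableAt.comp (g := fun z => (Real.log (g z) : ℂ)) z hgT (hTd.restrictScalars ℝ)
  have h1 : ∀ w ∈ U, (Real.log (f w) : ℂ) = (Real.log (‖t w‖ ^ 2) : ℂ) + (Real.log (g (T w)) : ℂ) := by
    intro w hw
    rw [h w hw, Real.log_mul (by simpa using ht0 w hw) (hg0 _ (hTV w hw)).ne']
    push_cast; rfl
  have h2 : ContDiffOn ℝ ∞ (fun z => (Real.log (‖t z‖ ^ 2) : ℂ)) U := by
    refine Complex.ofRealCLM.contDiff.comp_contDiffOn (ContDiffOn.log ?_ fun z hz => ?_)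
    · exact (contDiffOn_of_differentiableOn hU ht).norm_sq ℝ
    · simpa using ht0 z hz
  have h2d := ContDiffOn.differentiableAt_of_isOpen hU h2 hz
  have h3 : dz (fun z => (Real.log (‖t z‖ ^ 2) : ℂ)) z = deriv t z / t z := by
    have e1 : ∀ w ∈ U, Complex.exp (Real.log (‖t w‖ ^ 2) : ℂ) = t w * conj (t w) := by
      intro w hw
      rw [← Complex.ofReal_exp, Real.exp_log (by have := ht0 w hw; positivity), Complex.mul_conj,
        Complex.normSq_eq_norm_sq]
    have e2 := dz_congr hU e1 hz
    rw [dz_cexp h2d, e1 z hz, dz_mul (htd.restrictScalars ℝ)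
      (differentiableAt_conj_comp (htd.restrictScalars ℝ)), dz_conj (htd.restrictScalars ℝ),
      dzb_eq_zero_of_differentiableAt htd, dz_eq_deriv htd] at e2
    have hc : conj (t z) ≠ 0 := by simpa using ht0 z hz
    rw [map_zero, mul_zero, add_zero] at e2
    field_simp [ht0 z hz]
    apply mul_right_cancel₀ hc
    linear_combination e2
  rw [dz_congr hU h1 hz, dz_add h2d hgTd, h3,
    dz_comp (f := fun z => (Real.log (g z) : ℂ)) hTd hgT]

lemma dzb_dz_log_transition {U V : Set ℂ} {f g : ℂ → ℝ} {t T : ℂ → ℂ} {z : ℂ} (hU : IsOpen U)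
    (hV : IsOpen V) (hg : ContDiffOn ℝ ∞ g V) (hg0 : ∀ z ∈ V, 0 < g z)
    (ht : DifferentiableOn ℂ t U) (ht0 : ∀ z ∈ U, t z ≠ 0) (hT : DifferentiableOn ℂ T U)
    (hTV : ∀ z ∈ U, T z ∈ V) (h : ∀ z ∈ U, f z = ‖t z‖ ^ 2 * g (T z)) (hz : z ∈ U) :
    dzb (dz fun z => (Real.log (f z) : ℂ)) z =
      dzb (dz fun z => (Real.log (g z) : ℂ)) (T z) * (deriv T z * conj (deriv T z)) := by
  have hlog : ContDiffOn ℝ ∞ (fun z => (Real.log (g z) : ℂ)) V :=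
    Complex.ofRealCLM.contDiff.comp_contDiffOn (hg.log fun z hz => (hg0 z hz).ne')
  have hd := ContDiffOn.differentiableAt_of_isOpen hV (contDiffOn_dz hV hlog) (hTV z hz)
  have hTd := hT.differentiableAt (hU.mem_nhds hz)
  have htd := ht.differentiableAt (hU.mem_nhds hz)
  have ht' := (ht.deriv hU).differentiableAt (hU.mem_nhds hz)
  have hT' := (hT.deriv hU).differentiableAt (hU.mem_nhds hz)
  have hq : DifferentiableAt ℂ (fun z => deriv t z / t z) z := ht'.div htd (ht0 z hz)
  have hdT : DifferentiableAt ℝ (fun z => dz (fun z => (Real.log (g z) : ℂ)) (T z)) z :=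
    DifferentiableAt.comp (g := dz fun z => (Real.log (g z) : ℂ)) z hd (hTd.restrictScalars ℝ)
  rw [dzb_congr hU (fun w hw => dz_log_transition hU hV hg hg0 ht ht0 hT hTV h hw) hz,
    dzb_add (hq.restrictScalars ℝ) (hdT.fun_mul (hT'.restrictScalars ℝ)),
    dzb_eq_zero_of_differentiableAt hq, dzb_mul hdT (hT'.restrictScalars ℝ),
    dzb_eq_zero_of_differentiableAt hT', dzb_comp hTd hd]
  ring

section

variable {X : Type*} [TopologicalSpace X] [ChartedSpace ℂ X] [IsManifold 𝓘(ℂ) ω X]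
  {L : X → Type*} [TopologicalSpace (Bundle.TotalSpace ℂ L)]
  [∀ x, TopologicalSpace (L x)] [∀ x, AddCommGroup (L x)] [∀ x, Module ℂ (L x)]
  [FiberBundle ℂ L] [VectorBundle ℂ ℂ L] [ContMDiffVectorBundle ω ℂ L 𝓘(ℂ)] {x y : X} {z w : ℂ}

/-- The coefficient of a section in the preferred frame at `x`. -/
noncomputable def sectionCoord (φ : HolSection L) (x : X) (z : ℂ) : ℂ :=
  (trivializationAt ℂ L x ⟨(chartAt ℂ x).symm z, φ ((chartAt ℂ x).symm z)⟩).2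

lemma graph_mem_source (φ : HolSection L) (hz : z ∈ frameDomain L x) :
    (⟨(chartAt ℂ x).symm z, φ ((chartAt ℂ x).symm z)⟩ : Bundle.TotalSpace ℂ L) ∈
      (totalChart L x).source := by
  rw [totalChart_source]; exact ⟨(chartAt ℂ x).map_target hz.1, hz.2⟩

lemma totalChart_graph (φ : HolSection L) (hz : z ∈ frameDomain L x) :
    totalChart L x ⟨(chartAt ℂ x).symm z, φ ((chartAt ℂ x).symm z)⟩ =
      (z, sectionCoord φ x z) := by
  rw [totalChart_apply (graph_mem_source φ hz)]
  exact Prod.ext ((chartAt ℂ x).right_inv hz.1) rfl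

lemma totalChart_symm_sectionCoord (φ : HolSection L) (hz : z ∈ frameDomain L x) :
    (totalChart L x).symm (z, sectionCoord φ x z) =
      ⟨(chartAt ℂ x).symm z, φ ((chartAt ℂ x).symm z)⟩ := by
  rw [← totalChart_graph φ hz, (totalChart L x).left_inv (graph_mem_source φ hz)]

lemma chart_mem_frameDomain (hz : z ∈ frameOverlap L x y) :
    chartAt ℂ y ((chartAt ℂ x).symm z) ∈ frameDomain L y :=
  HolAtlas.tr_mem_target (A := lineAtlas L) hz

lemma chart_symm_chart (hz : z ∈ frameOverlap L x y) :
    (chartAt ℂ y).symm (chartAt ℂ y ((chartAt ℂ x).symm z)) = (chartAt ℂ x).symm z :=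
  (chartAt ℂ y).left_inv hz.2.1

lemma sectionCoord_transition (φ : HolSection L) (hz : z ∈ frameOverlap L x y) :
    sectionCoord φ y (chartAt ℂ y ((chartAt ℂ x).symm z)) =
      frameChange L x y z * sectionCoord φ x z := by
  have h1 := totalChart_graph φ (chart_mem_frameDomain hz)
  rw [chart_symm_chart hz, ← totalChart_symm_sectionCoord φ hz.1, totalChart_symm_transition hz] at h1
  exact (congrArg Prod.snd h1).symm

lemma differentiableAt_sectionCoord_center (φ : HolSection L) (x : X) :
    DifferentiableAt ℂ (sectionCoord φ x) (chartAt ℂ x x) := by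
  have h1 := (contMDiffAt_iff.1 (φ.contMDiff x)).2
  rw [ModelWithCorners.range_eq_univ, contDiffWithinAt_univ] at h1
  rw [extChartAt_totalSpace] at h1
  have h2 : DifferentiableAt ℂ (fun z => totalChart L x
      ⟨(chartAt ℂ x).symm z, φ ((chartAt ℂ x).symm z)⟩) (chartAt ℂ x x) :=
    h1.differentiableAt (by simp)
  refine h2.snd.congr_of_eventuallyEq ?_
  filter_upwards [(isOpen_frameDomain x).mem_nhds (center_mem_frameDomain (L := L) x)] with z hz
  rw [totalChart_graph φ hz]

lemma differentiableOn_sectionCoord (φ : HolSection L) (x : X) :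
    DifferentiableOn ℂ (sectionCoord φ x) (frameDomain L x) := by
  intro z hz
  have ho := HermitianMetric.self_mem_frameOverlap hz
  set y := (chartAt ℂ x).symm z
  have hU : IsOpen (frameOverlap L x y) := isOpen_frameOverlap x y
  have h1 : DifferentiableAt ℂ
      (fun z => sectionCoord φ y (chartAt ℂ y ((chartAt ℂ x).symm z))) z :=
    DifferentiableAt.comp (g := sectionCoord φ y) z (differentiableAt_sectionCoord_center φ y)
      (HolAtlas.differentiableAt_tr (A := lineAtlas L) ho)
  have h2 := (differentiableOn_frameChange x y).differentiableAt (hU.mem_nhds ho)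
  refine ((h1.fun_div h2 (frameChange_ne_zero ho)).congr_of_eventuallyEq ?_).differentiableWithinAt
  filter_upwards [hU.mem_nhds ho] with v hv
  rw [sectionCoord_transition φ hv, mul_div_cancel_left₀ _ (frameChange_ne_zero hv)]

lemma sectionNormSq_eq (h : HermitianMetric L) (φ : HolSection L) (hz : z ∈ frameDomain L x) :
    h.sectionNormSq φ ((chartAt ℂ x).symm z) = ‖sectionCoord φ x z‖ ^ 2 * h.weight x z := by
  rw [HermitianMetric.sectionNormSq, h.normSq_eq (x := x) ⟨(chartAt ℂ x).map_target hz.1, hz.2⟩,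
    (chartAt ℂ x).right_inv hz.1]
  rfl

lemma contDiffOn_sectionNormSq (h : HermitianMetric L) (φ : HolSection L) (x : X) :
    ContDiffOn ℝ ∞ (fun z => h.sectionNormSq φ ((chartAt ℂ x).symm z)) (frameDomain L x) := by
  have h1 := (contDiffOn_of_differentiableOn (isOpen_frameDomain x)
    (differentiableOn_sectionCoord φ x)).norm_sq ℝ
  exact (h1.mul (h.contDiffOn_weight x)).congr fun z hz => sectionNormSq_eq h φ hz

lemma sectionNormSq_eq_zero_iff (h : HermitianMetric L) (φ : HolSection L) (p : X) :
    h.sectionNormSq φ p = 0 ↔ φ p = 0 := by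
  constructor
  · intro h0
    by_contra hne
    exact (h.normSq_pos p _ hne).ne' h0
  · intro h0
    have := h.normSq_smul 0 p 0
    rw [HermitianMetric.sectionNormSq, h0]
    simpa using this

section Kahler

variable (g : KahlerMetric X) (h : HermitianMetric L)

lemma contDiffOn_kahlerWeight (x : X) : ContDiffOn ℝ ∞ (g.weight x) (chartAt ℂ x).target := by
  have : ContMDiffVectorBundle ω ℂ (TangentSpace 𝓘(ℂ) : X → Type) 𝓘(ℂ) :=
    TangentBundle.contMDiffVectorBundle
  have h1 := g.contDiffOn_weight x
  rwa [frameDomain_tangent] at h1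

lemma kahlerWeight_pos (hz : z ∈ (chartAt ℂ x).target) : 0 < g.weight x z :=
  g.weight_pos (by rwa [frameDomain_tangent])

lemma kahlerWeight_transition (hz : z ∈ frameOverlap L x y) :
    g.weight x z = ‖deriv (fun z => chartAt ℂ y ((chartAt ℂ x).symm z)) z‖ ^ 2 *
      g.weight y (chartAt ℂ y ((chartAt ℂ x).symm z)) := by
  have hz' := frameOverlap_subset_tangent x y hz
  rw [g.weight_transition hz', frameChange_tangent hz']

lemma isDensity_kahlerWeight : (lineAtlas L).IsDensity g.weight where
  form := by
    refine ⟨fun x => ?_, fun x y z hz => ?_⟩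
    · exact Complex.ofRealCLM.contDiff.comp_contDiffOn
        ((contDiffOn_kahlerWeight g x).mono fun z hz => hz.1)
    · rw [kahlerWeight_transition g hz, zpow_one, zpow_one, mul_assoc, Complex.mul_conj,
        Complex.normSq_eq_norm_sq, lineAtlas_tr]
      push_cast; ring
  pos x z hz := kahlerWeight_pos g hz.1

variable {τ α c : ℝ} (φ : HolSection L)

/-- The logarithm of the density of the Kähler form in the preferred coordinate at `x`. -/
noncomputable def kahlerPotential (x : X) (z : ℂ) : ℂ := Real.log (g.weight x z)

/-- The logarithm of the squared norm of the preferred frame at `x`. -/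
noncomputable def hermitianPotential (x : X) (z : ℂ) : ℂ := Real.log (h.weight x z)

/-- The squared norm of a section, as a complex valued function. -/
noncomputable def sectionDensity (p : X) : ℂ := h.sectionNormSq φ p

lemma contDiffOn_hermitianPotential (x : X) :
    ContDiffOn ℝ ∞ (hermitianPotential h x) (frameDomain L x) :=
  Complex.ofRealCLM.contDiff.comp_contDiffOn
    ((h.contDiffOn_weight x).log fun _ hz => (h.weight_pos hz).ne')

lemma contDiffOn_kahlerPotential (x : X) :
    ContDiffOn ℝ ∞ (kahlerPotential g x) (chartAt ℂ x).target :=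
  Complex.ofRealCLM.contDiff.comp_contDiffOn
    ((contDiffOn_kahlerWeight g x).log fun _ hz => (kahlerWeight_pos g hz).ne')

lemma isForm_sectionDensity :
    (lineAtlas L).IsForm 0 0 ((lineAtlas L).fn (sectionDensity h φ)) :=
  HolAtlas.isForm_fn fun x =>
    Complex.ofRealCLM.contDiff.comp_contDiffOn (contDiffOn_sectionNormSq h φ x)

lemma dz_hermitianPotential_transition (hz : z ∈ frameOverlap L x y) :
    dz (hermitianPotential h x) z = deriv (frameChange L x y) z / frameChange L x y z +
      dz (hermitianPotential h y) (chartAt ℂ y ((chartAt ℂ x).symm z)) *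
        deriv (fun z => chartAt ℂ y ((chartAt ℂ x).symm z)) z :=
  dz_log_transition (f := h.weight x) (g := h.weight y) (t := frameChange L x y)
    (T := fun z => chartAt ℂ y ((chartAt ℂ x).symm z)) (isOpen_frameOverlap x y) (isOpen_frameDomain y) (h.contDiffOn_weight y)
    (fun _ => h.weight_pos) (differentiableOn_frameChange x y) (fun _ => frameChange_ne_zero)
    (HolAtlas.differentiableOn_tr (A := lineAtlas L) x y) (fun _ => chart_mem_frameDomain)
    (fun _ => h.weight_transition) hz

lemma dzb_dz_hermitianPotential_transition (hz : z ∈ frameOverlap L x y) :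
    dzb (dz (hermitianPotential h x)) z =
      dzb (dz (hermitianPotential h y)) (chartAt ℂ y ((chartAt ℂ x).symm z)) *
        (deriv (fun z => chartAt ℂ y ((chartAt ℂ x).symm z)) z *
          conj (deriv (fun z => chartAt ℂ y ((chartAt ℂ x).symm z)) z)) :=
  dzb_dz_log_transition (f := h.weight x) (g := h.weight y) (t := frameChange L x y)
    (T := fun z => chartAt ℂ y ((chartAt ℂ x).symm z)) (isOpen_frameOverlap x y) (isOpen_frameDomain y) (h.contDiffOn_weight y)
    (fun _ => h.weight_pos) (differentiableOn_frameChange x y) (fun _ => frameChange_ne_zero)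
    (HolAtlas.differentiableOn_tr (A := lineAtlas L) x y) (fun _ => chart_mem_frameDomain)
    (fun _ => h.weight_transition) hz

lemma deriv_transition_ne_zero (hz : z ∈ frameOverlap L x y) :
    deriv (fun z => chartAt ℂ y ((chartAt ℂ x).symm z)) z ≠ 0 :=
  HolAtlas.deriv_tr_ne_zero (A := lineAtlas L) hz

lemma differentiableOn_deriv_transition (x y : X) :
    DifferentiableOn ℂ (deriv fun z => chartAt ℂ y ((chartAt ℂ x).symm z)) (frameOverlap L x y) :=
  (HolAtlas.differentiableOn_tr (A := lineAtlas L) x y).deriv (isOpen_frameOverlap x y)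

lemma dz_kahlerPotential_transition (hz : z ∈ frameOverlap L x y) :
    dz (kahlerPotential g x) z =
      deriv (deriv fun z => chartAt ℂ y ((chartAt ℂ x).symm z)) z /
        deriv (fun z => chartAt ℂ y ((chartAt ℂ x).symm z)) z +
      dz (kahlerPotential g y) (chartAt ℂ y ((chartAt ℂ x).symm z)) *
        deriv (fun z => chartAt ℂ y ((chartAt ℂ x).symm z)) z :=
  dz_log_transition (f := g.weight x) (g := g.weight y)
    (t := deriv fun z => chartAt ℂ y ((chartAt ℂ x).symm z))
    (T := fun z => chartAt ℂ y ((chartAt ℂ x).symm z)) (isOpen_frameOverlap (L := L) x y) (chartAt ℂ y).open_target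
    (contDiffOn_kahlerWeight g y) (fun _ => kahlerWeight_pos g)
    (differentiableOn_deriv_transition x y) (fun _ => deriv_transition_ne_zero)
    (HolAtlas.differentiableOn_tr (A := lineAtlas L) x y) (fun _ hz => (chart_mem_frameDomain hz).1)
    (fun _ => kahlerWeight_transition g) hz

lemma dzb_dz_kahlerPotential_transition (hz : z ∈ frameOverlap L x y) :
    dzb (dz (kahlerPotential g x)) z =
      dzb (dz (kahlerPotential g y)) (chartAt ℂ y ((chartAt ℂ x).symm z)) *
        (deriv (fun z => chartAt ℂ y ((chartAt ℂ x).symm z)) z *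
          conj (deriv (fun z => chartAt ℂ y ((chartAt ℂ x).symm z)) z)) :=
  dzb_dz_log_transition (f := g.weight x) (g := g.weight y)
    (t := deriv fun z => chartAt ℂ y ((chartAt ℂ x).symm z))
    (T := fun z => chartAt ℂ y ((chartAt ℂ x).symm z)) (isOpen_frameOverlap (L := L) x y) (chartAt ℂ y).open_target
    (contDiffOn_kahlerWeight g y) (fun _ => kahlerWeight_pos g)
    (differentiableOn_deriv_transition x y) (fun _ => deriv_transition_ne_zero)
    (HolAtlas.differentiableOn_tr (A := lineAtlas L) x y) (fun _ hz => (chart_mem_frameDomain hz).1)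
    (fun _ => kahlerWeight_transition g) hz

section Equations

variable {g h φ} (H : IsGravitatingVortex τ α c φ g h)
include H

lemma vortex_eq_center (x : X) : dzb (dz (hermitianPotential h x)) (chartAt ℂ x x) =
    -(1 / 4) * (g.weight x (chartAt ℂ x x) : ℂ) * (τ - sectionDensity h φ x) := by
  have h1 := laplacian_eq_dzb_dz (isOpen_frameDomain x)
    ((h.contDiffOn_weight x).log fun _ hz => (h.weight_pos hz).ne')
    (center_mem_frameDomain (L := L) x)
  have h2 := (H x).1
  have hpos : 0 < g.weight x (chartAt ℂ x x) := kahlerWeight_pos g (mem_chart_target ℂ x)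
  rw [contractedCurvature, HermitianMetric.curvature, density] at h2
  have h3 : Laplacian.laplacian (fun z => Real.log (h.weight x z)) (chartAt ℂ x x) =
      -(g.weight x (chartAt ℂ x x) * (τ - h.sectionNormSq φ x)) := by
    field_simp at h2
    linarith
  rw [h3] at h1
  change _ = 4 * dzb (dz (hermitianPotential h x)) _ at h1
  push_cast at h1
  rw [sectionDensity]
  linear_combination (-1 / 4) * h1

lemma gravity_eq_center (x : X) : dzb (dz (kahlerPotential g x)) (chartAt ℂ x x) =
    -2 * α * dzb (dz ((lineAtlas L).fn (sectionDensity h φ) x)) (chartAt ℂ x x)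
      - 1 / 2 * α * τ * (g.weight x (chartAt ℂ x x) : ℂ) * (τ - sectionDensity h φ x)
      - c / 2 * (g.weight x (chartAt ℂ x x) : ℂ) := by
  have hc := center_mem_frameDomain (L := L) x
  have h1 := laplacian_eq_dzb_dz (isOpen_frameDomain (L := L) x)
    ((contDiffOn_sectionNormSq h φ x).sub (contDiffOn_const (c := τ))) hc
  have h2 := laplacian_eq_dzb_dz (chartAt ℂ x).open_target
    ((contDiffOn_kahlerWeight g x).log fun _ hz => (kahlerWeight_pos g hz).ne')
    (mem_chart_target ℂ x)
  have hpos : 0 < g.weight x (chartAt ℂ x x) := kahlerWeight_pos g (mem_chart_target ℂ x)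
  have h3 := (H x).2
  rw [scalarCurvature, kahlerLaplacian, density] at h3
  have h4 : dz (fun z => ((h.sectionNormSq φ ((chartAt ℂ x).symm z) - τ : ℝ) : ℂ)) =ᶠ[𝓝 (chartAt ℂ x x)]
      dz ((lineAtlas L).fn (sectionDensity h φ) x) := by
    filter_upwards [(isOpen_frameDomain x).mem_nhds hc] with z hz
    have e : ∀ w ∈ frameDomain L x, ((h.sectionNormSq φ ((chartAt ℂ x).symm w) - τ : ℝ) : ℂ) =
        (lineAtlas L).fn (sectionDensity h φ) x w - τ := fun w _ => by
      push_cast; rfl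
    rw [dz_congr (isOpen_frameDomain x) e hz,
      dz_sub ((isForm_sectionDensity h φ).differentiableAt hz) (differentiableAt_const _),
      dz_const, sub_zero]
  have h5 : dzb (dz fun z => ((h.sectionNormSq φ ((chartAt ℂ x).symm z) - τ : ℝ) : ℂ)) (chartAt ℂ x x) =
      dzb (dz ((lineAtlas L).fn (sectionDensity h φ) x)) (chartAt ℂ x x) := Filter.EventuallyEq.dzb_eq h4
  rw [h5] at h1
  change _ = 4 * dzb (dz (kahlerPotential g x)) _ at h2
  set l₁ := Laplacian.laplacian (fun z => Real.log (g.weight x z)) (chartAt ℂ x x)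
  set l₂ := Laplacian.laplacian (fun z => h.sectionNormSq φ ((chartAt ℂ x).symm z) - τ)
    (chartAt ℂ x x)
  have h6 : l₁ = -2 * α * l₂ - 2 * α * τ * g.weight x (chartAt ℂ x x) * (τ - h.sectionNormSq φ x)
      - 2 * c * g.weight x (chartAt ℂ x x) := by
    field_simp at h3
    linarith
  rw [sectionDensity]
  have h7 : (l₁ : ℂ) = -2 * α * l₂ - 2 * α * τ * g.weight x (chartAt ℂ x x) *
      (τ - h.sectionNormSq φ x) - 2 * c * g.weight x (chartAt ℂ x x) := by
    rw [h6]; push_cast; ring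
  change (l₂ : ℂ) = _ at h1
  rw [h1, h2] at h7
  linear_combination (1 / 4) * h7

theorem localVortex (x : X) : LocalVortex τ α c (frameDomain L x) (fun z => (g.weight x z : ℂ))
    (kahlerPotential g x) (sectionCoord φ x) (hermitianPotential h x)
    ((lineAtlas L).fn (sectionDensity h φ) x) where
  isOpen := isOpen_frameDomain x
  smooth_rho := ((isDensity_kahlerWeight (L := L) g).form.smooth x)
  smooth_lam := (contDiffOn_kahlerPotential g x).mono fun _ hz => hz.1
  hol_phi := differentiableOn_sectionCoord φ x
  smooth_psi := contDiffOn_hermitianPotential h x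
  rho_eq z hz := by
    rw [kahlerPotential, ← Complex.ofReal_exp, Real.exp_log (kahlerWeight_pos g hz.1)]
  conj_lam z hz := Complex.conj_ofReal _
  conj_psi z hz := Complex.conj_ofReal _
  u_eq z hz := by
    change ((h.sectionNormSq φ ((chartAt ℂ x).symm z) : ℝ) : ℂ) = _
    rw [sectionNormSq_eq h φ hz, hermitianPotential, ← Complex.ofReal_exp,
      Real.exp_log (h.weight_pos hz), Complex.mul_conj, Complex.normSq_eq_norm_sq]
    push_cast; ring
  eq_vortex z hz := by
    have ho := HermitianMetric.self_mem_frameOverlap hz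
    rw [dzb_dz_hermitianPotential_transition h ho, vortex_eq_center H, kahlerWeight_transition g ho]
    change _ = _ * _ * (τ - sectionDensity h φ ((chartAt ℂ x).symm z))
    push_cast
    rw [← Complex.conj_mul']
    ring
  eq_gravity z hz := by
    have ho := HermitianMetric.self_mem_frameOverlap hz
    have h1 := (isForm_sectionDensity h φ).dz.dzb.trans x ((chartAt ℂ x).symm z) z ho
    rw [dzb_dz_kahlerPotential_transition g ho, gravity_eq_center H, kahlerWeight_transition g ho,
      h1, zpow_one, zpow_one]
    change _ = _ - _ * _ * (τ - sectionDensity h φ ((chartAt ℂ x).symm z)) - _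
    rw [lineAtlas_tr]
    push_cast
    rw [← Complex.conj_mul']
    ring

end Equations

lemma exists_eq_zero_of_divisorDegree (hdeg : 0 < divisorDegree φ) : ∃ p, φ p = 0 := by
  by_contra! hne
  have : ∀ x, vanishingOrder φ x = 0 := by
    intro x
    by_contra h0
    have h1 : sectionCoord φ x (chartAt ℂ x x) = 0 := by
      have han : AnalyticAt ℂ (sectionCoord φ x) (chartAt ℂ x x) :=
        (differentiableOn_sectionCoord φ x).analyticAt
          ((isOpen_frameDomain x).mem_nhds (center_mem_frameDomain x))
      have h2 : analyticOrderAt (sectionCoord φ x) (chartAt ℂ x x) ≠ 0 := by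
        intro h3
        apply h0
        change (analyticOrderAt (sectionCoord φ x) (chartAt ℂ x x)).toNat = 0
        rw [h3]; rfl
      exact han.analyticOrderAt_ne_zero.1 h2
    have h2 := totalChart_symm_sectionCoord φ (center_mem_frameDomain (L := L) x)
    rw [h1, totalChart_symm_apply (center_mem_frameDomain x),
      (chartAt ℂ x).left_inv (mem_chart_source ℂ x),
      trivializationAt_symm_eq_smul (FiberBundle.mem_baseSet_trivializationAt' x), zero_smul] at h2
    exact hne x (by simpa using h2.symm)
  rw [divisorDegree, finsum_congr this, finsum_zero] at hdeg
  exact lt_irrefl _ hdeg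

theorem isVortex (H : IsGravitatingVortex τ α c φ g h) (hdeg : 0 < divisorDegree φ) :
    (lineAtlas L).IsVortex τ α c g.weight (kahlerPotential g) (sectionCoord φ)
      (hermitianPotential h) (sectionDensity h φ) where
  density := isDensity_kahlerWeight g
  loc := localVortex H
  exists_zero := by
    obtain ⟨p, hp⟩ := exists_eq_zero_of_divisorDegree φ hdeg
    exact ⟨p, by rw [sectionDensity, (sectionNormSq_eq_zero_iff h φ p).2 hp, Complex.ofReal_zero]⟩

lemma exists_sectionDensity_ne_zero (hφ : φ ≠ 0) : ∃ p, sectionDensity h φ p ≠ 0 := by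
  by_contra! h0
  apply hφ
  ext p
  exact (sectionNormSq_eq_zero_iff h φ p).1 (Complex.ofReal_eq_zero.1 (h0 p))

end Kahler

end

section
variable {E H M E' H' M' : Type*} [NormedAddCommGroup E] [NormedSpace ℂ E] [CompleteSpace E]
  [TopologicalSpace H] {I : ModelWithCorners ℂ E H} [I.Boundaryless]
  [TopologicalSpace M] [ChartedSpace H M] [IsManifold I ω M]
  [NormedAddCommGroup E'] [NormedSpace ℂ E'] [CompleteSpace E'] [TopologicalSpace H']
  {I' : ModelWithCorners ℂ E' H'} [I'.Boundaryless]
  [TopologicalSpace M'] [ChartedSpace H' M'] [IsManifold I' ω M']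

/-- Vector fields that are related by a map at a point have related coordinate expressions. -/
lemma chartField_related {f : M → M'} {V : Π x : M, TangentSpace I x}
    {V' : Π x : M', TangentSpace I' x} {x₀ : M} {x₁ : M'} {z : E}
    (hz : z ∈ (extChartAt I x₀).target)
    (hf : MDifferentiableAt I I' f ((extChartAt I x₀).symm z))
    (hs : f ((extChartAt I x₀).symm z) ∈ (extChartAt I' x₁).source)
    (hV : V' (f ((extChartAt I x₀).symm z)) =
      mfderiv I I' f ((extChartAt I x₀).symm z) (V ((extChartAt I x₀).symm z))) :
    chartField V' x₁ (extChartAt I' x₁ (f ((extChartAt I x₀).symm z))) =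
      fderiv ℂ (extChartAt I' x₁ ∘ f ∘ (extChartAt I x₀).symm) z (chartField V x₀ z) := by
  set e := extChartAt I x₀ with he
  set e' := extChartAt I' x₁ with he'
  set q := e.symm z with hq
  set F : E → E' := e' ∘ f ∘ e.symm with hF
  have hqs : q ∈ e.source := e.map_target hz
  have hy1 : q ∈ (chartAt H x₀).source := by simpa [e] using hqs
  have hy2 : f q ∈ (chartAt H' x₁).source := by simpa [e'] using hs
  have hed : MDifferentiableAt I 𝓘(ℂ, E) e q := mdifferentiableAt_extChartAt hy1
  have hed' : MDifferentiableAt I' 𝓘(ℂ, E') e' (f q) := mdifferentiableAt_extChartAt hy2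
  have heq : e q = z := e.right_inv hz
  have hesd : MDifferentiableAt 𝓘(ℂ, E) I e.symm (e q) := by
    have := mdifferentiableWithinAt_extChartAt_symm (I := I) (x := x₀) (e.map_source hqs)
    rwa [I.range_eq_univ, mdifferentiableWithinAt_univ] at this
  have hFd : MDifferentiableAt 𝓘(ℂ, E) 𝓘(ℂ, E') F (e q) := by
    have h1 : MDifferentiableAt 𝓘(ℂ, E) I' (f ∘ e.symm) (e q) := by
      refine MDifferentiableAt.comp (e q) ?_ hesd
      rw [e.left_inv hqs]; exact hf
    refine MDifferentiableAt.comp (g := e') (I' := I') (e q) ?_ h1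
    simp only [Function.comp_apply, e.left_inv hqs]
    exact hed'
  have hEq : F ∘ e =ᶠ[𝓝 q] e' ∘ f := by
    have : e.source ∈ 𝓝 q := by
      simpa [e] using (chartAt H x₀).open_source.mem_nhds hy1
    filter_upwards [this] with p hp
    simp [F, e.left_inv hp]
  have hchain : ∀ t : TangentSpace I q, fderiv ℂ F (e q) (mfderiv I 𝓘(ℂ, E) e q t) =
      mfderiv I' 𝓘(ℂ, E') e' (f q) (mfderiv I I' f q t) := by
    intro t
    have hc1 : mfderiv I 𝓘(ℂ, E') (F ∘ e) q t = fderiv ℂ F (e q) (mfderiv I 𝓘(ℂ, E) e q t) := by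
      rw [mfderiv_comp q hFd hed, mfderiv_eq_fderiv]
      rfl
    have hc2 : mfderiv I 𝓘(ℂ, E') (e' ∘ f) q t =
        mfderiv I' 𝓘(ℂ, E') e' (f q) (mfderiv I I' f q t) := by
      rw [mfderiv_comp q hed' hf]
      rfl
    have hc3 : (mfderiv I 𝓘(ℂ, E') (F ∘ e) q : E →L[ℂ] E') = mfderiv I 𝓘(ℂ, E') (e' ∘ f) q :=
      hEq.mfderiv_eq
    exact hc1.symm.trans ((congrArg (fun T : E →L[ℂ] E' => T t) hc3).trans hc2)
  have h1 := chartField_eq V' x₁ (e'.map_source hs)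
  have h2 := chartField_eq V x₀ hz
  refine h1.trans ?_
  refine Eq.trans ?_ (congrArg (fderiv ℂ F z) h2).symm
  let G : M' → E' := fun y => mfderiv I' 𝓘(ℂ, E') e' y (V' y)
  have h4 : G (e'.symm (e' (f q))) = G (f q) := by rw [e'.left_inv hs]
  refine h4.trans ?_
  have h5 := hchain (V q)
  rw [heq] at h5
  refine Eq.trans ?_ h5.symm
  change mfderiv I' 𝓘(ℂ, E') e' (f q) (V' (f q)) = _
  rw [hV]

lemma chartField_transition (V : Π x : M, TangentSpace I x) {x₀ x₁ : M} {z : E}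
    (hz : z ∈ (extChartAt I x₀).target)
    (hs : (extChartAt I x₀).symm z ∈ (extChartAt I x₁).source) :
    chartField V x₁ (extChartAt I x₁ ((extChartAt I x₀).symm z)) =
      fderiv ℂ (extChartAt I x₁ ∘ (extChartAt I x₀).symm) z (chartField V x₀ z) := by
  refine chartField_related (f := id) hz mdifferentiableAt_id hs ?_
  rw [mfderiv_id]; rfl

lemma chartField_self (V : Π x : M, TangentSpace I x) (x : M) :
    chartField V x (extChartAt I x x) = V x := by
  have h1 := chartField_eq V x (mem_extChartAt_target (I := I) x)
  refine h1.trans ?_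
  let G : M → E := fun y => mfderiv I 𝓘(ℂ, E) (extChartAt I x) y (V y)
  have h4 : G ((extChartAt I x).symm (extChartAt I x x)) = G x := by rw [extChartAt_to_inv]
  refine h4.trans ?_
  change mfderiv I 𝓘(ℂ, E) (extChartAt I x) x (V x) = V x
  rw [mfderiv_extChartAt_self]
  rfl

lemma HolVectorField.differentiableAt_chartField (V : HolVectorField I M) {x₀ : M} {z : E}
    (hz : z ∈ (extChartAt I x₀).target) : DifferentiableAt ℂ (chartField V x₀) z := by
  set q := (extChartAt I x₀).symm z with hq
  have hqs : q ∈ (extChartAt I x₀).source := (extChartAt I x₀).map_target hz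
  set e := extChartAt I q
  set F := e ∘ (extChartAt I x₀).symm
  set G := extChartAt I x₀ ∘ e.symm
  have hFz : F z = e q := rfl
  have hF : ContDiffAt ℂ ω F z := by
    have h := contDiffWithinAt_ext_coord_change (I := I) (n := ω) q x₀ (y := z) (by
      rw [PartialEquiv.trans_source]; exact ⟨hz, mem_extChartAt_source (I := I) q⟩)
    rwa [I.range_eq_univ, contDiffWithinAt_univ] at h
  have hG : ContDiffAt ℂ ω G (F z) := by
    have h := contDiffWithinAt_ext_coord_change (I := I) (n := ω) x₀ q (y := e q) (by
      rw [PartialEquiv.trans_source]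
      refine ⟨mem_extChartAt_target (I := I) q, ?_⟩
      rw [Set.mem_preimage, extChartAt_to_inv]; exact hqs)
    rwa [I.range_eq_univ, contDiffWithinAt_univ] at h
  have hV : DifferentiableAt ℂ (chartField V q) (F z) :=
    GravVortex.differentiableAt_chartField (V.mdifferentiableAt q)
  have hG2 : DifferentiableAt ℂ (fderiv ℂ G) (F z) :=
    (hG.fderiv_right (m := 1) (by simp)).differentiableAt (by simp)
  have hFd : DifferentiableAt ℂ F z := hF.differentiableAt (by simp)
  have h1 : DifferentiableAt ℂ (fun v => fderiv ℂ G (F v) (chartField V q (F v))) z :=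
    DifferentiableAt.comp (g := fun v => fderiv ℂ G v (chartField V q v)) z (hG2.clm_apply hV) hFd
  refine h1.congr_of_eventuallyEq ?_
  have hU : ∀ᶠ v in 𝓝 z, v ∈ (extChartAt I x₀).target ∧ (extChartAt I x₀).symm v ∈ e.source := by
    refine Filter.Eventually.and ((isOpen_extChartAt_target x₀).mem_nhds hz) ?_
    have h2 : ContinuousAt (extChartAt I x₀).symm z := continuousAt_extChartAt_symm'' hz
    exact h2.eventually (extChartAt_source_mem_nhds (I := I) q)
  filter_upwards [hU] with v hv
  have h3 : e.symm (F v) = (extChartAt I x₀).symm v := e.left_inv hv.2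
  have h4 := chartField_transition V (x₀ := q) (x₁ := x₀) (z := F v) (e.map_source hv.2)
    (by rw [h3]; exact (extChartAt I x₀).map_target hv.1)
  rw [h3, (extChartAt I x₀).right_inv hv.1] at h4
  exact h4

end

lemma hasFDerivAt_skew_product {T t : ℂ → ℂ} {T' t' z : ℂ} (w : ℂ) (hT : HasDerivAt T T' z)
    (ht : HasDerivAt t t' z) :
    HasFDerivAt (fun q : ℂ × ℂ => (T q.1, t q.1 * q.2))
      ((T' • ContinuousLinearMap.fst ℂ ℂ ℂ).prod
        (t z • ContinuousLinearMap.snd ℂ ℂ ℂ + w • (t' • ContinuousLinearMap.fst ℂ ℂ ℂ))) (z, w) := by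
  have h1 : HasFDerivAt (fun q : ℂ × ℂ => T q.1) (T' • ContinuousLinearMap.fst ℂ ℂ ℂ) (z, w) :=
    HasDerivAt.comp_hasFDerivAt (f := fun q : ℂ × ℂ => q.1) (z, w) hT hasFDerivAt_fst
  have h2 : HasFDerivAt (fun q : ℂ × ℂ => t q.1) (t' • ContinuousLinearMap.fst ℂ ℂ ℂ) (z, w) :=
    HasDerivAt.comp_hasFDerivAt (f := fun q : ℂ × ℂ => q.1) (z, w) ht hasFDerivAt_fst
  exact h1.prodMk (h2.mul hasFDerivAt_snd)

section

variable {X : Type*} [TopologicalSpace X] [ChartedSpace ℂ X] [IsManifold 𝓘(ℂ) ω X]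
  {L : X → Type*} [TopologicalSpace (Bundle.TotalSpace ℂ L)]
  [∀ x, TopologicalSpace (L x)] [∀ x, AddCommGroup (L x)] [∀ x, Module ℂ (L x)]
  [FiberBundle ℂ L] [VectorBundle ℂ ℂ L] [ContMDiffVectorBundle ω ℂ L 𝓘(ℂ)] {x x₁ : X} {z w : ℂ}
  {φ : HolSection L} {y y₁ : HolVectorField totalModel (Bundle.TotalSpace ℂ L)}

/-- The coordinate expression of a vector field on the total space. -/
noncomputable abbrev totalField (y : HolVectorField totalModel (Bundle.TotalSpace ℂ L)) (x : X) :
    ℂ × ℂ → ℂ × ℂ :=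
  chartField y (⟨x, 0⟩ : Bundle.TotalSpace ℂ L)

/-- The horizontal coefficient of an invariant vector field. -/
noncomputable def fieldA (y : HolVectorField totalModel (Bundle.TotalSpace ℂ L)) (x : X) (z : ℂ) : ℂ :=
  (totalField y x (z, 1)).1

/-- The vertical coefficient of an invariant vector field. -/
noncomputable def fieldB (y : HolVectorField totalModel (Bundle.TotalSpace ℂ L)) (x : X) (z : ℂ) : ℂ :=
  (totalField y x (z, 1)).2

lemma differentiableAt_totalField (hz : z ∈ frameDomain L x) :
    DifferentiableAt ℂ (totalField y x) (z, w) :=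
  y.differentiableAt_chartField (mk_mem_totalChart_target hz)

lemma differentiableOn_fieldA (x : X) : DifferentiableOn ℂ (fieldA y x) (frameDomain L x) :=
  fun z hz => (DifferentiableAt.fst (DifferentiableAt.comp (g := totalField y x)
    (f := fun z => (z, (1 : ℂ))) z (differentiableAt_totalField hz)
    (differentiableAt_fun_id.prodMk (differentiableAt_const (1 : ℂ))))).differentiableWithinAt

lemma differentiableOn_fieldB (x : X) : DifferentiableOn ℂ (fieldB y x) (frameDomain L x) :=
  fun z hz => (DifferentiableAt.snd (DifferentiableAt.comp (g := totalField y x)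
    (f := fun z => (z, (1 : ℂ))) z (differentiableAt_totalField hz)
    (differentiableAt_fun_id.prodMk (differentiableAt_const (1 : ℂ))))).differentiableWithinAt

lemma eventually_mem_frameDomain_prod (hz : z ∈ frameDomain L x) :
    ∀ᶠ q : ℂ × ℂ in 𝓝 (z, w), q.1 ∈ frameDomain L x :=
  continuousAt_fst.eventually ((isOpen_frameDomain x).mem_nhds hz)

lemma totalField_fiberScale (hy : y ∈ lieAutPair L) (hz : z ∈ frameDomain L x) (c : ℂˣ) :
    totalField y x (z, c * w) = ((totalField y x (z, w)).1, c * (totalField y x (z, w)).2) := by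
  have hform : ∀ q : ℂ × ℂ, q.1 ∈ frameDomain L x →
      totalChart L x (fiberScale (c : ℂ) ((totalChart L x).symm q)) = (q.1, c * q.2) := by
    rintro ⟨z, w⟩ hz
    have h1 : fiberScale (c : ℂ) ((totalChart L x).symm (z, w)) =
        (totalChart L x).symm (z, c * w) := by
      rw [totalChart_symm_apply hz, totalChart_symm_apply hz, fiberScale]
      simp only [Bundle.TotalSpace.mk.injEq, heq_eq_eq, true_and]
      rw [trivializationAt_symm_eq_smul hz.2 w, trivializationAt_symm_eq_smul hz.2 (c * w), smul_smul]
    rw [h1]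
    exact (totalChart L x).right_inv (mk_mem_totalChart_target hz)
  have hs : fiberScale (c : ℂ) ((totalChart L x).symm (z, w)) ∈ (totalChart L x).source := by
    rw [totalChart_source, totalChart_symm_apply hz]
    exact ⟨(chartAt ℂ x).map_target hz.1, hz.2⟩
  have h1 := chartField_related (V := fun p => y p) (V' := fun p => y p)
    (f := fiberScale (L := L) (c : ℂ)) (mk_mem_totalChart_target (w := w) hz)
    ((contMDiff_fiberScale (c : ℂ)).mdifferentiableAt (by simp)) hs (hy c _)
  rw [hform _ hz] at h1
  refine h1.trans ?_
  have h2 : HasFDerivAt (fun q : ℂ × ℂ => (q.1, (c : ℂ) * q.2))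
      ((ContinuousLinearMap.fst ℂ ℂ ℂ).prod ((c : ℂ) • ContinuousLinearMap.snd ℂ ℂ ℂ)) (z, w) :=
    hasFDerivAt_fst.prodMk (hasFDerivAt_snd.const_mul (c : ℂ))
  have h3 : totalChart L x ∘ fiberScale (c : ℂ) ∘ (totalChart L x).symm =ᶠ[𝓝 (z, w)]
      fun q : ℂ × ℂ => (q.1, (c : ℂ) * q.2) := by
    filter_upwards [eventually_mem_frameDomain_prod hz] with q hq
    exact hform q hq
  rw [h3.fderiv_eq, h2.fderiv]
  rfl

/-- An invariant vector field is `a ∂_z + b w ∂_w` in coordinates. -/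
lemma totalField_eq (hy : y ∈ lieAutPair L) (hz : z ∈ frameDomain L x) (w : ℂ) :
    totalField y x (z, w) = (fieldA y x z, fieldB y x z * w) := by
  have hne : ∀ w : ℂ, w ≠ 0 → totalField y x (z, w) = (fieldA y x z, fieldB y x z * w) := by
    intro w hw
    have h1 := totalField_fiberScale (w := 1) hy hz (Units.mk0 w hw)
    rw [Units.val_mk0, mul_one, mul_comm w] at h1
    exact h1
  by_cases hw : w = 0
  · subst hw
    have h1 : ContinuousAt (fun w => totalField y x (z, w)) 0 :=
      ContinuousAt.comp (g := totalField y x) (f := fun w : ℂ => (z, w))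
        (differentiableAt_totalField hz).continuousAt (by fun_prop)
    have h2 : ContinuousAt (fun w => (fieldA y x z, fieldB y x z * w)) (0 : ℂ) := by fun_prop
    have h3 := h1.tendsto.mono_left (nhdsWithin_le_nhds (s := {0}ᶜ))
    have h4 := h2.tendsto.mono_left (nhdsWithin_le_nhds (s := {0}ᶜ))
    refine tendsto_nhds_unique (h3.congr' ?_) h4
    filter_upwards [self_mem_nhdsWithin] with w hw
    exact hne w hw
  · exact hne w hw

lemma totalField_transition (hz : z ∈ frameOverlap L x x₁) :
    totalField y x₁ (chartAt ℂ x₁ ((chartAt ℂ x).symm z), frameChange L x x₁ z * w) =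
      (deriv (fun z => chartAt ℂ x₁ ((chartAt ℂ x).symm z)) z * (totalField y x (z, w)).1,
        deriv (frameChange L x x₁) z * (totalField y x (z, w)).1 * w +
          frameChange L x x₁ z * (totalField y x (z, w)).2) := by
  have h1 := chartField_transition (fun p => y p) (mk_mem_totalChart_target (w := w) hz.1)
    (symm_mem_totalChart_source (w := w) hz)
  rw [totalChart_symm_transition hz] at h1
  refine h1.trans ?_
  have hU := (isOpen_frameOverlap (L := L) x x₁).mem_nhds hz
  have hT := (HolAtlas.differentiableAt_tr (A := lineAtlas L) hz).hasDerivAt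
  rw [lineAtlas_tr] at hT
  have ht := ((differentiableOn_frameChange (L := L) x x₁).differentiableAt hU).hasDerivAt
  have h2 := hasFDerivAt_skew_product w hT ht
  have h3 : totalChart L x₁ ∘ (totalChart L x).symm =ᶠ[𝓝 (z, w)]
      fun q : ℂ × ℂ => (chartAt ℂ x₁ ((chartAt ℂ x).symm q.1), frameChange L x x₁ q.1 * q.2) := by
    filter_upwards [continuousAt_fst.eventually hU] with q hq
    exact totalChart_symm_transition hq
  rw [h3.fderiv_eq, h2.fderiv]
  refine Prod.ext rfl ?_
  simp only [ContinuousLinearMap.prod_apply, add_apply, smul_apply,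
    ContinuousLinearMap.coe_fst', ContinuousLinearMap.coe_snd', smul_eq_mul]
  ring

lemma fieldA_transition (hy : y ∈ lieAutPair L) (hz : z ∈ frameOverlap L x x₁) :
    fieldA y x₁ (chartAt ℂ x₁ ((chartAt ℂ x).symm z)) =
      deriv (fun z => chartAt ℂ x₁ ((chartAt ℂ x).symm z)) z * fieldA y x z := by
  have h1 := totalField_transition (y := y) (w := 1) hz
  rw [totalField_eq hy (chart_mem_frameDomain hz)] at h1
  exact congrArg Prod.fst h1

lemma fieldB_transition (hy : y ∈ lieAutPair L) (hz : z ∈ frameOverlap L x x₁) :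
    fieldB y x₁ (chartAt ℂ x₁ ((chartAt ℂ x).symm z)) =
      deriv (frameChange L x x₁) z / frameChange L x x₁ z * fieldA y x z + fieldB y x z := by
  have h1 := totalField_transition (y := y) (w := 1) hz
  rw [totalField_eq hy (chart_mem_frameDomain hz)] at h1
  have h2 := congrArg Prod.snd h1
  have h3 := frameChange_ne_zero hz
  simp only [mul_one] at h2
  change _ = deriv (frameChange L x x₁) z * fieldA y x z + frameChange L x x₁ z * fieldB y x z at h2
  field_simp
  linear_combination h2

lemma apply_eq_of_mem_lieAutPair (hy : y ∈ lieAutPair L) (p : Bundle.TotalSpace ℂ L) :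
    y p = ((fieldA y p.1 (chartAt ℂ p.1 p.1),
      fieldB y p.1 (chartAt ℂ p.1 p.1) * (trivializationAt ℂ L p.1 p).2) : ℂ × ℂ) := by
  have h1 := chartField_self (fun p => y p) p
  refine h1.symm.trans ?_
  have hc := center_mem_frameDomain (L := L) p.1
  rw [← totalField_eq hy hc]
  have h2 : totalChart L p.1 p = (chartAt ℂ p.1 p.1, (trivializationAt ℂ L p.1 p).2) :=
    totalChart_apply (by
      rw [totalChart_source]
      exact ⟨mem_chart_source ℂ _, FiberBundle.mem_baseSet_trivializationAt' _⟩)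
  rw [extChartAt_totalSpace, h2]
  change chartField _ _ _ = chartField _ _ _
  unfold chartField
  rw [extChartAt_totalSpace]

lemma isForm_fieldA (hy : y ∈ lieAutPair L) : (lineAtlas L).IsForm (-1) 0 (fieldA y) where
  smooth x := contDiffOn_of_differentiableOn (isOpen_frameDomain x) (differentiableOn_fieldA x)
  trans x x₁ z hz := by
    have h := deriv_transition_ne_zero (L := L) hz
    rw [lineAtlas_tr, fieldA_transition hy hz, zpow_zero, zpow_neg_one, mul_one]
    field_simp

lemma chartField_coveredField (hy : y ∈ lieAutPair L) (hz : z ∈ frameDomain L x) :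
    chartField (coveredField y) x z = fieldA y x z := by
  have hp : (Bundle.TotalSpace.proj ((totalChart L x).symm (z, (0 : ℂ))) : X) =
      (chartAt ℂ x).symm z := by rw [totalChart_symm_apply hz]
  have h0 : ∀ p : Bundle.TotalSpace ℂ L, p.2 = 0 → coveredField y p.1 =
      mfderiv totalModel 𝓘(ℂ) (Bundle.TotalSpace.proj : Bundle.TotalSpace ℂ L → X) p (y p) := by
    rintro ⟨q, v⟩ hv
    change v = 0 at hv
    subst hv; rfl
  have h1 := chartField_related (V := fun p => y p) (V' := coveredField y) (x₁ := x)
    (f := (Bundle.TotalSpace.proj : Bundle.TotalSpace ℂ L → X))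
    (mk_mem_totalChart_target (w := 0) hz)
    ((Bundle.contMDiff_proj (n := ω) (IB := 𝓘(ℂ)) L).mdifferentiableAt (by simp))
    (by rw [hp]; simpa using (chartAt ℂ x).map_target hz.1)
    (h0 _ (by
      rw [totalChart_symm_apply hz]
      change (trivializationAt ℂ L x).symm _ (0 : ℂ) = 0
      rw [trivializationAt_symm_eq_smul hz.2, zero_smul]))
  rw [hp] at h1
  have h2 : extChartAt 𝓘(ℂ) x ((chartAt ℂ x).symm z) = z := (chartAt ℂ x).right_inv hz.1
  rw [h2] at h1
  refine h1.trans ?_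
  have h3 : extChartAt 𝓘(ℂ) x ∘ (Bundle.TotalSpace.proj : Bundle.TotalSpace ℂ L → X) ∘
      (totalChart L x).symm =ᶠ[𝓝 (z, (0 : ℂ))] Prod.fst := by
    filter_upwards [eventually_mem_frameDomain_prod hz] with q hq
    simp only [Function.comp_apply]
    rw [← Prod.mk.eta (p := q), totalChart_symm_apply hq]
    exact (chartAt ℂ x).right_inv hq.1
  rw [h3.fderiv_eq, fderiv_fst]
  change (totalField y x (z, 0)).1 = _
  rw [totalField_eq hy hz]

lemma chartField_projAlong (hy : y ∈ lieAutPair L) (hz : z ∈ frameDomain L x) :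
    chartField (projAlong φ y) x z = fieldA y x z := by
  have hp : (Bundle.TotalSpace.proj ((totalChart L x).symm (z, sectionCoord φ x z)) : X) =
      (chartAt ℂ x).symm z := by rw [totalChart_symm_apply hz]
  have h0 : ∀ p : Bundle.TotalSpace ℂ L, p.2 = φ p.1 → projAlong φ y p.1 =
      mfderiv totalModel 𝓘(ℂ) (Bundle.TotalSpace.proj : Bundle.TotalSpace ℂ L → X) p (y p) := by
    rintro ⟨q, v⟩ hv
    change v = φ q at hv
    subst hv; rfl
  have h1 := chartField_related (V := fun p => y p) (V' := projAlong φ y) (x₁ := x)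
    (f := (Bundle.TotalSpace.proj : Bundle.TotalSpace ℂ L → X))
    (mk_mem_totalChart_target (w := sectionCoord φ x z) hz)
    ((Bundle.contMDiff_proj (n := ω) (IB := 𝓘(ℂ)) L).mdifferentiableAt (by simp))
    (by rw [hp]; simpa using (chartAt ℂ x).map_target hz.1)
    (h0 _ (by rw [totalChart_symm_sectionCoord φ hz]))
  rw [hp] at h1
  have h2 : extChartAt 𝓘(ℂ) x ((chartAt ℂ x).symm z) = z := (chartAt ℂ x).right_inv hz.1
  rw [h2] at h1
  refine h1.trans ?_
  have h3 : extChartAt 𝓘(ℂ) x ∘ (Bundle.TotalSpace.proj : Bundle.TotalSpace ℂ L → X) ∘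
      (totalChart L x).symm =ᶠ[𝓝 (z, sectionCoord φ x z)] Prod.fst := by
    filter_upwards [eventually_mem_frameDomain_prod hz] with q hq
    simp only [Function.comp_apply]
    rw [← Prod.mk.eta (p := q), totalChart_symm_apply hq]
    exact (chartAt ℂ x).right_inv hq.1
  rw [h3.fderiv_eq, fderiv_fst]
  change (totalField y x (z, sectionCoord φ x z)).1 = _
  rw [totalField_eq hy hz]

/-- The coordinate form of the invariance of the section. -/
lemma fieldB_mul_sectionCoord (hy : y ∈ lieAutTriple φ) (hz : z ∈ frameDomain L x) :
    fieldB y x z * sectionCoord φ x z = fieldA y x z * deriv (sectionCoord φ x) z := by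
  have h1 := chartField_related (V := projAlong φ y) (V' := fun p => y p)
    (x₁ := (⟨x, 0⟩ : Bundle.TotalSpace ℂ L)) (x₀ := x) (z := z)
    (f := fun x' => (⟨x', φ x'⟩ : Bundle.TotalSpace ℂ L)) (by simpa using hz.1)
    ((φ.contMDiff _).mdifferentiableAt (by simp)) (graph_mem_source φ hz) (hy.2 _)
  have h2 : totalChart L x ⟨(extChartAt 𝓘(ℂ) x).symm z, φ ((extChartAt 𝓘(ℂ) x).symm z)⟩ =
    (z, sectionCoord φ x z) := totalChart_graph φ hz
  rw [h2] at h1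
  have hd := ((differentiableOn_sectionCoord φ x).differentiableAt
    ((isOpen_frameDomain x).mem_nhds hz)).hasDerivAt
  have h3 : HasFDerivAt (fun z => (z, sectionCoord φ x z)) _ z :=
    (hasFDerivAt_id z).prodMk hd.hasFDerivAt
  have h4 : totalChart L x ∘ (fun x' => (⟨x', φ x'⟩ : Bundle.TotalSpace ℂ L)) ∘
      (extChartAt 𝓘(ℂ) x).symm =ᶠ[𝓝 z] fun z => (z, sectionCoord φ x z) := by
    filter_upwards [(isOpen_frameDomain x).mem_nhds hz] with v hv
    exact totalChart_graph φ hv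
  rw [h4.fderiv_eq, h3.fderiv, chartField_projAlong hy.1 hz] at h1
  have h5 := (totalField_eq hy.1 hz (sectionCoord φ x z)).symm.trans h1
  have h6 := congrArg Prod.snd h5
  exact h6

end

section

variable {X : Type*} [TopologicalSpace X] [ChartedSpace ℂ X] [IsManifold 𝓘(ℂ) ω X]
  {L : X → Type*} [TopologicalSpace (Bundle.TotalSpace ℂ L)]
  [∀ x, TopologicalSpace (L x)] [∀ x, AddCommGroup (L x)] [∀ x, Module ℂ (L x)]
  [FiberBundle ℂ L] [VectorBundle ℂ ℂ L] [ContMDiffVectorBundle ω ℂ L 𝓘(ℂ)] {x x₁ : X} {z w : ℂ}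
  {φ : HolSection L} {y y₁ : HolVectorField totalModel (Bundle.TotalSpace ℂ L)}
  (g : KahlerMetric X) (h : HermitianMetric L)

/-- The potential of an invariant vector field with respect to the hermitian metric. -/
noncomputable def fieldTheta (y : HolVectorField totalModel (Bundle.TotalSpace ℂ L)) (p : X) : ℂ :=
  fieldB y p (chartAt ℂ p p) + fieldA y p (chartAt ℂ p p) * dz (hermitianPotential h p) (chartAt ℂ p p)

/-- The divergence of an invariant vector field with respect to the Kähler metric. -/
noncomputable def fieldDiv (y : HolVectorField totalModel (Bundle.TotalSpace ℂ L)) (p : X) : ℂ :=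
  dz (fieldA y p) (chartAt ℂ p p) + fieldA y p (chartAt ℂ p p) * dz (kahlerPotential g p) (chartAt ℂ p p)

lemma differentiableAt_fieldA (hz : z ∈ frameDomain L x) : DifferentiableAt ℂ (fieldA y x) z :=
  (differentiableOn_fieldA x).differentiableAt ((isOpen_frameDomain x).mem_nhds hz)

lemma fieldTheta_eq (hy : y ∈ lieAutPair L) (hz : z ∈ frameDomain L x) :
    fieldTheta h y ((chartAt ℂ x).symm z) =
      fieldB y x z + fieldA y x z * dz (hermitianPotential h x) z := by
  have ho := HermitianMetric.self_mem_frameOverlap hz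
  rw [fieldTheta, fieldA_transition hy ho, fieldB_transition hy ho,
    dz_hermitianPotential_transition h ho]
  ring

lemma fieldDiv_eq (hy : y ∈ lieAutPair L) (hz : z ∈ frameDomain L x) :
    fieldDiv g y ((chartAt ℂ x).symm z) =
      dz (fieldA y x) z + fieldA y x z * dz (kahlerPotential g x) z := by
  have ho := HermitianMetric.self_mem_frameOverlap hz
  have hU := isOpen_frameOverlap (L := L) x ((chartAt ℂ x).symm z)
  have hne := deriv_transition_ne_zero (L := L) ho
  have h1 := dz_congr hU (fun v hv => fieldA_transition hy hv) ho
  have hT : DifferentiableAt ℂ (fun v => chartAt ℂ ((chartAt ℂ x).symm z) ((chartAt ℂ x).symm v)) z :=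
    HolAtlas.differentiableAt_tr (A := lineAtlas L) ho
  have hT' := (differentiableOn_deriv_transition (L := L) x ((chartAt ℂ x).symm z)).differentiableAt
    (hU.mem_nhds ho)
  have hc := chart_mem_frameDomain (L := L) ho
  rw [dz_comp hT ((differentiableAt_fieldA hc).restrictScalars ℝ),
    dz_mul (hT'.restrictScalars ℝ) ((differentiableAt_fieldA hz).restrictScalars ℝ),
    dz_eq_deriv hT'] at h1
  rw [fieldDiv, fieldA_transition hy ho, dz_kahlerPotential_transition g ho]
  apply mul_right_cancel₀ hne
  rw [add_mul, h1]
  field_simp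
  ring

theorem isField (hy : y ∈ lieAutTriple φ) :
    (lineAtlas L).IsField (kahlerPotential g) (sectionCoord φ) (hermitianPotential h)
      (fieldA y) (fieldB y) (fieldTheta h y) (fieldDiv g y) where
  form := isForm_fieldA hy.1
  loc x :=
    { hol_a := differentiableOn_fieldA x
      hol_b := differentiableOn_fieldB x
      preserves := fun z hz => by
        rw [dz_eq_deriv ((differentiableOn_sectionCoord φ x).differentiableAt
          ((isOpen_frameDomain x).mem_nhds hz))]
        exact fieldB_mul_sectionCoord hy hz
      theta_eq := fun z hz => fieldTheta_eq h hy.1 hz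
      d_eq := fun z hz => fieldDiv_eq g hy.1 hz }

section Linear

lemma totalField_add (hz : z ∈ frameDomain L x) :
    totalField (y + y₁) x (z, w) = totalField y x (z, w) + totalField y₁ x (z, w) := by
  have hm := mk_mem_totalChart_target (w := w) hz
  have e := chartField_eq (fun p => (y + y₁) p) (⟨x, 0⟩ : Bundle.TotalSpace ℂ L) hm
  have e1 := chartField_eq (fun p => y p) (⟨x, 0⟩ : Bundle.TotalSpace ℂ L) hm
  have e2 := chartField_eq (fun p => y₁ p) (⟨x, 0⟩ : Bundle.TotalSpace ℂ L) hm
  let T : ℂ × ℂ →L[ℂ] ℂ × ℂ :=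
    mfderiv totalModel 𝓘(ℂ, ℂ × ℂ) (totalChart L x) ((totalChart L x).symm (z, w))
  have e3 : ∀ u v : ℂ × ℂ, T (u + v) = T u + T v := T.map_add
  exact e.trans ((e3 _ _).trans (congrArg₂ (· + ·) e1.symm e2.symm))

lemma totalField_smul (l : ℂ) (hz : z ∈ frameDomain L x) :
    totalField (l • y) x (z, w) = l • totalField y x (z, w) := by
  have hm := mk_mem_totalChart_target (w := w) hz
  have e := chartField_eq (fun p => (l • y) p) (⟨x, 0⟩ : Bundle.TotalSpace ℂ L) hm
  have e1 := chartField_eq (fun p => y p) (⟨x, 0⟩ : Bundle.TotalSpace ℂ L) hm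
  let T : ℂ × ℂ →L[ℂ] ℂ × ℂ :=
    mfderiv totalModel 𝓘(ℂ, ℂ × ℂ) (totalChart L x) ((totalChart L x).symm (z, w))
  have e3 : ∀ u : ℂ × ℂ, T (l • u) = l • T u := T.map_smul l
  exact e.trans ((e3 _).trans (congrArg (l • ·) e1.symm))

lemma fieldA_smul (l : ℂ) (hz : z ∈ frameDomain L x) :
    fieldA (l • y) x z = l * fieldA y x z := congrArg Prod.fst (totalField_smul l hz)

lemma fieldB_smul (l : ℂ) (hz : z ∈ frameDomain L x) :
    fieldB (l • y) x z = l * fieldB y x z := congrArg Prod.snd (totalField_smul l hz)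

lemma fieldA_add (hz : z ∈ frameDomain L x) :
    fieldA (y + y₁) x z = fieldA y x z + fieldA y₁ x z := congrArg Prod.fst (totalField_add hz)

lemma fieldB_add (hz : z ∈ frameDomain L x) :
    fieldB (y + y₁) x z = fieldB y x z + fieldB y₁ x z := congrArg Prod.snd (totalField_add hz)

lemma fieldTheta_smul (l : ℂ) (p : X) : fieldTheta h (l • y) p = l * fieldTheta h y p := by
  have hc := center_mem_frameDomain (L := L) p
  rw [fieldTheta, fieldTheta, fieldA_smul l hc, fieldB_smul l hc]; ring

lemma fieldTheta_add (p : X) :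
    fieldTheta h (y + y₁) p = fieldTheta h y p + fieldTheta h y₁ p := by
  have hc := center_mem_frameDomain (L := L) p
  rw [fieldTheta, fieldTheta, fieldTheta, fieldA_add hc, fieldB_add hc]; ring

lemma fieldDiv_smul (l : ℂ) (p : X) : fieldDiv g (l • y) p = l * fieldDiv g y p := by
  have hc := center_mem_frameDomain (L := L) p
  rw [fieldDiv, fieldDiv, fieldA_smul l hc,
    dz_congr (isOpen_frameDomain (L := L) p) (fun z hz => fieldA_smul l hz) hc,
    dz_const_mul l ((differentiableAt_fieldA hc).restrictScalars ℝ)]; ring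

lemma fieldDiv_add (p : X) :
    fieldDiv g (y + y₁) p = fieldDiv g y p + fieldDiv g y₁ p := by
  have hc := center_mem_frameDomain (L := L) p
  rw [fieldDiv, fieldDiv, fieldDiv, fieldA_add hc,
    dz_congr (isOpen_frameDomain (L := L) p) (fun z hz => fieldA_add hz) hc,
    dz_add ((differentiableAt_fieldA hc).restrictScalars ℝ)
      ((differentiableAt_fieldA hc).restrictScalars ℝ)]; ring

end Linear

/-- An invariant field whose coefficients vanish at the centres of the charts vanishes. -/
lemma eq_zero_of_coefficients (hy : y ∈ lieAutPair L)
    (ha : ∀ p, fieldA y p (chartAt ℂ p p) = 0) (hb : ∀ p, fieldB y p (chartAt ℂ p p) = 0) :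
    y = 0 := by
  ext p
  rw [apply_eq_of_mem_lieAutPair hy p, ha, hb, zero_mul]
  rfl

lemma dz_ofReal_eq_mul_dz_log {U : Set ℂ} {f : ℂ → ℝ} (hU : IsOpen U) (hf : ContDiffOn ℝ ∞ f U)
    (hf0 : ∀ z ∈ U, 0 < f z) (hz : z ∈ U) :
    dz (fun z => (f z : ℂ)) z = f z * dz (fun z => (Real.log (f z) : ℂ)) z := by
  have h1 : ∀ v ∈ U, (f v : ℂ) = Complex.exp (Real.log (f v) : ℂ) := fun v hv => by
    rw [← Complex.ofReal_exp, Real.exp_log (hf0 v hv)]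
  have h2 : DifferentiableAt ℝ (fun z => (Real.log (f z) : ℂ)) z :=
    ContDiffOn.differentiableAt_of_isOpen hU (Complex.ofRealCLM.contDiff.comp_contDiffOn
      (hf.log fun z hz => (hf0 z hz).ne')) hz
  rw [dz_congr hU h1 hz, dz_cexp h2, ← h1 z hz]

lemma fderiv_eq_mul_re_dz_log {U : Set ℂ} {f : ℂ → ℝ} (hU : IsOpen U) (hf : ContDiffOn ℝ ∞ f U)
    (hf0 : ∀ z ∈ U, 0 < f z) (hz : z ∈ U) (v : ℂ) :
    fderiv ℝ f z v = 2 * f z * (v * dz (fun z => (Real.log (f z) : ℂ)) z).re := by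
  have h1 : DifferentiableAt ℝ f z := (hf.contDiffAt (hU.mem_nhds hz)).differentiableAt (by simp)
  rw [fderiv_eq_two_mul_re_dz h1, dz_ofReal_eq_mul_dz_log hU hf hf0 hz, mul_assoc,
    Complex.re_ofReal_mul, mul_comm v]
  ring

lemma mfderiv_normSq (hy : y ∈ lieAutPair L) (p : Bundle.TotalSpace ℂ L) :
    @Eq ℝ (mfderiv totalModelReal 𝓘(ℝ, ℝ) h.normSq p (y p : ℂ × ℂ))
      (2 * ‖(trivializationAt ℂ L p.1 p).2‖ ^ 2 * h.weight p.1 (chartAt ℂ p.1 p.1) *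
        (fieldTheta h y p.1).re) := by
  set x := p.1 with hx
  have hc := center_mem_frameDomain (L := L) x
  set c := chartAt ℂ x x with hcd
  set w := (trivializationAt ℂ L x p).2 with hw
  have e2 : extChartAt totalModelReal p p = (c, w) := by
    simp only [mfld_simps, FiberBundle.chartedSpace_chartAt]
    rfl
  have e1 : ∀ q, (extChartAt totalModelReal p).symm q = (totalChart L x).symm q := fun q => by
    simp only [totalChart, mfld_simps, FiberBundle.chartedSpace_chartAt]
    rfl
  have hmd : MDifferentiableAt totalModelReal 𝓘(ℝ, ℝ) h.normSq p :=
    (h.smooth p).mdifferentiableAt (by simp)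
  have h1 : mfderiv totalModelReal 𝓘(ℝ, ℝ) h.normSq p =
      fderiv ℝ (fun q => h.normSq ((totalChart L x).symm q)) (c, w) := by
    rw [hmd.mfderiv, ModelWithCorners.range_eq_univ, fderivWithin_univ, e2]
    have : writtenInExtChartAt totalModelReal 𝓘(ℝ, ℝ) p h.normSq =
        fun q => h.normSq ((totalChart L x).symm q) := by
      funext q
      rw [← e1]; rfl
    rw [this]
  have hWd : DifferentiableAt ℝ (h.weight x) c :=
    ((h.contDiffOn_weight x).contDiffAt ((isOpen_frameDomain x).mem_nhds hc)).differentiableAt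
      (by simp)
  have h2 : HasFDerivAt (fun q : ℂ × ℂ => h.weight x q.1 * ‖q.2‖ ^ 2)
      (h.weight x c • ((2 : ℝ) • (innerSL ℝ w).comp (ContinuousLinearMap.snd ℝ ℂ ℂ)) +
        ‖w‖ ^ 2 • (fderiv ℝ (h.weight x) c).comp (ContinuousLinearMap.fst ℝ ℂ ℂ)) (c, w) := by
    have k1 : HasFDerivAt (fun q : ℂ × ℂ => h.weight x q.1)
        ((fderiv ℝ (h.weight x) c).comp (ContinuousLinearMap.fst ℝ ℂ ℂ)) (c, w) :=
      HasFDerivAt.comp (g := h.weight x) (f := fun q : ℂ × ℂ => q.1) (c, w)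
        hWd.hasFDerivAt hasFDerivAt_fst
    have k2 : HasFDerivAt (fun q : ℂ × ℂ => ‖q.2‖ ^ 2)
        ((2 : ℝ) • (innerSL ℝ w).comp (ContinuousLinearMap.snd ℝ ℂ ℂ)) (c, w) := by
      have := (hasFDerivAt_snd (𝕜 := ℝ) (E := ℂ) (F := ℂ) (p := (c, w))).norm_sq
      simpa [two_smul] using this
    exact k1.fun_mul k2
  have h3 : (fun q => h.normSq ((totalChart L x).symm q)) =ᶠ[𝓝 (c, w)]
      fun q : ℂ × ℂ => h.weight x q.1 * ‖q.2‖ ^ 2 := by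
    filter_upwards [eventually_mem_frameDomain_prod hc] with q hq
    rw [mul_comm]
    exact h.normSq_totalChart_symm hq
  have h4 : @Eq ℝ (mfderiv totalModelReal 𝓘(ℝ, ℝ) h.normSq p (y p : ℂ × ℂ))
      (fderiv ℝ (fun q => h.normSq ((totalChart L x).symm q)) (c, w) (fieldA y x c, fieldB y x c * w)) := by
    rw [h1]
    exact congrArg _ (apply_eq_of_mem_lieAutPair hy p)
  refine h4.trans ?_
  rw [h3.fderiv_eq, h2.fderiv]
  have h5 := fderiv_eq_mul_re_dz_log (isOpen_frameDomain x) (h.contDiffOn_weight x)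
    (fun _ => h.weight_pos) hc (fieldA y x c)
  have h6 : inner ℝ w (fieldB y x c * w) = ‖w‖ ^ 2 * (fieldB y x c).re := by
    rw [Complex.inner, mul_assoc, Complex.mul_conj, Complex.normSq_eq_norm_sq, mul_comm,
      Complex.re_ofReal_mul]
  simp only [add_apply, smul_apply, ContinuousLinearMap.comp_apply, ContinuousLinearMap.coe_fst',
    ContinuousLinearMap.coe_snd', innerSL_apply_apply, h5, h6, smul_eq_mul]
  rw [fieldTheta, Complex.add_re]
  rw [show hermitianPotential h x = fun z => (Real.log (h.weight x z) : ℂ) from rfl]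
  ring

lemma lieDerivative_kahler (hy : y ∈ lieAutPair L) (x : X) :
    fderiv ℝ (g.weight x) (chartAt ℂ x x) (chartField (coveredField y) x (chartAt ℂ x x)) +
      2 * density g x * (deriv (chartField (coveredField y) x) (chartAt ℂ x x)).re =
    2 * density g x * (fieldDiv g y x).re := by
  have hc := center_mem_frameDomain (L := L) x
  have h1 : chartField (coveredField y) x =ᶠ[𝓝 (chartAt ℂ x x)] fieldA y x := by
    filter_upwards [(isOpen_frameDomain x).mem_nhds hc] with z hz
    exact chartField_coveredField hy hz
  rw [h1.deriv_eq, h1.eq_of_nhds, fderiv_eq_mul_re_dz_log (chartAt ℂ x).open_target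
    (contDiffOn_kahlerWeight g x) (fun _ => kahlerWeight_pos g) hc.1, fieldDiv,
    dz_eq_deriv (differentiableAt_fieldA hc), Complex.add_re, density]
  rw [show kahlerPotential g x = fun z => (Real.log (g.weight x z) : ℂ) from rfl]
  ring

lemma isInfinitesimalIsometry_iff (hy : y ∈ lieAutPair L) :
    IsInfinitesimalIsometry g h y ↔
      ∀ p, (fieldTheta h y p).re = 0 ∧ (fieldDiv g y p).re = 0 := by
  constructor
  · rintro ⟨h1, h2⟩ p
    constructor
    · have hb := FiberBundle.mem_baseSet_trivializationAt' (F := ℂ) (E := L) p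
      have h3 := (mfderiv_normSq h hy ⟨p, (trivializationAt ℂ L p).symm p (1 : ℂ)⟩).symm.trans (h1 _)
      rw [(trivializationAt ℂ L p).apply_mk_symm hb] at h3
      have h4 := h.weight_pos (center_mem_frameDomain (L := L) p)
      rw [norm_one] at h3
      have h5 : 0 < 2 * (1 : ℝ) ^ 2 * h.weight p (chartAt ℂ p p) := by positivity
      exact (mul_eq_zero.1 h3).resolve_left h5.ne'
    · have h3 := (lieDerivative_kahler g hy p).symm.trans (h2 p)
      have h4 : 0 < density g p := kahlerWeight_pos g (mem_chart_target ℂ p)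
      simpa [h4.ne'] using h3
  · intro H
    refine ⟨fun p => ?_, fun x => ?_⟩
    · refine (mfderiv_normSq h hy p).trans ?_
      rw [(H p.1).1]
      exact mul_zero _
    · rw [lieDerivative_kahler g hy, (H x).2, mul_zero]

end

section AbstractLie

variable {𝔤 : Type*} [LieRing 𝔤] [LieAlgebra ℂ 𝔤]

lemma isReductive_of_isLieAbelian [IsLieAbelian 𝔤] [Module.Finite ℂ 𝔤] : IsReductive 𝔤 :=
  ⟨inferInstance, by
    rw [LieAlgebra.radical_eq_top_of_isSolvable,
      (LieAlgebra.isLieAbelian_iff_center_eq_top ℂ 𝔤).1 inferInstance]⟩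

/-- If every element is a multiple of an element of `P`, and any two elements of `P` are real
multiples of each other, then the Lie algebra is at most one-dimensional. -/
lemma exists_forall_eq_smul {P : 𝔤 → Prop} (h1 : ∀ y, ∃ l : ℂ, l ≠ 0 ∧ P (l • y))
    (h2 : ∀ y z, P y → P z → y ≠ 0 → ∃ t : ℝ, z = (t : ℂ) • y) :
    ∃ y₀, P y₀ ∧ ∀ z, ∃ s : ℂ, z = s • y₀ := by
  by_cases h0 : ∀ z : 𝔤, z = 0
  · obtain ⟨l, -, hl⟩ := h1 0
    exact ⟨_, hl, fun z => ⟨0, by rw [zero_smul]; exact h0 z⟩⟩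
  · push Not at h0
    obtain ⟨z, hz⟩ := h0
    obtain ⟨l, hl, hP⟩ := h1 z
    refine ⟨l • z, hP, fun v => ?_⟩
    obtain ⟨m, hm, hv⟩ := h1 v
    obtain ⟨t, ht⟩ := h2 _ _ hP hv (smul_ne_zero hl hz)
    refine ⟨m⁻¹ * t, ?_⟩
    rw [mul_smul, ← ht, smul_smul, inv_mul_cancel₀ hm, one_smul]

lemma isLieAbelian_of_forall_eq_smul {y₀ : 𝔤} (h : ∀ z, ∃ s : ℂ, z = s • y₀) : IsLieAbelian 𝔤 := by
  refine ⟨fun x y => ?_⟩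
  obtain ⟨s, rfl⟩ := h x
  obtain ⟨t, rfl⟩ := h y
  rw [lie_smul, smul_lie, lie_self, smul_zero, smul_zero]

lemma finite_of_forall_eq_smul {y₀ : 𝔤} (h : ∀ z, ∃ s : ℂ, z = s • y₀) : Module.Finite ℂ 𝔤 := by
  refine ⟨⟨{y₀}, ?_⟩⟩
  rw [Finset.coe_singleton, Submodule.eq_top_iff']
  intro z
  obtain ⟨s, rfl⟩ := h z
  exact Submodule.smul_mem _ s (Submodule.mem_span_singleton_self y₀)

/-- The complexification of a real form. -/
lemma exists_complexification_equiv [LieAlgebra ℝ 𝔤] [IsScalarTower ℝ ℂ 𝔤] [IsLieAbelian 𝔤]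
    (𝔨 : LieSubalgebra ℝ 𝔤) (h1 : ∀ y : 𝔤, ∃ l : ℂ, l ≠ 0 ∧ l • y ∈ 𝔨)
    (h2 : ∀ y z : 𝔤, y ∈ 𝔨 → z ∈ 𝔨 → y ≠ 0 → ∃ t : ℝ, z = t • y) :
    ∃ e : (ℂ ⊗[ℝ] 𝔨) ≃ₗ⁅ℂ⁆ 𝔤, ∀ (a : ℂ) (k : 𝔨), e (a ⊗ₜ[ℝ] k) = a • (k : 𝔤) := by
  let f : (ℂ ⊗[ℝ] 𝔨) →ₗ[ℂ] 𝔤 := LinearMap.liftBaseChange ℂ (𝔨.toSubmodule.subtype)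
  have hf : ∀ (a : ℂ) (k : 𝔨), f (a ⊗ₜ[ℝ] k) = a • (k : 𝔤) := fun a k => by
    simp only [f, LinearMap.liftBaseChange_tmul]; rfl
  have hsurj : Function.Surjective f := fun y => by
    obtain ⟨l, hl, hy⟩ := h1 y
    refine ⟨l⁻¹ ⊗ₜ ⟨l • y, hy⟩, ?_⟩
    rw [hf, smul_smul, inv_mul_cancel₀ hl, one_smul]
  have hinj : Function.Injective f := by
    by_cases h0 : ∀ k : 𝔨, k = 0
    · have : Subsingleton 𝔨 := ⟨fun a b => (h0 a).trans (h0 b).symm⟩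
      have : Subsingleton (ℂ ⊗[ℝ] 𝔨) := inferInstance
      exact Function.injective_of_subsingleton f
    · push Not at h0
      obtain ⟨k₀, hk₀⟩ := h0
      have hk₀' : (k₀ : 𝔤) ≠ 0 := fun h => hk₀ (Subtype.ext h)
      have hrep : ∀ t : ℂ ⊗[ℝ] 𝔨, ∃ a : ℂ, t = a ⊗ₜ k₀ := by
        intro t
        induction t with
        | zero => exact ⟨0, (TensorProduct.zero_tmul _ _).symm⟩
        | tmul a k =>
          obtain ⟨s, hs⟩ := h2 _ _ k₀.2 k.2 hk₀'
          have hk : k = s • k₀ := Subtype.ext hs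
          exact ⟨s • a, by rw [hk, TensorProduct.tmul_smul, TensorProduct.smul_tmul']⟩
        | add x y hx hy =>
          obtain ⟨a, rfl⟩ := hx
          obtain ⟨b, rfl⟩ := hy
          exact ⟨a + b, (TensorProduct.add_tmul _ _ _).symm⟩
      rw [injective_iff_map_eq_zero]
      intro t ht
      obtain ⟨a, rfl⟩ := hrep t
      rw [hf, smul_eq_zero] at ht
      rw [ht.resolve_right hk₀', TensorProduct.zero_tmul]
  have hab : ∀ s t : ℂ ⊗[ℝ] 𝔨, ⁅s, t⁆ = 0 := by
    intro s t
    apply hinj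
    rw [map_zero]
    induction s with
    | zero => rw [zero_lie, map_zero]
    | add x y hx hy => rw [add_lie, map_add, hx, hy, add_zero]
    | tmul a k =>
      induction t with
      | zero => exact (congrArg f (lie_zero (a ⊗ₜ[ℝ] k))).trans (map_zero f)
      | add x y hx hy =>
        exact (congrArg f (lie_add (a ⊗ₜ[ℝ] k) x y)).trans (by rw [map_add, hx, hy, add_zero])
      | tmul b l =>
        rw [LieAlgebra.ExtendScalars.bracket_tmul, hf, LieSubalgebra.coe_bracket, trivial_lie_zero,
          smul_zero]
  let e : (ℂ ⊗[ℝ] 𝔨) →ₗ⁅ℂ⁆ 𝔤 := { f with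
    map_lie' := fun {s t} => by
      change f ⁅s, t⁆ = ⁅f s, f t⁆
      rw [hab, map_zero, trivial_lie_zero] }
  exact ⟨LieEquiv.ofBijective e ⟨hinj, hsurj⟩, hf⟩

end AbstractLie

section

variable {X : Type*} [TopologicalSpace X] [ChartedSpace ℂ X] [IsManifold 𝓘(ℂ) ω X]
  [CompactSpace X] [ConnectedSpace X] [T2Space X]
  {L : X → Type*} [TopologicalSpace (Bundle.TotalSpace ℂ L)]
  [∀ x, TopologicalSpace (L x)] [∀ x, AddCommGroup (L x)] [∀ x, Module ℂ (L x)]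
  [FiberBundle ℂ L] [VectorBundle ℂ ℂ L] [ContMDiffVectorBundle ω ℂ L 𝓘(ℂ)]
  {φ : HolSection L} {y y₁ : HolVectorField totalModel (Bundle.TotalSpace ℂ L)}
  {g : KahlerMetric X} {h : HermitianMetric L} {τ α c : ℝ}

lemma eq_zero_of_fieldA_eq_zero (H : IsGravitatingVortex τ α c φ g h) (hdeg : 0 < divisorDegree φ)
    (hφ : φ ≠ 0) (hy : y ∈ lieAutTriple φ) (ha : ∀ p, fieldA y p (chartAt ℂ p p) = 0) : y = 0 := by
  refine eq_zero_of_coefficients hy.1 ha fun p => ?_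
  have h1 := HolAtlas.IsField.theta_eq_zero (isVortex g h φ H hdeg) (exists_sectionDensity_ne_zero h φ hφ)
    (isField g h hy) ha p
  rw [fieldTheta, ha, zero_mul, add_zero] at h1
  exact h1

lemma exists_smul_isometry (H : IsGravitatingVortex τ α c φ g h) (hdeg : 0 < divisorDegree φ)
    (hφ : φ ≠ 0) (hτ : 0 < τ) (hα : 0 < α) (hy : y ∈ lieAutTriple φ) :
    ∃ l : ℂ, l ≠ 0 ∧ IsInfinitesimalIsometry g h (l • y) := by
  obtain ⟨l, hl, h1⟩ := HolAtlas.IsField.exists_multiple (isVortex g h φ H hdeg) hτ hα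
    (exists_sectionDensity_ne_zero h φ hφ) (isField g h hy)
  refine ⟨l, hl, ?_⟩
  rw [isInfinitesimalIsometry_iff g h ((lieAutPair L).smul_mem l hy.1)]
  intro p
  rw [fieldTheta_smul, fieldDiv_smul]
  exact h1 p

lemma eq_smul_of_isometry (H : IsGravitatingVortex τ α c φ g h) (hdeg : 0 < divisorDegree φ)
    (hφ : φ ≠ 0) (hτ : 0 < τ) (hy : y ∈ lieAutTriple φ) (hy₁ : y₁ ∈ lieAutTriple φ)
    (hi : IsInfinitesimalIsometry g h y) (hi₁ : IsInfinitesimalIsometry g h y₁) (hne : y ≠ 0) :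
    ∃ t : ℝ, y₁ = (t : ℂ) • y := by
  rw [isInfinitesimalIsometry_iff g h hy.1] at hi
  rw [isInfinitesimalIsometry_iff g h hy₁.1] at hi₁
  have hA : ∃ p, (lineAtlas L).val (fieldA y) p ≠ 0 := by
    by_contra! h0
    exact hne (eq_zero_of_fieldA_eq_zero H hdeg hφ hy h0)
  obtain ⟨t, ht⟩ := HolAtlas.IsField.exists_real_relation (isVortex g h φ H hdeg) hτ
    (exists_sectionDensity_ne_zero h φ hφ) (isField g h hy) (isField g h hy₁)
    (fun p => (hi p).1) (fun p => (hi₁ p).1) hA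
  refine ⟨t, ?_⟩
  rw [← sub_eq_zero]
  have hm : y₁ + (-(t : ℂ)) • y ∈ lieAutTriple φ :=
    add_mem hy₁ ((lieAutTriple φ).smul_mem _ hy)
  rw [sub_eq_add_neg, ← neg_smul]
  refine eq_zero_of_fieldA_eq_zero H hdeg hφ hm fun p => ?_
  have hc := center_mem_frameDomain (L := L) p
  have h1 := ht p
  change fieldA y₁ p (chartAt ℂ p p) = t * fieldA y p (chartAt ℂ p p) at h1
  rw [fieldA_add hc, fieldA_smul _ hc, h1]
  ring

/-- The infinitesimal isometries form a real form of the Lie algebra, which is abelian. -/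
theorem lie_conclusions (H : IsGravitatingVortex τ α c φ g h) (hdeg : 0 < divisorDegree φ)
    (hφ : φ ≠ 0) (hτ : 0 < τ) (hα : 0 < α) :
    IsReductive (lieAutTriple φ) ∧ ∃ 𝔨 : LieSubalgebra ℝ (lieAutTriple φ),
      (∀ y, y ∈ 𝔨 ↔ IsInfinitesimalIsometry g h y) ∧
      ∃ e : (ℂ ⊗[ℝ] 𝔨) ≃ₗ⁅ℂ⁆ lieAutTriple φ,
        ∀ (a : ℂ) (k : 𝔨), e (a ⊗ₜ[ℝ] k) = a • (k : lieAutTriple φ) := by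
  have h1 : ∀ y : lieAutTriple φ, ∃ l : ℂ, l ≠ 0 ∧
      IsInfinitesimalIsometry g h ((l • y : lieAutTriple φ) : HolVectorField totalModel (Bundle.TotalSpace ℂ L)) :=
    fun y => exists_smul_isometry H hdeg hφ hτ hα y.2
  have h2 : ∀ y z : lieAutTriple φ, IsInfinitesimalIsometry g h (y : HolVectorField totalModel (Bundle.TotalSpace ℂ L)) →
      IsInfinitesimalIsometry g h (z : HolVectorField totalModel (Bundle.TotalSpace ℂ L)) → y ≠ 0 →
      ∃ t : ℝ, z = (t : ℂ) • y := by
    intro y z hy hz hne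
    obtain ⟨t, ht⟩ := eq_smul_of_isometry H hdeg hφ hτ y.2 z.2 hy hz
      (fun h0 => hne (Subtype.ext h0))
    exact ⟨t, Subtype.ext ht⟩
  obtain ⟨y₀, -, hy₀⟩ := exists_forall_eq_smul h1 h2
  have := isLieAbelian_of_forall_eq_smul hy₀
  have := finite_of_forall_eq_smul hy₀
  refine ⟨isReductive_of_isLieAbelian, ?_⟩
  let 𝔨 : LieSubalgebra ℝ (lieAutTriple φ) :=
    { carrier := {y | IsInfinitesimalIsometry g h (y : HolVectorField totalModel (Bundle.TotalSpace ℂ L))}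
      add_mem' := by
        intro y z hy hz
        change IsInfinitesimalIsometry g h ((y : HolVectorField totalModel (Bundle.TotalSpace ℂ L)) + z)
        rw [isInfinitesimalIsometry_iff g h (add_mem y.2.1 z.2.1)]
        intro p
        have k1 := (isInfinitesimalIsometry_iff g h y.2.1).1 hy p
        have k2 := (isInfinitesimalIsometry_iff g h z.2.1).1 hz p
        rw [fieldTheta_add, fieldDiv_add, Complex.add_re, Complex.add_re, k1.1, k1.2, k2.1, k2.2]
        simp
      zero_mem' := by
        change IsInfinitesimalIsometry g h (0 : HolVectorField totalModel (Bundle.TotalSpace ℂ L))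
        rw [← zero_smul ℂ (0 : HolVectorField totalModel (Bundle.TotalSpace ℂ L)),
          isInfinitesimalIsometry_iff g h ((lieAutPair L).smul_mem _ (zero_mem _))]
        intro p
        rw [fieldTheta_smul, fieldDiv_smul]
        simp
      smul_mem' := by
        intro t y hy
        change IsInfinitesimalIsometry g h ((t : ℂ) • (y : HolVectorField totalModel (Bundle.TotalSpace ℂ L)))
        rw [isInfinitesimalIsometry_iff g h ((lieAutPair L).smul_mem _ y.2.1)]
        intro p
        have k1 := (isInfinitesimalIsometry_iff g h y.2.1).1 hy p
        rw [fieldTheta_smul, fieldDiv_smul, Complex.re_ofReal_mul, Complex.re_ofReal_mul, k1.1, k1.2]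
        simp
      lie_mem' := by
        intro y z hy hz
        rw [trivial_lie_zero]
        change IsInfinitesimalIsometry g h (0 : HolVectorField totalModel (Bundle.TotalSpace ℂ L))
        rw [← zero_smul ℂ (0 : HolVectorField totalModel (Bundle.TotalSpace ℂ L)),
          isInfinitesimalIsometry_iff g h ((lieAutPair L).smul_mem _ (zero_mem _))]
        intro p
        rw [fieldTheta_smul, fieldDiv_smul]
        simp }
  exact ⟨𝔨, fun _ => Iff.rfl, exists_complexification_equiv 𝔨 h1 h2⟩

end

/-- If `b f = a f'` and `f` has an isolated zero, then `a` vanishes there. -/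
lemma eq_zero_of_mul_eq_mul_deriv {f a b : ℂ → ℂ} {z₀ : ℂ} (hf : AnalyticAt ℂ f z₀)
    (ha : ContinuousAt a z₀) (hb : ContinuousAt b z₀) (h0 : f z₀ = 0)
    (hne : ¬ ∀ᶠ z in 𝓝 z₀, f z = 0) (h : ∀ᶠ z in 𝓝 z₀, b z * f z = a z * deriv f z) :
    a z₀ = 0 := by
  obtain ⟨n, g, hg, hg0, hfg⟩ := hf.exists_eventuallyEq_pow_smul_nonzero_iff.2 hne
  have hn : n ≠ 0 := by
    rintro rfl
    have := hfg.self_of_nhds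
    rw [pow_zero, one_smul, h0] at this
    exact hg0 this.symm
  obtain ⟨m, rfl⟩ := Nat.exists_eq_succ_of_ne_zero hn
  have hd : ∀ᶠ z in 𝓝 z₀, deriv f z =
      (z - z₀) ^ m * (((m + 1 : ℕ) : ℂ) * g z + (z - z₀) * deriv g z) := by
    filter_upwards [hfg.eventually_nhds, hg.eventually_analyticAt] with z hz hgz
    have hE : f =ᶠ[𝓝 z] fun z => (z - z₀) ^ (m + 1) * g z := hz
    rw [hE.deriv_eq]
    have h1 : HasDerivAt (fun z => (z - z₀) ^ (m + 1)) (((m + 1 : ℕ) : ℂ) * (z - z₀) ^ m * 1) z := by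
      exact ((hasDerivAt_id' z).sub_const z₀).fun_pow (m + 1)
    rw [(h1.fun_mul hgz.differentiableAt.hasDerivAt).deriv]
    ring
  have hE : (fun z => b z * ((z - z₀) * g z)) =ᶠ[𝓝[≠] z₀]
      fun z => a z * (((m + 1 : ℕ) : ℂ) * g z + (z - z₀) * deriv g z) := by
    filter_upwards [nhdsWithin_le_nhds (hd.and (hfg.and h)), self_mem_nhdsWithin] with z hz hzne
    have h1 := hz.2.2
    rw [hz.1, hz.2.1, smul_eq_mul, pow_succ] at h1
    have h2 : (z - z₀) ^ m ≠ 0 := pow_ne_zero _ (sub_ne_zero.2 hzne)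
    apply mul_left_cancel₀ h2
    linear_combination h1
  have hg' : ContinuousAt (deriv g) z₀ := hg.deriv.continuousAt
  have hgc := hg.continuousAt
  have c1 : ContinuousAt (fun z => b z * ((z - z₀) * g z)) z₀ := by fun_prop
  have c2 : ContinuousAt (fun z => a z * (((m + 1 : ℕ) : ℂ) * g z + (z - z₀) * deriv g z)) z₀ := by
    fun_prop
  have h3 := tendsto_nhds_unique ((c1.tendsto.mono_left nhdsWithin_le_nhds).congr' hE)
    (c2.tendsto.mono_left nhdsWithin_le_nhds)
  rw [sub_self, zero_mul, mul_zero, zero_mul, add_zero] at h3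
  refine (mul_eq_zero.1 h3.symm).resolve_right (mul_ne_zero ?_ hg0)
  exact_mod_cast Nat.succ_ne_zero m

lemma eq_zero_of_apply_eq_zero {T : ℂ →L[ℂ] ℂ} {v : ℂ} (h : T v = 0) (hv : v ≠ 0) : T = 0 := by
  ext
  have h3 := T.map_smul (1 / v) v
  rwa [h, smul_zero, smul_eq_mul, div_mul_cancel₀ _ hv] at h3

section OneForms

variable {X : Type*} [TopologicalSpace X] [ChartedSpace ℂ X] [IsManifold 𝓘(ℂ) ω X] {x x₁ : X} {z : ℂ}
  {L : X → Type*} [TopologicalSpace (Bundle.TotalSpace ℂ L)]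
  [∀ x, TopologicalSpace (L x)] [∀ x, AddCommGroup (L x)] [∀ x, Module ℂ (L x)]
  [FiberBundle ℂ L] [VectorBundle ℂ ℂ L] [ContMDiffVectorBundle ω ℂ L 𝓘(ℂ)]

/-- The coefficient of a holomorphic 1-form in the preferred chart at `x`. -/
noncomputable def oneFormCoord (η : HolOneForm X) (x : X) (z : ℂ) : ℂ :=
  (η ((chartAt ℂ x).symm z) : ℂ →L[ℂ] ℂ)
    ((trivializationAt ℂ (TangentSpace 𝓘(ℂ) : X → Type) x).symm ((chartAt ℂ x).symm z) (1 : ℂ))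

lemma oneFormCoord_transition (η : HolOneForm X)
    (hz : z ∈ frameOverlap (TangentSpace 𝓘(ℂ) : X → Type) x x₁) :
    oneFormCoord η x z = oneFormCoord η x₁ (chartAt ℂ x₁ ((chartAt ℂ x).symm z)) *
      deriv (fun z => chartAt ℂ x₁ ((chartAt ℂ x).symm z)) z := by
  have h1 := chart_symm_chart hz
  have h2 : ∀ p q : X, p = q → (η p : ℂ →L[ℂ] ℂ)
      ((trivializationAt ℂ (TangentSpace 𝓘(ℂ) : X → Type) x₁).symm p (1 : ℂ)) =
      (η q : ℂ →L[ℂ] ℂ)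
      ((trivializationAt ℂ (TangentSpace 𝓘(ℂ) : X → Type) x₁).symm q (1 : ℂ)) := by
    rintro p _ rfl; rfl
  rw [oneFormCoord, oneFormCoord, h2 _ _ h1, ← frameChange_tangent hz]
  set p := (chartAt ℂ x).symm z with hp
  have h3 : (trivializationAt ℂ (TangentSpace 𝓘(ℂ) : X → Type) x).symm p (1 : ℂ) =
      frameChange (TangentSpace 𝓘(ℂ) : X → Type) x x₁ z •
        (trivializationAt ℂ (TangentSpace 𝓘(ℂ) : X → Type) x₁).symm p (1 : ℂ) := by
    rw [← trivializationAt_symm_eq_smul hz.2.2, frameChange, ← hp]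
    exact ((trivializationAt ℂ (TangentSpace 𝓘(ℂ) : X → Type) x₁).symm_apply_apply_mk hz.2.2 _).symm
  rw [h3, mul_comm]
  exact ContinuousLinearMap.map_smul (η p : ℂ →L[ℂ] ℂ) _ _

lemma differentiableAt_oneFormCoord_center (η : HolOneForm X) (x : X) :
    DifferentiableAt ℂ (oneFormCoord η x) (chartAt ℂ x x) := by
  have h1 := ((contMDiffAt_hom_bundle _).1 (η.contMDiff x)).2
  have h2 : ContMDiffAt 𝓘(ℂ) 𝓘(ℂ) ω (fun p => (ContinuousLinearMap.inCoordinates ℂ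
      (TangentSpace 𝓘(ℂ) : X → Type) ℂ (Bundle.Trivial X ℂ) x p x p (η p) : ℂ →L[ℂ] ℂ) (1 : ℂ)) x :=
    ContMDiffAt.clm_apply h1 contMDiffAt_const
  have h3 := (contMDiffAt_iff.1 h2).2
  rw [ModelWithCorners.range_eq_univ, contDiffWithinAt_univ] at h3
  refine (h3.differentiableAt (by simp)).congr_of_eventuallyEq ?_
  filter_upwards [(chartAt ℂ x).open_target.mem_nhds (mem_chart_target ℂ x)] with z hz
  have hb : (chartAt ℂ x).symm z ∈
      (trivializationAt ℂ (TangentSpace 𝓘(ℂ) : X → Type) x).baseSet := by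
    rw [TangentBundle.trivializationAt_baseSet]; exact (chartAt ℂ x).map_target hz
  rw [oneFormCoord, ← (trivializationAt ℂ (TangentSpace 𝓘(ℂ) : X → Type) x).symmL_apply (R := ℂ) hb]
  have e : ∀ (p : X) (v : ℂ),
      ((trivializationAt ℂ (Bundle.Trivial X ℂ) x).continuousLinearMapAt ℂ p : ℂ →L[ℂ] ℂ) v = v :=
    fun p v => congrArg (fun T : ℂ →L[ℂ] ℂ => T v)
      (Bundle.Trivial.continuousLinearMapAt_trivialization ℂ X ℂ p)
  exact (e _ _).symm

lemma differentiableOn_oneFormCoord (η : HolOneForm X) (x : X) :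
    DifferentiableOn ℂ (oneFormCoord η x) (chartAt ℂ x).target := by
  intro z hz
  have ho := HermitianMetric.self_mem_frameOverlap (L := (TangentSpace 𝓘(ℂ) : X → Type)) (x := x)
    (z := z) (by rwa [frameDomain_tangent])
  set y := (chartAt ℂ x).symm z
  have hU := isOpen_frameOverlap (L := (TangentSpace 𝓘(ℂ) : X → Type)) x y
  have hd := differentiableOn_transition (X := X) x y
  have hO : IsOpen ((chartAt ℂ x).target ∩ (chartAt ℂ x).symm ⁻¹' (chartAt ℂ y).source) :=
    (chartAt ℂ x).isOpen_inter_preimage_symm (chartAt ℂ y).open_source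
  have hzO : z ∈ (chartAt ℂ x).target ∩ (chartAt ℂ x).symm ⁻¹' (chartAt ℂ y).source := ⟨hz, ho.2.1⟩
  have h1 : DifferentiableAt ℂ
      (fun z => oneFormCoord η y (chartAt ℂ y ((chartAt ℂ x).symm z))) z :=
    DifferentiableAt.comp (g := oneFormCoord η y) z (differentiableAt_oneFormCoord_center η y)
      (hd.differentiableAt (hO.mem_nhds hzO))
  have h2 := (hd.deriv hO).differentiableAt (hO.mem_nhds hzO)
  refine ((h1.fun_mul h2).congr_of_eventuallyEq ?_).differentiableWithinAt
  filter_upwards [hU.mem_nhds ho] with v hv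
  exact oneFormCoord_transition η hv

lemma isForm_oneFormCoord (η : HolOneForm X) : (lineAtlas L).IsForm 1 0 (oneFormCoord η) where
  smooth x := contDiffOn_of_differentiableOn (isOpen_frameDomain x)
    ((differentiableOn_oneFormCoord η x).mono fun _ hz => hz.1)
  trans x y z hz := by
    rw [oneFormCoord_transition η (frameOverlap_subset_tangent x y hz), zpow_one, zpow_zero, mul_one]
    rfl

lemma isHol_oneFormCoord (η : HolOneForm X) : (lineAtlas L).IsHol (oneFormCoord η) := fun x =>
  (differentiableOn_oneFormCoord η x).mono fun _ hz => hz.1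

lemma exists_oneFormCoord_ne_zero {η : HolOneForm X} (hη : η ≠ 0) :
    ∃ p, oneFormCoord η p (chartAt ℂ p p) ≠ 0 := by
  by_contra! h0
  apply hη
  ext p : 1
  have h1 := h0 p
  have h2 : ∀ q : X, q = p → (η q : ℂ →L[ℂ] ℂ)
      ((trivializationAt ℂ (TangentSpace 𝓘(ℂ) : X → Type) p).symm q (1 : ℂ)) =
      (η p : ℂ →L[ℂ] ℂ)
      ((trivializationAt ℂ (TangentSpace 𝓘(ℂ) : X → Type) p).symm p (1 : ℂ)) := by
    rintro _ rfl; rfl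
  rw [oneFormCoord, h2 _ ((chartAt ℂ p).left_inv (mem_chart_source ℂ p))] at h1
  set v : ℂ := (trivializationAt ℂ (TangentSpace 𝓘(ℂ) : X → Type) p).symm p (1 : ℂ) with hv
  have hv0 : v ≠ 0 := by
    intro hv0
    have hb := FiberBundle.mem_baseSet_trivializationAt' (F := ℂ)
      (E := (TangentSpace 𝓘(ℂ) : X → Type)) p
    have e1 := (trivializationAt ℂ (TangentSpace 𝓘(ℂ) : X → Type) p).apply_mk_symm hb (1 : ℂ)
    rw [← hv, hv0] at e1
    have e2 := (trivializationAt ℂ (TangentSpace 𝓘(ℂ) : X → Type) p).zeroSection ℂ hb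
    exact zero_ne_one (congrArg Prod.snd (e2.symm.trans e1))
  exact eq_zero_of_apply_eq_zero (T := (η p : ℂ →L[ℂ] ℂ)) h1 hv0

end OneForms

section

variable {X : Type*} [TopologicalSpace X] [ChartedSpace ℂ X] [IsManifold 𝓘(ℂ) ω X]
  [CompactSpace X] [ConnectedSpace X] [T2Space X]
  {L : X → Type*} [TopologicalSpace (Bundle.TotalSpace ℂ L)]
  [∀ x, TopologicalSpace (L x)] [∀ x, AddCommGroup (L x)] [∀ x, Module ℂ (L x)]
  [FiberBundle ℂ L] [VectorBundle ℂ ℂ L] [ContMDiffVectorBundle ω ℂ L 𝓘(ℂ)]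
  {φ : HolSection L} {y y₁ : HolVectorField totalModel (Bundle.TotalSpace ℂ L)}
  {g : KahlerMetric X} {h : HermitianMetric L} {τ α c : ℝ} {p x : X}

lemma sectionCoord_center_eq_zero_iff (φ : HolSection L) (p : X) :
    sectionCoord φ p (chartAt ℂ p p) = 0 ↔ φ p = 0 := by
  have hc := center_mem_frameDomain (L := L) p
  have h1 := totalChart_symm_sectionCoord φ hc
  rw [(chartAt ℂ p).left_inv (mem_chart_source ℂ p), totalChart_symm_apply hc,
    (chartAt ℂ p).left_inv (mem_chart_source ℂ p)] at h1
  have h2 : (trivializationAt ℂ L p).symm p (sectionCoord φ p (chartAt ℂ p p)) = φ p := by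
    simpa using h1
  rw [← h2, trivializationAt_symm_eq_smul (FiberBundle.mem_baseSet_trivializationAt' p)]
  constructor
  · intro h; rw [h, zero_smul]
  · intro h
    by_contra hne
    have h3 : (trivializationAt ℂ L p).symm p (1 : ℂ) = 0 := by
      have := congrArg ((sectionCoord φ p (chartAt ℂ p p))⁻¹ • ·) h
      simpa [smul_smul, hne] using this
    have hb := FiberBundle.mem_baseSet_trivializationAt' (F := ℂ) (E := L) p
    have e1 := (trivializationAt ℂ L p).apply_mk_symm hb (1 : ℂ)
    rw [h3] at e1
    have e2 := (trivializationAt ℂ L p).zeroSection ℂ hb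
    exact zero_ne_one (congrArg Prod.snd (e2.symm.trans e1))

lemma sectionCoord_eq_zero_iff (φ : HolSection L) {z : ℂ} (hz : z ∈ frameDomain L x) :
    φ ((chartAt ℂ x).symm z) = 0 ↔ sectionCoord φ x z = 0 := by
  have ho := HermitianMetric.self_mem_frameOverlap hz
  rw [← sectionCoord_center_eq_zero_iff, sectionCoord_transition φ ho, mul_eq_zero]
  simp [frameChange_ne_zero ho]

lemma section_zero_set_analytic (φ : HolSection L) (x : X) : ∃ f : ℂ → ℂ,
    AnalyticAt ℂ f ((lineAtlas L).center x) ∧ ∀ᶠ z in 𝓝 ((lineAtlas L).center x),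
      ((lineAtlas L).chart x).symm z ∈ {p | φ p = 0} ↔ f z = 0 := by
  have hc := center_mem_frameDomain (L := L) x
  refine ⟨sectionCoord φ x, (differentiableOn_sectionCoord φ x).analyticAt
    ((isOpen_frameDomain x).mem_nhds hc), ?_⟩
  filter_upwards [(isOpen_frameDomain (L := L) x).mem_nhds hc] with z hz
  exact sectionCoord_eq_zero_iff φ hz

lemma eventually_section_ne_zero (hφ : φ ≠ 0) (x : X) : ∀ᶠ p in 𝓝[≠] x, φ p ≠ 0 := by
  refine HolAtlas.eventually_notMem_of_ne_univ (A := lineAtlas L) (section_zero_set_analytic φ)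
    (fun h => hφ ?_) x
  ext p
  exact Set.eq_univ_iff_forall.1 h p

lemma fieldA_eq_zero_of_section_eq_zero (hφ : φ ≠ 0) (hy : y ∈ lieAutTriple φ) (hp : φ p = 0) :
    fieldA y p (chartAt ℂ p p) = 0 := by
  have hc := center_mem_frameDomain (L := L) p
  have hU := (isOpen_frameDomain (L := L) p).mem_nhds hc
  refine eq_zero_of_mul_eq_mul_deriv (b := fieldB y p) ((differentiableOn_sectionCoord φ p).analyticAt hU)
    ((differentiableOn_fieldA p).differentiableAt hU).continuousAt
    ((differentiableOn_fieldB p).differentiableAt hU).continuousAt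
    ((sectionCoord_center_eq_zero_iff φ p).2 hp) (fun h0 => ?_) ?_
  · have h1 : ∀ᶠ q in 𝓝 p, φ q = 0 := by
      have hcont : ContinuousAt (chartAt ℂ p) p := (chartAt ℂ p).continuousAt (mem_chart_source ℂ p)
      filter_upwards [hcont.eventually (h0.and hU), (chartAt ℂ p).open_source.mem_nhds
        (mem_chart_source ℂ p)] with q hq hqs
      have e := (sectionCoord_eq_zero_iff φ hq.2).2 hq.1
      rwa [(chartAt ℂ p).left_inv hqs] at e
    have := (lineAtlas L).nhdsNE_neBot p
    obtain ⟨q, hq⟩ := ((h1.filter_mono nhdsWithin_le_nhds).and (eventually_section_ne_zero hφ p)).exists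
    exact hq.2 hq.1
  · filter_upwards [hU] with z hz
    exact fieldB_mul_sectionCoord hy hz

lemma exists_oneForm_ne_zero (hg : 0 < genus X) : ∃ η : HolOneForm X, η ≠ 0 := by
  by_contra! h0
  have : Subsingleton (HolOneForm X) := ⟨fun a b => (h0 a).trans (h0 b).symm⟩
  rw [genus, rank_subsingleton'] at hg
  simp at hg

/-- On a compact surface of positive genus, there are no nonzero infinitesimal automorphisms of a
gravitating vortex. -/
theorem subsingleton_lieAutTriple (H : IsGravitatingVortex τ α c φ g h) (hdeg : 0 < divisorDegree φ)
    (hφ : φ ≠ 0) (hg : 0 < genus X) : Subsingleton (lieAutTriple φ) := by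
  obtain ⟨p₀, hp₀⟩ := exists_eq_zero_of_divisorDegree φ hdeg
  obtain ⟨η, hη⟩ := exists_oneForm_ne_zero hg
  obtain ⟨q₁, hq₁⟩ := exists_oneFormCoord_ne_zero hη
  have hf := isForm_oneFormCoord (L := L) η
  have hh := isHol_oneFormCoord (L := L) η
  suffices hs : ∀ y ∈ lieAutTriple φ, y = 0 from
    ⟨fun a b => Subtype.ext ((hs a a.2).trans (hs b b.2).symm)⟩
  intro y hy
  have ha := isForm_fieldA (L := L) hy.1
  have hha : (lineAtlas L).IsHol (fieldA y) := fun x => differentiableOn_fieldA x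
  set f : X → ℂ := fun p => oneFormCoord η p (chartAt ℂ p p) * fieldA y p (chartAt ℂ p p) with hfdef
  have hfn : (lineAtlas L).IsHol ((lineAtlas L).fn f) := by
    intro x z hz
    have h0 := (hf.mul ha).cast (k' := 0) (l' := 0) (by norm_num) (by norm_num)
    exact (((hh x).mul (hha x)) z hz).congr (fun v hv => (h0.fn_val hv).symm) (h0.fn_val hz).symm
  have hzero : ∀ p, f p = 0 := fun p => by
    rw [HolAtlas.eq_of_isHol hfn p p₀, hfdef]
    simp only [fieldA_eq_zero_of_section_eq_zero hφ hy hp₀, mul_zero]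
  refine eq_zero_of_fieldA_eq_zero H hdeg hφ hy fun p => ?_
  by_contra hne
  have hne1 := hf.eventually_val_ne_zero hh (x₁ := q₁) hq₁ p
  have hne2 := ha.eventually_val_ne_zero hha (x₁ := p) hne p
  have := (lineAtlas L).nhdsNE_neBot p
  obtain ⟨q, h1, h2⟩ := (hne1.and hne2).exists
  exact (mul_ne_zero h1 h2) (hzero q)

end

namespace HolAtlas

variable {X : Type*} [TopologicalSpace X] {A : HolAtlas X} {η : X → ℂ → ℂ} {x y q : X} {z : ℂ}

variable (A) in
/-- A map that is holomorphic in the charts. -/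
def IsHolMap (f : X → X) : Prop :=
  ∀ x y, ∀ z ∈ (A.chart x).target, f ((A.chart x).symm z) ∈ (A.chart y).source →
    DifferentiableAt ℂ (fun z => A.chart y (f ((A.chart x).symm z))) z

/-- A holomorphic map that is the identity on a nonempty open set is the identity. -/
lemma IsHolMap.eq_id [T2Space X] [PreconnectedSpace X] {f : X → X} (hf : A.IsHolMap f)
    (hc : Continuous f) (hne : (interior {q | f q = q}).Nonempty) (q : X) : f q = q := by
  have h := eq_univ_of_interior_nonempty (A := A) (Z := {q | f q = q}) (fun x => ?_) hne
  · exact Set.eq_univ_iff_forall.1 h q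
  have hsymm : ContinuousAt (A.chart x).symm (A.center x) :=
    (A.chart x).symm.continuousAt (center_mem x)
  have hfs : ContinuousAt (fun z => f ((A.chart x).symm z)) (A.center x) :=
    hc.continuousAt.comp hsymm
  by_cases hx : f x = x
  · have hev : ∀ᶠ z in 𝓝 (A.center x), z ∈ (A.chart x).target ∧
        f ((A.chart x).symm z) ∈ (A.chart x).source := by
      refine Filter.Eventually.and ((A.chart x).open_target.mem_nhds (center_mem x))
        (hfs.eventually ((A.chart x).open_source.mem_nhds ?_))
      change f ((A.chart x).symm (A.center x)) ∈ _
      rw [symm_center, hx]; exact A.mem_source x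
    refine ⟨fun z => A.chart x (f ((A.chart x).symm z)) - z, ?_, ?_⟩
    · rw [Complex.analyticAt_iff_eventually_differentiableAt]
      filter_upwards [hev] with z hz
      exact (hf x x z hz.1 hz.2).sub differentiableAt_id
    · filter_upwards [hev] with z hz
      rw [sub_eq_zero]
      constructor
      · intro h; rw [h]; exact (A.chart x).right_inv hz.1
      · intro h
        rw [← (A.chart x).left_inv hz.2, h]
  · refine ⟨fun _ => 1, analyticAt_const, ?_⟩
    have h1 : ∀ᶠ z in 𝓝 (A.center x), f ((A.chart x).symm z) ≠ (A.chart x).symm z := by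
      have hO : IsOpen {q | f q ≠ q} := isOpen_ne_fun hc continuous_id
      refine hsymm.eventually (hO.mem_nhds ?_)
      rw [symm_center]; exact hx
    filter_upwards [h1] with z hz
    simpa using hz

/-- A primitive of a form in a disc around the centre of the chart at `x`. -/
structure IsPrimitiveAt (A : HolAtlas X) (η : X → ℂ → ℂ) (x : X) (r : ℝ) (P : ℂ → ℂ) : Prop where
  pos : 0 < r
  subset : Metric.ball (A.center x) r ⊆ (A.chart x).target
  deriv : ∀ z ∈ Metric.ball (A.center x) r, HasDerivAt P (η x z) z

lemma IsHol.exists_primitive (hη : A.IsHol η) (x : X) : ∃ r P, IsPrimitiveAt A η x r P := by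
  obtain ⟨r, hr, hsub⟩ := Metric.isOpen_iff.1 (A.chart x).open_target _ (center_mem x)
  obtain ⟨P, hP⟩ := ((hη x).mono hsub).isExactOn_ball
  exact ⟨r, P, hr, hsub, hP⟩

/-- The neighbourhood of `x` given by a disc in the chart at `x`. -/
def disc (A : HolAtlas X) (x : X) (r : ℝ) : Set X :=
  (A.chart x).source ∩ A.chart x ⁻¹' Metric.ball (A.center x) r

lemma isOpen_disc (x : X) (r : ℝ) : IsOpen (A.disc x r) :=
  (A.chart x).isOpen_inter_preimage Metric.isOpen_ball

lemma mem_disc_self {r : ℝ} (hr : 0 < r) : x ∈ A.disc x r :=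
  ⟨A.mem_source x, Metric.mem_ball_self hr⟩

/-- Primitives of the same form differ by locally constant functions. -/
lemma IsPrimitiveAt.eventually_sub_eq (hη : A.IsForm 1 0 η) {r r' : ℝ} {P P' : ℂ → ℂ}
    (hP : IsPrimitiveAt A η x r P) (hP' : IsPrimitiveAt A η y r' P') (hx : q ∈ A.disc x r)
    (hy : q ∈ A.disc y r') : ∀ᶠ p in 𝓝 q, P (A.chart x p) - P' (A.chart y p) =
      P (A.chart x q) - P' (A.chart y q) := by
  set O : Set ℂ := (A.overlap x y ∩ A.tr x y ⁻¹' Metric.ball (A.center y) r') ∩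
    Metric.ball (A.center x) r with hO
  have hOo : IsOpen O := ((continuousOn_tr x y).isOpen_inter_preimage (isOpen_overlap x y)
    Metric.isOpen_ball).inter Metric.isOpen_ball
  have hmem : ∀ p, p ∈ (A.chart x).source → p ∈ (A.chart y).source →
      A.tr x y (A.chart x p) = A.chart y p := fun p hp _ => by
    rw [tr, (A.chart x).left_inv hp]
  have hqO : A.chart x q ∈ O := by
    refine ⟨⟨⟨(A.chart x).map_source hx.1, ?_⟩, ?_⟩, hx.2⟩
    · rw [Set.mem_preimage, (A.chart x).left_inv hx.1]; exact hy.1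
    · rw [Set.mem_preimage, hmem q hx.1 hy.1]; exact hy.2
  obtain ⟨ε, hε, hball⟩ := Metric.isOpen_iff.1 hOo _ hqO
  have hder : ∀ z ∈ Metric.ball (A.chart x q) ε,
      HasDerivAt (fun z => P z - P' (A.tr x y z)) 0 z := by
    intro z hz
    obtain ⟨⟨h1, h2⟩, h3⟩ := hball hz
    have e := (hP.deriv z h3).sub
      ((hP'.deriv _ h2).comp z (differentiableAt_tr h1).hasDerivAt)
    rw [hη.trans x y z h1, zpow_one, zpow_zero, mul_one, sub_self] at e
    exact e
  have hconst : ∀ z ∈ Metric.ball (A.chart x q) ε,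
      P z - P' (A.tr x y z) = P (A.chart x q) - P' (A.tr x y (A.chart x q)) := by
    intro z hz
    exact Metric.isOpen_ball.is_const_of_deriv_eq_zero
      (convex_ball (A.chart x q) ε).isPreconnected
      (fun w hw => (hder w hw).differentiableAt.differentiableWithinAt)
      (fun w hw => (hder w hw).deriv) hz (Metric.mem_ball_self hε)
  have hcx : ContinuousAt (A.chart x) q := (A.chart x).continuousAt hx.1
  filter_upwards [hcx.eventually (Metric.ball_mem_nhds _ hε), (A.chart x).open_source.mem_nhds hx.1,
    (A.chart y).open_source.mem_nhds hy.1] with p h1 h2 h3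
  have h4 := hconst _ h1
  rwa [hmem p h2 h3, hmem q hx.1 hy.1] at h4

/-- On a compact surface with a nonzero holomorphic 1-form, a holomorphic map that fixes a given
point and is close to the identity is the identity. -/
theorem eventually_eq_id [CompactSpace X] [T2Space X] [PreconnectedSpace X] (hη : A.IsForm 1 0 η)
    (hh : A.IsHol η) {q₁ : X} (hq₁ : A.val η q₁ ≠ 0) (p₀ : X) :
    ∀ᶠ f : C(X, X) in 𝓝 (ContinuousMap.id X), A.IsHolMap f → f p₀ = p₀ → ∀ q, f q = q := by
  classical
  choose r P hP using hh.exists_primitive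
  have hloc : ∀ x, ∃ K : Set X, IsCompact K ∧ x ∈ interior K ∧ K ⊆ A.disc x (r x) := fun x =>
    exists_compact_subset (isOpen_disc x (r x)) (mem_disc_self (hP x).pos)
  choose K hKc hKx hKs using hloc
  obtain ⟨F, -, hF⟩ := isCompact_univ.elim_nhds_subcover (fun x => interior (K x))
    (fun x _ => isOpen_interior.mem_nhds (hKx x))
  have hcov : ∀ q, ∃ x ∈ insert q₁ F, q ∈ interior (K x) := fun q => by
    obtain ⟨x, hx, hq⟩ := Set.mem_iUnion₂.1 (hF (Set.mem_univ q))
    exact ⟨x, Finset.mem_insert_of_mem hx, hq⟩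
  have hid : ∀ (K U : Set X), IsCompact K → IsOpen U → K ⊆ U →
      ∀ᶠ f : C(X, X) in 𝓝 (ContinuousMap.id X), Set.MapsTo f K U := fun K U hK hU h =>
    ContinuousMap.eventually_mapsTo hK hU fun q hq => h hq
  have hmaps : ∀ᶠ f : C(X, X) in 𝓝 (ContinuousMap.id X),
      ∀ x ∈ insert q₁ F, Set.MapsTo f (K x) (A.disc x (r x)) := by
    rw [Filter.eventually_all_finset]
    exact fun x _ => hid _ _ (hKc x) (isOpen_disc x (r x)) (hKs x)
  have hcompat : ∀ᶠ f : C(X, X) in 𝓝 (ContinuousMap.id X), ∀ x ∈ insert q₁ F, ∀ y ∈ insert q₁ F,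
      ∀ q ∈ K x ∩ K y, P x (A.chart x (f q)) - P y (A.chart y (f q)) =
        P x (A.chart x q) - P y (A.chart y q) := by
    rw [Filter.eventually_all_finset]
    intro x _
    rw [Filter.eventually_all_finset]
    intro y _
    refine ((hKc x).inter (hKc y)).eventually_forall_of_forall_eventually
      (P := fun (f : C(X, X)) q => P x (A.chart x (f q)) - P y (A.chart y (f q)) =
        P x (A.chart x q) - P y (A.chart y q)) fun q hq => ?_
    have hc := (hP x).eventually_sub_eq hη (hP y) (hKs x hq.1) (hKs y hq.2)
    have hev : Filter.Tendsto (fun p : C(X, X) × X => p.1 p.2) (𝓝 (ContinuousMap.id X, q)) (𝓝 q) :=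
      (continuous_eval (F := C(X, X)) (X := X) (Y := X)).tendsto (ContinuousMap.id X, q)
    have hsnd : Filter.Tendsto (fun p : C(X, X) × X => p.2) (𝓝 (ContinuousMap.id X, q)) (𝓝 q) :=
      continuous_snd.tendsto (ContinuousMap.id X, q)
    filter_upwards [hev.eventually hc, hsnd.eventually hc] with p h1 h2
    exact h1.trans h2.symm
  have hd := (hP q₁).deriv _ (Metric.mem_ball_self (hP q₁).pos)
  have hana : AnalyticAt ℂ (P q₁) (A.center q₁) := by
    rw [Complex.analyticAt_iff_eventually_differentiableAt]
    filter_upwards [Metric.ball_mem_nhds _ (hP q₁).pos] with z hz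
    exact ((hP q₁).deriv z hz).differentiableAt
  have hstrict : HasStrictDerivAt (P q₁) (η q₁ (A.center q₁)) (A.center q₁) := by
    have := hana.contDiffAt.hasStrictDerivAt (n := ω) (by simp)
    rwa [hd.deriv] at this
  have hinj := hstrict.eventually_left_inverse hq₁
  obtain ⟨O, hOsub, hOo, hqO⟩ := mem_nhds_iff.1 hinj
  obtain ⟨C, hCc, hqC, hCs⟩ := exists_compact_subset
    ((((A.chart q₁).isOpen_inter_preimage hOo)).inter (isOpen_interior (s := K q₁)))
    (show q₁ ∈ _ from ⟨⟨A.mem_source q₁, hqO⟩, hKx q₁⟩)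
  have hCmaps := hid C _ hCc ((A.chart q₁).isOpen_inter_preimage hOo) fun q hq => (hCs hq).1
  filter_upwards [hmaps, hcompat, hCmaps] with f hf1 hf2 hf3 hf hfp
  have hmem1 : q₁ ∈ insert q₁ F := Finset.mem_insert_self _ _
  choose i hiF hi using hcov
  set H : X → ℂ := fun q => P (i q) (A.chart (i q) (f q)) - P (i q) (A.chart (i q) q) with hH
  have hHeq : ∀ x ∈ insert q₁ F, ∀ q ∈ interior (K x),
      H q = P x (A.chart x (f q)) - P x (A.chart x q) := by
    intro x hx q hq
    have h1 := hf2 x hx (i q) (hiF q) q ⟨interior_subset hq, interior_subset (hi q)⟩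
    simp only [hH]
    linear_combination (-1 : ℂ) * h1
  have hhol : A.IsHol (A.fn H) := by
    intro x z hz
    refine DifferentiableAt.differentiableWithinAt ?_
    set q := (A.chart x).symm z with hq
    set y := i q
    have hqy : q ∈ A.disc y (r y) := hKs y (interior_subset (hi q))
    have hfq : f q ∈ A.disc y (r y) := hf1 y (hiF q) (interior_subset (hi q))
    have hov : z ∈ A.overlap x y := ⟨hz, hqy.1⟩
    have h1 : DifferentiableAt ℂ (fun z => P y (A.chart y (f ((A.chart x).symm z)))) z :=
      DifferentiableAt.comp (g := P y) z ((hP y).deriv _ hfq.2).differentiableAt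
        (hf x y z hz hfq.1)
    have h2 : DifferentiableAt ℂ (fun z => P y (A.tr x y z)) z :=
      DifferentiableAt.comp (g := P y) z ((hP y).deriv _ hqy.2).differentiableAt
        (differentiableAt_tr hov)
    refine (h1.sub h2).congr_of_eventuallyEq ?_
    have hsymm : ContinuousAt (A.chart x).symm z := (A.chart x).symm.continuousAt hz
    filter_upwards [hsymm.eventually (isOpen_interior.mem_nhds (hi q))] with v hv
    exact hHeq y (hiF q) _ hv
  have hzero : ∀ q, H q = 0 := by
    intro q
    rw [eq_of_isHol hhol q p₀]
    simp only [hH, hfp, sub_self]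
  refine hf.eq_id f.continuous ⟨q₁, mem_interior_iff_mem_nhds.2 ?_⟩
  filter_upwards [isOpen_interior.mem_nhds hqC] with q hq
  have hqC' := interior_subset hq
  have h1 := hHeq q₁ hmem1 q (hCs hqC').2
  rw [hzero, eq_comm, sub_eq_zero] at h1
  have h2 := hOsub (hCs hqC').1.2
  have h3 := hOsub (hf3 hqC').2
  have h4 : A.chart q₁ (f q) = A.chart q₁ q := by
    have h2' : hstrict.localInverse (P q₁) _ _ hq₁ (P q₁ (A.chart q₁ q)) = A.chart q₁ q := h2
    have h3' : hstrict.localInverse (P q₁) _ _ hq₁ (P q₁ (A.chart q₁ (f q))) = A.chart q₁ (f q) := h3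
    rw [← h3', h1, h2']
  exact (A.chart q₁).injOn (hf3 hqC').1 (hCs hqC').1.1 h4

end HolAtlas

section Automorphisms

variable {X : Type*} [TopologicalSpace X] [ChartedSpace ℂ X]
  {L : X → Type*} [TopologicalSpace (Bundle.TotalSpace ℂ L)]
  [∀ x, TopologicalSpace (L x)] [∀ x, AddCommGroup (L x)] [∀ x, Module ℂ (L x)]
  [FiberBundle ℂ L] [VectorBundle ℂ ℂ L]
  {σ : Bundle.TotalSpace ℂ L ≃ₜ Bundle.TotalSpace ℂ L}

variable (L) in
lemma t2Space_totalSpace [T2Space X] : T2Space (Bundle.TotalSpace ℂ L) := by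
  refine ⟨fun p q hpq => ?_⟩
  by_cases hb : p.1 = q.1
  · set e := trivializationAt ℂ L p.1
    have hp : p ∈ e.source := e.mem_source.2 (FiberBundle.mem_baseSet_trivializationAt' p.1)
    have hq : q ∈ e.source := e.mem_source.2 (by
      rw [← hb]; exact FiberBundle.mem_baseSet_trivializationAt' p.1)
    obtain ⟨U, V, hU, hV, hpU, hqV, hd⟩ := t2_separation fun h => hpq (e.injOn hp hq h)
    exact ⟨_, _, e.continuousOn.isOpen_inter_preimage e.open_source hU,
      e.continuousOn.isOpen_inter_preimage e.open_source hV, ⟨hp, hpU⟩, ⟨hq, hqV⟩,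
      (hd.preimage e).mono Set.inter_subset_right Set.inter_subset_right⟩
  · exact separated_by_continuous (FiberBundle.continuous_proj ℂ L) hb

variable (L) in
lemma continuous_zeroSection : Continuous fun x : X => (⟨x, 0⟩ : Bundle.TotalSpace ℂ L) := by
  refine continuous_iff_continuousAt.2 fun x => ?_
  refine (FiberBundle.continuousAt_totalSpace ℂ _).2 ⟨continuousAt_id, ?_⟩
  refine (continuousAt_const (y := (0 : ℂ))).congr ?_
  filter_upwards [(trivializationAt ℂ L x).open_baseSet.mem_nhds
    (FiberBundle.mem_baseSet_trivializationAt' x)] with y hy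
  exact (congrArg Prod.snd ((trivializationAt ℂ L x).zeroSection ℂ hy)).symm

lemma trivializationAt_snd_eq_zero_iff {x p : X} (hp : p ∈ (trivializationAt ℂ L x).baseSet)
    (v : L p) : (trivializationAt ℂ L x ⟨p, v⟩).2 = 0 ↔ v = 0 := by
  have h := (trivializationAt ℂ L x).zeroSection ℂ hp
  constructor
  · intro hv
    have h1 : trivializationAt ℂ L x ⟨p, v⟩ = trivializationAt ℂ L x ⟨p, 0⟩ := by
      refine Prod.ext ?_ (hv.trans (congrArg Prod.snd h).symm)
      rw [(trivializationAt ℂ L x).coe_fst' hp, (trivializationAt ℂ L x).coe_fst' hp]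
    have h2 := (trivializationAt ℂ L x).injOn ((trivializationAt ℂ L x).mem_source.2 hp)
      ((trivializationAt ℂ L x).mem_source.2 hp) h1
    simpa using h2
  · rintro rfl
    exact congrArg Prod.snd h

lemma exists_smul_eq {p : X} {v : L p} (hv : v ≠ 0) (u : L p) : ∃ c : ℂ, c • v = u := by
  have hp := FiberBundle.mem_baseSet_trivializationAt' (F := ℂ) (E := L) p
  have h := (trivializationAt ℂ L p).linear ℂ hp
  set a := (trivializationAt ℂ L p ⟨p, v⟩).2 with ha
  have ha0 : a ≠ 0 := fun h0 => hv ((trivializationAt_snd_eq_zero_iff hp v).1 h0)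
  refine ⟨(trivializationAt ℂ L p ⟨p, u⟩).2 / a, ?_⟩
  rw [← sub_eq_zero, ← trivializationAt_snd_eq_zero_iff hp]
  refine (h.mk' _).map_sub _ _ |>.trans ?_
  rw [(h.mk' _).map_smul]
  change (trivializationAt ℂ L p ⟨p, u⟩).2 / a * a - (trivializationAt ℂ L p ⟨p, u⟩).2 = 0
  rw [div_mul_cancel₀ _ ha0, sub_self]

lemma continuous_fiberScale_left (p : Bundle.TotalSpace ℂ L) :
    Continuous fun c : ℂ => fiberScale c p := by
  have hp := FiberBundle.mem_baseSet_trivializationAt' (F := ℂ) (E := L) p.1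
  refine continuous_iff_continuousAt.2 fun c => (FiberBundle.continuousAt_totalSpace ℂ _).2
    ⟨continuousAt_const, ?_⟩
  have h : (fun c : ℂ => (trivializationAt ℂ L p.1 (fiberScale c p)).2) =
      fun c => c • (trivializationAt ℂ L p.1 p).2 :=
    funext fun c => ((trivializationAt ℂ L p.1).linear ℂ hp).map_smul c p.2
  exact h ▸ (continuous_id.smul continuous_const).continuousAt

lemma fiberScale_zero (p : Bundle.TotalSpace ℂ L) : fiberScale 0 p = ⟨p.1, 0⟩ := by
  simp [fiberScale]

section T2
variable [T2Space X]

/-- Automorphisms cover their base maps. -/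
lemma proj_apply_of_mem_autPair (hσ : σ ∈ autPair L) (p : Bundle.TotalSpace ℂ L) :
    (σ p).1 = baseMap σ p.1 := by
  have hc : Continuous fun c : ℂ => (σ (fiberScale c p)).1 :=
    (FiberBundle.continuous_proj ℂ L).comp (σ.continuous.comp (continuous_fiberScale_left p))
  have h0 := hc.continuousAt (x := 0)
  have h1 : Filter.Tendsto (fun c : ℂ => (σ (fiberScale c p)).1) (𝓝[≠] 0) (𝓝 (σ p).1) := by
    refine tendsto_const_nhds.congr' ?_
    filter_upwards [self_mem_nhdsWithin] with c hc
    exact (congrArg Bundle.TotalSpace.proj (hσ.2.2 (Units.mk0 c hc) p)).symm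
  have h2 := tendsto_nhds_unique h1 (h0.tendsto.mono_left nhdsWithin_le_nhds)
  rw [h2, fiberScale_zero]
  rfl

lemma apply_fiberScale_of_mem_autPair (hσ : σ ∈ autPair L) (c : ℂ) (p : Bundle.TotalSpace ℂ L) :
    σ (fiberScale c p) = fiberScale c (σ p) := by
  by_cases hc : c = 0
  · rw [hc, fiberScale_zero, fiberScale_zero, apply_zero_of_mem_autPair hσ,
      proj_apply_of_mem_autPair hσ]
  · exact hσ.2.2 (Units.mk0 c hc) p

lemma apply_section_of_mem_autTriple {φ : HolSection L} (hσ : σ ∈ autTriple φ) (x : X) :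
    σ ⟨x, φ x⟩ = ⟨baseMap σ x, φ (baseMap σ x)⟩ := by
  have h : σ ⟨x, φ x⟩ ∈ sectionGraph φ := by
    rw [← hσ.2]; exact ⟨_, ⟨x, rfl⟩, rfl⟩
  obtain ⟨y, hy⟩ := h
  have h1 : y = baseMap σ x := by
    rw [← proj_apply_of_mem_autPair hσ.1 ⟨x, φ x⟩, ← hy]
  rw [← hy, h1]

lemma section_baseMap_eq_zero {φ : HolSection L} (hσ : σ ∈ autTriple φ) {x : X} (hx : φ x = 0) :
    φ (baseMap σ x) = 0 := by
  have h := apply_section_of_mem_autTriple hσ x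
  rw [hx, apply_zero_of_mem_autPair hσ.1] at h
  simpa using h.symm

end T2

section Continuity

/-- The map of the base induced by a map of the total space. -/
def inducedMap (F : C(Bundle.TotalSpace ℂ L, Bundle.TotalSpace ℂ L)) : C(X, X) :=
  ((⟨Bundle.TotalSpace.proj, FiberBundle.continuous_proj ℂ L⟩ : C(Bundle.TotalSpace ℂ L, X)).comp
    F).comp ⟨_, continuous_zeroSection L⟩

lemma continuous_inducedMap : Continuous (inducedMap (L := L)) :=
  (ContinuousMap.continuous_precomp _).comp (ContinuousMap.continuous_postcomp _)

lemma continuous_homeo_toContinuousMap (Y : Type*) [TopologicalSpace Y] :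
    Continuous fun σ : Y ≃ₜ Y => (⟨σ, σ.continuous⟩ : C(Y, Y)) :=
  continuous_induced_dom

lemma continuous_homeo_mul_left {Y : Type*} [TopologicalSpace Y] (σ : Y ≃ₜ Y) :
    Continuous fun τ : Y ≃ₜ Y => σ * τ :=
  continuous_induced_rng.2 ((ContinuousMap.continuous_postcomp (⟨σ, σ.continuous⟩ : C(Y, Y))).comp
    (continuous_homeo_toContinuousMap Y))

/-- A group of homeomorphisms is discrete if its elements near the identity are trivial. -/
lemma discreteTopology_of_eventually_eq_one {Y : Type*} [TopologicalSpace Y]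
    (G : Subgroup (Y ≃ₜ Y)) (h : ∀ᶠ σ in 𝓝 (1 : Y ≃ₜ Y), σ ∈ G → σ = 1) : DiscreteTopology G := by
  refine discreteTopology_iff_isOpen_singleton.2 fun σ => isOpen_singleton_iff_nhds_eq_pure _ |>.2
    (le_antisymm ?_ (pure_le_nhds σ))
  rw [Filter.le_pure_iff]
  have h1 : Filter.Tendsto (fun τ : G => (σ : Y ≃ₜ Y)⁻¹ * τ) (𝓝 σ) (𝓝 1) := by
    have := ((continuous_homeo_mul_left (σ : Y ≃ₜ Y)⁻¹).comp continuous_subtype_val).tendsto σ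
    rwa [Function.comp_apply, inv_mul_cancel] at this
  filter_upwards [h1.eventually h] with τ hτ
  exact (Subtype.ext (inv_mul_eq_one.1 (hτ (mul_mem (inv_mem σ.2) τ.2)))).symm

end Continuity

variable [IsManifold 𝓘(ℂ) ω X] [ContMDiffVectorBundle ω ℂ L 𝓘(ℂ)]

lemma differentiableAt_baseMap (hσ : σ ∈ autPair L) {x y : X} {z : ℂ}
    (hz : z ∈ (chartAt ℂ x).target) (hy : baseMap σ ((chartAt ℂ x).symm z) ∈ (chartAt ℂ y).source) :
    DifferentiableAt ℂ (fun z => chartAt ℂ y (baseMap σ ((chartAt ℂ x).symm z))) z := by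
  have h := (mdifferentiableAt_iff_of_mem_source (I := 𝓘(ℂ)) (I' := 𝓘(ℂ)) (f := baseMap σ)
    (x := x) (y := y) (x' := (chartAt ℂ x).symm z) ((chartAt ℂ x).map_target hz) hy).1
    (mdifferentiable_baseMap hσ _)
  have h2 := h.2
  rw [ModelWithCorners.range_eq_univ, differentiableWithinAt_univ] at h2
  have h3 : extChartAt 𝓘(ℂ) x ((chartAt ℂ x).symm z) = z := (chartAt ℂ x).right_inv hz
  rw [h3] at h2
  exact h2

lemma isHolMap_baseMap (hσ : σ ∈ autPair L) : (lineAtlas L).IsHolMap (baseMap σ) :=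
  fun _ _ _ hz hy => differentiableAt_baseMap hσ hz.1 hy.1

variable [T2Space X]

lemma eq_one_of_baseMap_eq_id {φ : HolSection L} (hφ : ∀ x, ∀ᶠ p in 𝓝[≠] x, φ p ≠ 0)
    (hσ : σ ∈ autTriple φ) (h : ∀ x, baseMap σ x = x) : σ = 1 := by
  have := t2Space_totalSpace L
  have hd : Dense {p : Bundle.TotalSpace ℂ L | φ p.1 ≠ 0} := by
    refine Dense.preimage (s := {x | φ x ≠ 0}) (fun x => ?_) (FiberBundle.isOpenMap_proj ℂ L)
    have := (lineAtlas L).nhdsNE_neBot x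
    exact mem_closure_iff_frequently.2 ((hφ x).frequently.filter_mono nhdsWithin_le_nhds)
  have hcl : IsClosed {p | σ p = p} := isClosed_eq σ.continuous continuous_id
  have hsub : {p : Bundle.TotalSpace ℂ L | φ p.1 ≠ 0} ⊆ {p | σ p = p} := by
    rintro ⟨x, v⟩ hp
    obtain ⟨c, rfl⟩ := exists_smul_eq (v := φ x) hp v
    have h1 := apply_fiberScale_of_mem_autPair hσ.1 c ⟨x, φ x⟩
    rw [apply_section_of_mem_autTriple hσ, h] at h1
    exact h1
  ext p : 1
  exact (hcl.closure_subset_iff.2 hsub) (hd p)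

/-- On a compact surface of positive genus, the automorphism group of a line bundle with a section
that has a zero is discrete. -/
theorem discreteTopology_autTriple [CompactSpace X] [ConnectedSpace X] {φ : HolSection L}
    (hφ : φ ≠ 0) (hdeg : 0 < divisorDegree φ) (hg : 0 < genus X) :
    DiscreteTopology (autTriple φ) := by
  obtain ⟨p₀, hp₀⟩ := exists_eq_zero_of_divisorDegree φ hdeg
  obtain ⟨η, hη⟩ := exists_oneForm_ne_zero hg
  obtain ⟨q₁, hq₁⟩ := exists_oneFormCoord_ne_zero hη
  have h1 := HolAtlas.eventually_eq_id (A := lineAtlas L) (isForm_oneFormCoord η)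
    (isHol_oneFormCoord η) (q₁ := q₁) hq₁ p₀
  have hne := eventually_section_ne_zero hφ
  have hC : Filter.Tendsto (fun σ : Bundle.TotalSpace ℂ L ≃ₜ Bundle.TotalSpace ℂ L =>
      inducedMap (⟨σ, σ.continuous⟩ : C(Bundle.TotalSpace ℂ L, Bundle.TotalSpace ℂ L))) (𝓝 1)
      (𝓝 (ContinuousMap.id X)) :=
    (continuous_inducedMap.comp (continuous_homeo_toContinuousMap _)).tendsto 1
  have hev : Filter.Tendsto (fun σ : Bundle.TotalSpace ℂ L ≃ₜ Bundle.TotalSpace ℂ L =>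
      baseMap σ p₀) (𝓝 1) (𝓝 p₀) :=
    ((continuous_eval_const p₀).tendsto (ContinuousMap.id X)).comp hC
  have h2 : ∀ᶠ p in 𝓝 p₀, p ≠ p₀ → φ p ≠ 0 := eventually_nhdsWithin_iff.1 (hne p₀)
  refine discreteTopology_of_eventually_eq_one _ ?_
  filter_upwards [hC.eventually h1, hev.eventually h2] with σ h3 h4 hσ
  refine eq_one_of_baseMap_eq_id hne hσ (h3 (isHolMap_baseMap hσ.1) ?_)
  by_contra h5
  exact h4 h5 (section_baseMap_eq_zero hσ hp₀)

end Automorphisms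

namespace HolAtlas

variable {X : Type*} [TopologicalSpace X] {A : HolAtlas X}

/-- A holomorphic map whose derivative is bounded as long as its values stay in a disc does not
leave this disc in short time. -/
lemma IsHolMap.mem_disc_of_deriv_le [T2Space X] {f : X → X} (hf : A.IsHolMap f) (hc : Continuous f)
    {p q : X} {r R C : ℝ} (hC : 0 ≤ C) (hrC : C * r ≤ R / 2)
    (hp : Metric.ball (A.center p) r ⊆ (A.chart p).target)
    (hq : Metric.closedBall (A.center q) R ⊆ (A.chart q).target)
    (hd : ∀ z ∈ Metric.ball (A.center p) r, f ((A.chart p).symm z) ∈ (A.chart q).source →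
      A.chart q (f ((A.chart p).symm z)) ∈ Metric.closedBall (A.center q) R →
      ‖deriv (fun z => A.chart q (f ((A.chart p).symm z))) z‖ ≤ C)
    (h0 : f p ∈ A.disc q (R / 2)) {z : ℂ} (hz : z ∈ Metric.ball (A.center p) r) :
    f ((A.chart p).symm z) ∈ A.disc q R := by
  have hr : 0 < r := (dist_nonneg).trans_lt (Metric.mem_ball.1 hz)
  have hR : 0 < R / 2 := (dist_nonneg).trans_lt (Metric.mem_ball.1 h0.2)
  set γ : ℝ → ℂ := fun t => A.center p + t • (z - A.center p) with hγ
  have hγb : ∀ t ∈ Set.Icc (0 : ℝ) 1, γ t ∈ Metric.ball (A.center p) r := by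
    intro t ht
    rw [Metric.mem_ball, dist_eq_norm]
    simp only [hγ, add_sub_cancel_left, norm_smul, Real.norm_eq_abs, abs_of_nonneg ht.1]
    refine lt_of_le_of_lt (mul_le_of_le_one_left (norm_nonneg _) ht.2) ?_
    rwa [← dist_eq_norm]
  have hγc : Continuous γ := by fun_prop
  set k : ℝ → X := fun t => f ((A.chart p).symm (γ t)) with hk
  have hkc : ContinuousOn k (Set.Icc 0 1) :=
    hc.comp_continuousOn ((A.chart p).continuousOn_symm.comp hγc.continuousOn
      fun t ht => hp (hγb t ht))
  by_contra hnot
  have hT : IsCompact (Set.Icc (0 : ℝ) 1 ∩ k ⁻¹' (A.disc q R)ᶜ) :=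
    isCompact_Icc.of_isClosed_subset
      (hkc.preimage_isClosed_of_isClosed isClosed_Icc (isOpen_disc q R).isClosed_compl)
      Set.inter_subset_left
  obtain ⟨t₁, ht₁, hmin⟩ := hT.exists_isLeast ⟨1, ⟨zero_le_one, le_rfl⟩, by
    simpa [hk, hγ] using hnot⟩
  have hlt : ∀ t ∈ Set.Ico 0 t₁, k t ∈ A.disc q R := fun t ht => by
    by_contra h
    exact absurd (hmin ⟨⟨ht.1, ht.2.le.trans ht₁.1.2⟩, h⟩) (not_le.2 ht.2)
  have hk0 : k 0 = f p := by simp [hk, hγ, symm_center]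
  have h0R : f p ∈ A.disc q R := ⟨h0.1, Metric.ball_subset_ball (by linarith) h0.2⟩
  have ht0 : 0 < t₁ := ht₁.1.1.lt_of_ne fun h => ht₁.2 (by rw [← h, hk0]; exact h0R)
  set Kc : Set X := (A.chart q).symm '' Metric.closedBall (A.center q) R with hKc
  have hKcl : IsClosed Kc := ((isCompact_closedBall _ _).image_of_continuousOn
    ((A.chart q).continuousOn_symm.mono hq)).isClosed
  have hsub : A.disc q R ⊆ Kc := fun x hx =>
    ⟨A.chart q x, Metric.ball_subset_closedBall hx.2, (A.chart q).left_inv hx.1⟩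
  have hle : ∀ t ∈ Set.Icc 0 t₁, k t ∈ Kc := by
    have h1 : Set.MapsTo k (closure (Set.Ico 0 t₁)) (closure Kc) := by
      refine Set.MapsTo.closure_of_continuousOn (fun t ht => hsub (hlt t ht)) ?_
      rw [closure_Ico ht0.ne]
      exact hkc.mono (Set.Icc_subset_Icc_right ht₁.1.2)
    rwa [closure_Ico ht0.ne, hKcl.closure_eq] at h1
  have hKmem : ∀ x ∈ Kc, x ∈ (A.chart q).source ∧
      A.chart q x ∈ Metric.closedBall (A.center q) R := by
    rintro _ ⟨w, hw, rfl⟩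
    exact ⟨(A.chart q).map_target (hq hw), by rwa [(A.chart q).right_inv (hq hw)]⟩
  set F : ℂ → ℂ := fun z => A.chart q (f ((A.chart p).symm z)) with hF
  have hder : ∀ t ∈ Set.Icc 0 t₁, HasDerivWithinAt (fun t => F (γ t))
      (deriv F (γ t) * (z - A.center p)) (Set.Icc 0 t₁) t := by
    intro t ht
    have hb := hγb t ⟨ht.1, ht.2.trans ht₁.1.2⟩
    have h1 : HasDerivAt F (deriv F (γ t)) (γ t) :=
      (hf p q _ (hp hb) (hKmem _ (hle t ht)).1).hasDerivAt
    have h2 : HasDerivAt γ (z - A.center p) t := by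
      have := ((hasDerivAt_id t).smul_const (z - A.center p)).const_add (A.center p)
      rwa [one_smul] at this
    exact (h1.comp t h2).hasDerivWithinAt
  have hbound := (convex_Icc 0 t₁).norm_image_sub_le_of_norm_hasDerivWithin_le (C := C * dist z (A.center p))
    hder (fun t ht => by
      rw [norm_mul, ← dist_eq_norm]
      exact mul_le_mul_of_nonneg_right (hd _ (hγb t ⟨ht.1, ht.2.trans ht₁.1.2⟩)
        (hKmem _ (hle t ht)).1 (hKmem _ (hle t ht)).2) dist_nonneg)
    (Set.left_mem_Icc.2 ht0.le) (Set.right_mem_Icc.2 ht0.le)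
  refine ht₁.2 ⟨(hKmem _ (hle t₁ (Set.right_mem_Icc.2 ht0.le))).1, ?_⟩
  have e0 : F (γ 0) = A.chart q (f p) := by simp [hF, hγ, symm_center]
  rw [e0] at hbound
  change dist (F (γ t₁)) _ < R
  have h3 : dist (F (γ t₁)) (A.chart q (f p)) ≤ R / 2 := by
    rw [dist_eq_norm]
    refine hbound.trans (le_trans ?_ hrC)
    rw [sub_zero, Real.norm_eq_abs, abs_of_pos ht0]
    have h4 : C * dist z (A.center p) ≤ C * r :=
      mul_le_mul_of_nonneg_left (Metric.mem_ball.1 hz).le hC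
    exact (mul_le_of_le_one_right (mul_nonneg hC dist_nonneg) ht₁.1.2).trans h4
  have h5 : dist (A.chart q (f p)) (A.center q) < R / 2 := h0.2
  linarith [dist_triangle (F (γ t₁)) (A.chart q (f p)) (A.center q)]

end HolAtlas

section BaseIsometries

variable {X : Type*} [TopologicalSpace X] [ChartedSpace ℂ X] [IsManifold 𝓘(ℂ) ω X]

/-- The derivative of the preferred chart at `x`. -/
noncomputable def chartDeriv (x q : X) : ℂ →L[ℂ] ℂ := mfderiv 𝓘(ℂ) 𝓘(ℂ) (extChartAt 𝓘(ℂ) x) q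

lemma KahlerMetric.normSq_eq_mfderiv (g : KahlerMetric X) {x q : X} (hq : q ∈ (chartAt ℂ x).source)
    (v : ℂ) : g.normSq (⟨q, v⟩ : TangentBundle 𝓘(ℂ) X) =
      ‖chartDeriv x q v‖ ^ 2 *
        g.weight x (chartAt ℂ x q) := by
  have h := TangentBundle.continuousLinearMapAt_trivializationAt (I := 𝓘(ℂ)) (x₀ := x) (x := q) hq
  have hb : q ∈ (trivializationAt ℂ (TangentSpace 𝓘(ℂ) : X → Type) x).baseSet := by
    rwa [TangentBundle.trivializationAt_baseSet]
  refine (HermitianMetric.normSq_eq g (x := x) ⟨hq, hb⟩ v).trans ?_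
  have h2 := congrArg (fun T : ℂ →L[ℂ] ℂ => T v) h
  have h3 : (trivializationAt ℂ (TangentSpace 𝓘(ℂ) : X → Type) x).continuousLinearMapAt ℂ q v =
      (trivializationAt ℂ (TangentSpace 𝓘(ℂ) : X → Type) x ⟨q, v⟩).2 := by
    rw [Bundle.Trivialization.continuousLinearMapAt_apply,
      Bundle.Trivialization.coe_linearMapAt_of_mem _ hb]
  exact congrArg (fun c : ℂ => ‖c‖ ^ 2 * g.weight x (chartAt ℂ x q)) (h3.symm.trans h2)

lemma KahlerMetric.normSq_tangentMap (g : KahlerMetric X) {f : X → X} {x y : X} {z : ℂ}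
    (hz : z ∈ (chartAt ℂ x).target)
    (hf : MDifferentiableAt 𝓘(ℂ) 𝓘(ℂ) f ((chartAt ℂ x).symm z))
    (hy : f ((chartAt ℂ x).symm z) ∈ (chartAt ℂ y).source) (v : ℂ) :
    g.normSq (tangentMap 𝓘(ℂ) 𝓘(ℂ) f (⟨(chartAt ℂ x).symm z, v⟩ : TangentBundle 𝓘(ℂ) X)) =
      ‖deriv (fun z => chartAt ℂ y (f ((chartAt ℂ x).symm z))) z‖ ^ 2 *
      ‖chartDeriv x ((chartAt ℂ x).symm z) v‖ ^ 2 *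
        g.weight y (chartAt ℂ y (f ((chartAt ℂ x).symm z))) := by
  set q := (chartAt ℂ x).symm z with hq
  set u : ℂ := mfderiv 𝓘(ℂ) 𝓘(ℂ) f q v with hu
  have h1 := chartField_related (I := 𝓘(ℂ)) (I' := 𝓘(ℂ)) (V := fun _ : X => v)
    (V' := fun _ : X => u) (x₀ := x) (x₁ := y) (f := f) (z := z) (by simpa using hz) hf
    (by simpa using hy) rfl
  have e1 := chartField_eq (I := 𝓘(ℂ)) (fun _ : X => u) y (z := chartAt ℂ y (f q))
    (by simpa using (chartAt ℂ y).map_source hy)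
  have e2 := chartField_eq (I := 𝓘(ℂ)) (fun _ : X => v) x (z := z) (by simpa using hz)
  have e3 : (extChartAt 𝓘(ℂ) y).symm (chartAt ℂ y (f q)) = f q := (chartAt ℂ y).left_inv hy
  rw [e3] at e1
  have h2 : (chartDeriv y (f q) u) =
      deriv (fun z => chartAt ℂ y (f ((chartAt ℂ x).symm z))) z *
        (chartDeriv x q v) := by
    refine e1.symm.trans (h1.trans ?_)
    refine (congrArg (fderiv ℂ (extChartAt 𝓘(ℂ) y ∘ f ∘ (extChartAt 𝓘(ℂ) x).symm) z) e2).trans ?_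
    exact (fderiv_eq_smul_deriv (𝕜 := ℂ) (chartDeriv x q v)).trans (mul_comm _ _)
  have h3 := g.normSq_eq_mfderiv hy u
  rw [h2, norm_mul, mul_pow] at h3
  exact h3

/-- The coordinate expression of an isometry. -/
lemma KahlerMetric.weight_of_isometry (g : KahlerMetric X) {f : X → X}
    (hf : MDifferentiable 𝓘(ℂ) 𝓘(ℂ) f)
    (h : ∀ v : TangentBundle 𝓘(ℂ) X, g.normSq (tangentMap 𝓘(ℂ) 𝓘(ℂ) f v) = g.normSq v) {x y : X}
    {z : ℂ} (hz : z ∈ (chartAt ℂ x).target)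
    (hy : f ((chartAt ℂ x).symm z) ∈ (chartAt ℂ y).source) :
    ‖deriv (fun z => chartAt ℂ y (f ((chartAt ℂ x).symm z))) z‖ ^ 2 *
      g.weight y (chartAt ℂ y (f ((chartAt ℂ x).symm z))) = g.weight x z := by
  have hq := (chartAt ℂ x).map_target hz
  set v : ℂ := (trivializationAt ℂ (TangentSpace 𝓘(ℂ) : X → Type) x).symm ((chartAt ℂ x).symm z)
    (1 : ℂ)
  have hw : g.weight x z = g.normSq (⟨(chartAt ℂ x).symm z, v⟩ : TangentBundle 𝓘(ℂ) X) := rfl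
  have h1 := g.normSq_tangentMap hz (hf _) hy v
  have h2 := g.normSq_eq_mfderiv hq v
  have hpos := kahlerWeight_pos g hz
  rw [h, h2] at h1
  rw [← hw, (chartAt ℂ x).right_inv hz] at h2
  rw [(chartAt ℂ x).right_inv hz] at h1
  have h3 : ‖chartDeriv x ((chartAt ℂ x).symm z) v‖ ^ 2 = 1 := by
    refine mul_right_cancel₀ hpos.ne' ?_
    rw [one_mul]
    exact h2.symm
  rw [h3, mul_one, one_mul] at h1
  exact h1.symm

lemma KahlerMetric.isometry_of_weight (g : KahlerMetric X) {f : X → X}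
    (hf : MDifferentiable 𝓘(ℂ) 𝓘(ℂ) f)
    (h : ∀ q, ‖deriv (fun z => chartAt ℂ (f q) (f ((chartAt ℂ q).symm z))) (chartAt ℂ q q)‖ ^ 2 *
      g.weight (f q) (chartAt ℂ (f q) (f q)) = g.weight q (chartAt ℂ q q))
    (v : TangentBundle 𝓘(ℂ) X) : g.normSq (tangentMap 𝓘(ℂ) 𝓘(ℂ) f v) = g.normSq v := by
  obtain ⟨q, v⟩ := v
  have hq := mem_chart_source ℂ q
  have hz := mem_chart_target ℂ q
  have hs : (chartAt ℂ q).symm (chartAt ℂ q q) = q := (chartAt ℂ q).left_inv hq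
  have hy := mem_chart_source ℂ (f q)
  have h2 := g.normSq_tangentMap (f := f) (y := f q) hz (hf _) (by rwa [hs]) v
  rw [hs] at h2
  refine h2.trans (Eq.trans ?_ (g.normSq_eq_mfderiv hq v).symm)
  rw [← h q]
  ring

end BaseIsometries

section Coordinates

variable {X : Type*} [TopologicalSpace X] [ChartedSpace ℂ X]
  {L : X → Type*} [TopologicalSpace (Bundle.TotalSpace ℂ L)]
  [∀ x, TopologicalSpace (L x)] [∀ x, AddCommGroup (L x)] [∀ x, Module ℂ (L x)]
  [FiberBundle ℂ L] [VectorBundle ℂ ℂ L]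
  {σ : Bundle.TotalSpace ℂ L ≃ₜ Bundle.TotalSpace ℂ L}
  {G : Bundle.TotalSpace ℂ L → Bundle.TotalSpace ℂ L} {p q : X} {z w : ℂ}

lemma fiberScale_totalChart_symm (hz : z ∈ frameDomain L p) (c : ℂ) :
    fiberScale c ((totalChart L p).symm (z, w)) = (totalChart L p).symm (z, c * w) := by
  rw [totalChart_symm_apply hz, totalChart_symm_apply hz, trivializationAt_symm_eq_smul hz.2 w,
    trivializationAt_symm_eq_smul hz.2 (c * w), mul_smul]
  rfl

lemma fiberScale_mem_source {v : Bundle.TotalSpace ℂ L} (hv : v ∈ (totalChart L q).source) (c : ℂ) :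
    fiberScale c v ∈ (totalChart L q).source := by
  rw [totalChart_source] at hv ⊢
  exact hv

lemma totalChart_fiberScale {v : Bundle.TotalSpace ℂ L} (hv : v ∈ (totalChart L q).source) (c : ℂ) :
    totalChart L q (fiberScale c v) = ((totalChart L q v).1, c * (totalChart L q v).2) := by
  rw [totalChart_apply (fiberScale_mem_source hv c), totalChart_apply hv]
  rw [totalChart_source] at hv
  exact Prod.ext rfl (((trivializationAt ℂ L q).linear ℂ hv.2).map_smul c v.2)

/-- The coordinate expression of the image of the preferred frame under a map of the total space. -/
noncomputable def frameImage (G : Bundle.TotalSpace ℂ L → Bundle.TotalSpace ℂ L) (p q : X) (z : ℂ) :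
    ℂ × ℂ :=
  totalChart L q (G ((totalChart L p).symm (z, 1)))

lemma apply_totalChart_symm (hG : ∀ (c : ℂ) v, G (fiberScale c v) = fiberScale c (G v))
    (hz : z ∈ frameDomain L p) (w : ℂ) :
    G ((totalChart L p).symm (z, w)) = fiberScale w (G ((totalChart L p).symm (z, 1))) := by
  rw [← hG, fiberScale_totalChart_symm hz, mul_one]

lemma apply_totalChart_symm_mem_source (hG : ∀ (c : ℂ) v, G (fiberScale c v) = fiberScale c (G v))
    (hz : z ∈ frameDomain L p) (hs : G ((totalChart L p).symm (z, 1)) ∈ (totalChart L q).source)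
    (w : ℂ) : G ((totalChart L p).symm (z, w)) ∈ (totalChart L q).source := by
  rw [apply_totalChart_symm hG hz]
  exact fiberScale_mem_source hs w

lemma totalChart_apply_totalChart_symm
    (hG : ∀ (c : ℂ) v, G (fiberScale c v) = fiberScale c (G v))
    (hz : z ∈ frameDomain L p) (hs : G ((totalChart L p).symm (z, 1)) ∈ (totalChart L q).source)
    (w : ℂ) : totalChart L q (G ((totalChart L p).symm (z, w))) =
      ((frameImage G p q z).1, w * (frameImage G p q z).2) := by
  rw [apply_totalChart_symm hG hz, totalChart_fiberScale hs]
  rfl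

lemma frameImage_fst_mem (hs : G ((totalChart L p).symm (z, 1)) ∈ (totalChart L q).source) :
    (frameImage G p q z).1 ∈ frameDomain L q := by
  have := (totalChart L q).map_source hs
  rw [totalChart_target] at this
  exact this.1

lemma norm_frameImage_snd {h : HermitianMetric L} (hG : ∀ v, h.normSq (G v) = h.normSq v)
    (hz : z ∈ frameDomain L p) (hs : G ((totalChart L p).symm (z, 1)) ∈ (totalChart L q).source) :
    ‖(frameImage G p q z).2‖ ^ 2 * h.weight q (frameImage G p q z).1 = h.weight p z := by
  rw [← h.normSq_totalChart_symm (frameImage_fst_mem hs), h.weight_eq_totalChart hz,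
    ← hG ((totalChart L p).symm (z, 1)), ← (totalChart L q).left_inv hs]
  rfl

lemma differentiableAt_frameImage [IsManifold 𝓘(ℂ) ω X] [ContMDiffVectorBundle ω ℂ L 𝓘(ℂ)]
    (hσ : σ ∈ autPair L) (hz : z ∈ frameDomain L p)
    (hs : σ ((totalChart L p).symm (z, 1)) ∈ (totalChart L q).source) :
    DifferentiableAt ℂ (frameImage σ p q) z := by
  have ht := mk_mem_totalChart_target (w := 1) hz
  have h := ((contMDiffAt_iff_of_mem_source (I := totalModel) (I' := totalModel)
    (x := (⟨p, 0⟩ : Bundle.TotalSpace ℂ L)) (y := (⟨q, 0⟩ : Bundle.TotalSpace ℂ L))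
    (x' := (totalChart L p).symm (z, 1))
    (by simpa using (totalChart L p).map_target ht) (by simpa using hs)).1 (hσ.1 _)).2
  rw [ModelWithCorners.range_eq_univ, contDiffWithinAt_univ, (totalChart L p).right_inv ht] at h
  exact DifferentiableAt.comp (f := fun z => (z, (1 : ℂ))) z (h.differentiableAt (by simp))
    (differentiableAt_fun_id.prodMk (differentiableAt_const (1 : ℂ)))

variable [T2Space X]

lemma frameImage_fst (hσ : σ ∈ autPair L) (hz : z ∈ frameDomain L p)
    (hs : σ ((totalChart L p).symm (z, 1)) ∈ (totalChart L q).source) :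
    (frameImage σ p q z).1 = chartAt ℂ q (baseMap σ ((chartAt ℂ p).symm z)) := by
  rw [frameImage, totalChart_apply hs, proj_apply_of_mem_autPair hσ, totalChart_symm_apply hz]

lemma apply_totalChart_symm_mem_source_iff (hσ : σ ∈ autPair L) (hz : z ∈ frameDomain L p) :
    σ ((totalChart L p).symm (z, w)) ∈ (totalChart L q).source ↔
      baseMap σ ((chartAt ℂ p).symm z) ∈ (chartAt ℂ q).source ∩ (trivializationAt ℂ L q).baseSet := by
  rw [totalChart_source, Set.mem_ofPred_eq, proj_apply_of_mem_autPair hσ, totalChart_symm_apply hz]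
  rfl

end Coordinates

lemma le_sqrt_of_sq_mul_eq {a m M x y : ℝ} (hm : 0 < m) (h : a ^ 2 * y = x)
    (hy : m ≤ y) (hx : x ≤ M) : a ≤ √(M / m) := by
  refine Real.le_sqrt_of_sq_le ?_
  rw [le_div_iff₀ hm]
  nlinarith [sq_nonneg a]

section Estimate

variable {X : Type*} [TopologicalSpace X] [ChartedSpace ℂ X] [IsManifold 𝓘(ℂ) ω X] [T2Space X]
  {L : X → Type*} [TopologicalSpace (Bundle.TotalSpace ℂ L)]
  [∀ x, TopologicalSpace (L x)] [∀ x, AddCommGroup (L x)] [∀ x, Module ℂ (L x)]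
  [FiberBundle ℂ L] [VectorBundle ℂ ℂ L] [ContMDiffVectorBundle ω ℂ L 𝓘(ℂ)]
  {φ : HolSection L} (g : KahlerMetric X) (h : HermitianMetric L)

lemma exists_closedBall_weight_bounds (p : X) : ∃ r > 0, ∃ m > 0, ∃ M,
    Metric.closedBall (chartAt ℂ p p) r ⊆ frameDomain L p ∧
    ∀ z ∈ Metric.closedBall (chartAt ℂ p p) r,
      (m ≤ g.weight p z ∧ g.weight p z ≤ M) ∧ m ≤ h.weight p z ∧ h.weight p z ≤ M := by
  have hc := center_mem_frameDomain (L := L) p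
  have hU := (isOpen_frameDomain (L := L) p).mem_nhds hc
  have h1 : ContinuousAt (g.weight p) (chartAt ℂ p p) :=
    ((contDiffOn_kahlerWeight g p).continuousOn).continuousAt
      ((chartAt ℂ p).open_target.mem_nhds hc.1)
  have h2 : ContinuousAt (h.weight p) (chartAt ℂ p p) :=
    ((h.contDiffOn_weight p).continuousOn).continuousAt hU
  have hp1 := kahlerWeight_pos g hc.1
  have hp2 := h.weight_pos hc
  set a := g.weight p (chartAt ℂ p p)
  set b := h.weight p (chartAt ℂ p p)
  have e1 := h1.eventually (Ioo_mem_nhds (half_lt_self hp1) (lt_add_of_pos_right a hp2))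
  have e2 := h2.eventually (Ioo_mem_nhds (half_lt_self hp2) (lt_add_of_pos_left b hp1))
  obtain ⟨r, hr, hball⟩ := Metric.nhds_basis_closedBall.mem_iff.1
    (Filter.inter_mem hU (Filter.inter_mem e1 e2))
  refine ⟨r, hr, min (a / 2) (b / 2), lt_min (half_pos hp1) (half_pos hp2), a + b,
    fun z hz => (hball hz).1, fun z hz => ?_⟩
  obtain ⟨-, ⟨e1, e2⟩, e3, e4⟩ := hball hz
  exact ⟨⟨(min_le_left _ _).trans e1.le, e2.le⟩, (min_le_right _ _).trans e3.le, e4.le⟩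

/-- Isometries that move a given point to a point near `q` are uniformly Lipschitz near the given
point. -/
theorem exists_uniform_lipschitz (p q : X) : ∃ r > 0, ∃ C, ∃ ε > 0,
    Metric.ball (chartAt ℂ p p) r ⊆ frameDomain L p ∧
    ∀ σ ∈ isometryGroup φ g h, baseMap σ p ∈ (lineAtlas L).disc q ε →
      ∀ z ∈ Metric.ball (chartAt ℂ p p) r,
        σ ((totalChart L p).symm (z, 1)) ∈ (totalChart L q).source ∧
        ‖frameImage σ p q z - frameImage σ p q (chartAt ℂ p p)‖ ≤ C * ‖z - chartAt ℂ p p‖ ∧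
        ‖(frameImage σ p q z).2‖ ≤ C := by
  obtain ⟨s, hs, _, _, M, hsub, hM⟩ := exists_closedBall_weight_bounds (L := L) g h p
  obtain ⟨R, hR, m, hm, _, hsubq, hmq⟩ := exists_closedBall_weight_bounds (L := L) g h q
  set C := √(M / m) with hC
  have hC0 : 0 ≤ C := Real.sqrt_nonneg _
  set r := min s (R / 2 / (C + 1)) with hr
  have hr0 : 0 < r := lt_min hs (by positivity)
  have hrC : C * r ≤ R / 2 := by
    have h1 : r ≤ R / 2 / (C + 1) := min_le_right _ _
    rw [le_div_iff₀ (by positivity)] at h1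
    nlinarith
  have hball : Metric.ball (chartAt ℂ p p) r ⊆ Metric.closedBall (chartAt ℂ p p) s :=
    (Metric.ball_subset_ball (min_le_left _ _)).trans Metric.ball_subset_closedBall
  refine ⟨r / 2, half_pos hr0, C + C / (r / 4), R / 2, half_pos hR,
    (Metric.ball_subset_ball (half_le_self hr0.le)).trans (hball.trans hsub), ?_⟩
  rintro σ ⟨hσ, hσh, hσg⟩ hq
  have hder : ∀ z ∈ Metric.ball (chartAt ℂ p p) r,
      baseMap σ ((chartAt ℂ p).symm z) ∈ (chartAt ℂ q).source →
      chartAt ℂ q (baseMap σ ((chartAt ℂ p).symm z)) ∈ Metric.closedBall (chartAt ℂ q q) R →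
      ‖deriv (fun z => chartAt ℂ q (baseMap σ ((chartAt ℂ p).symm z))) z‖ ≤ C := fun z hz h1 h2 =>
    le_sqrt_of_sq_mul_eq hm 
      (g.weight_of_isometry (mdifferentiable_baseMap hσ.1) hσg (hsub (hball hz)).1 h1)
      (hmq _ h2).1.1 (hM z (hball hz)).1.2
  have hdisc : ∀ z ∈ Metric.ball (chartAt ℂ p p) r,
      baseMap σ ((chartAt ℂ p).symm z) ∈ (lineAtlas L).disc q R := fun z hz =>
    (isHolMap_baseMap hσ.1).mem_disc_of_deriv_le (p := p) (q := q)
      (FiberBundle.continuous_proj ℂ L |>.comp (σ.continuous.comp (continuous_zeroSection L)))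
      hC0 hrC (hball.trans hsub) hsubq (fun z hz h1 h2 => hder z hz h1.1 h2) hq hz
  have hsrc : ∀ z ∈ Metric.ball (chartAt ℂ p p) r,
      σ ((totalChart L p).symm (z, 1)) ∈ (totalChart L q).source := fun z hz =>
    (apply_totalChart_symm_mem_source_iff hσ.1 (hsub (hball hz))).2 (hdisc z hz).1
  have hdiff : ∀ z ∈ Metric.ball (chartAt ℂ p p) r, DifferentiableAt ℂ (frameImage σ p q) z :=
    fun z hz => differentiableAt_frameImage hσ.1 (hsub (hball hz)) (hsrc z hz)
  have hfst : ∀ z ∈ Metric.ball (chartAt ℂ p p) r, (frameImage σ p q z).1 =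
      chartAt ℂ q (baseMap σ ((chartAt ℂ p).symm z)) := fun z hz =>
    frameImage_fst hσ.1 (hsub (hball hz)) (hsrc z hz)
  have hcl : ∀ z ∈ Metric.ball (chartAt ℂ p p) r,
      (frameImage σ p q z).1 ∈ Metric.closedBall (chartAt ℂ q q) R := fun z hz => by
    rw [hfst z hz]; exact Metric.ball_subset_closedBall (hdisc z hz).2
  have hsnd : ∀ z ∈ Metric.ball (chartAt ℂ p p) r, ‖(frameImage σ p q z).2‖ ≤ C := fun z hz =>
    le_sqrt_of_sq_mul_eq hm
      (norm_frameImage_snd hσh (hsub (hball hz)) (hsrc z hz)) (hmq _ (hcl z hz)).2.1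
      (hM z (hball hz)).2.2
  have hd1 : ∀ z ∈ Metric.ball (chartAt ℂ p p) r,
      ‖deriv (fun z => (frameImage σ p q z).1) z‖ ≤ C := fun z hz => by
    have : (fun z => (frameImage σ p q z).1) =ᶠ[𝓝 z]
        fun z => chartAt ℂ q (baseMap σ ((chartAt ℂ p).symm z)) := by
      filter_upwards [Metric.isOpen_ball.mem_nhds hz] with v hv using hfst v hv
    rw [this.deriv_eq]
    exact hder z hz (hdisc z hz).1.1 (Metric.ball_subset_closedBall (hdisc z hz).2)
  have hd2 : ∀ z ∈ Metric.ball (chartAt ℂ p p) (r / 2),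
      ‖deriv (fun z => (frameImage σ p q z).2) z‖ ≤ C / (r / 4) := fun z hz => by
    have hin : Metric.closedBall z (r / 4) ⊆ Metric.ball (chartAt ℂ p p) r := by
      refine Metric.closedBall_subset_ball' ?_
      linarith [Metric.mem_ball.1 hz]
    refine Complex.norm_deriv_le_of_forall_mem_sphere_norm_le (by positivity)
      (DifferentiableOn.diffContOnCl_ball (U := Metric.ball (chartAt ℂ p p) r)
        (fun v hv => (hdiff v hv).snd.differentiableWithinAt) hin)
      fun v hv => hsnd v (hin (Metric.sphere_subset_closedBall hv))
  have hsub2 : Metric.ball (chartAt ℂ p p) (r / 2) ⊆ Metric.ball (chartAt ℂ p p) r :=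
    Metric.ball_subset_ball (half_le_self hr0.le)
  have hC4 : 0 ≤ C / (r / 4) := by positivity
  intro z hz
  have hcen := Metric.mem_ball_self (x := chartAt ℂ p p) (half_pos hr0)
  refine ⟨hsrc z (hsub2 hz), ?_, (hsnd z (hsub2 hz)).trans (by linarith)⟩
  have l1 := (convex_ball (chartAt ℂ p p) (r / 2)).norm_image_sub_le_of_norm_deriv_le
    (f := fun z => (frameImage σ p q z).1) (fun v hv => (hdiff v (hsub2 hv)).fst)
    (fun v hv => hd1 v (hsub2 hv)) hcen hz
  have l2 := (convex_ball (chartAt ℂ p p) (r / 2)).norm_image_sub_le_of_norm_deriv_le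
    (f := fun z => (frameImage σ p q z).2) (fun v hv => (hdiff v (hsub2 hv)).snd)
    (fun v hv => hd2 v hv) hcen hz
  have hn := norm_nonneg (z - chartAt ℂ p p)
  rw [Prod.norm_def, Prod.fst_sub, Prod.snd_sub]
  exact max_le (l1.trans (mul_le_mul_of_nonneg_right (by linarith) hn))
    (l2.trans (mul_le_mul_of_nonneg_right (by linarith) hn))

end Estimate

section Limits

variable {X : Type*} [TopologicalSpace X] [ChartedSpace ℂ X] [IsManifold 𝓘(ℂ) ω X] [T2Space X]
  {L : X → Type*} [TopologicalSpace (Bundle.TotalSpace ℂ L)]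
  [∀ x, TopologicalSpace (L x)] [∀ x, AddCommGroup (L x)] [∀ x, Module ℂ (L x)]
  [FiberBundle ℂ L] [VectorBundle ℂ ℂ L] [ContMDiffVectorBundle ω ℂ L 𝓘(ℂ)]
  {φ : HolSection L} {g : KahlerMetric X} {h : HermitianMetric L}

lemma continuousAt_totalChart {q : X} {v : Bundle.TotalSpace ℂ L} (hv : v ∈ (totalChart L q).source) :
    ContinuousAt (totalChart L q) v :=
  continuousAt_extChartAt' hv

lemma continuousAt_totalChart_symm {q : X} {a : ℂ × ℂ} (ha : a ∈ (totalChart L q).target) :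
    ContinuousAt (totalChart L q).symm a :=
  continuousAt_extChartAt_symm'' ha

lemma totalChart_source_mem_nhds {q : X} {v : Bundle.TotalSpace ℂ L}
    (hv : v ∈ (totalChart L q).source) : (totalChart L q).source ∈ 𝓝 v :=
  (isOpen_extChartAt_source _).mem_nhds hv

lemma self_mem_totalChart_source (v : Bundle.TotalSpace ℂ L) : v ∈ (totalChart L v.1).source := by
  rw [totalChart_source]
  exact ⟨mem_chart_source ℂ _, FiberBundle.mem_baseSet_trivializationAt' _⟩

/-- Bounded ultrafilters on the total space of a line bundle over a compact surface converge. -/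
lemma exists_ultrafilter_le_nhds [CompactSpace X] (g : KahlerMetric X) (h : HermitianMetric L)
    (u : Ultrafilter (Bundle.TotalSpace ℂ L)) {r : ℝ} (hu : ∀ᶠ v in (u : Filter _), h.normSq v ≤ r) :
    ∃ v, (u : Filter (Bundle.TotalSpace ℂ L)) ≤ 𝓝 v := by
  obtain ⟨x, -, hx⟩ := isCompact_univ.ultrafilter_le_nhds (u.map Bundle.TotalSpace.proj) (by simp)
  have hproj : Filter.Tendsto (Bundle.TotalSpace.proj : Bundle.TotalSpace ℂ L → X) u (𝓝 x) := hx
  obtain ⟨s, hs, m, hm, _, hsub, hbd⟩ := exists_closedBall_weight_bounds (L := L) g h x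
  have hcx : ContinuousAt (chartAt ℂ x) x := (chartAt ℂ x).continuousAt (mem_chart_source ℂ x)
  have h1 : ∀ᶠ v in (u : Filter (Bundle.TotalSpace ℂ L)), v ∈ (totalChart L x).source := by
    rw [totalChart_source]
    exact hproj.eventually (((chartAt ℂ x).open_source.inter
      (trivializationAt ℂ L x).open_baseSet).mem_nhds
      ⟨mem_chart_source ℂ x, FiberBundle.mem_baseSet_trivializationAt' x⟩)
  have h2 : ∀ᶠ v in (u : Filter (Bundle.TotalSpace ℂ L)),
      chartAt ℂ x v.1 ∈ Metric.closedBall (chartAt ℂ x x) s :=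
    (hcx.tendsto.comp hproj).eventually (Metric.closedBall_mem_nhds _ hs)
  have h3 : ∀ᶠ v in (u : Filter (Bundle.TotalSpace ℂ L)), totalChart L x v ∈
      Metric.closedBall (chartAt ℂ x x) s ×ˢ Metric.closedBall (0 : ℂ) √(r / m) := by
    filter_upwards [hu, h1, h2] with v hv1 hv2 hv3
    have hfst : (totalChart L x v).1 = chartAt ℂ x v.1 := by rw [totalChart_apply hv2]
    have hv3' : (totalChart L x v).1 ∈ Metric.closedBall (chartAt ℂ x x) s := by rwa [hfst]
    refine ⟨hv3', ?_⟩
    have e := h.normSq_totalChart_symm (w := (totalChart L x v).2) (hsub hv3')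
    rw [Prod.mk.eta, (totalChart L x).left_inv hv2] at e
    rw [mem_closedBall_zero_iff]
    exact le_sqrt_of_sq_mul_eq hm e.symm (hbd _ hv3').2.1 hv1
  obtain ⟨a, ha, hau⟩ := ((isCompact_closedBall (chartAt ℂ x x) s).prod
    (isCompact_closedBall (0 : ℂ) √(r / m))).ultrafilter_le_nhds' (u.map (totalChart L x)) h3
  have hat : a ∈ (totalChart L x).target := by
    rw [totalChart_target]; exact ⟨hsub ha.1, Set.mem_univ _⟩
  refine ⟨(totalChart L x).symm a, ?_⟩
  have h4 : Filter.Tendsto (fun v => (totalChart L x).symm (totalChart L x v)) u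
      (𝓝 ((totalChart L x).symm a)) := (continuousAt_totalChart_symm hat).tendsto.comp hau
  have h5 : Filter.Tendsto id (u : Filter (Bundle.TotalSpace ℂ L)) (𝓝 ((totalChart L x).symm a)) := by
    refine h4.congr' ?_
    filter_upwards [h1] with v hv using (totalChart L x).left_inv hv
  exact h5

/-- Continuous convergence of homeomorphisms to a map along a filter. -/
def ConvergesContinuously {Y : Type*} [TopologicalSpace Y] (U : Filter (Y ≃ₜ Y)) (G : Y → Y) : Prop :=
  ∀ v, Filter.Tendsto (fun s : (Y ≃ₜ Y) × Y => s.1 s.2) (U ×ˢ 𝓝 v) (𝓝 (G v))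

/-- Pointwise limits of isometries are continuous limits. -/
lemma convergesContinuously_of_tendsto {U : Filter (Bundle.TotalSpace ℂ L ≃ₜ Bundle.TotalSpace ℂ L)}
    (hU : ∀ᶠ σ in U, σ ∈ isometryGroup φ g h) {G : Bundle.TotalSpace ℂ L → Bundle.TotalSpace ℂ L}
    (hG : ∀ v, Filter.Tendsto (fun σ : Bundle.TotalSpace ℂ L ≃ₜ Bundle.TotalSpace ℂ L => σ v) U
      (𝓝 (G v))) : ConvergesContinuously U G := by
  intro v
  set p := v.1 with hp
  set q := (G v).1 with hq
  have hvs : v ∈ (totalChart L p).source := self_mem_totalChart_source v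
  have hGs : G v ∈ (totalChart L q).source := self_mem_totalChart_source (G v)
  obtain ⟨r, hr, C, ε, hε, hsub, hest⟩ := exists_uniform_lipschitz (φ := φ) g h p q
  have hc : (totalChart L p v).1 = chartAt ℂ p p := by rw [totalChart_apply hvs]
  set w₀ := (totalChart L p v).2 with hw₀
  have hgood : ∀ᶠ σ in U, σ ∈ isometryGroup φ g h ∧ baseMap σ p ∈ (lineAtlas L).disc q ε ∧
      σ v ∈ (totalChart L q).source := by
    have h1 : Filter.Tendsto (fun σ : Bundle.TotalSpace ℂ L ≃ₜ Bundle.TotalSpace ℂ L => (σ v).1) U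
        (𝓝 q) := ((FiberBundle.continuous_proj ℂ L).tendsto (G v)).comp (hG v)
    filter_upwards [hU, h1.eventually ((HolAtlas.isOpen_disc (A := lineAtlas L) q ε).mem_nhds
      (HolAtlas.mem_disc_self hε)), (hG v).eventually (totalChart_source_mem_nhds hGs)] with σ h1 h2 h3
    refine ⟨h1, ?_, h3⟩
    rwa [proj_apply_of_mem_autPair h1.1.1] at h2
  have hnear : ∀ᶠ v' in 𝓝 v, v' ∈ (totalChart L p).source ∧
      (totalChart L p v').1 ∈ Metric.ball (chartAt ℂ p p) r :=
    Filter.Eventually.and (totalChart_source_mem_nhds hvs)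
      ((continuousAt_totalChart hvs).fst.eventually (by
        rw [show (fun x => (totalChart L p x).1) v = chartAt ℂ p p from hc]
        exact Metric.ball_mem_nhds _ hr))
  have hboth := hgood.prod_mk hnear
  have hkey : ∀ᶠ s in U ×ˢ 𝓝 v, s.1 s.2 ∈ (totalChart L q).source ∧
      ‖totalChart L q (s.1 s.2) - totalChart L q (s.1 v)‖ ≤
        C * ‖(totalChart L p s.2).1 - chartAt ℂ p p‖ +
        (‖(totalChart L p s.2).2 - w₀‖ * C +
          ‖w₀‖ * (C * ‖(totalChart L p s.2).1 - chartAt ℂ p p‖)) := by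
    filter_upwards [hboth] with ⟨σ, v'⟩ ⟨⟨hσ, hσd, _⟩, hv's, hv'b⟩
    dsimp only at hσ hσd hv's hv'b ⊢
    set z := (totalChart L p v').1 with hz
    set w := (totalChart L p v').2 with hw
    have hG' := apply_fiberScale_of_mem_autPair hσ.1.1
    obtain ⟨e1, e2, e3⟩ := hest σ hσ hσd z hv'b
    obtain ⟨f1, f2, f3⟩ := hest σ hσ hσd _ (Metric.mem_ball_self hr)
    have hv' : v' = (totalChart L p).symm (z, w) := ((totalChart L p).left_inv hv's).symm
    have hv : v = (totalChart L p).symm (chartAt ℂ p p, w₀) := by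
      rw [← hc]; exact ((totalChart L p).left_inv hvs).symm
    have hzD := hsub hv'b
    have hcD := hsub (Metric.mem_ball_self hr)
    have k1 := totalChart_apply_totalChart_symm hG' hzD e1 w
    have k2 := totalChart_apply_totalChart_symm hG' hcD f1 w₀
    rw [← hv'] at k1
    rw [← hv] at k2
    refine ⟨?_, ?_⟩
    · rw [hv']; exact apply_totalChart_symm_mem_source hG' hzD e1 w
    rw [k1, k2]
    set a := frameImage σ p q z
    set b := frameImage σ p q (chartAt ℂ p p)
    have n1 : ‖a.1 - b.1‖ ≤ C * ‖z - chartAt ℂ p p‖ := (norm_fst_le (a - b)).trans e2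
    have n2 : ‖a.2 - b.2‖ ≤ C * ‖z - chartAt ℂ p p‖ := (norm_snd_le (a - b)).trans e2
    have n3 : ‖w * a.2 - w₀ * b.2‖ ≤ ‖w - w₀‖ * C + ‖w₀‖ * (C * ‖z - chartAt ℂ p p‖) := by
      have : w * a.2 - w₀ * b.2 = (w - w₀) * a.2 + w₀ * (a.2 - b.2) := by ring
      rw [this]
      refine (norm_add_le _ _).trans ?_
      rw [norm_mul, norm_mul]
      gcongr
    have n4 : 0 ≤ C * ‖z - chartAt ℂ p p‖ := (norm_nonneg _).trans n1
    have n5 := (norm_nonneg _).trans n3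
    rw [Prod.norm_def]
    exact max_le (n1.trans (by linarith)) (n3.trans (by linarith))
  have hbound : Filter.Tendsto (fun s : (Bundle.TotalSpace ℂ L ≃ₜ Bundle.TotalSpace ℂ L) ×
      Bundle.TotalSpace ℂ L => C * ‖(totalChart L p s.2).1 - chartAt ℂ p p‖ +
        (‖(totalChart L p s.2).2 - w₀‖ * C +
          ‖w₀‖ * (C * ‖(totalChart L p s.2).1 - chartAt ℂ p p‖))) (U ×ˢ 𝓝 v) (𝓝 0) := by
    have hcont : ContinuousAt (fun v' => C * ‖(totalChart L p v').1 - chartAt ℂ p p‖ +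
        (‖(totalChart L p v').2 - w₀‖ * C +
          ‖w₀‖ * (C * ‖(totalChart L p v').1 - chartAt ℂ p p‖))) v := by
      have h1 := (continuousAt_totalChart hvs).fst
      have h2 := (continuousAt_totalChart hvs).snd
      fun_prop
    have h0 := hcont.tendsto
    simp only [hc, ← hw₀, sub_self, norm_zero, mul_zero, zero_mul, add_zero] at h0
    exact h0.comp Filter.tendsto_snd
  have hdiff := squeeze_zero_norm' (hkey.mono fun s hs => hs.2) hbound
  have hpt : Filter.Tendsto (fun s : (Bundle.TotalSpace ℂ L ≃ₜ Bundle.TotalSpace ℂ L) ×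
      Bundle.TotalSpace ℂ L => totalChart L q (s.1 v)) (U ×ˢ 𝓝 v) (𝓝 (totalChart L q (G v))) :=
    ((continuousAt_totalChart hGs).tendsto.comp (hG v)).comp Filter.tendsto_fst
  have hsum := hdiff.add hpt
  simp only [sub_add_cancel, zero_add] at hsum
  have hfin := (continuousAt_totalChart_symm ((totalChart L q).map_source hGs)).tendsto.comp hsum
  rw [(totalChart L q).left_inv hGs] at hfin
  refine hfin.congr' ?_
  filter_upwards [hkey] with s hs using (totalChart L q).left_inv hs.1

lemma exists_convergesContinuously [CompactSpace X]
    (U : Ultrafilter (Bundle.TotalSpace ℂ L ≃ₜ Bundle.TotalSpace ℂ L))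
    (hU : ∀ᶠ σ in (U : Filter _), σ ∈ isometryGroup φ g h) : 
    ∃ G, ConvergesContinuously (U : Filter (Bundle.TotalSpace ℂ L ≃ₜ Bundle.TotalSpace ℂ L)) G := by
  have h1 : ∀ v, ∃ u, Filter.Tendsto
      (fun σ : Bundle.TotalSpace ℂ L ≃ₜ Bundle.TotalSpace ℂ L => σ v) U (𝓝 u) := fun v =>
    exists_ultrafilter_le_nhds g h
      (U.map fun σ : Bundle.TotalSpace ℂ L ≃ₜ Bundle.TotalSpace ℂ L => σ v) (r := h.normSq v)
      (hU.mono fun σ hσ => (hσ.2.1 v).le : ∀ᶠ σ : Bundle.TotalSpace ℂ L ≃ₜ Bundle.TotalSpace ℂ L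
        in U, h.normSq (σ v) ≤ h.normSq v)
  choose G hG using h1
  exact ⟨G, convergesContinuously_of_tendsto hU hG⟩

end Limits

namespace ConvergesContinuously

variable {Y : Type*} [TopologicalSpace Y] {U : Filter (Y ≃ₜ Y)} {G : Y → Y}

lemma tendsto_apply (hG : ConvergesContinuously U G) {α : Type*} {l : Filter α} {u : α → Y ≃ₜ Y}
    {f : α → Y} {v : Y} (hu : Filter.Tendsto u l U) (hf : Filter.Tendsto f l (𝓝 v)) :
    Filter.Tendsto (fun a => u a (f a)) l (𝓝 (G v)) :=
  (hG v).comp (hu.prodMk hf)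

lemma tendsto (hG : ConvergesContinuously U G) (v : Y) :
    Filter.Tendsto (fun σ : Y ≃ₜ Y => σ v) U (𝓝 (G v)) :=
  hG.tendsto_apply Filter.tendsto_id tendsto_const_nhds

lemma continuous [RegularSpace Y] [U.NeBot] (hG : ConvergesContinuously U G) : Continuous G := by
  refine continuous_iff_continuousAt.2 fun v => (closed_nhds_basis (G v)).tendsto_right_iff.2 ?_
  rintro V ⟨hV, hVc⟩
  obtain ⟨A, hA, W, hW, hAW⟩ := Filter.mem_prod_iff.1 ((hG v) hV)
  filter_upwards [hW] with w hw
  exact hVc.mem_of_tendsto (hG.tendsto w) (Filter.mem_of_superset hA fun σ hσ =>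
    hAW (show (σ, w) ∈ A ×ˢ W from ⟨hσ, hw⟩))

/-- Continuous convergence implies convergence in the compact-open topology. -/
lemma le_nhds {σ₀ : Y ≃ₜ Y} (hG : ConvergesContinuously U σ₀) : U ≤ 𝓝 σ₀ := by
  rw [nhds_induced, ← Filter.map_le_iff_le_comap]
  refine ContinuousMap.tendsto_nhds_compactOpen.2 fun K hK O hO hmaps => ?_
  refine hK.induction_on (p := fun S => ∀ᶠ σ : Y ≃ₜ Y in U, Set.MapsTo σ S O)
    (Filter.Eventually.of_forall fun σ => Set.mapsTo_empty _ _)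
    (fun S T hST hT => hT.mono fun σ hσ => hσ.mono_left hST)
    (fun S T hS hT => (hS.and hT).mono fun σ hσ => hσ.1.union hσ.2) fun v hv => ?_
  obtain ⟨A, hA, W, hW, hAW⟩ := Filter.mem_prod_iff.1 ((hG v) (hO.mem_nhds (hmaps hv)))
  exact ⟨W, mem_nhdsWithin_of_mem_nhds hW, Filter.mem_of_superset hA fun σ hσ w hw =>
    hAW (show (σ, w) ∈ A ×ˢ W from ⟨hσ, hw⟩)⟩

lemma rightInverse [T2Space Y] [U.NeBot] {G' : Y → Y} (hG : ConvergesContinuously U G)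
    (hG' : ConvergesContinuously (U.map fun σ => σ⁻¹) G') : Function.RightInverse G' G := fun v => by
  have h1 := hG.tendsto_apply (u := id) Filter.tendsto_id
    ((hG'.tendsto v).comp (Filter.tendsto_map (f := fun σ : Y ≃ₜ Y => σ⁻¹)))
  refine tendsto_nhds_unique h1 (tendsto_const_nhds.congr fun σ => ?_)
  exact (σ.apply_symm_apply v).symm

end ConvergesContinuously

section Holomorphic

variable {X : Type*} [TopologicalSpace X] [ChartedSpace ℂ X] [IsManifold 𝓘(ℂ) ω X] [T2Space X]
  {L : X → Type*} [TopologicalSpace (Bundle.TotalSpace ℂ L)]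
  [∀ x, TopologicalSpace (L x)] [∀ x, AddCommGroup (L x)] [∀ x, Module ℂ (L x)]
  [FiberBundle ℂ L] [VectorBundle ℂ ℂ L] [ContMDiffVectorBundle ω ℂ L 𝓘(ℂ)]
  {φ : HolSection L} {g : KahlerMetric X} {h : HermitianMetric L}
  {U : Filter (Bundle.TotalSpace ℂ L ≃ₜ Bundle.TotalSpace ℂ L)} [U.NeBot]
  {G : Bundle.TotalSpace ℂ L → Bundle.TotalSpace ℂ L}

/-- Continuous limits of automorphisms are locally uniform limits in coordinates. -/
lemma ConvergesContinuously.exists_tendstoLocallyUniformlyOn (hG : ConvergesContinuously U G)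
    (hGc : Continuous G) {p q : X}
    (hs : G ((totalChart L p).symm (chartAt ℂ p p, 1)) ∈ (totalChart L q).source) :
    ∃ N, IsOpen N ∧ chartAt ℂ p p ∈ N ∧ N ⊆ frameDomain L p ∧
      (∀ z ∈ N, G ((totalChart L p).symm (z, 1)) ∈ (totalChart L q).source) ∧
      (∀ᶠ σ in U, ∀ z ∈ N, σ ((totalChart L p).symm (z, 1)) ∈ (totalChart L q).source) ∧
      TendstoLocallyUniformlyOn (fun (σ : Bundle.TotalSpace ℂ L ≃ₜ Bundle.TotalSpace ℂ L) =>
        frameImage σ p q) (frameImage G p q) U N := by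
  have hcont : ∀ z ∈ frameDomain L p,
      ContinuousAt (fun z => (totalChart L p).symm (z, (1 : ℂ))) z := fun z hz =>
    ContinuousAt.comp (f := fun z => (z, (1 : ℂ)))
      (continuousAt_totalChart_symm (mk_mem_totalChart_target hz)) (by fun_prop)
  have hc := center_mem_frameDomain (L := L) p
  obtain ⟨A, hA, W, hW, hAW⟩ := Filter.mem_prod_iff.1
    ((hG _) ((isOpen_extChartAt_source _).mem_nhds hs))
  obtain ⟨N, hN, hNo, hcN⟩ := mem_nhds_iff.1 (Filter.inter_mem
    ((isOpen_frameDomain (L := L) p).mem_nhds hc) (Filter.inter_mem ((hcont _ hc) hW)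
      ((hGc.continuousAt.comp (hcont _ hc)) ((isOpen_extChartAt_source _).mem_nhds hs))))
  have hGN : ∀ z ∈ N, G ((totalChart L p).symm (z, 1)) ∈ (totalChart L q).source :=
    fun z hz => (hN hz).2.2
  refine ⟨N, hNo, hcN, fun z hz => (hN hz).1, hGN,
    Filter.mem_of_superset hA fun σ hσ z hz =>
      hAW (show (σ, (totalChart L p).symm (z, 1)) ∈ A ×ˢ W from ⟨hσ, (hN hz).2.1⟩), ?_⟩
  rw [tendstoLocallyUniformlyOn_iff_forall_tendsto]
  intro z hz
  have h0 : Filter.Tendsto (fun y => (totalChart L p).symm (y, (1 : ℂ))) (𝓝[N] z)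
      (𝓝 ((totalChart L p).symm (z, 1))) := ((hcont z (hN hz).1).tendsto).mono_left nhdsWithin_le_nhds
  have hE := (continuousAt_totalChart (hGN z hz)).tendsto
  have h1 : Filter.Tendsto (fun s : (Bundle.TotalSpace ℂ L ≃ₜ Bundle.TotalSpace ℂ L) × ℂ =>
      frameImage s.1 p q s.2) (U ×ˢ 𝓝[N] z) (𝓝 (frameImage G p q z)) :=
    hE.comp (hG.tendsto_apply Filter.tendsto_fst (h0.comp Filter.tendsto_snd))
  have h2 : Filter.Tendsto (fun s : (Bundle.TotalSpace ℂ L ≃ₜ Bundle.TotalSpace ℂ L) × ℂ =>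
      frameImage G p q s.2) (U ×ˢ 𝓝[N] z) (𝓝 (frameImage G p q z)) :=
    hE.comp ((hGc.tendsto _).comp (h0.comp Filter.tendsto_snd))
  have h3 := h2.prodMk_nhds h1
  exact h3.mono_right (nhds_le_uniformity _)

/-- Continuous limits of automorphisms are holomorphic. -/
lemma ConvergesContinuously.contMDiff (hG : ConvergesContinuously U G) (hGc : Continuous G)
    (hGe : ∀ (c : ℂ) v, G (fiberScale c v) = fiberScale c (G v))
    (hU : ∀ᶠ σ in U, σ ∈ autPair L) : ContMDiff totalModel totalModel ω G := by
  intro v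
  set p := v.1 with hp
  set q := (G v).1 with hq
  have hc := center_mem_frameDomain (L := L) p
  have hvs : v ∈ (totalChart L p).source := self_mem_totalChart_source v
  have hGs : G v ∈ (totalChart L q).source := self_mem_totalChart_source (G v)
  have hv : v = (totalChart L p).symm (chartAt ℂ p p, (totalChart L p v).2) := by
    have e : totalChart L p v = (chartAt ℂ p p, (totalChart L p v).2) := by
      rw [totalChart_apply hvs]
    rw [← e, (totalChart L p).left_inv hvs]
  have hs : G ((totalChart L p).symm (chartAt ℂ p p, 1)) ∈ (totalChart L q).source := by
    rw [hv, apply_totalChart_symm hGe hc, totalChart_source] at hGs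
    rw [totalChart_source]
    exact hGs
  obtain ⟨N, hNo, hcN, hND, hGN, hev, hlim⟩ := hG.exists_tendstoLocallyUniformlyOn hGc hs
  have hdiff : DifferentiableOn ℂ (frameImage G p q) N := by
    refine hlim.differentiableOn ?_ hNo
    filter_upwards [hU, hev] with σ hσ hσN z hz
    exact (differentiableAt_frameImage hσ (hND hz) (hσN z hz)).differentiableWithinAt
  have hana : ContDiffAt ℂ ω (frameImage G p q) (chartAt ℂ p p) :=
    (hdiff.analyticAt (hNo.mem_nhds hcN)).contDiffAt
  refine contMDiffAt_iff.2 ⟨hGc.continuousAt, ?_⟩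
  rw [ModelWithCorners.range_eq_univ, contDiffWithinAt_univ, extChartAt_totalSpace,
    extChartAt_totalSpace, ← hp, ← hq]
  have hE : (totalChart L p v).1 = chartAt ℂ p p := by rw [totalChart_apply hvs]
  have h1 : ContDiffAt ℂ ω (fun a : ℂ × ℂ => frameImage G p q a.1) (totalChart L p v) :=
    ContDiffAt.comp (g := frameImage G p q) _ (by rw [hE]; exact hana) contDiffAt_fst
  have h2 : ContDiffAt ℂ ω (fun a : ℂ × ℂ => ((frameImage G p q a.1).1, a.2 * (frameImage G p q a.1).2))
      (totalChart L p v) := h1.fst.prodMk (contDiffAt_snd.mul h1.snd)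
  refine h2.congr_of_eventuallyEq ?_
  have hN1 : ∀ᶠ a : ℂ × ℂ in 𝓝 (totalChart L p v), a.1 ∈ N :=
    continuousAt_fst.eventually (by rw [hE]; exact hNo.mem_nhds hcN)
  filter_upwards [hN1] with a ha
  exact totalChart_apply_totalChart_symm hGe (hND ha) (hGN _ ha) a.2

/-- Continuous limits of lifts of base isometries are lifts of base isometries. -/
lemma ConvergesContinuously.isometry {σ₀ : Bundle.TotalSpace ℂ L ≃ₜ Bundle.TotalSpace ℂ L}
    (hG : ConvergesContinuously U σ₀) (hσ₀ : σ₀ ∈ autPair L)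
    (hU : ∀ᶠ σ in U, σ ∈ isometryGroup φ g h) (v : TangentBundle 𝓘(ℂ) X) :
    g.normSq (tangentMap 𝓘(ℂ) 𝓘(ℂ) (baseMap σ₀) v) = g.normSq v := by
  refine g.isometry_of_weight (mdifferentiable_baseMap hσ₀) (fun p => ?_) v
  set q := baseMap σ₀ p with hq
  set c := chartAt ℂ p p with hcdef
  have hc := center_mem_frameDomain (L := L) p
  have hpc : (chartAt ℂ p).symm c = p := (chartAt ℂ p).left_inv (mem_chart_source ℂ p)
  have hs : σ₀ ((totalChart L p).symm (c, 1)) ∈ (totalChart L q).source := by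
    rw [apply_totalChart_symm_mem_source_iff hσ₀ hc, hpc]
    exact ⟨mem_chart_source ℂ _, FiberBundle.mem_baseSet_trivializationAt' _⟩
  obtain ⟨N, hNo, hcN, hND, hGN, hev, hlim⟩ :=
    hG.exists_tendstoLocallyUniformlyOn σ₀.continuous hs
  have hfst : ∀ σ ∈ autPair L, (∀ z ∈ N, σ ((totalChart L p).symm (z, 1)) ∈ (totalChart L q).source) →
      deriv (fun z => chartAt ℂ q (baseMap σ ((chartAt ℂ p).symm z))) c =
        (deriv (frameImage σ p q) c).1 := by
    intro σ hσ hσN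
    have h1 : (fun z => chartAt ℂ q (baseMap σ ((chartAt ℂ p).symm z))) =ᶠ[𝓝 c]
        fun z => (frameImage σ p q z).1 := by
      filter_upwards [hNo.mem_nhds hcN] with z hz
      exact (frameImage_fst hσ (hND hz) (hσN z hz)).symm
    rw [h1.deriv_eq]
    exact (hasFDerivAt_fst.comp_hasDerivAt c
      (differentiableAt_frameImage hσ hc (hσN c hcN)).hasDerivAt).deriv
  have hev' : ∀ᶠ σ : Bundle.TotalSpace ℂ L ≃ₜ Bundle.TotalSpace ℂ L in U,
      ‖(deriv (frameImage σ p q) c).1‖ ^ 2 * g.weight q (frameImage σ p q c).1 =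
      g.weight p c := by
    filter_upwards [hU, hev] with σ hσ hσN
    have hb := (apply_totalChart_symm_mem_source_iff hσ.1.1 hc).1 (hσN c hcN)
    rw [← hfst σ hσ.1.1 hσN, frameImage_fst hσ.1.1 hc (hσN c hcN)]
    exact g.weight_of_isometry (mdifferentiable_baseMap hσ.1.1) hσ.2.2 hc.1 hb.1
  have hdl := (hlim.deriv (by
    filter_upwards [hU, hev] with σ hσ hσN z hz
    exact (differentiableAt_frameImage hσ.1.1 (hND hz) (hσN z hz)).differentiableWithinAt) hNo).tendsto_at hcN
  have hpl := hlim.tendsto_at hcN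
  have hF : (frameImage σ₀ p q c).1 = chartAt ℂ q q := by
    rw [frameImage_fst hσ₀ hc hs, hpc]
  have hw : ContinuousAt (g.weight q) (frameImage σ₀ p q c).1 := by
    rw [hF]
    exact ((contDiffOn_kahlerWeight g q).continuousOn).continuousAt
      ((chartAt ℂ q).open_target.mem_nhds (mem_chart_target ℂ q))
  have h1 : Filter.Tendsto (fun σ : Bundle.TotalSpace ℂ L ≃ₜ Bundle.TotalSpace ℂ L =>
      ‖(deriv (frameImage σ p q) c).1‖ ^ 2 * g.weight q (frameImage σ p q c).1) U
      (𝓝 (‖(deriv (frameImage σ₀ p q) c).1‖ ^ 2 * g.weight q (frameImage σ₀ p q c).1)) :=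
    ((((continuous_fst.tendsto _).comp hdl).norm).pow 2).mul
      (hw.tendsto.comp ((continuous_fst.tendsto _).comp hpl))
  have h2 := tendsto_nhds_unique h1 (tendsto_const_nhds.congr' (hev'.mono fun σ hσ => hσ.symm))
  rw [← hF, hfst σ₀ hσ₀ hGN]
  exact h2

/-- Properties of automorphisms of a line bundle with a section that are inherited by limits. -/
lemma ConvergesContinuously.inherits (hG : ConvergesContinuously U G)
    [RegularSpace (Bundle.TotalSpace ℂ L)] (hU : ∀ᶠ σ in U, σ ∈ autTriple φ) :
    Continuous G ∧ (∀ (c : ℂ) v, G (fiberScale c v) = fiberScale c (G v)) ∧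
    ContMDiff totalModel totalModel ω G ∧ Set.MapsTo G (sectionGraph φ) (sectionGraph φ) := by
  have := t2Space_totalSpace L
  have hGc := hG.continuous
  have hGe : ∀ (c : ℂ) v, G (fiberScale c v) = fiberScale c (G v) := fun c v => by
    refine tendsto_nhds_unique (hG.tendsto (fiberScale c v))
      ((((contMDiff_fiberScale c).continuous.tendsto (G v)).comp (hG.tendsto v)).congr' ?_)
    filter_upwards [hU] with σ hσ using (apply_fiberScale_of_mem_autPair hσ.1 c v).symm
  refine ⟨hGc, hGe, hG.contMDiff hGc hGe (hU.mono fun σ hσ => hσ.1), ?_⟩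
  rintro _ ⟨x, rfl⟩
  have hsec : Continuous fun x => (⟨x, φ x⟩ : Bundle.TotalSpace ℂ L) := φ.contMDiff.continuous
  have h1 := (((hsec.comp (FiberBundle.continuous_proj ℂ L)).tendsto _).comp
    (hG.tendsto ⟨x, φ x⟩)).congr' (f₂ := fun σ : Bundle.TotalSpace ℂ L ≃ₜ Bundle.TotalSpace ℂ L =>
      σ ⟨x, φ x⟩) (by
    filter_upwards [hU] with σ hσ
    simp only [Function.comp_apply, apply_section_of_mem_autTriple hσ])
  exact ⟨_, (tendsto_nhds_unique (hG.tendsto ⟨x, φ x⟩) h1).symm⟩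

/-- The isometry group of a Kähler metric and a hermitian metric is compact. -/
theorem isCompact_isometryGroup [CompactSpace X] (φ : HolSection L) (g : KahlerMetric X)
    (h : HermitianMetric L) : IsCompact (isometryGroup φ g h :
      Set (Bundle.TotalSpace ℂ L ≃ₜ Bundle.TotalSpace ℂ L)) := by
  have := t2Space_totalSpace L
  have : LocallyCompactSpace (ModelProd ℂ ℂ) := inferInstanceAs (LocallyCompactSpace (ℂ × ℂ))
  have : LocallyCompactSpace (Bundle.TotalSpace ℂ L) :=
    ChartedSpace.locallyCompactSpace (ModelProd ℂ ℂ) _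
  refine isCompact_iff_ultrafilter_le_nhds'.2 fun U hU => ?_
  have hU' : ∀ᶠ σ in (U : Filter (Bundle.TotalSpace ℂ L ≃ₜ Bundle.TotalSpace ℂ L)),
      σ ∈ isometryGroup φ g h := hU
  have hV' : ∀ᶠ σ in (U.map (fun σ => σ⁻¹) : Filter (Bundle.TotalSpace ℂ L ≃ₜ Bundle.TotalSpace ℂ L)),
      σ ∈ isometryGroup φ g h := Filter.eventually_map.2 (hU'.mono fun σ hσ => inv_mem hσ)
  obtain ⟨G, hG⟩ := exists_convergesContinuously U hU'
  obtain ⟨G', hG'⟩ := exists_convergesContinuously (U.map fun σ => σ⁻¹) hV'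
  obtain ⟨hc, he, hd, hm⟩ := hG.inherits (hU'.mono fun σ hσ => hσ.1)
  obtain ⟨hc', he', hd', hm'⟩ := hG'.inherits (hV'.mono fun σ hσ => hσ.1)
  have hr : Function.RightInverse G' G := hG.rightInverse hG'
  have hl : Function.LeftInverse G' G := hG'.rightInverse (G' := G) (by
    rw [Ultrafilter.coe_map, Filter.map_map]
    simpa only [Function.comp_def, inv_inv, Filter.map_id'] using hG)
  set σ₀ : Bundle.TotalSpace ℂ L ≃ₜ Bundle.TotalSpace ℂ L :=
    { toFun := G
      invFun := G'
      left_inv := hl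
      right_inv := hr
      continuous_toFun := hc
      continuous_invFun := hc' } with hσ₀
  have hG₀ : ConvergesContinuously
      (U : Filter (Bundle.TotalSpace ℂ L ≃ₜ Bundle.TotalSpace ℂ L)) σ₀ := hG
  have hpair : σ₀ ∈ autPair L := ⟨hd, hd', fun c p => he c p⟩
  have htriple : σ₀ ∈ autTriple φ := by
    refine ⟨hpair, Set.Subset.antisymm (Set.image_subset_iff.2 hm) ?_⟩
    intro v hv
    exact ⟨G' v, hm' hv, hr v⟩
  refine ⟨σ₀, ⟨htriple, fun p => ?_, hG₀.isometry hpair hU'⟩, hG₀.le_nhds⟩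
  have h1 := (h.smooth.continuous.tendsto (G p)).comp (hG.tendsto p)
  refine tendsto_nhds_unique h1 (tendsto_const_nhds.congr' ?_)
  filter_upwards [hU'] with σ hσ using (hσ.2.1 p).symm

end Holomorphic

end GravVortex

theorem mainTheorem4
    {X : Type*} [TopologicalSpace X] [ChartedSpace ℂ X] [IsManifold 𝓘(ℂ) ω X]
    [CompactSpace X] [ConnectedSpace X] [T2Space X]
    (L : X → Type*) [TopologicalSpace (Bundle.TotalSpace ℂ L)]
    [∀ x, TopologicalSpace (L x)] [∀ x, AddCommGroup (L x)] [∀ x, Module ℂ (L x)]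
    [FiberBundle ℂ L] [VectorBundle ℂ ℂ L] [ContMDiffVectorBundle ω ℂ L 𝓘(ℂ)]
    (φ : GravVortex.HolSection L) (hφ : φ ≠ 0) (hdeg : 0 < GravVortex.divisorDegree φ)
    (τ α c : ℝ) (hτ : 0 < τ) (hα : 0 < α)
    (g : GravVortex.KahlerMetric X) (h : GravVortex.HermitianMetric L)
    (hsol : GravVortex.IsGravitatingVortex τ α c φ g h) :
    GravVortex.IsReductive (GravVortex.lieAutTriple φ) ∧
    (0 < GravVortex.genus X →
      DiscreteTopology (GravVortex.autTriple φ) ∧ Subsingleton (GravVortex.lieAutTriple φ)) ∧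
    (GravVortex.genus X = 0 →
      IsCompact (GravVortex.isometryGroup φ g h :
        Set (Bundle.TotalSpace ℂ L ≃ₜ Bundle.TotalSpace ℂ L)) ∧
      ∃ 𝔨 : LieSubalgebra ℝ (GravVortex.lieAutTriple φ),
        (∀ y, y ∈ 𝔨 ↔ GravVortex.IsInfinitesimalIsometry g h y) ∧
        ∃ e : (ℂ ⊗[ℝ] 𝔨) ≃ₗ⁅ℂ⁆ GravVortex.lieAutTriple φ,
          ∀ (a : ℂ) (k : 𝔨), e (a ⊗ₜ[ℝ] k) = a • (k : GravVortex.lieAutTriple φ)) := by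
  obtain ⟨h1, h2⟩ := GravVortex.lie_conclusions hsol hdeg hφ hτ hα
  exact ⟨h1, fun hg => ⟨GravVortex.discreteTopology_autTriple hφ hdeg hg,
    GravVortex.subsingleton_lieAutTriple hsol hdeg hφ hg⟩,
    fun _ => ⟨GravVortex.isCompact_isometryGroup φ g h, h2⟩⟩
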